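/- Conventions. Let $\mathbb{k}$ be a field of characteristic $0$. A ($\mathbb{Z}$-graded, cohomological) $L_\infty$-algebra $\mathfrak{g}$ is a graded vector space with a degree $1$ codifferential on the cofree graded cocommutative coalgebra on $s^{-1}\mathfrak{g}$; its Taylor coefficients are the brackets $\ell_r$ ($r\ge 1$) of degree $2-r$ on $\mathfrak g$, with $\ell_1=d$. Let $F_m\mathfrak{g}$ be the span of all iterated brackets of at least $m$ elements and $\mathfrak{g}^{(m)}=\mathfrak{g}/F_m\mathfrak{g}$; $\mathfrak g$ is complete if $\mathfrak{g}\cong\varprojlim_m\mathfrak{g}^{(m)}$ (in each degree). Let $\Omega_n=\mathbb{k}[t_0,\dots,t_n,dt_0,\dots,dt_n]/(\sum t_i=1,\sum dt_i=0)$ be the dg algebra of polynomial differential forms on $\Delta^n$, and $C_n\subseteq\Omega_n$ the span of the basic forms $$\omega_{i_0\ldots i_k}=k!\sum_{j=0}^k(-1)^jt_{i_j}\,dt_{i_0}\cdots\widehat{dt_{i_j}}\cdots dt_{i_k},\qquad i_0<\dots<i_k.$$ Let $\mathrm{MC}_n(\mathfrak{g})=\varprojlim_m\mathrm{MC}(\mathfrak{g}^{(m)}\otimes\Omega_n)$,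 where $\mathrm{MC}$ is the set of degree $1$ solutions of $\sum_{r\ge1}\frac1{r!}\ell_r(x,\dots,x)=0$. Let $(p_n,i_n,h_n)$ be Dupont's contraction of $\Omega_n$ onto $C_n$: $p_n(w)=\sum_I(\int_{\Delta^I}w)\,\omega_I$ (sum over the faces $I$ of $\Delta^n$), $i_n$ is the inclusion, and $h_n=\sum_k\sum_{i_0<\dots<i_k}(-1)^k\omega_{i_0\ldots i_k}\,h^{i_k}\cdots h^{i_0}$, where $h^i$ is the Poincaré homotopy for the dilation centred at the vertex $i$ (so $dh^i+h^id=1-\mathrm{ev}_i$, $1-i_np_n=dh_n+h_nd$). Let $P$ and $I$ be the maps on Maurer–Cartan elements ($x\mapsto\sum_{r\ge1}\frac1{r!}f_r(x,\dots,x)$) induced by the $\infty$-morphisms $(1\otimes p_n)_\infty$, $(1\otimes i_n)_\infty$ given by the standard explicit formulas of the Homotopy Transfer Theorem for the contraction $1\otimes(p_n,i_n,h_n)$, and let $R_n=I\circ P$ be the rectification map; for complete $\mathfrak g$ it is taken as the limit over $m$ of these maps for $\mathfrak g^{(m)}$. Below, $\mathfrak g\otimes\Omega_n^k$ stands for $\varprojlim_m\mathfrak{g}^{(m)}\otimes\Omega_n^k$.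 Proposition. Let $\mathfrak{g}$ be a complete $L_\infty$-algebra, $n\ge0$, and let $\alpha\in\mathrm{MC}_n(\mathfrak{g})$, with component $\alpha_1(t_0,\dots,t_n)$ in $\mathfrak{g}^1\otimes\Omega_n^0$. Then $\beta:=R_n(\alpha)$ lies in $\mathrm{MC}_n(\mathfrak{g})$ and, if $n\ge 1$, it is of the form $$\beta=\beta_1(t_0,\dots,t_n)+\cdots+\xi\otimes\omega_{0\ldots n},$$ where $\beta_1\in\mathfrak{g}^1\otimes\Omega_n^0$, the dots indicate terms in $\mathfrak{g}^{1-k}\otimes\Omega_n^k$ with $1\le k\le n-1$, and $\xi\in\mathfrak{g}^{1-n}$; for $n=0$, $\beta=\beta_1=\xi\otimes\omega_0$ with $\xi\in\mathfrak g^1$. Moreover $\alpha_1$ and $\beta_1$ agree at the vertices of $\Delta^n$. In particular, if $\alpha\in\mathrm{MC}_1(\mathfrak{g})$ then, with $t=t_1$, $\beta=\beta_1(t)+\lambda\,dt$ for some $\lambda\in\mathfrak{g}^0$, and $\beta_1(0)=\alpha_1(0)$, $\beta_1(1)=\alpha_1(1)$. -/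

import Mathlib

open scoped TensorProduct Nat

noncomputable section

namespace DHG

/-! ## Signs -/

/-- The sign `(-1)^k`. -/
def sgn (k : ℤ) : ℤ := (k.negOnePow : ℤ)

/-- Koszul sign of rearranging a word `x₀ x₁ ⋯` of letters of degrees `D` by sorting it (stably)
according to the keys `f`: a factor `(-1)^(D a * D b)` for every pair of letters `a < b` that
changes its order. -/
def koszulSign {r : ℕ} {κ : Type*} [LinearOrder κ] (D : Fin r → ℤ) (f : Fin r → κ) : ℤ :=
  ∏ a, ∏ b, if a < b ∧ f b < f a then sgn (D a * D b) else 1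

/-- Sorting key that moves the letters with positions in `S` to the front. -/
def frontKey {r : ℕ} (S : Finset (Fin r)) (a : Fin r) : ℕ := if a ∈ S then 0 else 1

/-- The subfamily of `x` with positions in `S`, in increasing order. -/
def sub {r : ℕ} {α : Type*} (x : Fin r → α) (S : Finset (Fin r)) : Fin S.card → α :=
  fun a => x (S.orderEmbOfFin rfl a)

/-! ## Complete `L∞`-algebras -/

/-- A (`ℤ`-graded, cohomological) `L∞`-algebra structure on a vector space `G`, that is, a degree `1`
codifferential on the cofree graded cocommutative coalgebra on the shift `s⁻¹G`, given through its
Taylor coefficients.  `bracket r` is the bracket of arity `r`, and `bracket 1` is the differential.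
In terms of the grading of `G` (not shifted) `bracket r` has degree `2 - r`; it is graded symmetric,
and satisfies the generalized Jacobi identities, with the Koszul signs of the shifted degrees
`deg x - 1`. -/
structure LInftyAlgebra (𝕜 : Type*) [Field 𝕜] (G : Type*) [AddCommGroup G] [Module 𝕜 G] where
  /-- the subspace of elements of degree `d` -/
  deg : ℤ → Submodule 𝕜 G
  isInternal : DirectSum.IsInternal deg
  /-- the bracket of arity `r` -/
  bracket : (r : ℕ) → MultilinearMap 𝕜 (fun _ : Fin r => G) G
  bracket_zero : bracket 0 = 0
  bracket_mem : ∀ (r : ℕ) (D : Fin r → ℤ) (x : Fin r → G), (∀ a, x a ∈ deg (D a)) →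
    bracket r x ∈ deg ((∑ a, D a) + 2 - r)
  bracket_perm : ∀ (r : ℕ) (D : Fin r → ℤ) (x : Fin r → G), (∀ a, x a ∈ deg (D a)) →
    ∀ σ : Equiv.Perm (Fin r), bracket r (fun a => x (σ a)) =
      koszulSign (fun a => D a - 1) (σ.symm : Fin r → Fin r) • bracket r x
  jacobi : ∀ (r : ℕ) (D : Fin r → ℤ) (x : Fin r → G), (∀ a, x a ∈ deg (D a)) →
    ∑ S : Finset (Fin r), koszulSign (fun a => D a - 1) (frontKey S) •
      bracket (Sᶜ.card + 1) (Fin.cons (bracket S.card (sub x S)) (sub x Sᶜ)) = 0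

namespace LInftyAlgebra

variable {𝕜 : Type*} [Field 𝕜] {G : Type*} [AddCommGroup G] [Module 𝕜 G]
variable (L : LInftyAlgebra 𝕜 G)

/-- `L.IsBracketing w x`: the element `x` is an iterated bracket of `w` elements. -/
inductive IsBracketing : ℕ → G → Prop
  | leaf (x : G) : IsBracketing 1 x
  | node (r : ℕ) (w : Fin r → ℕ) (x : Fin r → G) (h : ∀ a, IsBracketing (w a) (x a)) :
      IsBracketing (∑ a, w a) (L.bracket r x)

/-- The canonical filtration: `L.filt m` is spanned by all bracketings of at least `m` elements. -/
def filt (m : ℕ) : Submodule 𝕜 G :=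
  Submodule.span 𝕜 {x | ∃ w, m ≤ w ∧ L.IsBracketing w x}

lemma filt_succ_le (m : ℕ) : L.filt (m + 1) ≤ L.filt m :=
  Submodule.span_mono fun _ ⟨w, hw, hx⟩ => ⟨w, by omega, hx⟩

/-- Completeness: the canonical map from `G` to the limit of the `G ⧸ L.filt m` is an isomorphism
(of graded vector spaces, that is, in every degree). -/
def IsComplete : Prop :=
  ∀ d : ℤ, (∀ x ∈ L.deg d, (∀ m, x ∈ L.filt m) → x = 0) ∧
    ∀ y : ℕ → G, (∀ m, y m ∈ L.deg d) → (∀ m, y (m + 1) - y m ∈ L.filt m) →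
      ∃ x ∈ L.deg d, ∀ m, x - y m ∈ L.filt m

lemma bracket_mem_filt (m r : ℕ) (x : Fin r → G) (a : Fin r) (ha : x a ∈ L.filt m) :
    L.bracket r x ∈ L.filt m := by
  have key : ∀ y ∈ L.filt m, L.bracket r (Function.update x a y) ∈ L.filt m := by
    intro y hy
    induction hy using Submodule.span_induction with
    | mem y hy =>
      obtain ⟨w, hw, hy⟩ := hy
      refine Submodule.subset_span ⟨_, ?_, IsBracketing.node r (Function.update (fun _ => 1) a w) _
        fun b => ?_⟩
      · refine hw.trans ?_
        have := Finset.single_le_sum (f := Function.update (fun _ : Fin r => 1) a w)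
          (fun _ _ => Nat.zero_le _) (Finset.mem_univ a)
        simpa using this
      · by_cases hb : b = a
        · subst hb; simpa using hy
        · simpa [hb] using IsBracketing.leaf (x b)
    | zero => simp
    | add y z _ _ hy hz => rw [MultilinearMap.map_update_add]; exact add_mem hy hz
    | smul c y _ hy => rw [MultilinearMap.map_update_smul]; exact Submodule.smul_mem _ _ hy
  simpa using key _ ha

lemma bracket_congr (m r : ℕ) (x y : Fin r → G)
    (h : ∀ a, (Submodule.Quotient.mk (x a) : G ⧸ L.filt m) = Submodule.Quotient.mk (y a)) :
    (Submodule.Quotient.mk (L.bracket r x) : G ⧸ L.filt m) =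
      Submodule.Quotient.mk (L.bracket r y) := by
  have key : ∀ s : Finset (Fin r),
      (Submodule.Quotient.mk (L.bracket r (s.piecewise x y)) : G ⧸ L.filt m) =
        Submodule.Quotient.mk (L.bracket r y) := by
    intro s
    induction s using Finset.induction_on with
    | empty => simp
    | insert a s ha ih =>
      rw [← ih, Finset.piecewise_insert, Submodule.Quotient.eq]
      have h1 : s.piecewise x y = Function.update (s.piecewise x y) a (y a) := by
        rw [eq_comm, Function.update_eq_self_iff]; simp [ha]
      rw [h1, Function.update_idem, ← MultilinearMap.map_update_sub]
      exact L.bracket_mem_filt m r _ a (by simpa using (Submodule.Quotient.eq _).1 (h a))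
  simpa using key Finset.univ

/-- The bracket of the quotient `L∞`-algebra `G ⧸ L.filt m`. -/
def quotBracket (m r : ℕ) : MultilinearMap 𝕜 (fun _ : Fin r => G ⧸ L.filt m) (G ⧸ L.filt m) where
  toFun x := Submodule.Quotient.mk (L.bracket r fun a => (x a).out)
  map_update_add' x a y z := by
    rw [← Submodule.Quotient.mk_add]
    refine (L.bracket_congr m r _
      (Function.update (fun b => (x b).out) a (y.out + z.out)) fun b => ?_).trans ?_
    · by_cases hb : b = a
      · subst hb; simp [Submodule.Quotient.mk_out]
      · simp [hb]
    · rw [MultilinearMap.map_update_add]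
      congr 2 <;> congr 1 <;> ext b <;> by_cases hb : b = a <;> first | (subst hb; simp) | simp [hb]
  map_update_smul' x a c y := by
    rw [← Submodule.Quotient.mk_smul]
    refine (L.bracket_congr m r _
      (Function.update (fun b => (x b).out) a (c • y.out)) fun b => ?_).trans ?_
    · by_cases hb : b = a
      · subst hb; simp [Submodule.Quotient.mk_out]
      · simp [hb]
    · rw [MultilinearMap.map_update_smul]
      congr 2; congr 1; ext b; by_cases hb : b = a <;> first | (subst hb; simp) | simp [hb]

lemma quotBracket_mk (m r : ℕ) (x : Fin r → G) :
    L.quotBracket m r (fun a => Submodule.Quotient.mk (x a)) =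
      Submodule.Quotient.mk (L.bracket r x) :=
  L.bracket_congr m r _ _ fun a => by simp [Submodule.Quotient.mk_out]

/-- The elements of degree `d` of the quotient `G ⧸ L.filt m`. -/
def quotDeg (m : ℕ) (d : ℤ) : Submodule 𝕜 (G ⧸ L.filt m) := (L.deg d).map (L.filt m).mkQ

end LInftyAlgebra

/-! ## Polynomial differential forms on simplices -/

section Forms

variable (𝕜 : Type*) [Field 𝕜]

/-- The algebra `Ω_n` of polynomial differential forms on the `n`-simplex, presented as the free
graded commutative algebra on `t_1, …, t_n` (degree `0`) and `dt_1, …, dt_n` (degree `1`): the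
relations `t_0 + ⋯ + t_n = 1` and `dt_0 + ⋯ + dt_n = 0` are used to eliminate `t_0` and `dt_0`.
The index `j : Fin n` stands for the coordinate number `j + 1`. -/
abbrev Form (n : ℕ) : Type _ := MvPolynomial (Fin n) 𝕜 ⊗[𝕜] ExteriorAlgebra 𝕜 (Fin n → 𝕜)

/-- The barycentric coordinate `t_i` as a polynomial in `t_1, …, t_n`. -/
def tPoly (n : ℕ) (i : Fin (n + 1)) : MvPolynomial (Fin n) 𝕜 :=
  Fin.cases (1 - ∑ j, MvPolynomial.X j) (fun j => MvPolynomial.X j) i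

/-- The coordinates of `dt_i` with respect to `dt_1, …, dt_n`. -/
def dtVec (n : ℕ) (i : Fin (n + 1)) : Fin n → 𝕜 :=
  Fin.cases (-∑ j, Pi.single j 1) (fun j => Pi.single j 1) i

/-- The function `t_i` on the `n`-simplex, as an element of `Ω_n`. -/
def t (n : ℕ) (i : Fin (n + 1)) : Form 𝕜 n := tPoly 𝕜 n i ⊗ₜ 1

/-- The form `dt_i` on the `n`-simplex. -/
def dt (n : ℕ) (i : Fin (n + 1)) : Form 𝕜 n := 1 ⊗ₜ ExteriorAlgebra.ι 𝕜 (dtVec 𝕜 n i)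

/-- The differential `f ⊗ w ↦ ∑ j, ∂_j f ⊗ (dt_j ∧ w)`. -/
def formD (n : ℕ) : Form 𝕜 n →ₗ[𝕜] Form 𝕜 n :=
  ∑ j : Fin n, TensorProduct.map (MvPolynomial.pderiv (R := 𝕜) j).toLinearMap
    (LinearMap.mulLeft 𝕜 (ExteriorAlgebra.ι 𝕜 (Pi.single j 1)))

/-- The projection of the exterior algebra onto its part of degree `e`. -/
def extProj (n e : ℕ) :
    ExteriorAlgebra 𝕜 (Fin n → 𝕜) →ₗ[𝕜] ExteriorAlgebra 𝕜 (Fin n → 𝕜) :=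
  GradedAlgebra.proj (fun i : ℕ => ⋀[𝕜]^i (Fin n → 𝕜)) e

/-- The projection of `Ω_n` onto the space `Ω_n^e` of forms of degree `e`. -/
def formProj (n e : ℕ) : Form 𝕜 n →ₗ[𝕜] Form 𝕜 n :=
  TensorProduct.map LinearMap.id (extProj 𝕜 n e)

/-- The pullback of forms along the affine map of simplices that is given by `θ` on vertices:
`t_i ↦ ∑_{θ b = i} t_b` and `dt_i ↦ ∑_{θ b = i} dt_b`. -/
def pullback {k n : ℕ} (θ : Fin (k + 1) → Fin (n + 1)) : Form 𝕜 n →ₐ[𝕜] Form 𝕜 k :=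
  Algebra.TensorProduct.map
    (MvPolynomial.aeval fun j : Fin n => ∑ b, if θ b = j.succ then tPoly 𝕜 k b else 0)
    (ExteriorAlgebra.map (Fintype.linearCombination 𝕜
      fun j : Fin n => ∑ b, if θ b = j.succ then dtVec 𝕜 k b else 0))

/-- Evaluation at the point with coordinates `t_j = x_j`; forms of positive degree are sent to
`0`. -/
def evalAt {n : ℕ} (x : Fin n → 𝕜) : Form 𝕜 n →ₗ[𝕜] 𝕜 :=
  (TensorProduct.lid 𝕜 𝕜).toLinearMap ∘ₗ TensorProduct.map (MvPolynomial.aeval x).toLinearMap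
    (ExteriorAlgebra.algebraMapInv (R := 𝕜) (M := Fin n → 𝕜)).toLinearMap

/-- The coordinates `t_1, …, t_n` of the vertex number `i` of the `n`-simplex, where `t_i = 1`. -/
def vertex (n : ℕ) (i : Fin (n + 1)) : Fin n → 𝕜 := fun j => if i = j.succ then 1 else 0

/-- Integration of forms over the `k`-simplex:
`t_1^{a_1} ⋯ t_k^{a_k} dt_1 ⋯ dt_k ↦ a_1! ⋯ a_k! / (a_1 + ⋯ + a_k + k)!`, and forms of degree
different from `k` are sent to `0`. -/
def integral (k : ℕ) : Form 𝕜 k →ₗ[𝕜] 𝕜 :=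
  (TensorProduct.lid 𝕜 𝕜).toLinearMap ∘ₗ TensorProduct.map
    ((MvPolynomial.basisMonomials (Fin k) 𝕜).constr 𝕜
      fun a => ((∏ j, (a j)! : ℕ) : 𝕜) / (((∑ j, a j) + k)! : 𝕜))
    (ExteriorAlgebra.liftAlternating (Pi.single k Matrix.detRowAlternating))

/-- The basic form
`ω_{θ_0 … θ_k} = k! ∑_j (-1)^j t_{θ_j} dt_{θ_0} ⋯ (omit dt_{θ_j}) ⋯ dt_{θ_k}`. -/
def basicForm {k n : ℕ} (θ : Fin (k + 1) → Fin (n + 1)) : Form 𝕜 n :=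
  (k ! : 𝕜) • ∑ j : Fin (k + 1), sgn (j : ℕ) •
    (t 𝕜 n (θ j) * (List.ofFn fun l : Fin k => dt 𝕜 n (θ (j.succAbove l))).prod)

/-- The `k`-dimensional faces of the `n`-simplex. -/
abbrev Face (n k : ℕ) : Type := {θ : Fin (k + 1) → Fin (n + 1) // StrictMono θ}

instance (n k : ℕ) : Fintype (Face n k) := Fintype.ofFinite _

/-- The subspace `C_n` of `Ω_n` spanned by the basic forms. -/
def basicForms (n : ℕ) : Submodule 𝕜 (Form 𝕜 n) :=
  Submodule.span 𝕜 {w | ∃ (k : ℕ) (θ : Face n k), w = basicForm 𝕜 θ.1}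

/-- The projection `p_n : Ω_n → C_n` of Dupont's contraction,
`w ↦ ∑_I (∫_{Δ^I} w) ω_I`, with the sum over all the faces `I` of the simplex. -/
def dupontP (n : ℕ) : Form 𝕜 n →ₗ[𝕜] basicForms 𝕜 n :=
  ∑ k ∈ Finset.range (n + 1), ∑ θ : Face n k,
    (integral 𝕜 k ∘ₗ (pullback 𝕜 θ.1).toLinearMap).smulRight
      ⟨basicForm 𝕜 θ.1, Submodule.subset_span ⟨k, θ, rfl⟩⟩

/-- Pullback of functions along `(u, x) ↦ u x + (1 - u) v_i`, where `v_i` is the vertex number `i`;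
the variable `u` is the variable of the outer polynomial ring. -/
def dilate (n : ℕ) (i : Fin (n + 1)) :
    MvPolynomial (Fin n) 𝕜 →ₐ[𝕜] Polynomial (MvPolynomial (Fin n) 𝕜) :=
  MvPolynomial.aeval fun j => Polynomial.X * Polynomial.C (MvPolynomial.X j) +
    (1 - Polynomial.X) * Polynomial.C (MvPolynomial.C (vertex 𝕜 n i j))

/-- `f ↦ ∫_0^1 u^(e-1) f(u x + (1 - u) v_i) du`, for `e ≥ 1`. -/
def radialIntegral (n : ℕ) (i : Fin (n + 1)) (e : ℕ) :
    MvPolynomial (Fin n) 𝕜 →ₗ[𝕜] MvPolynomial (Fin n) 𝕜 :=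
  (Polynomial.lsum fun c => ((c + e : ℕ) : 𝕜)⁻¹ • LinearMap.id) ∘ₗ (dilate 𝕜 n i).toLinearMap

/-- Contraction of forms with the vector field `∑_j (t_j - t_j(v_i)) ∂_j`. -/
def radialContraction (n : ℕ) (i : Fin (n + 1)) : Form 𝕜 n →ₗ[𝕜] Form 𝕜 n :=
  ∑ j : Fin n, TensorProduct.map
    (LinearMap.mulLeft 𝕜 (MvPolynomial.X j - MvPolynomial.C (vertex 𝕜 n i j)))
    (CliffordAlgebra.contractLeft (Q := (0 : QuadraticForm 𝕜 (Fin n → 𝕜))) (LinearMap.proj j))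

/-- The Poincaré homotopy `h^i`: pull back along the dilation `(u, x) ↦ u x + (1 - u) v_i` and
integrate over `u ∈ [0, 1]`.  In degree `e` this is
`f w ↦ (∫_0^1 u^(e-1) f(u x + (1 - u) v_i) du) ι w`, where `ι` is the contraction with the radial
vector field.  It satisfies `d h^i + h^i d = 1 - (evaluation at v_i)`. -/
def vertexHomotopy (n : ℕ) (i : Fin (n + 1)) : Form 𝕜 n →ₗ[𝕜] Form 𝕜 n :=
  ∑ e ∈ Finset.Icc 1 n, radialContraction 𝕜 n i ∘ₗ
    TensorProduct.map (radialIntegral 𝕜 n i e) (extProj 𝕜 n e)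

/-- The homotopy `h_n` of Dupont's contraction,
`h_n = ∑_k ∑_{i_0 < ⋯ < i_k} (-1)^k ω_{i_0 … i_k} h^{i_k} ∘ ⋯ ∘ h^{i_0}`, normalized so that
`1 - i_n p_n = d h_n + h_n d`. -/
def dupontH (n : ℕ) : Form 𝕜 n →ₗ[𝕜] Form 𝕜 n :=
  ∑ k ∈ Finset.range (n + 1), ∑ θ : Face n k, sgn k •
    (LinearMap.mulLeft 𝕜 (basicForm 𝕜 θ.1) ∘ₗ
      ((List.ofFn fun a => vertexHomotopy 𝕜 n (θ.1 a)).reverse.prod :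
        Module.End 𝕜 (Form 𝕜 n)))

end Forms

/-! ## Homotopy transfer

In this section the degrees are those of the shifted spaces, so that all the brackets are graded
symmetric of degree `1`.  A multilinear operation on a graded space `V` is given by its values on
homogeneous arguments: the family `D` holds the degrees of the arguments, and is only used for
the signs. -/

section Transfer

/-- Operations of all arities from `V` to `V'`; the second argument holds the degrees of the
arguments. -/
abbrev Ops (V V' : Type*) : Type _ := (r : ℕ) → (Fin r → ℤ) → (Fin r → V) → V'

/-- The positions with `f a = j`. -/
def block {r k : ℕ} (f : Fin r → Fin k) (j : Fin k) : Finset (Fin r) :=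
  Finset.univ.filter fun a => f a = j

lemma block_card_lt {r k : ℕ} (f : {f : Fin r → Fin (k + 2) // Function.Surjective f})
    (j : Fin (k + 2)) : (block f.1 j).card < r := by
  obtain ⟨j', hj'⟩ := exists_ne j
  obtain ⟨a, ha⟩ := f.2 j'
  have : block f.1 j ⊂ Finset.univ := by
    refine (Finset.ssubset_univ_iff).2 fun h => ?_
    have : a ∈ block f.1 j := h ▸ Finset.mem_univ a
    exact hj' (ha.symm.trans (Finset.mem_filter.1 this).2)
  simpa using Finset.card_lt_card this

lemma compl_card_lt {r : ℕ} (S : {S : Finset (Fin (r + 2)) // 2 ≤ S.card}) :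
    S.1ᶜ.card + 1 < r + 2 := by
  have h1 := S.2
  have h2 := Finset.card_le_univ S.1
  rw [Finset.card_compl]
  simp only [Fintype.card_fin] at h2 ⊢
  omega

variable (𝕜 : Type*) [Field 𝕜] {V W : Type*} [AddCommGroup V] [Module 𝕜 V]
  [AddCommGroup W] [Module 𝕜 W]

/-- The components `i_r` of the `∞`-morphism `i_∞ : W ⇝ V` given by the homotopy transfer theorem,
for an `L∞`-algebra `V` with brackets `q` and a contraction `p : V → W`, `i : W → V`, `h` with
`1 - i p = d h + h d`.  This is the sum over rooted trees with `i` at the leaves, the brackets at the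
vertices, and `-h` at the inner edges and at the root, written as a recursion over the branches at
the root: `i_1 = i`, and `i_r = -h ∑_k q_k (i_{|B_1|}, …, i_{|B_k|})` for `r ≥ 2`, with the sum over
all partitions of the inputs in `k ≥ 2` non-empty blocks (which are numbered here, hence the
`1 / k!`). -/
def transferI (q : Ops V V) (h : ℤ → V → V) (i : W → V) : Ops W V
  | 0, _, _ => 0
  | 1, _, x => i (x 0)
  | r + 2, D, x => -h ((∑ a, D a) + 1) (∑ k ∈ Finset.range (r + 1), ((k + 2)! : 𝕜)⁻¹ •
      ∑ f : {f : Fin (r + 2) → Fin (k + 2) // Function.Surjective f}, koszulSign D f.1 •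
        q (k + 2) (fun j => ∑ a ∈ block f.1 j, D a)
          (fun j => transferI q h i (block f.1 j).card (sub D (block f.1 j))
            (sub x (block f.1 j))))
  termination_by r => r
  decreasing_by exact block_card_lt f j

/-- The letters of the word `i p x_0, …, i p x_{j-1}, h x_j, x_{j+1}, …`. -/
def homotopyWord {r : ℕ} (h : ℤ → V → V) (i : W → V) (p : V → W) (D : Fin r → ℤ)
    (x : Fin r → V) (j : Fin r) : Fin r → V :=
  fun a => if a < j then i (p (x a)) else if a = j then h (D a) (x a) else x a

/-- The degrees of the letters of `homotopyWord`. -/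
def homotopyDeg {r : ℕ} (D : Fin r → ℤ) (j : Fin r) : Fin r → ℤ :=
  fun a => if a = j then D a - 1 else D a

/-- The components `p_r` of the `∞`-morphism `p_∞ : V ⇝ W` given by the homotopy transfer theorem,
for an `L∞`-algebra `V` with brackets `q` and a contraction `p : V → W`, `i : W → V`, `h` with
`1 - i p = d h + h d`: the component with values in `W` of `∑_m p (-δ H)^m` on symmetric words.
Here `H` is the symmetrized homotopy
`x_1 ⋯ x_r ↦ 1 / r! ∑_σ ∑_j ± (i p x_{σ 1}) ⋯ (i p x_{σ (j-1)}) (h x_{σ j}) x_{σ (j+1)} ⋯ x_{σ r}`,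
and `δ` replaces the letters `x_S` in at least two places `S` by the letter `q (x_S)`, in all
possible ways.  So `p_1 = p`, and `p_r = -∑_s p_s δ H` for `r ≥ 2`, where `s < r`. -/
def transferP (q : Ops V V) (h : ℤ → V → V) (i : W → V) (p : V → W) : Ops V W
  | 0, _, _ => 0
  | 1, _, x => p (x 0)
  | r + 2, D, x => -((r + 2)! : 𝕜)⁻¹ •
      ∑ σ : Equiv.Perm (Fin (r + 2)), ∑ j : Fin (r + 2),
        (koszulSign D (σ.symm : Fin (r + 2) → Fin (r + 2)) *
          sgn (∑ a ∈ Finset.univ.filter (· < j), D (σ a))) •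
        ∑ S : {S : Finset (Fin (r + 2)) // 2 ≤ S.card},
          koszulSign (homotopyDeg (fun a => D (σ a)) j) (frontKey S.1) •
          transferP q h i p (S.1ᶜ.card + 1)
            (Fin.cons ((∑ a ∈ S.1, homotopyDeg (fun a => D (σ a)) j a) + 1)
              (sub (homotopyDeg (fun a => D (σ a)) j) S.1ᶜ))
            (Fin.cons
              (q S.1.card (sub (homotopyDeg (fun a => D (σ a)) j) S.1)
                (sub (homotopyWord h i p (fun a => D (σ a)) (fun a => x (σ a)) j) S.1))
              (sub (homotopyWord h i p (fun a => D (σ a)) (fun a => x (σ a)) j) S.1ᶜ))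
  termination_by r => r
  decreasing_by exact compl_card_lt S

/-- The sum `∑_{r ≥ 1} 1 / r! f_r (x, …, x)` for an element `x` of shifted degree `0`.  (In a
nilpotent algebra only finitely many terms are different from `0`.)  For the components `f` of an
`∞`-morphism this is the induced map on Maurer–Cartan elements. -/
def diagonalSum (f : Ops V W) (x : V) : W :=
  ∑ᶠ r : ℕ, ((r + 1)! : 𝕜)⁻¹ • f (r + 1) (fun _ => 0) (fun _ => x)

/-- The Maurer–Cartan equation `∑_{r ≥ 1} 1 / r! q_r (x, …, x) = 0`, where `q_1` is the
differential. -/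
def MCEquation (q : Ops V V) (x : V) : Prop := diagonalSum 𝕜 q x = 0

end Transfer

/-! ## Tensor products with forms -/

section Tensor

variable {𝕜 : Type*} [Field 𝕜] {M : Type*} [AddCommGroup M] [Module 𝕜 M] {n : ℕ}

/-- The part of an element of `M ⊗ Ω_n` in `M ⊗ Ω_n^e`. -/
def part (e : ℕ) : M ⊗[𝕜] Form 𝕜 n →ₗ[𝕜] M ⊗[𝕜] Form 𝕜 n := (formProj 𝕜 n e).lTensor M

/-- Evaluation of an element of `M ⊗ Ω_n` at the point with coordinates `t_j = x_j`. -/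
def evalPoint (x : Fin n → 𝕜) : M ⊗[𝕜] Form 𝕜 n →ₗ[𝕜] M :=
  (TensorProduct.rid 𝕜 M).toLinearMap ∘ₗ (evalAt 𝕜 x).lTensor M

/-- The map `1 ⊗ u` on the elements of degree `D` of `M ⊗ Ω_n`, for a map `u` of odd degree, with
the Koszul sign: `v ⊗ w ↦ (-1)^(deg v) v ⊗ u w`, where `deg v = D - deg w`. -/
def oddMap (u : Form 𝕜 n →ₗ[𝕜] Form 𝕜 n) (D : ℤ) : M ⊗[𝕜] Form 𝕜 n →ₗ[𝕜] M ⊗[𝕜] Form 𝕜 n :=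
  ∑ e : Fin (n + 1), sgn (D - (e : ℕ)) • (u.lTensor M ∘ₗ part e)

/-- The linear map on the tensor algebra of `M` that is `f` on words of length `r`, and `0` on words
of other lengths. -/
def liftWord {r : ℕ} (f : MultilinearMap 𝕜 (fun _ : Fin r => M) M) : TensorAlgebra 𝕜 M →ₗ[𝕜] M :=
  PiTensorProduct.lift f ∘ₗ DirectSum.component 𝕜 ℕ (fun k => ⨂[𝕜]^k M) r ∘ₗ
    (TensorAlgebra.equivDirectSum (R := 𝕜) (M := M)).toLinearMap

/-- The multilinear map `(v_1 ⊗ w_1, …, v_r ⊗ w_r) ↦ f (v_1, …, v_r) ⊗ w_1 ⋯ w_r`. -/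
def extendScalars {r : ℕ} (f : MultilinearMap 𝕜 (fun _ : Fin r => M) M) :
    MultilinearMap 𝕜 (fun _ : Fin r => M ⊗[𝕜] Form 𝕜 n) (M ⊗[𝕜] Form 𝕜 n) :=
  ((liftWord f).rTensor (Form 𝕜 n)).compMultilinearMap
    ((MultilinearMap.mkPiAlgebraFin 𝕜 r (TensorAlgebra 𝕜 M ⊗[𝕜] Form 𝕜 n)).compLinearMap
      fun _ => (TensorAlgebra.ι 𝕜).rTensor (Form 𝕜 n))

/-- The sign of `v_1 ⊗ w_1 ⊗ ⋯ ⊗ v_r ⊗ w_r ↦ v_1 ⊗ ⋯ ⊗ v_r ⊗ w_1 ⊗ ⋯ ⊗ w_r`, where `w_a` is of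
degree `e a` and `v_a ⊗ w_a` of degree `D a`. -/
def shuffleSign {r : ℕ} (D : Fin r → ℤ) (e : Fin r → Fin (n + 1)) : ℤ :=
  ∏ a, ∏ b, if a < b then sgn ((e a : ℕ) * (D b - (e b : ℕ))) else 1

/-- The brackets of `M ⊗ Ω_n` induced by the brackets `f` of `M` and the multiplication of `Ω_n`:
`(v_1 ⊗ w_1, …, v_r ⊗ w_r) ↦ ± f_r (v_1, …, v_r) ⊗ w_1 ⋯ w_r`, with, in arity `1`, the additional
summand `v ⊗ w ↦ (-1)^(deg v) v ⊗ dw`. -/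
def tensorOps (f : (r : ℕ) → MultilinearMap 𝕜 (fun _ : Fin r => M) M) :
    Ops (M ⊗[𝕜] Form 𝕜 n) (M ⊗[𝕜] Form 𝕜 n) := fun r D X =>
  (∑ e : Fin r → Fin (n + 1), shuffleSign D e • extendScalars (f r) fun a => part (e a) (X a)) +
    ∑ a : Fin r, if r = 1 then oddMap (formD 𝕜 n) (D a) (X a) else 0

/-- The elements of (not shifted) degree `d` of `M ⊗ Ω_n`, where `M` is graded by `deg`. -/
def totalDeg (deg : ℤ → Submodule 𝕜 M) (d : ℤ) : Submodule 𝕜 (M ⊗[𝕜] Form 𝕜 n) :=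
  ⨆ e : ℕ, Submodule.map₂ (TensorProduct.mk 𝕜 M (Form 𝕜 n)) (deg (d - e))
    (LinearMap.range (formProj 𝕜 n e))

/-- The map `P : V → M ⊗ C_n` on Maurer–Cartan elements of `V = M ⊗ Ω_n` induced by the
`∞`-morphism `(1 ⊗ p_n)_∞` obtained from the contraction `(1 ⊗ p_n, 1 ⊗ i_n, 1 ⊗ h_n)`. -/
def mapP (f : (r : ℕ) → MultilinearMap 𝕜 (fun _ : Fin r => M) M) :
    M ⊗[𝕜] Form 𝕜 n → M ⊗[𝕜] basicForms 𝕜 n :=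
  diagonalSum 𝕜 (transferP 𝕜 (tensorOps f) (fun D => oddMap (dupontH 𝕜 n) D)
    ((basicForms 𝕜 n).subtype.lTensor M) ((dupontP 𝕜 n).lTensor M))

/-- The map `I : M ⊗ C_n → M ⊗ Ω_n` on Maurer–Cartan elements induced by the `∞`-morphism
`(1 ⊗ i_n)_∞` obtained from the contraction `(1 ⊗ p_n, 1 ⊗ i_n, 1 ⊗ h_n)`. -/
def mapI (f : (r : ℕ) → MultilinearMap 𝕜 (fun _ : Fin r => M) M) :
    M ⊗[𝕜] basicForms 𝕜 n → M ⊗[𝕜] Form 𝕜 n :=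
  diagonalSum 𝕜 (transferI 𝕜 (tensorOps f) (fun D => oddMap (dupontH 𝕜 n) D)
    ((basicForms 𝕜 n).subtype.lTensor M))

end Tensor

/-! ## The Deligne–Hinich–Getzler `∞`-groupoid and the rectification map -/

namespace LInftyAlgebra

variable {𝕜 : Type*} [Field 𝕜] {G : Type*} [AddCommGroup G] [Module 𝕜 G]
variable (L : LInftyAlgebra 𝕜 G)

/-- Families of elements of `(G ⧸ L.filt m) ⊗ Ω_n`, for all `m`. -/
abbrev Tower (n : ℕ) : Type _ := (m : ℕ) → (G ⧸ L.filt m) ⊗[𝕜] Form 𝕜 n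

/-- The set `MC_n(G)` of `n`-simplices of the Deligne–Hinich–Getzler `∞`-groupoid of `G`, that is,
the limit of the sets of Maurer–Cartan elements of `(G ⧸ L.filt m) ⊗ Ω_n`. -/
def MCSimplices (n : ℕ) : Set (L.Tower n) :=
  {α | (∀ m, (Submodule.factor (L.filt_succ_le m)).rTensor (Form 𝕜 n) (α (m + 1)) = α m) ∧
    ∀ m, α m ∈ totalDeg (L.quotDeg m) 1 ∧ MCEquation 𝕜 (tensorOps (L.quotBracket m)) (α m)}

/-- The rectification map `R = I ∘ P` (in every quotient `G ⧸ L.filt m`). -/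
def rectify (n : ℕ) (α : L.Tower n) : L.Tower n :=
  fun m => mapI (L.quotBracket m) (mapP (L.quotBracket m) (α m))

end LInftyAlgebra

end DHG

/-!
The proof never inspects the trees behind the formulas of homotopy transfer. It replaces them by two
properties of the maps `P` and `I` on Maurer–Cartan elements, valid for every contraction with side
conditions (`h h = 0`, `h i = 0`, `p h = 0`) of a nilpotent `L∞`-algebra.

*The map `I`.* `I w` is the unique solution of `x = i w - h Q x`, where `Q` is the nonlinear part of
the curvature `F x = d x + Q x` (`Contraction.diagonalSum_opsI`, `Contraction.fixedPoint_unique`).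
In particular a Maurer–Cartan element `x` with `h x = 0` satisfies `x = I (p x)`, and also
`P x = p x`, so that it is fixed by rectification.

*The map `P`.* On the set of Maurer–Cartan elements the derivative of `P` vanishes along the vector
field `x ↦ - F'_x (h x)` (`Contraction.dPhi_dF`). Besides `P x = p x` for `h x = 0`, this is the only
consequence of the symmetrized recursion for `p_∞` that is needed; it comes from a telescoping sum
over the position of the homotopy in a word (`Contraction.sum_P_update_sub_proj`) and from a
matching of the words in which the letters `h x` and `h y` occur (`Contraction.sum_P_update_h`).

The vector field is tangent to the Maurer–Cartan set by the Bianchi identity (`Contraction.dF_dF`),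
and along its flow `h x` decays like `exp (-s)`. Since `V` is nilpotent, the flow is polynomial in
the time `s` and in `e = exp (-s)`, so it can be constructed over any field of characteristic zero
as an element of `V ⊗ 𝕜[s, e]` with the derivation `s ↦ 1`, `e ↦ -e` (`Contraction.exists_flow`).
Its value at `s = 0`, `e = 1` is the initial point `α`, its value at `e = 0` is the limit, where `h`
vanishes. By the two properties above the limit is `R α = I (P α)`. Hence
(`Contraction.rectification`) `R α` is a Maurer–Cartan element, `h (R α) = 0`, and `R α - α` lies in
every ideal of the `L∞`-algebra that contains the image of `h`.

That Dupont's data form such a contraction is an identity between operators on forms. Antisymmetry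
in the vertices turns the sums over faces into iterates of the operations `A ↦ ∑ t_i A h^i` and
`A ↦ ∑ dt_i A h^i` (`dupontH_eq`), and the relations collected in `DupontSystem` then give the
homotopy formula and the side conditions. The main input is that the Poincaré homotopies of
different vertices anticommute (`opH_opH`); the key step is that they also anticommute with Dupont's
homotopy (`DupontSystem.H_h`). The projection by integrals over the faces agrees with the one by
evaluations and homotopies since `∫_{Δ^{k+1}} w` is the integral of `h^0 w` over the face opposite
to the vertex `0` (`integral_oppFace_opH`). The contraction of the forms is then tensored with a
nilpotent `L∞`-algebra, with Koszul signs (`NilpotentBrackets.contraction`).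

The statements about `β = R α` follow. The component of `β` of top degree is a multiple of
`ω_{0…n}`: the homotopy formula and `h β = 0` give `β = i p β + h d β`, and `h` has no values in
degree `n` (`part_top_eq`). The values at the vertices agree because the elements that vanish
at a given vertex form an ideal, which contains the image of `h`. All maps are natural in the
nilpotent quotients of `𝔤` (`NilpotentBrackets.rTensor_mapI_mapP`), so the coefficients of
`ω_{0…n}` form a compatible family, and completeness provides `ξ`.
-/


namespace DHG

/-! ### Koszul signs -/

lemma sgn_add (a b : ℤ) : sgn (a + b) = sgn a * sgn b := by
  simp [sgn, Int.negOnePow_add]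

@[simp] lemma sgn_zero : sgn 0 = 1 := by simp [sgn]

@[simp] lemma sgn_one : sgn 1 = -1 := by simp [sgn]

@[simp] lemma sgn_neg (a : ℤ) : sgn (-a) = sgn a := by simp [sgn]

lemma sgn_sub (a b : ℤ) : sgn (a - b) = sgn a * sgn b := by
  rw [sub_eq_add_neg, sgn_add, sgn_neg]

lemma sgn_mul_self (a : ℤ) : sgn a * sgn a = 1 := by
  rcases Int.units_eq_one_or a.negOnePow with h | h <;> simp [sgn, h]

lemma sgn_add_one (a : ℤ) : sgn (a + 1) = -sgn a := by rw [sgn_add]; simp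

lemma sgn_sub_one (a : ℤ) : sgn (a - 1) = -sgn a := by rw [sgn_sub]; simp

lemma sgn_sum {ι : Type*} (s : Finset ι) (f : ι → ℤ) :
    sgn (∑ a ∈ s, f a) = ∏ a ∈ s, sgn (f a) := by
  classical
  induction s using Finset.induction_on with
  | empty => simp
  | insert a s ha ih => rw [Finset.sum_insert ha, Finset.prod_insert ha, sgn_add, ih]

/-- The Koszul sign relating the orders of letters given by two keys: a factor
`(-1)^(D a * D b)` for every pair of letters whose order differs. -/
def ordSign {ι κ κ' : Type*} [Fintype ι] [LinearOrder κ] [LinearOrder κ'] (D : ι → ℤ)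
    (f : ι → κ) (g : ι → κ') : ℤ :=
  ∏ a, ∏ b, if f a < f b ∧ g b < g a then sgn (D a * D b) else 1

lemma koszulSign_eq_ordSign {r : ℕ} {κ : Type*} [LinearOrder κ] (D : Fin r → ℤ) (f : Fin r → κ) :
    koszulSign D f = ordSign D (id : Fin r → Fin r) f := rfl

lemma prod_prod_eq_prod_pairs {ι M : Type*} [Fintype ι] [LinearOrder ι] [CommMonoid M]
    (c : ι → ι → M) :
    ∏ a, ∏ b, c a b =
      ∏ a, ∏ b, if a < b then c a b * c b a else if a = b then c a a else 1 := by
  have h : ∀ a b, c a b = (if a < b then c a b else 1) * (if b < a then c a b else 1) *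
      (if a = b then c a a else 1) := by
    intro a b
    rcases lt_trichotomy a b with h | h | h
    · simp [h, h.ne, h.not_gt]
    · subst h; simp
    · simp [h, h.ne', h.not_gt]
  have h' : ∀ a b, (if a < b then c a b * c b a else if a = b then c a a else 1) =
      (if a < b then c a b else 1) * (if a < b then c b a else 1) *
      (if a = b then c a a else 1) := by
    intro a b
    rcases lt_trichotomy a b with h | h | h
    · simp [h, h.ne]
    · subst h; simp
    · simp [h.ne', h.not_gt]
  conv_lhs => enter [2, a, 2, b]; rw [h a b]
  conv_rhs => enter [2, a, 2, b]; rw [h' a b]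
  simp only [Finset.prod_mul_distrib]
  congr 2
  rw [Finset.prod_comm]

/-- Two products over ordered pairs agree if they agree on unordered pairs. -/
lemma prod_prod_congr_pairs {ι M : Type*} [Fintype ι] [LinearOrder ι] [CommMonoid M]
    {c c' : ι → ι → M} (h : ∀ a b, a < b → c a b * c b a = c' a b * c' b a)
    (h0 : ∀ a, c a a = c' a a) : ∏ a, ∏ b, c a b = ∏ a, ∏ b, c' a b := by
  rw [prod_prod_eq_prod_pairs c, prod_prod_eq_prod_pairs c']
  refine Finset.prod_congr rfl fun a _ => Finset.prod_congr rfl fun b _ => ?_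
  split_ifs with h1 h2
  · exact h a b h1
  · exact h0 a
  · rfl

lemma ordSign_mul {r : ℕ} {κ₁ κ₂ κ₃ : Type*} [LinearOrder κ₁] [LinearOrder κ₂] [LinearOrder κ₃]
    (D : Fin r → ℤ) {f : Fin r → κ₁} {g : Fin r → κ₂} {h : Fin r → κ₃}
    (hf : Function.Injective f) (hg : Function.Injective g) (hh : Function.Injective h) :
    ordSign D f g * ordSign D g h = ordSign D f h := by
  unfold ordSign
  simp only [← Finset.prod_mul_distrib]
  refine prod_prod_congr_pairs (fun a b hab => ?_) (by simp)
  have e : sgn (D b * D a) = sgn (D a * D b) := by rw [mul_comm]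
  have s := sgn_mul_self (D a * D b)
  rcases lt_or_gt_of_ne (hf.ne hab.ne) with h1 | h1 <;>
  rcases lt_or_gt_of_ne (hg.ne hab.ne) with h2 | h2 <;>
  rcases lt_or_gt_of_ne (hh.ne hab.ne) with h3 | h3 <;>
  simp [h1, h2, h3, h1.not_gt, h2.not_gt, h3.not_gt, e, s]

lemma ordSign_comp {ι ι' κ κ' : Type*} [Fintype ι] [Fintype ι'] [LinearOrder κ] [LinearOrder κ']
    (e : ι' ≃ ι) (D : ι → ℤ) (f : ι → κ) (g : ι → κ') :
    ordSign (D ∘ e) (f ∘ e) (g ∘ e) = ordSign D f g := by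
  unfold ordSign
  rw [← e.prod_comp]
  refine Finset.prod_congr rfl fun a _ => ?_
  rw [← e.prod_comp]
  rfl

/-- The Koszul sign is a cocycle on the symmetric group. -/
lemma koszulSign_mul {r : ℕ} (D : Fin r → ℤ) (σ τ : Equiv.Perm (Fin r)) :
    koszulSign D ((σ * τ).symm : Fin r → Fin r) =
      koszulSign D (σ.symm : Fin r → Fin r) * koszulSign (D ∘ σ) (τ.symm : Fin r → Fin r) := by
  simp only [koszulSign_eq_ordSign]
  have : ordSign (D ∘ σ) (id : Fin r → Fin r) (τ.symm : Fin r → Fin r) =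
      ordSign D (σ.symm : Fin r → Fin r) ((σ * τ).symm : Fin r → Fin r) := by
    rw [← ordSign_comp σ D]
    congr 1 <;> ext a <;> simp [Equiv.Perm.mul_def]
  rw [this, ordSign_mul D Function.injective_id σ.symm.injective (σ * τ).symm.injective]

lemma koszulSign_of_even {r : ℕ} {κ : Type*} [LinearOrder κ] (D : Fin r → ℤ) (f : Fin r → κ)
    (h : ∀ a b, a < b → f b < f a → sgn (D a * D b) = 1) : koszulSign D f = 1 := by
  unfold koszulSign
  refine Finset.prod_eq_one fun a _ => Finset.prod_eq_one fun b _ => ?_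
  split_ifs with h'
  · exact h a b h'.1 h'.2
  · rfl

/-- No signs arise if at most one letter is of nonzero degree. -/
lemma koszulSign_single {r : ℕ} {κ : Type*} [LinearOrder κ] (D : Fin r → ℤ) (f : Fin r → κ)
    (j : Fin r) (h : ∀ a, a ≠ j → D a = 0) : koszulSign D f = 1 := by
  refine koszulSign_of_even D f fun a b hab _ => ?_
  by_cases ha : a = j
  · rw [h b (ha ▸ hab.ne'), mul_zero, sgn_zero]
  · rw [h a ha, zero_mul, sgn_zero]

lemma koszulSign_zero {r : ℕ} {κ : Type*} [LinearOrder κ] (f : Fin r → κ) :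
    koszulSign (fun _ => 0) f = 1 :=
  koszulSign_of_even _ f fun _ _ _ _ => by simp

lemma koszulSign_mul_self {r : ℕ} {κ : Type*} [LinearOrder κ] (D : Fin r → ℤ) (f : Fin r → κ) :
    koszulSign D f * koszulSign D f = 1 := by
  unfold koszulSign
  rw [← Finset.prod_mul_distrib]
  refine Finset.prod_eq_one fun a _ => ?_
  rw [← Finset.prod_mul_distrib]
  refine Finset.prod_eq_one fun b _ => ?_
  split_ifs <;> simp [sgn_mul_self]

/-! ### Graded symmetric operations -/

section GradedSymm

variable {V V' V'' : Type*} [AddCommGroup V] [AddCommGroup V'] [AddCommGroup V'']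

/-- An operation is graded symmetric on the elements that are homogeneous with respect to `U`:
permuting the arguments changes the value by the Koszul sign. -/
def IsGradedSymm {𝕜 : Type*} [Field 𝕜] [Module 𝕜 V] (U : ℤ → Submodule 𝕜 V) (F : Ops V V') :
    Prop :=
  ∀ (r : ℕ) (D : Fin r → ℤ) (x : Fin r → V), (∀ a, x a ∈ U (D a)) →
    ∀ σ : Equiv.Perm (Fin r), F r (fun a => D (σ a)) (fun a => x (σ a)) =
      koszulSign D (σ.symm : Fin r → Fin r) • F r D x

variable {𝕜 : Type*} [Field 𝕜] [Module 𝕜 V] {U : ℤ → Submodule 𝕜 V}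

/-- The subword of the letters at the places `g 0, g 1, …` of a word, in this order, against the
same letters in their original order. -/
lemma IsGradedSymm.comp_injective {F : Ops V V'} (hF : IsGradedSymm U F) {k r : ℕ}
    (D : Fin r → ℤ) (x : Fin r → V) (hx : ∀ a, x a ∈ U (D a)) (g : Fin k → Fin r)
    (hg : Function.Injective g) (S : Finset (Fin r)) (hS : Finset.univ.map ⟨g, hg⟩ = S) :
    F k (D ∘ g) (x ∘ g) = koszulSign (D ∘ g) g • F S.card (sub D S) (sub x S) := by
  have hk : S.card = k := by rw [← hS]; simp
  subst hk
  have hmem : ∀ a, g a ∈ S := fun a => by rw [← hS]; simp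
  let o := S.orderIsoOfFin rfl
  have hbij : Function.Bijective fun a => o.symm ⟨g a, hmem a⟩ := by
    rw [← Finite.injective_iff_bijective]
    intro a b hab
    exact hg (congrArg Subtype.val (o.symm.injective hab))
  let ρ : Equiv.Perm (Fin S.card) := Equiv.ofBijective _ hbij
  have hρ : ∀ a, S.orderEmbOfFin rfl (ρ a) = g a := fun a => by
    rw [← Finset.coe_orderIsoOfFin_apply]
    simp [ρ, o]
  have h := hF S.card (sub D S) (sub x S) (fun a => hx _) ρ
  have e1 : (fun a => sub D S (ρ a)) = D ∘ g := by ext a; simp [sub, hρ]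
  have e2 : (fun a => sub x S (ρ a)) = x ∘ g := by funext a; simp [sub, hρ]
  rw [e1, e2] at h
  rw [h]
  congr 1
  rw [koszulSign_eq_ordSign, koszulSign_eq_ordSign, ← ordSign_comp ρ, ← e1]
  unfold ordSign
  have hlt : ∀ a b, g b < g a ↔ ρ b < ρ a := fun a b => by
    rw [← hρ, ← hρ]; simp
  simp only [Function.comp_apply, id, Equiv.symm_apply_apply, hlt]
  rw [Finset.prod_comm]
  refine Finset.prod_congr rfl fun a _ => Finset.prod_congr rfl fun b _ => ?_
  rw [mul_comm]
  simp only [and_comm]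

lemma koszulSign_cons_decomposeFin {r : ℕ} (d : ℤ) (D : Fin r → ℤ) (ρ : Equiv.Perm (Fin r)) :
    koszulSign (Fin.cons d D : Fin (r + 1) → ℤ)
      ((Equiv.Perm.decomposeFin.symm (0, ρ)).symm : Fin (r + 1) → Fin (r + 1)) =
    koszulSign D (ρ.symm : Fin r → Fin r) := by
  have h0 : (Equiv.Perm.decomposeFin.symm (0, ρ)).symm 0 = 0 := by
    rw [Equiv.symm_apply_eq]; simp
  have hs : ∀ a : Fin r, (Equiv.Perm.decomposeFin.symm (0, ρ)).symm a.succ = (ρ.symm a).succ := by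
    intro a; rw [Equiv.symm_apply_eq]; simp
  unfold koszulSign
  simp [Fin.prod_univ_succ, h0, hs]

/-- A graded symmetric operation with its first argument fixed is graded symmetric in the other
arguments. -/
lemma IsGradedSymm.cons {F : Ops V V'} (hF : IsGradedSymm U F) {d : ℤ} {z : V} (hz : z ∈ U d) :
    IsGradedSymm U (fun r D x => F (r + 1) (Fin.cons d D) (Fin.cons z x)) := by
  intro r D x hx ρ
  have h := hF (r + 1) (Fin.cons d D) (Fin.cons z x)
    (fun a => by refine Fin.cases ?_ (fun a => ?_) a <;> simp [hz, hx])
    (Equiv.Perm.decomposeFin.symm (0, ρ))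
  rw [koszulSign_cons_decomposeFin] at h
  dsimp only
  rw [← h]
  congr 1 <;> funext a <;> refine Fin.cases ?_ (fun a => ?_) a <;> simp

/-- The summand of `δ` that replaces the letters at the places `S` by their bracket. -/
def mergeTerm (q : Ops V V) (F : Ops V V') {r : ℕ} (D : Fin r → ℤ) (x : Fin r → V)
    (S : Finset (Fin r)) : V' :=
  koszulSign D (frontKey S) • F (Sᶜ.card + 1) (Fin.cons ((∑ a ∈ S, D a) + 1) (sub D Sᶜ))
    (Fin.cons (q S.card (sub D S) (sub x S)) (sub x Sᶜ))

lemma sum_sub {r : ℕ} (D : Fin r → ℤ) (S : Finset (Fin r)) :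
    ∑ a, sub D S a = ∑ a ∈ S, D a := by
  rw [← Finset.sum_coe_sort S, ← (S.orderIsoOfFin rfl).toEquiv.sum_comp]
  rfl

lemma frontKey_lt {r : ℕ} (S : Finset (Fin r)) (a b : Fin r) :
    frontKey S b < frontKey S a ↔ b ∈ S ∧ a ∉ S := by
  unfold frontKey; split_ifs <;> simp_all

lemma prod_prod_orderEmb {r : ℕ} (S : Finset (Fin r)) (c : Fin r → Fin r → ℤ) :
    ∏ a, ∏ b, c (S.orderEmbOfFin rfl a) (S.orderEmbOfFin rfl b) =
      ∏ a, ∏ b, if a ∈ S ∧ b ∈ S then c a b else 1 := by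
  have h : ∀ f : Fin r → ℤ, ∏ a, f (S.orderEmbOfFin rfl a) = ∏ a, if a ∈ S then f a else 1 := by
    intro f
    rw [Finset.prod_ite_mem, Finset.univ_inter, ← Finset.prod_coe_sort S,
      ← (S.orderIsoOfFin rfl).toEquiv.prod_comp]
    rfl
  rw [h fun a => ∏ b, c a (S.orderEmbOfFin rfl b)]
  refine Finset.prod_congr rfl fun a _ => ?_
  split_ifs with ha
  · rw [h]; simp [ha]
  · simp [ha]

/-- The sign identity behind `mergeTerm_perm`. -/
lemma koszulSign_split {r : ℕ} (D : Fin r → ℤ) (σ : Equiv.Perm (Fin r)) (S : Finset (Fin r)) :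
    koszulSign (fun a => D (σ a)) (frontKey S) *
        (koszulSign (D ∘ (σ ∘ S.orderEmbOfFin rfl)) (σ ∘ S.orderEmbOfFin rfl) *
          koszulSign (D ∘ (σ ∘ Sᶜ.orderEmbOfFin rfl)) (σ ∘ Sᶜ.orderEmbOfFin rfl)) =
      koszulSign D (σ.symm : Fin r → Fin r) *
        koszulSign D (frontKey (S.map σ.toEmbedding)) := by
  have e1 : ∀ S : Finset (Fin r),
      koszulSign (D ∘ (σ ∘ S.orderEmbOfFin rfl)) (σ ∘ S.orderEmbOfFin rfl) =
      ∏ a, ∏ b, if a ∈ S ∧ b ∈ S then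
        (if a < b ∧ σ b < σ a then sgn (D (σ a) * D (σ b)) else 1) else 1 := by
    intro S
    rw [← prod_prod_orderEmb]
    unfold koszulSign
    simp
  have e2 : koszulSign D (σ.symm : Fin r → Fin r) =
      ∏ a, ∏ b, if σ a < σ b ∧ b < a then sgn (D (σ a) * D (σ b)) else 1 := by
    rw [koszulSign_eq_ordSign, ← ordSign_comp σ]
    simp [ordSign]
  have e3 : koszulSign D (frontKey (S.map σ.toEmbedding)) =
      ∏ a, ∏ b, if σ a < σ b ∧ b ∈ S ∧ a ∉ S then sgn (D (σ a) * D (σ b)) else 1 := by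
    rw [koszulSign_eq_ordSign, ← ordSign_comp σ]
    simp [ordSign, frontKey_lt]
  rw [e1, e1, e2, e3]
  unfold koszulSign
  simp only [frontKey_lt, ← Finset.prod_mul_distrib]
  refine prod_prod_congr_pairs (fun a b hab => ?_) (by simp)
  have e : sgn (D (σ b) * D (σ a)) = sgn (D (σ a) * D (σ b)) := by rw [mul_comm]
  have s := sgn_mul_self (D (σ a) * D (σ b))
  rcases lt_or_gt_of_ne (σ.injective.ne hab.ne) with h1 | h1 <;>
  by_cases ha : a ∈ S <;> by_cases hb : b ∈ S <;>
  simp [h1, h1.not_gt, hab, hab.not_gt, ha, hb, e, s]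

lemma mergeTerm_perm {q : Ops V V} {F : Ops V V'} (hq : IsGradedSymm U q)
    (hF : IsGradedSymm U F)
    (hmem : ∀ (r : ℕ) (D : Fin r → ℤ) (x : Fin r → V), (∀ a, x a ∈ U (D a)) →
      q r D x ∈ U (∑ a, D a + 1))
    (hqs : ∀ (r : ℕ) (D : Fin r → ℤ) (x : Fin r → V) (n : ℤ) (k : ℕ) (d : ℤ) (E : Fin k → ℤ)
      (y : Fin k → V), F (k + 1) (Fin.cons d E) (Fin.cons (n • q r D x) y) =
        n • F (k + 1) (Fin.cons d E) (Fin.cons (q r D x) y))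
    {r : ℕ} (D : Fin r → ℤ) (x : Fin r → V) (hx : ∀ a, x a ∈ U (D a))
    (σ : Equiv.Perm (Fin r)) (S : Finset (Fin r)) :
    mergeTerm q F (fun a => D (σ a)) (fun a => x (σ a)) S =
      koszulSign D (σ.symm : Fin r → Fin r) • mergeTerm q F D x (S.map σ.toEmbedding) := by
  have hinj : ∀ T : Finset (Fin r), Function.Injective (σ ∘ T.orderEmbOfFin rfl) := fun T =>
    σ.injective.comp (T.orderEmbOfFin rfl).injective
  have hmap : ∀ T : Finset (Fin r), Finset.univ.map ⟨σ ∘ T.orderEmbOfFin rfl, hinj T⟩ =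
      T.map σ.toEmbedding := by
    intro T
    conv_rhs => rw [← Finset.map_orderEmbOfFin_univ T rfl, Finset.map_map]
    congr 1
  have h1 := hq.comp_injective D x hx _ (hinj S) _ (hmap S)
  have hc : (S.map σ.toEmbedding)ᶜ = Sᶜ.map σ.toEmbedding := by
    ext a; simp
  have hz : q S.card (D ∘ σ ∘ S.orderEmbOfFin rfl) (x ∘ σ ∘ S.orderEmbOfFin rfl) ∈
      U (∑ a ∈ S, D (σ a) + 1) := by
    have := hmem S.card (D ∘ σ ∘ S.orderEmbOfFin rfl) (x ∘ σ ∘ S.orderEmbOfFin rfl) fun a => hx _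
    rwa [show ∑ a, (D ∘ σ ∘ S.orderEmbOfFin rfl) a = ∑ a ∈ S, D (σ a) from
      sum_sub (fun a => D (σ a)) S] at this
  have h2 := (hF.cons hz).comp_injective D x hx _ (hinj Sᶜ) _ (hmap Sᶜ)
  have hsum : ∑ a ∈ S.map σ.toEmbedding, D a = ∑ a ∈ S, D (σ a) := by simp
  unfold mergeTerm
  rw [hc, hsum]
  have h3 : koszulSign (fun a => D (σ a)) (frontKey S) •
      F (Sᶜ.card + 1) (Fin.cons (∑ a ∈ S, D (σ a) + 1) (D ∘ σ ∘ Sᶜ.orderEmbOfFin rfl))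
        (Fin.cons (q S.card (D ∘ σ ∘ S.orderEmbOfFin rfl) (x ∘ σ ∘ S.orderEmbOfFin rfl))
          (x ∘ σ ∘ Sᶜ.orderEmbOfFin rfl)) =
      koszulSign D (σ.symm : Fin r → Fin r) •
      koszulSign D (frontKey (S.map σ.toEmbedding)) •
      F ((Sᶜ.map σ.toEmbedding).card + 1)
        (Fin.cons (∑ a ∈ S, D (σ a) + 1) (sub D (Sᶜ.map σ.toEmbedding)))
        (Fin.cons (q (S.map σ.toEmbedding).card (sub D (S.map σ.toEmbedding))
          (sub x (S.map σ.toEmbedding))) (sub x (Sᶜ.map σ.toEmbedding))) := by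
    rw [h2, h1, hqs, smul_smul, smul_smul, smul_smul, ← koszulSign_split]
    congr 1
    ring
  exact h3

/-- The composite `F δ` for the coderivation `δ` that replaces the letters in a set of places `S`,
with `P S`, by their bracket. -/
def mergeSum (q : Ops V V) (F : Ops V V') (P : ℕ → Prop) [DecidablePred P] : Ops V V' :=
  fun _ D x => ∑ S : Finset _, if P S.card then mergeTerm q F D x S else 0

lemma mergeSum_isGradedSymm {q : Ops V V} {F : Ops V V'} (hq : IsGradedSymm U q)
    (hF : IsGradedSymm U F)
    (hmem : ∀ (r : ℕ) (D : Fin r → ℤ) (x : Fin r → V), (∀ a, x a ∈ U (D a)) →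
      q r D x ∈ U (∑ a, D a + 1))
    (hqs : ∀ (r : ℕ) (D : Fin r → ℤ) (x : Fin r → V) (n : ℤ) (k : ℕ) (d : ℤ) (E : Fin k → ℤ)
      (y : Fin k → V), F (k + 1) (Fin.cons d E) (Fin.cons (n • q r D x) y) =
        n • F (k + 1) (Fin.cons d E) (Fin.cons (q r D x) y)) (P : ℕ → Prop) [DecidablePred P] :
    IsGradedSymm U (mergeSum q F P) := by
  intro r D x hx σ
  unfold mergeSum
  rw [Finset.smul_sum, ← (Equiv.finsetCongr σ).sum_comp fun S =>
    koszulSign D (σ.symm : Fin r → Fin r) • if P S.card then mergeTerm q F D x S else 0]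
  refine Finset.sum_congr rfl fun S _ => ?_
  rw [mergeTerm_perm hq hF hmem hqs D x hx σ S]
  simp [Equiv.finsetCongr_apply]

end GradedSymm


/-! ### Contractions of nilpotent `L∞`-algebras -/

/-- The number of maps with prescribed sizes of the fibers is a multinomial coefficient. -/
lemma sum_card_block {V : Type*} [AddCommGroup V] (r k : ℕ) (G : (Fin k → ℕ) → V) :
    ∑ f : Fin r → Fin k, G (fun j => (block f j).card) =
      ∑ n ∈ Finset.piAntidiag (Finset.univ : Finset (Fin k)) r,
        Nat.multinomial Finset.univ n • G n := by
  classical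
  let ψ : MvPolynomial (Fin k) ℤ →ₗ[ℤ] V :=
    (MvPolynomial.basisMonomials (Fin k) ℤ).constr ℤ fun m => G m
  have hψ : ∀ m : Fin k →₀ ℕ, ψ (MvPolynomial.monomial m 1) = G m := fun m => by
    have := (MvPolynomial.basisMonomials (Fin k) ℤ).constr_basis ℤ (fun m => G m) m
    simpa using this
  have hmon : ∀ n : Fin k → ℕ, (∏ j, (MvPolynomial.X j : MvPolynomial (Fin k) ℤ) ^ n j) =
      MvPolynomial.monomial (Finsupp.equivFunOnFinite.symm n) 1 := by
    intro n
    rw [MvPolynomial.monomial_eq]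
    simp [Finsupp.prod_fintype]
  have h1 := Finset.sum_pow_eq_sum_piAntidiag (Finset.univ : Finset (Fin k))
    (fun j => (MvPolynomial.X j : MvPolynomial (Fin k) ℤ)) r
  have h2 : (∑ j, (MvPolynomial.X j : MvPolynomial (Fin k) ℤ)) ^ r =
      ∑ f : Fin r → Fin k, ∏ j, MvPolynomial.X j ^ (block f j).card := by
    rw [← Fin.prod_const, Finset.prod_univ_sum]
    simp only [Fintype.piFinset_univ]
    refine Finset.sum_congr rfl fun f _ => ?_
    rw [← Finset.prod_fiberwise (s := Finset.univ) (g := f)]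
    refine Finset.prod_congr rfl fun j _ => ?_
    rw [Finset.prod_congr rfl (g := fun _ => MvPolynomial.X j), Finset.prod_const]
    · rfl
    · intro a ha; rw [(Finset.mem_filter.1 ha).2]
  rw [h2] at h1
  have h3 := congrArg ψ h1
  rw [map_sum, map_sum] at h3
  simp only [hmon, hψ] at h3
  simp only [Finsupp.coe_equivFunOnFinite_symm] at h3
  rw [h3]
  refine Finset.sum_congr rfl fun n _ => ?_
  rw [← nsmul_eq_mul, map_nsmul, hψ]
  simp

lemma diagonalSum_eq_sum {𝕜 V W : Type*} [Field 𝕜] [AddCommGroup V] [Module 𝕜 V]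
    [AddCommGroup W] [Module 𝕜 W] (f : Ops V W) (x : V) (B : ℕ)
    (hB : ∀ r, B < r → f r (fun _ => 0) (fun _ => x) = 0) :
    diagonalSum 𝕜 f x = ∑ r ∈ Finset.range B, ((r + 1)! : 𝕜)⁻¹ •
      f (r + 1) (fun _ => 0) (fun _ => x) := by
  unfold diagonalSum
  refine finsum_eq_sum_of_support_subset _ fun r hr => ?_
  by_contra h
  refine hr ?_
  dsimp only
  rw [hB _ (by simp at h; omega), smul_zero]

/-- A contraction (with the side conditions) of a nilpotent `L∞`-algebra `V` onto a complex `W`.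
All degrees are those of the shifted space `V`, so that the brackets `q` are graded symmetric
of degree `1`; they may depend on the degrees `D` of their arguments, as may the homotopy `h`. -/
structure Contraction (𝕜 V W : Type*) [Field 𝕜] [AddCommGroup V] [Module 𝕜 V] [AddCommGroup W]
    [Module 𝕜 W] where
  /-- the subspace of elements of shifted degree `d` -/
  U : ℤ → Submodule 𝕜 V
  /-- a filtration that makes `V` nilpotent -/
  Fil : ℕ → Submodule 𝕜 V
  /-- the length of the filtration -/
  N : ℕ
  /-- the brackets -/
  q : (r : ℕ) → (Fin r → ℤ) → MultilinearMap 𝕜 (fun _ : Fin r => V) V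
  /-- the homotopy -/
  h : ℤ → V →ₗ[𝕜] V
  /-- the inclusion -/
  i : W →ₗ[𝕜] V
  /-- the projection -/
  p : V →ₗ[𝕜] W
  q_zero : ∀ D, q 0 D = 0
  q_mem : ∀ (r : ℕ) (D : Fin r → ℤ) (x : Fin r → V), (∀ a, x a ∈ U (D a)) →
    q r D x ∈ U (∑ a, D a + 1)
  q_symm : IsGradedSymm U (fun r D x => q r D x)
  q_jacobi : ∀ (r : ℕ) (D : Fin r → ℤ) (x : Fin r → V), (∀ a, x a ∈ U (D a)) →
    ∑ S : Finset (Fin r),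
      mergeTerm (fun r D x => q r D x) (fun r D x => q r D x) D x S = 0
  Fil_one : Fil 1 = ⊤
  Fil_anti : Antitone Fil
  Fil_N : Fil N = ⊥
  q_fil : ∀ (r : ℕ) (D : Fin r → ℤ) (k : Fin r → ℕ) (x : Fin r → V), (∀ a, x a ∈ Fil (k a)) →
    q r D x ∈ Fil (∑ a, k a)
  h_mem : ∀ (D : ℤ), ∀ x ∈ U D, h D x ∈ U (D - 1)
  h_fil : ∀ (D : ℤ) (k : ℕ), ∀ x ∈ Fil k, h D x ∈ Fil k
  homotopy : ∀ (D : ℤ) (x : V), q 1 (fun _ => D - 1) (fun _ => h D x) +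
    h (D + 1) (q 1 (fun _ => D) (fun _ => x)) = x - i (p x)
  h_h : ∀ (D : ℤ) (x : V), h (D - 1) (h D x) = 0
  h_i_p : ∀ (D : ℤ) (x : V), h D (i (p x)) = 0
  i_p_h : ∀ (D : ℤ) (x : V), i (p (h D x)) = 0
  i_p_i_p : ∀ x : V, i (p (i (p x))) = i (p x)
  i_injective : Function.Injective i

namespace Contraction

variable {𝕜 V W : Type*} [Field 𝕜] [AddCommGroup V] [Module 𝕜 V] [AddCommGroup W]
  [Module 𝕜 W] (C : Contraction 𝕜 V W)

/-- The brackets as operations. -/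
def ops : Ops V V := fun r D x => C.q r D x

/-- The components of the `∞`-morphism `i_∞`. -/
def opsI : Ops W V := transferI 𝕜 C.ops (fun D => C.h D) C.i

/-- The components of the `∞`-morphism `p_∞`. -/
def opsP : Ops V W := transferP 𝕜 C.ops (fun D => C.h D) C.i C.p

/-- The idempotent `i p`. -/
def proj : V →ₗ[𝕜] V := C.i ∘ₗ C.p

lemma mem_Fil_one (x : V) : x ∈ C.Fil 1 := by rw [C.Fil_one]; trivial

lemma mem_Fil_zero (x : V) : x ∈ C.Fil 0 := C.Fil_anti (Nat.zero_le 1) (C.mem_Fil_one x)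

lemma eq_zero_of_mem_Fil {x : V} {k : ℕ} (hk : C.N ≤ k) (hx : x ∈ C.Fil k) : x = 0 := by
  have := C.Fil_anti hk hx
  rwa [C.Fil_N, Submodule.mem_bot] at this

lemma q_fil_card (r : ℕ) (D : Fin r → ℤ) (x : Fin r → V) : C.q r D x ∈ C.Fil r := by
  have := C.q_fil r D (fun _ => 1) x fun a => C.mem_Fil_one _
  simpa using this

lemma q_fil_one (r : ℕ) (D : Fin r → ℤ) (x : Fin r → V) (b : Fin r) (k : ℕ)
    (hb : x b ∈ C.Fil k) : C.q r D x ∈ C.Fil (k + (r - 1)) := by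
  have := C.q_fil r D (fun a => if a = b then k else 1) x fun a => by
    split_ifs with h
    · rwa [h]
    · exact C.mem_Fil_one _
  refine C.Fil_anti (le_of_eq ?_) this
  rw [Finset.sum_ite, Finset.filter_eq' Finset.univ b, Finset.filter_ne' Finset.univ b]
  simp

lemma q_eq_zero {r : ℕ} (hr : C.N ≤ r) (D : Fin r → ℤ) (x : Fin r → V) : C.q r D x = 0 :=
  C.eq_zero_of_mem_Fil hr (C.q_fil_card r D x)

/-- The nonlinear part `∑_{k ≥ 2} 1 / k! q_k (x, …, x)` of the curvature of `x`. -/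
def Q (x : V) : V :=
  ∑ k ∈ Finset.range C.N, ((k + 2)! : 𝕜)⁻¹ • C.q (k + 2) (fun _ => 0) (fun _ => x)

/-- The curvature of an element `x` of degree `0`. -/
def F (x : V) : V := C.q 1 (fun _ => 0) (fun _ => x) + C.Q x

lemma F_eq (x : V) : C.F x =
    ∑ k ∈ Finset.range (C.N + 1), ((k + 1)! : 𝕜)⁻¹ • C.q (k + 1) (fun _ => 0) (fun _ => x) := by
  rw [Finset.sum_range_succ', F, Q, add_comm]
  simp

lemma diagonalSum_ops (x : V) : diagonalSum 𝕜 C.ops x = C.F x := by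
  rw [F_eq, diagonalSum_eq_sum _ _ (C.N + 1)]
  · rfl
  · intro r hr
    exact C.q_eq_zero (by omega) _ _

lemma q_sub_mem (r : ℕ) (x y : Fin r → V) (k : ℕ) (hxy : ∀ a, x a - y a ∈ C.Fil k)
    (D : Fin r → ℤ) : C.q r D x - C.q r D y ∈ C.Fil (k + (r - 1)) := by
  classical
  have key : ∀ s : Finset (Fin r),
      C.q r D (s.piecewise x y) - C.q r D y ∈ C.Fil (k + (r - 1)) := by
    intro s
    induction s using Finset.induction_on with
    | empty => simp
    | insert a s ha ih =>
      have h1 : C.q r D ((insert a s).piecewise x y) - C.q r D (s.piecewise x y) ∈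
          C.Fil (k + (r - 1)) := by
        rw [Finset.piecewise_insert]
        have h1 : s.piecewise x y = Function.update (s.piecewise x y) a (y a) := by
          rw [eq_comm, Function.update_eq_self_iff]; simp [ha]
        rw [h1, Function.update_idem, ← MultilinearMap.map_update_sub]
        exact C.q_fil_one r D _ a k (by simpa using hxy a)
      have := add_mem h1 ih
      rwa [sub_add_sub_cancel] at this
  simpa using key Finset.univ

lemma Q_sub_mem (x y : V) (k : ℕ) (hxy : x - y ∈ C.Fil k) : C.Q x - C.Q y ∈ C.Fil (k + 1) := by
  unfold Q
  rw [← Finset.sum_sub_distrib]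
  refine Submodule.sum_mem _ fun r _ => ?_
  rw [← smul_sub]
  refine Submodule.smul_mem _ _ (C.Fil_anti ?_ (C.q_sub_mem _ _ _ k (fun _ => hxy) _))
  omega

/-- The equation `x = i w - h Q(x)` has at most one solution. -/
lemma fixedPoint_unique {w x y : V} (hx : x = w - C.h 1 (C.Q x)) (hy : y = w - C.h 1 (C.Q y)) :
    x = y := by
  have key : ∀ k, x - y ∈ C.Fil k := by
    intro k
    induction k with
    | zero => exact C.mem_Fil_zero _
    | succ k ih =>
      have : x - y = C.h 1 (C.Q y - C.Q x) := by
        rw [map_sub]; nth_rewrite 1 [hx]; nth_rewrite 1 [hy]; abel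
      rw [this]
      refine C.h_fil _ _ _ (C.Q_sub_mem _ _ _ ?_)
      rw [← neg_sub]; exact neg_mem ih
  exact sub_eq_zero.1 (C.eq_zero_of_mem_Fil le_rfl (key C.N))

lemma opsI_one (D : Fin 1 → ℤ) (w : Fin 1 → W) : C.opsI 1 D w = C.i (w 0) := by
  simp [opsI, transferI]

lemma opsI_zero (D : Fin 0 → ℤ) (w : Fin 0 → W) : C.opsI 0 D w = 0 := by
  simp [opsI, transferI]

/-- The values of `i_r` on the word `w ⋯ w`. -/
def diagI (w : W) (r : ℕ) : V := C.opsI r (fun _ => 0) (fun _ => w)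

lemma diagI_add_two (w : W) (r : ℕ) : C.diagI w (r + 2) =
    -C.h 1 (∑ k ∈ Finset.range (r + 1), ((k + 2)! : 𝕜)⁻¹ • ∑ f : Fin (r + 2) → Fin (k + 2),
      C.q (k + 2) (fun _ => 0) (fun j => C.diagI w (block f j).card)) := by
  unfold diagI
  conv_lhs => rw [opsI, transferI]
  simp only [Finset.sum_const_zero, zero_add]
  refine congrArg (fun z => -C.h 1 z) (Finset.sum_congr rfl fun k _ => congrArg _ ?_)
  have h0 : ∀ f : Fin (r + 2) → Fin (k + 2), ¬ Function.Surjective f →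
      C.q (k + 2) (fun _ => 0) (fun j => C.opsI (block f j).card (fun _ => 0) (fun _ => w)) =
        0 := by
    intro f hf
    obtain ⟨j, hj⟩ := not_forall.1 hf
    refine MultilinearMap.map_coord_zero _ j ?_
    have : block f j = ∅ := by
      rw [block, Finset.filter_eq_empty_iff]
      exact fun a _ ha => hj ⟨a, ha⟩
    rw [this]
    exact C.opsI_zero _ _
  have h1 := Finset.sum_filter_of_ne (s := Finset.univ)
    (p := fun f : Fin (r + 2) → Fin (k + 2) => Function.Surjective f)
    (fun f _ hf => by by_contra h; exact hf (h0 f h))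
  rw [← h1, Finset.sum_subtype (p := fun f : Fin (r + 2) → Fin (k + 2) => Function.Surjective f)
    (Finset.univ.filter fun f => Function.Surjective f)
      (by simp)]
  refine Finset.sum_congr rfl fun f _ => ?_
  rw [koszulSign_zero, one_smul]
  rfl

lemma diagI_mem_Fil (w : W) (r : ℕ) : C.diagI w r ∈ C.Fil r := by
  induction r using Nat.strong_induction_on with
  | _ r ih =>
    match r with
    | 0 => rw [diagI, opsI_zero]; exact zero_mem _
    | 1 => exact C.mem_Fil_one _
    | r + 2 =>
      rw [diagI_add_two]
      refine neg_mem (C.h_fil _ _ _ (Submodule.sum_mem _ fun k _ => Submodule.smul_mem _ _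
        (Submodule.sum_mem _ fun f _ => ?_)))
      have hsum : ∑ j, (block f j).card = r + 2 := by
        have := Finset.card_eq_sum_card_fiberwise (f := f) (s := Finset.univ)
          (t := Finset.univ) (fun _ _ => by simp)
        simpa [block] using this.symm
      by_cases hf : Function.Surjective f
      · have := C.q_fil (k + 2) (fun _ => 0) (fun j => (block f j).card)
          (fun j => C.diagI w (block f j).card)
          (fun j => ih _ (block_card_lt ⟨f, hf⟩ j))
        rwa [hsum] at this
      · obtain ⟨j, hj⟩ := not_forall.1 hf
        rw [MultilinearMap.map_coord_zero _ j]
        · exact zero_mem _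
        have : block f j = ∅ := by
          rw [block, Finset.filter_eq_empty_iff]
          exact fun a _ ha => hj ⟨a, ha⟩
        rw [this]
        exact C.opsI_zero _ _

/-- The summands of the map on Maurer–Cartan elements that is induced by `i_∞`. -/
def termI (w : W) (r : ℕ) : V := (r ! : 𝕜)⁻¹ • C.diagI w r

lemma termI_zero (w : W) : C.termI w 0 = 0 := by rw [termI, diagI, opsI_zero, smul_zero]

lemma termI_one (w : W) : C.termI w 1 = C.i w := by simp [termI, diagI, opsI_one]

lemma termI_mem_Fil (w : W) (r : ℕ) : C.termI w r ∈ C.Fil r :=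
  Submodule.smul_mem _ _ (C.diagI_mem_Fil w r)

lemma q_termI_eq_zero (w : W) {k : ℕ} (n : Fin k → ℕ) (h : ∑ j, n j < k ∨ C.N ≤ ∑ j, n j) :
    C.q k (fun _ => 0) (fun j => C.termI w (n j)) = 0 := by
  rcases h with h | h
  · obtain ⟨j, hj⟩ : ∃ j, n j = 0 := by
      by_contra hn
      push Not at hn
      have : ∑ j : Fin k, 1 ≤ ∑ j, n j :=
        Finset.sum_le_sum fun j _ => Nat.one_le_iff_ne_zero.2 (hn j)
      simp at this
      omega
    exact MultilinearMap.map_coord_zero _ j (by rw [hj, termI_zero])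
  · exact C.eq_zero_of_mem_Fil h (C.q_fil k _ n _ fun j => C.termI_mem_Fil w _)

variable [CharZero 𝕜]

lemma termI_add_two (w : W) (r : ℕ) : C.termI w (r + 2) =
    -C.h 1 (∑ k ∈ Finset.range C.N, ((k + 2)! : 𝕜)⁻¹ •
      ∑ n ∈ Finset.piAntidiag (Finset.univ : Finset (Fin (k + 2))) (r + 2),
        C.q (k + 2) (fun _ => 0) (fun j => C.termI w (n j))) := by
  have hk : ∀ k : ℕ, ((r + 2)! : 𝕜)⁻¹ • ∑ f : Fin (r + 2) → Fin (k + 2),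
      C.q (k + 2) (fun _ => 0) (fun j => C.diagI w (block f j).card) =
      ∑ n ∈ Finset.piAntidiag (Finset.univ : Finset (Fin (k + 2))) (r + 2),
        C.q (k + 2) (fun _ => 0) (fun j => C.termI w (n j)) := by
    intro k
    rw [sum_card_block (r + 2) (k + 2) fun n =>
      C.q (k + 2) (fun _ => 0) (fun j => C.diagI w (n j)), Finset.smul_sum]
    refine Finset.sum_congr rfl fun n hn => ?_
    unfold termI
    rw [MultilinearMap.map_smul_univ, ← Nat.cast_smul_eq_nsmul 𝕜, smul_smul]
    congr 1
    have h1 := Nat.multinomial_spec (Finset.univ : Finset (Fin (k + 2))) n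
    rw [(Finset.mem_piAntidiag.1 hn).1] at h1
    have h2 : ((r + 2)! : 𝕜) ≠ 0 := Nat.cast_ne_zero.2 (Nat.factorial_ne_zero _)
    have h3 : (∏ j, ((n j)! : 𝕜)) ≠ 0 :=
      Finset.prod_ne_zero_iff.2 fun j _ => Nat.cast_ne_zero.2 (Nat.factorial_ne_zero _)
    rw [Finset.prod_inv_distrib, inv_mul_eq_iff_eq_mul₀ h2, eq_mul_inv_iff_mul_eq₀ h3, mul_comm]
    exact_mod_cast h1
  unfold termI at hk ⊢
  rw [diagI_add_two, smul_neg, ← map_smul, Finset.smul_sum]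
  congr 2
  simp only [smul_comm (((r + 2)! : 𝕜)⁻¹), hk]
  have hz : ∀ k, r + 1 ≤ k ∨ C.N ≤ k → ((k + 2)! : 𝕜)⁻¹ •
      ∑ n ∈ Finset.piAntidiag (Finset.univ : Finset (Fin (k + 2))) (r + 2),
        C.q (k + 2) (fun _ => 0) (fun j => ((n j)! : 𝕜)⁻¹ • C.diagI w (n j)) = 0 := by
    intro k hk
    rw [Finset.sum_eq_zero, smul_zero]
    intro n hn
    have hn' : ∑ j, n j = r + 2 := (Finset.mem_piAntidiag.1 hn).1
    rcases hk with hk | hk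
    · exact C.q_termI_eq_zero w n (Or.inl (by omega))
    · exact C.q_eq_zero (by omega) _ _
  rw [Finset.sum_subset (Finset.range_mono (le_max_left (r + 1) C.N)),
    Finset.sum_subset (Finset.range_mono (le_max_right (r + 1) C.N))]
  · intro k _ hk'
    exact hz k (Or.inr (by simpa using hk'))
  · intro k _ hk'
    exact hz k (Or.inl (by simpa using hk'))

/-- The map on Maurer–Cartan elements induced by `i_∞` is the solution of `x = i w - h Q(x)`. -/
lemma diagonalSum_opsI (w : W) :
    diagonalSum 𝕜 C.opsI w = C.i w - C.h 1 (C.Q (diagonalSum 𝕜 C.opsI w)) := by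
  have h1 : diagonalSum 𝕜 C.opsI w = ∑ r ∈ Finset.range (C.N + 2), C.termI w r := by
    rw [diagonalSum_eq_sum _ _ (C.N + 1), Finset.sum_range_succ' _ (C.N + 1), termI_zero, add_zero]
    · rfl
    · intro r hr
      exact C.eq_zero_of_mem_Fil (by omega) (C.diagI_mem_Fil w r)
  rw [h1]
  have h2 : C.Q (∑ r ∈ Finset.range (C.N + 2), C.termI w r) =
      ∑ k ∈ Finset.range C.N, ((k + 2)! : 𝕜)⁻¹ • ∑ r ∈ Finset.range C.N,
        ∑ n ∈ Finset.piAntidiag (Finset.univ : Finset (Fin (k + 2))) (r + 2),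
          C.q (k + 2) (fun _ => 0) (fun j => C.termI w (n j)) := by
    unfold Q
    refine Finset.sum_congr rfl fun k _ => ?_
    congr 1
    rw [MultilinearMap.map_sum_finset]
    have hs := Finset.sum_range_succ' (fun r =>
      ∑ n ∈ Finset.piAntidiag (Finset.univ : Finset (Fin (k + 2))) r,
          C.q (k + 2) (fun _ => 0) (fun j => C.termI w (n j))) (C.N + 1)
    rw [Finset.sum_range_succ' _ C.N] at hs
    have hz : ∀ r < 2, ∑ n ∈ Finset.piAntidiag (Finset.univ : Finset (Fin (k + 2))) r,
          C.q (k + 2) (fun _ => 0) (fun j => C.termI w (n j)) = 0 := by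
      intro r hr
      refine Finset.sum_eq_zero fun n hn => C.q_termI_eq_zero w n (Or.inl ?_)
      have : ∑ j, n j = r := (Finset.mem_piAntidiag.1 hn).1
      omega
    rw [hz 0 (by norm_num), hz (0 + 1) (by norm_num), add_zero, add_zero] at hs
    rw [← hs]
    rw [← Finset.sum_filter_of_ne (p := fun n => ∑ j, n j ∈ Finset.range (C.N + 2))
      (s := Fintype.piFinset fun _ => Finset.range (C.N + 2))]
    · rw [← Finset.sum_fiberwise_of_maps_to (t := Finset.range (C.N + 2))
        (g := fun n : Fin (k + 2) → ℕ => ∑ j, n j)]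
      · refine Finset.sum_congr rfl fun r hr => Finset.sum_congr ?_ fun _ _ => rfl
        ext n
        simp only [Finset.mem_filter, Fintype.mem_piFinset, Finset.mem_range,
          Finset.mem_piAntidiag, Finset.mem_univ, implies_true, and_true] at hr ⊢
        constructor
        · exact fun h => h.2
        · intro h
          refine ⟨⟨fun j => lt_of_le_of_lt ?_ hr, lt_of_eq_of_lt h hr⟩, h⟩
          rw [← h]
          exact Finset.single_le_sum (fun _ _ => Nat.zero_le _) (Finset.mem_univ j)
      · intro n hn
        exact (Finset.mem_filter.1 hn).2
    · intro n _ hn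
      by_contra h
      refine hn (C.q_termI_eq_zero w n (Or.inr ?_))
      have h' : C.N + 2 ≤ ∑ j, n j := by rwa [Finset.mem_range, not_lt] at h
      exact le_trans (Nat.le_add_right _ 2) h'
  rw [h2, Finset.sum_range_succ', Finset.sum_range_succ', termI_zero, add_zero, zero_add,
    termI_one, add_comm, sub_eq_add_neg]
  congr 1
  simp only [Finset.smul_sum (s := Finset.range C.N)]
  rw [Finset.sum_comm, map_sum, ← Finset.sum_neg_distrib]
  refine Finset.sum_congr rfl fun r _ => ?_
  rw [termI_add_two]

end Contraction

/-! ### Words with few special letters -/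

section Words

lemma ops_sub_eq {V V' : Type*} (F : Ops V V') {k r : ℕ} (D : Fin r → ℤ) (x : Fin r → V)
    (S : Finset (Fin r))
    (g : Fin k → Fin r) (hg : StrictMono g) (hS : ∀ a, a ∈ S ↔ a ∈ Set.range g) :
    F S.card (sub D S) (sub x S) = F k (fun a => D (g a)) (fun a => x (g a)) := by
  have hk : S.card = k := by
    have : S = Finset.univ.map ⟨g, hg.injective⟩ := by ext a; simp [hS]
    rw [this]; simp
  subst hk
  have := Finset.orderEmbOfFin_unique (s := S) rfl (fun a => (hS (g a)).2 ⟨a, rfl⟩) hg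
  rw [this]
  rfl

variable {V V' : Type*} [AddCommGroup V']

/-- The sum over the sets of places of a word, sorted by whether they contain the first place. -/
lemma sum_finset_fin_succ {M : Type*} [AddCommMonoid M] {m : ℕ} (f : Finset (Fin (m + 1)) → M) :
    ∑ S, f S = ∑ T : Finset (Fin m), f (insert 0 (T.map (Fin.succEmb m))) +
      ∑ T : Finset (Fin m), f (T.map (Fin.succEmb m)) := by
  have h : (Finset.univ : Finset (Fin (m + 1))) =
      insert 0 (Finset.univ.map (Fin.succEmb m)) := by
    ext a; refine Fin.cases ?_ (fun a => ?_) a <;> simp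
  have h0 : (0 : Fin (m + 1)) ∉ Finset.univ.map (Fin.succEmb m) := by simp
  have h1 : ∀ g : Finset (Fin (m + 1)) → M,
      ∑ S ∈ (Finset.univ.map (Fin.succEmb m)).powerset, g S =
        ∑ T : Finset (Fin m), g (T.map (Fin.succEmb m)) := by
    intro g
    refine Eq.trans ?_
      (Finset.sum_map Finset.univ (Finset.mapEmbedding (Fin.succEmb m)).toEmbedding g)
    refine Finset.sum_congr ?_ fun _ _ => rfl
    ext S
    simp only [Finset.mem_powerset, Finset.subset_map_iff, Finset.mem_map, Finset.mem_univ,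
      Finset.subset_univ, true_and]
    exact exists_congr fun T => eq_comm
  rw [← Finset.powerset_univ, h, Finset.sum_powerset_insert h0, h1, h1, add_comm]

lemma sum_finset_card {M : Type*} [AddCommMonoid M] {m : ℕ} (f : ℕ → M) :
    ∑ T : Finset (Fin m), f T.card = ∑ k ∈ Finset.range (m + 1), m.choose k • f k := by
  rw [← Finset.powerset_univ, Finset.sum_powerset_apply_card]
  simp

lemma strictMono_cons_succ {k m : ℕ} {g : Fin k → Fin m} (hg : StrictMono g) :
    StrictMono (Fin.cons 0 (Fin.succ ∘ g) : Fin (k + 1) → Fin (m + 1)) := by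
  intro a b
  refine Fin.cases ?_ (fun a => ?_) a <;> refine Fin.cases ?_ (fun b => ?_) b
  · simp
  · simp [Fin.succ_pos]
  · simp
  · simpa using fun h => hg h

lemma mem_range_cons_succ {k m : ℕ} (g : Fin k → Fin m) (a : Fin (m + 1)) :
    a ∈ Set.range (Fin.cons 0 (Fin.succ ∘ g) : Fin (k + 1) → Fin (m + 1)) ↔
      a = 0 ∨ ∃ b ∈ Set.range g, b.succ = a := by
  simp [Fin.range_cons, Set.range_comp]

/-- Merging letters of a word whose letters are all equal to an element `x` of degree `0`, except
for the first one. -/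
lemma mergeSum_cons_const (q : Ops V V) (F : Ops V V') (P : ℕ → Prop) [DecidablePred P] (m : ℕ)
    (d : ℤ) (y x : V) :
    mergeSum q F P (m + 1) (Fin.cons d fun _ => 0) (Fin.cons y fun _ => x) =
      ∑ k ∈ Finset.range (m + 1), m.choose k •
        ((if P (k + 1) then F (m - k + 1) (Fin.cons (d + 1) fun _ => 0)
            (Fin.cons (q (k + 1) (Fin.cons d fun _ => 0) (Fin.cons y fun _ => x)) fun _ => x)
            else 0) +
          if P k then F (m - k + 2) (Fin.cons 1 (Fin.cons d fun _ => 0))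
            (Fin.cons (q k (fun _ => 0) fun _ => x) (Fin.cons y fun _ => x)) else 0) := by
  rw [← sum_finset_card fun k =>
    ((if P (k + 1) then F (m - k + 1) (Fin.cons (d + 1) fun _ => 0)
            (Fin.cons (q (k + 1) (Fin.cons d fun _ => 0) (Fin.cons y fun _ => x)) fun _ => x)
            else 0) +
          if P k then F (m - k + 2) (Fin.cons 1 (Fin.cons d fun _ => 0))
            (Fin.cons (q k (fun _ => 0) fun _ => x) (Fin.cons y fun _ => x)) else 0)]
  unfold mergeSum
  rw [sum_finset_fin_succ, Finset.sum_add_distrib]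
  have hsgn : ∀ S : Finset (Fin (m + 1)),
      koszulSign (Fin.cons d fun _ => 0 : Fin (m + 1) → ℤ) (frontKey S) = 1 := by
    intro S
    refine koszulSign_single _ _ 0 fun a ha => ?_
    obtain ⟨b, rfl⟩ := Fin.exists_succ_eq.2 ha
    simp
  have hcard : ∀ T : Finset (Fin m), (insert 0 (T.map (Fin.succEmb m))).card = T.card + 1 := by
    intro T; rw [Finset.card_insert_of_notMem (by simp)]; simp
  have hcard' : ∀ T : Finset (Fin m), (T.map (Fin.succEmb m)).card = T.card := by
    intro T; simp
  congr 1
  · refine Finset.sum_congr rfl fun T _ => ?_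
    rw [hcard]
    refine if_congr Iff.rfl ?_ rfl
    unfold mergeTerm
    rw [hsgn, one_smul]
    have e1 : q (insert 0 (T.map (Fin.succEmb m))).card
        (sub (Fin.cons d fun _ => 0) (insert 0 (T.map (Fin.succEmb m))))
        (sub (Fin.cons y fun _ => x) (insert 0 (T.map (Fin.succEmb m)))) =
        q (T.card + 1) (Fin.cons d fun _ => 0) (Fin.cons y fun _ => x) := by
      rw [ops_sub_eq q _ _ _ _ (strictMono_cons_succ (T.orderEmbOfFin rfl).strictMono)
        (fun a => by rw [mem_range_cons_succ]; simp)]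
      congr 1 <;> funext a <;> refine Fin.cases ?_ (fun a => ?_) a <;> simp
    have e2 : ∑ a ∈ insert 0 (T.map (Fin.succEmb m)),
        (Fin.cons d fun _ => 0 : Fin (m + 1) → ℤ) a = d := by
      rw [Finset.sum_insert (by simp)]; simp
    rw [e1, e2, ops_sub_eq (fun r D z => F (r + 1) (Fin.cons (d + 1) D)
      (Fin.cons (q (T.card + 1) (Fin.cons d fun _ => 0) (Fin.cons y fun _ => x)) z)) _ _ _
      (Fin.succ ∘ Tᶜ.orderEmbOfFin rfl)
      (Fin.strictMono_succ.comp (Tᶜ.orderEmbOfFin rfl).strictMono)]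
    · simp only [Function.comp_apply, Fin.cons_succ]
      rw [Finset.card_compl, Fintype.card_fin]
    · intro a
      refine Fin.cases ?_ (fun a => ?_) a
      · simp [Fin.succ_ne_zero]
      · simp [Set.range_comp]
  · refine Finset.sum_congr rfl fun T _ => ?_
    rw [hcard']
    refine if_congr Iff.rfl ?_ rfl
    unfold mergeTerm
    rw [hsgn, one_smul]
    have e1 : q (T.map (Fin.succEmb m)).card
        (sub (Fin.cons d fun _ => 0) (T.map (Fin.succEmb m)))
        (sub (Fin.cons y fun _ => x) (T.map (Fin.succEmb m))) =
        q T.card (fun _ => 0) (fun _ => x) := by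
      rw [ops_sub_eq q _ _ _ (Fin.succ ∘ T.orderEmbOfFin rfl)
        (Fin.strictMono_succ.comp (T.orderEmbOfFin rfl).strictMono)]
      · simp
      · intro a
        refine Fin.cases ?_ (fun a => ?_) a
        · simp [Fin.succ_ne_zero]
        · simp [Set.range_comp]
    have e2 : ∑ a ∈ T.map (Fin.succEmb m),
        (Fin.cons d fun _ => 0 : Fin (m + 1) → ℤ) a = 0 := by simp
    rw [e1, e2, zero_add, ops_sub_eq (fun r D z => F (r + 1) (Fin.cons 1 D)
      (Fin.cons (q T.card (fun _ => 0) (fun _ => x)) z)) _ _ _ _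
      (strictMono_cons_succ (Tᶜ.orderEmbOfFin rfl).strictMono)
      (by
        intro a
        rw [mem_range_cons_succ]
        refine Fin.cases ?_ (fun a => ?_) a <;> simp)]
    have e3 : (fun a => (Fin.cons d fun _ => 0 : Fin (m + 1) → ℤ)
        ((Fin.cons 0 (Fin.succ ∘ Tᶜ.orderEmbOfFin rfl) : Fin (Tᶜ.card + 1) → Fin (m + 1)) a)) =
        Fin.cons d fun _ => 0 := by
      funext a; refine Fin.cases ?_ (fun a => ?_) a <;> simp
    have e4 : (fun a => (Fin.cons y fun _ => x : Fin (m + 1) → V)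
        ((Fin.cons 0 (Fin.succ ∘ Tᶜ.orderEmbOfFin rfl) : Fin (Tᶜ.card + 1) → Fin (m + 1)) a)) =
        Fin.cons y fun _ => x := by
      funext a; refine Fin.cases ?_ (fun a => ?_) a <;> simp
    rw [e3, e4, Finset.card_compl, Fintype.card_fin]

end Words
namespace Contraction

variable {𝕜 V W : Type*} [Field 𝕜] [AddCommGroup V] [Module 𝕜 V] [AddCommGroup W]
  [Module 𝕜 W] (C : Contraction 𝕜 V W)

/-! ### The components of `p_∞` -/

/-- The words obtained by merging the letters in `S` are multilinear in the letters. -/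
def mergeMulti {r : ℕ} (S : Finset (Fin r))
    (G : MultilinearMap 𝕜 (fun _ : Fin (Sᶜ.card + 1) => V) W)
    (g : MultilinearMap 𝕜 (fun _ : Fin S.card => V) V) :
    MultilinearMap 𝕜 (fun _ : Fin r => V) W :=
  (MultilinearMap.curryFinFinset 𝕜 W V rfl rfl).symm (G.curryLeft.compMultilinearMap g)

lemma mergeMulti_apply {r : ℕ} (S : Finset (Fin r))
    (G : MultilinearMap 𝕜 (fun _ : Fin (Sᶜ.card + 1) => V) W)
    (g : MultilinearMap 𝕜 (fun _ : Fin S.card => V) V) (x : Fin r → V) :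
    mergeMulti S G g x = G (Fin.cons (g (sub x S)) (sub x Sᶜ)) := by
  simp [mergeMulti, MultilinearMap.curryFinFinset_symm_apply]
  rfl

/-- The letters of `homotopyWord` as linear functions of the original letters. -/
def letter {r : ℕ} (D : Fin r → ℤ) (j a : Fin r) : V →ₗ[𝕜] V :=
  if a < j then C.proj else if a = j then C.h (D a) else LinearMap.id

/-- The word in which the homotopy is applied to the letter at the place `j`. -/
def word {r : ℕ} (D : Fin r → ℤ) (x : Fin r → V) (j : Fin r) : Fin r → V :=
  homotopyWord (fun D => C.h D) C.i C.p D x j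

lemma word_eq {r : ℕ} (D : Fin r → ℤ) (x : Fin r → V) (j : Fin r) :
    C.word D x j = fun a => C.letter D j a (x a) := by
  funext a
  unfold word homotopyWord letter
  split_ifs <;> simp [proj]

/-- The composite `p_∞ δ`, with values in `W`. -/
def merged : Ops V W := mergeSum C.ops C.opsP (2 ≤ ·)

lemma sum_subtype_mergeTerm {r : ℕ} (D : Fin r → ℤ) (x : Fin r → V) :
    ∑ S : {S : Finset (Fin r) // 2 ≤ S.card}, mergeTerm C.ops C.opsP D x S.1 =
      C.merged r D x := by
  unfold merged mergeSum
  rw [← Finset.sum_filter]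
  exact (Finset.sum_subtype (p := fun S : Finset (Fin r) => 2 ≤ S.card)
    (Finset.univ.filter fun S => 2 ≤ S.card) (by simp) _).symm

/-- The composite `p_∞ δ H` before symmetrization. -/
def mergedH : Ops V W := fun r D x => ∑ j : Fin r,
  sgn (∑ a ∈ Finset.univ.filter (· < j), D a) •
    C.merged r (homotopyDeg D j) (C.word D x j)

lemma opsP_add_two (r : ℕ) (D : Fin (r + 2) → ℤ) (x : Fin (r + 2) → V) :
    C.opsP (r + 2) D x = -((r + 2)! : 𝕜)⁻¹ • ∑ σ : Equiv.Perm (Fin (r + 2)),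
      koszulSign D (σ.symm : Fin (r + 2) → Fin (r + 2)) •
        C.mergedH (r + 2) (fun a => D (σ a)) (fun a => x (σ a)) := by
  conv_lhs => rw [opsP, transferP]
  congr 1
  refine Finset.sum_congr rfl fun σ _ => ?_
  unfold mergedH
  rw [Finset.smul_sum]
  refine Finset.sum_congr rfl fun j _ => ?_
  rw [smul_smul, ← sum_subtype_mergeTerm]
  rfl

lemma opsP_zero (D : Fin 0 → ℤ) (x : Fin 0 → V) : C.opsP 0 D x = 0 := by
  simp [opsP, transferP]

lemma opsP_one (D : Fin 1 → ℤ) (x : Fin 1 → V) : C.opsP 1 D x = C.p (x 0) := by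
  simp [opsP, transferP]

lemma exists_multilinear_opsP (r : ℕ) : ∀ D : Fin r → ℤ,
    ∃ f : MultilinearMap 𝕜 (fun _ : Fin r => V) W, ∀ x, C.opsP r D x = f x := by
  induction r using Nat.strong_induction_on with
  | _ r ih =>
    intro D
    match r, ih, D with
    | 0, _, D => exact ⟨0, fun x => C.opsP_zero D x⟩
    | 1, _, D => exact ⟨C.p.compMultilinearMap
        (MultilinearMap.ofSubsingleton 𝕜 V V (0 : Fin 1) LinearMap.id), fun x => by
        rw [opsP_one]; simp⟩
    | r + 2, ih, D =>
      have h1 : ∀ (D : Fin (r + 2) → ℤ) (S : {S : Finset (Fin (r + 2)) // 2 ≤ S.card}),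
          ∃ f : MultilinearMap 𝕜 (fun _ : Fin (r + 2) => V) W,
            ∀ x, mergeTerm C.ops C.opsP D x S.1 = f x := by
        intro D S
        obtain ⟨G, hG⟩ := ih _ (compl_card_lt S) (Fin.cons (∑ a ∈ S.1, D a + 1) (sub D S.1ᶜ))
        refine ⟨koszulSign D (frontKey S.1) • mergeMulti S.1 G (C.q S.1.card (sub D S.1)),
          fun x => ?_⟩
        rw [smul_apply, mergeMulti_apply, ← hG]
        rfl
      choose f hf using h1
      refine ⟨-((r + 2)! : 𝕜)⁻¹ • ∑ σ : Equiv.Perm (Fin (r + 2)),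
        koszulSign D (σ.symm : Fin (r + 2) → Fin (r + 2)) • ∑ j : Fin (r + 2),
          sgn (∑ a ∈ Finset.univ.filter (· < j), D (σ a)) •
            ∑ S, ((f (homotopyDeg (fun a => D (σ a)) j) S).compLinearMap
              (C.letter (fun a => D (σ a)) j)).domDomCongr σ, fun x => ?_⟩
      rw [opsP_add_two, smul_apply, sum_apply]
      congr 1
      refine Finset.sum_congr rfl fun σ _ => ?_
      rw [smul_apply, sum_apply]
      unfold mergedH
      congr 1
      refine Finset.sum_congr rfl fun j _ => ?_
      rw [smul_apply, sum_apply, ← sum_subtype_mergeTerm]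
      congr 1
      refine Finset.sum_congr rfl fun S _ => ?_
      rw [hf, word_eq]
      rfl

/-- The components of `p_∞` as multilinear maps. -/
def P (r : ℕ) (D : Fin r → ℤ) : MultilinearMap 𝕜 (fun _ : Fin r => V) W :=
  (C.exists_multilinear_opsP r D).choose

lemma opsP_eq (r : ℕ) (D : Fin r → ℤ) (x : Fin r → V) : C.opsP r D x = C.P r D x :=
  (C.exists_multilinear_opsP r D).choose_spec x

/-- The composite `p_∞ δ` as a family of multilinear maps. -/
def Psi (r : ℕ) (D : Fin r → ℤ) : MultilinearMap 𝕜 (fun _ : Fin r => V) W :=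
  ∑ S : Finset (Fin r), if 2 ≤ S.card then koszulSign D (frontKey S) •
    mergeMulti S (C.P _ (Fin.cons (∑ a ∈ S, D a + 1) (sub D Sᶜ))) (C.q S.card (sub D S)) else 0

lemma merged_eq (r : ℕ) (D : Fin r → ℤ) (x : Fin r → V) : C.merged r D x = C.Psi r D x := by
  unfold Psi merged mergeSum
  rw [sum_apply]
  refine Finset.sum_congr rfl fun S _ => ?_
  split_ifs
  · rw [smul_apply, mergeMulti_apply, ← opsP_eq]; rfl
  · rfl

lemma opsP_isGradedSymm : IsGradedSymm C.U C.opsP := by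
  intro r D x _ τ
  match r, D, x, τ with
  | 0, D, x, τ => simp [opsP_zero]
  | 1, D, x, τ =>
    have : τ = 1 := Subsingleton.elim _ _
    subst this
    have : koszulSign D ((1 : Equiv.Perm (Fin 1)).symm : Fin 1 → Fin 1) = 1 := by
      simp [koszulSign]
    rw [this, one_smul]; rfl
  | r + 2, D, x, τ =>
    rw [opsP_add_two, opsP_add_two, smul_comm (koszulSign _ _)]
    congr 1
    rw [Finset.smul_sum]
    refine Fintype.sum_equiv (Equiv.mulLeft τ) _ _ fun σ => ?_
    rw [Equiv.coe_mulLeft, koszulSign_mul, smul_smul, ← mul_assoc, koszulSign_mul_self, one_mul]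
    rfl

lemma P_symm (r : ℕ) (D : Fin r → ℤ) (x : Fin r → V) (hx : ∀ a, x a ∈ C.U (D a))
    (σ : Equiv.Perm (Fin r)) : C.P r (fun a => D (σ a)) (fun a => x (σ a)) =
      koszulSign D (σ.symm : Fin r → Fin r) • C.P r D x := by
  rw [← opsP_eq, ← opsP_eq]
  exact C.opsP_isGradedSymm r D x hx σ

lemma Psi_symm (r : ℕ) (D : Fin r → ℤ) (x : Fin r → V) (hx : ∀ a, x a ∈ C.U (D a))
    (σ : Equiv.Perm (Fin r)) : C.Psi r (fun a => D (σ a)) (fun a => x (σ a)) =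
      koszulSign D (σ.symm : Fin r → Fin r) • C.Psi r D x := by
  rw [← merged_eq, ← merged_eq]
  refine mergeSum_isGradedSymm (F := C.opsP) C.q_symm C.opsP_isGradedSymm C.q_mem ?_ _ r D x hx σ
  intro r D x n k d E y
  rw [opsP_eq, opsP_eq]
  have := (C.P (k + 1) (Fin.cons d E)).cons_smul y (n : 𝕜) (C.q r D x)
  rw [Int.cast_smul_eq_zsmul, Int.cast_smul_eq_zsmul] at this
  exact this

lemma proj_fil (k : ℕ) (x : V) (hx : x ∈ C.Fil k) : C.proj x ∈ C.Fil k := by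
  have h := C.homotopy 0 x
  have : C.proj x = x - (C.q 1 (fun _ => 0 - 1) (fun _ => C.h 0 x) +
    C.h (0 + 1) (C.q 1 (fun _ => 0) (fun _ => x))) := by rw [h]; simp [proj]
  rw [this]
  refine sub_mem hx (add_mem ?_ (C.h_fil _ _ _ ?_))
  · simpa using C.q_fil 1 (fun _ => 0 - 1) (fun _ => k) _ fun _ => C.h_fil _ _ _ hx
  · simpa using C.q_fil 1 (fun _ => 0) (fun _ => k) _ fun _ => hx

lemma proj_mem (D : ℤ) (x : V) (hx : x ∈ C.U D) : C.proj x ∈ C.U D := by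
  have h := C.homotopy D x
  have : C.proj x = x - (C.q 1 (fun _ => D - 1) (fun _ => C.h D x) +
    C.h (D + 1) (C.q 1 (fun _ => D) (fun _ => x))) := by rw [h]; simp [proj]
  rw [this]
  refine sub_mem hx (add_mem ?_ ?_)
  · have := C.q_mem 1 (fun _ => D - 1) (fun _ => C.h D x) fun _ => C.h_mem _ _ hx
    simpa using this
  · have h1 : C.q 1 (fun _ => D) (fun _ => x) ∈ C.U (D + 1) := by
      simpa using C.q_mem 1 (fun _ => D) (fun _ => x) fun _ => hx
    simpa using C.h_mem (D + 1) _ h1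

lemma word_fil {r : ℕ} (D : Fin r → ℤ) (x : Fin r → V) (j : Fin r) (k : Fin r → ℕ)
    (hx : ∀ a, x a ∈ C.Fil (k a)) (a : Fin r) : C.word D x j a ∈ C.Fil (k a) := by
  rw [word_eq]
  unfold letter
  dsimp only
  split_ifs
  · exact C.proj_fil _ _ (hx a)
  · exact C.h_fil _ _ _ (hx a)
  · exact hx a

lemma opsP_fil (r : ℕ) : ∀ (D : Fin r → ℤ) (k : Fin r → ℕ) (x : Fin r → V),
    (∀ a, x a ∈ C.Fil (k a)) → C.i (C.opsP r D x) ∈ C.Fil (∑ a, k a) := by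
  induction r using Nat.strong_induction_on with
  | _ r ih =>
    intro D k x hx
    match r, ih, D, k, x, hx with
    | 0, _, D, k, x, hx => rw [opsP_zero, map_zero]; exact zero_mem _
    | 1, _, D, k, x, hx => rw [opsP_one]; simpa [proj] using C.proj_fil _ _ (hx 0)
    | r + 2, ih, D, k, x, hx =>
      rw [opsP_add_two, map_smul, map_sum]
      refine Submodule.smul_mem _ _ (Submodule.sum_mem _ fun σ _ => ?_)
      rw [map_zsmul]
      refine zsmul_mem ?_ _
      unfold mergedH
      rw [map_sum]
      refine Submodule.sum_mem _ fun j _ => ?_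
      rw [map_zsmul]
      refine zsmul_mem ?_ _
      rw [← sum_subtype_mergeTerm, map_sum]
      refine Submodule.sum_mem _ fun S _ => ?_
      unfold mergeTerm
      rw [map_zsmul]
      refine zsmul_mem ?_ _
      set y := C.word (fun a => D (σ a)) (fun a => x (σ a)) j with hy
      have hyk : ∀ a, y a ∈ C.Fil (k (σ a)) :=
        C.word_fil _ _ _ (fun a => k (σ a)) fun a => hx _
      have h1 := ih _ (compl_card_lt S) (Fin.cons ((∑ a ∈ S.1,
          homotopyDeg (fun a => D (σ a)) j a) + 1) (sub (homotopyDeg (fun a => D (σ a)) j) S.1ᶜ))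
        (Fin.cons (∑ a, sub (fun a => k (σ a)) S.1 a) (sub (fun a => k (σ a)) S.1ᶜ))
        (Fin.cons (C.ops S.1.card (sub (homotopyDeg (fun a => D (σ a)) j) S.1) (sub y S.1))
          (sub y S.1ᶜ)) (by
          intro a
          refine Fin.cases ?_ (fun a => ?_) a
          · exact C.q_fil _ _ _ _ fun a => hyk _
          · exact hyk _)
      refine C.Fil_anti (le_of_eq ?_) h1
      have hs : ∀ S : Finset (Fin (r + 2)),
          ∑ a, sub (fun a => k (σ a)) S a = ∑ a ∈ S, k (σ a) := by
        intro S
        rw [← Finset.sum_coe_sort S, ← (S.orderIsoOfFin rfl).toEquiv.sum_comp]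
        rfl
      rw [Fin.sum_cons, hs, hs, Finset.sum_add_sum_compl, Equiv.sum_comp]

lemma P_eq_zero {r : ℕ} (D : Fin r → ℤ) (k : Fin r → ℕ) (x : Fin r → V)
    (hx : ∀ a, x a ∈ C.Fil (k a)) (hk : C.N ≤ ∑ a, k a) : C.P r D x = 0 := by
  rw [← opsP_eq]
  apply C.i_injective
  rw [map_zero]
  exact C.eq_zero_of_mem_Fil hk (C.opsP_fil r D k x hx)

end Contraction

/-! ### The derivative of the map on Maurer–Cartan elements along the homotopy -/

lemma koszulSign_pair {r : ℕ} {κ : Type*} [LinearOrder κ] (D : Fin r → ℤ) (f : Fin r → κ)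
    (s s' : Fin r) (hss : s < s') (h : ∀ a, a ≠ s → a ≠ s' → D a = 0) :
    koszulSign D f = if f s' < f s then sgn (D s * D s') else 1 := by
  unfold koszulSign
  have h1 : ∀ a b, a < b → (a ≠ s ∨ b ≠ s') → sgn (D a * D b) = 1 := by
    intro a b hab hne
    by_cases ha : a = s
    · subst ha
      have hb : b ≠ s' := by simpa using hne
      rw [h b hab.ne' hb, mul_zero, sgn_zero]
    · by_cases ha' : a = s'
      · subst ha'
        rw [h b (hss.trans hab).ne' hab.ne', mul_zero, sgn_zero]
      · rw [h a ha ha', zero_mul, sgn_zero]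
  rw [Finset.prod_eq_single s, Finset.prod_eq_single s']
  · simp [hss]
  · intro b _ hb
    split_ifs with hc
    · exact h1 s b hc.1 (Or.inr hb)
    · rfl
  · simp
  · intro a _ ha
    refine Finset.prod_eq_one fun b _ => ?_
    split_ifs with hc
    · exact h1 a b hc.1 (Or.inl ha)
    · rfl
  · simp

lemma koszulSign_swap_zero_one {r : ℕ} (D : Fin (r + 2) → ℤ) :
    koszulSign D ((Equiv.swap (0 : Fin (r + 2)) 1).symm : Fin (r + 2) → Fin (r + 2)) =
      sgn (D 0 * D 1) := by
  unfold koszulSign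
  have key : ∀ a b : Fin (r + 2), a < b →
      Equiv.swap (0 : Fin (r + 2)) 1 b < Equiv.swap (0 : Fin (r + 2)) 1 a → a = 0 ∧ b = 1 := by
    intro a b hab h
    by_cases ha : a = 0
    · subst ha
      refine ⟨rfl, ?_⟩
      rw [Equiv.swap_apply_left] at h
      by_contra hb
      rw [Equiv.swap_apply_of_ne_of_ne hab.ne' hb, Fin.lt_one_iff] at h
      exact hab.ne' h
    · by_cases ha' : a = 1
      · subst ha'
        rw [Equiv.swap_apply_right] at h
        exact absurd h (Fin.not_lt_zero _)
      · have hb : b ≠ 0 := ((Fin.zero_le a).trans_lt hab).ne'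
        have hb' : b ≠ 1 := by
          rintro rfl
          rw [Fin.lt_one_iff] at hab
          exact ha hab
        rw [Equiv.swap_apply_of_ne_of_ne hb hb', Equiv.swap_apply_of_ne_of_ne ha ha'] at h
        exact absurd h hab.not_gt
  rw [Finset.prod_eq_single 0, Finset.prod_eq_single 1]
  · simp
  · intro b _ hb
    split_ifs with hc
    · exact absurd (key 0 b hc.1 hc.2).2 hb
    · rfl
  · simp
  · intro a _ ha
    refine Finset.prod_eq_one fun b _ => ?_
    split_ifs with hc
    · exact absurd (key a b hc.1 hc.2).1 ha
    · rfl
  · simp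

lemma exists_perm_zero_one {r : ℕ} {j k : Fin (r + 2)} (hjk : j ≠ k) :
    ∃ σ : Equiv.Perm (Fin (r + 2)), σ 0 = j ∧ σ 1 = k := by
  have h : (0 : Fin (r + 2)) ≠ Equiv.swap 0 j k := by
    intro h
    have h' := congrArg (Equiv.swap 0 j) h
    rw [Equiv.swap_apply_self, Equiv.swap_apply_left] at h'
    exact hjk h'
  refine ⟨Equiv.swap 0 j * Equiv.swap 1 (Equiv.swap 0 j k), ?_, ?_⟩
  · rw [Equiv.Perm.mul_apply, Equiv.swap_apply_of_ne_of_ne Fin.zero_ne_one h,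
      Equiv.swap_apply_left]
  · rw [Equiv.Perm.mul_apply, Equiv.swap_apply_left, Equiv.swap_apply_self]

lemma comp_swap_zero_one {r : ℕ} {α : Type*} (f : Fin (r + 2) → α) (hf : f 0 = f 1) :
    (fun a => f (Equiv.swap (0 : Fin (r + 2)) 1 a)) = f := by
  funext a
  by_cases ha : a = 0
  · subst ha; rw [Equiv.swap_apply_left, hf]
  · by_cases ha' : a = 1
    · subst ha'; rw [Equiv.swap_apply_right, hf]
    · rw [Equiv.swap_apply_of_ne_of_ne ha ha']

/-- Each place `j` contributes `f j`, and each later place contributes a difference. -/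
lemma sum_telescope {M : Type*} [AddCommGroup M] (f : ℕ → M) (R : ℕ) :
    ∑ j ∈ Finset.range R, (f j + ∑ s ∈ Finset.range R, if j < s then f j - f (j + 1) else 0) =
      R • f 0 := by
  induction R with
  | zero => simp
  | succ R ih =>
    simp only [Finset.sum_range_succ _ R, ← add_assoc]
    rw [Finset.sum_add_distrib, ih, Finset.sum_congr rfl (g := fun j => f j - f (j + 1))
      (fun j hj => if_pos (Finset.mem_range.1 hj)), Finset.sum_range_sub', add_smul, one_smul,
      Finset.sum_eq_zero]
    · simp only [lt_irrefl, if_false, add_zero]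
      abel
    · intro s hs
      rw [if_neg (Finset.mem_range.1 hs).not_gt]

namespace Contraction

variable {𝕜 V W : Type*} [Field 𝕜] [AddCommGroup V] [Module 𝕜 V] [AddCommGroup W]
  [Module 𝕜 W] (C : Contraction 𝕜 V W)

lemma proj_apply (x : V) : C.proj x = C.i (C.p x) := rfl

lemma Psi_symm_single {r : ℕ} (D : Fin r → ℤ) (x : Fin r → V) (hx : ∀ a, x a ∈ C.U (D a))
    (j : Fin r) (hD : ∀ a, a ≠ j → D a = 0) (σ : Equiv.Perm (Fin r)) :
    C.Psi r (fun a => D (σ a)) (fun a => x (σ a)) = C.Psi r D x := by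
  rw [C.Psi_symm r D x hx, koszulSign_single _ _ j hD, one_smul]

/-- The degrees of the letters of `wordW`. -/
def degW {R : ℕ} (j : Fin R) : Fin R → ℤ := fun a => if a = j then -1 else 0

/-- The word `π x, …, π x, h x, x, …, x` with the letter `h x` at the place `j`. -/
def wordW {R : ℕ} (x : V) (j : Fin R) : Fin R → V :=
  fun a => if a < j then C.proj x else if a = j then C.h 0 x else x

lemma wordW_mem {R : ℕ} {x : V} (hx : x ∈ C.U 0) (j a : Fin R) :
    C.wordW x j a ∈ C.U (degW j a) := by
  unfold wordW degW
  by_cases h1 : a < j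
  · simp [h1, h1.ne, C.proj_mem _ _ hx]
  · by_cases h2 : a = j
    · simpa [h2] using C.h_mem _ _ hx
    · simp [h1, h2, hx]

lemma homotopyDeg_zero {R : ℕ} (j : Fin R) : homotopyDeg (fun _ => 0) j = degW j := by
  funext a; simp [homotopyDeg, degW]

lemma word_update {R : ℕ} (x z : V) (s j : Fin R) :
    C.word (fun _ => 0) (Function.update (fun _ => x) s z) j =
      Function.update (C.wordW x j) s (C.letter (fun _ => 0) j s z) := by
  rw [word_eq]
  funext a
  by_cases ha : a = s
  · subst ha; simp
  · simp only [Function.update_of_ne ha]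
    unfold letter wordW
    split_ifs <;> simp

/-- Moving the letter `i p x` from a place after `h x` to the place of `h x`, and `h x` to the next
place, gives the word in which the homotopy acts on the next letter. -/
lemma Psi_shift {R : ℕ} {x : V} (hx : x ∈ C.U 0) {j j' s : Fin R} (hj : (j' : ℕ) = j + 1)
    (hs : j < s) : C.Psi R (degW j) (Function.update (C.wordW x j) s (C.proj x)) =
      C.Psi R (degW j') (C.wordW x j') := by
  have hjj' : j ≠ j' := by intro h; rw [h] at hj; omega
  rw [← C.Psi_symm_single (degW j) (Function.update (C.wordW x j) s (C.proj x)) ?_ j ?_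
    (Equiv.swap j s * Equiv.swap j' s)]
  · have key : ∀ a : Fin R, (Equiv.swap j s * Equiv.swap j' s) a =
        if a = j then s else if a = j' then j else if a = s then j' else a := by
      intro a
      rw [Equiv.Perm.mul_apply]
      by_cases h1 : a = j
      · subst h1; simp [Equiv.swap_apply_of_ne_of_ne hjj' hs.ne]
      · by_cases h2 : a = j'
        · subst h2; simp [h1]
        · by_cases h3 : a = s
          · subst h3; simp [h1, h2, Equiv.swap_apply_of_ne_of_ne hjj'.symm (Ne.symm h2)]
          · simp [h1, h2, h3, Equiv.swap_apply_of_ne_of_ne]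
    have e1 : (fun a => degW j ((Equiv.swap j s * Equiv.swap j' s) a)) = degW j' := by
      funext a
      rw [key]
      unfold degW
      by_cases h1 : a = j
      · subst h1; simp [hs.ne', hjj']
      · by_cases h2 : a = j'
        · subst h2; simp [h1]
        · by_cases h3 : a = s
          · subst h3; simp [h1, h2, hjj'.symm]
          · simp [h1, h2, h3]
    have e2 : (fun a => Function.update (C.wordW x j) s (C.proj x)
        ((Equiv.swap j s * Equiv.swap j' s) a)) = C.wordW x j' := by
      funext a
      rw [key]
      unfold wordW
      by_cases h1 : a = j
      · subst h1
        have : a < j' := by rw [Fin.lt_def]; omega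
        simp [this]
      · by_cases h2 : a = j'
        · subst h2
          simp [h1, hs.ne]
        · have hlt : a < j ↔ a < j' := by
            rw [Fin.lt_def, Fin.lt_def]
            have : (a : ℕ) ≠ j := fun h => h1 (Fin.ext h)
            omega
          by_cases h3 : a = s
          · subst h3
            have hlt' : ¬ j' < j := by rw [Fin.lt_def]; omega
            have : ¬ a < j' := fun h => absurd (hlt.2 h) hs.not_gt
            simp [h1, h2, hjj'.symm, hlt', this, Function.update_of_ne (Ne.symm h2)]
          · simp [h1, h2, h3, hlt]
    rw [e1, e2]
  · intro a
    by_cases ha : a = s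
    · subst ha
      simpa [degW, hs.ne'] using C.proj_mem _ _ hx
    · rw [Function.update_of_ne ha]; exact C.wordW_mem hx j a
  · intro a ha
    simp [degW, ha]

lemma Psi_wordW_zero {r : ℕ} (x : V) : C.Psi (r + 1) (degW 0) (C.wordW x 0) =
    C.Psi (r + 1) (Fin.cons (-1) fun _ => 0) (Fin.cons (C.h 0 x) fun _ => x) := by
  have e1 : degW (0 : Fin (r + 1)) = Fin.cons (-1) fun _ => 0 := by
    funext a; refine Fin.cases ?_ (fun a => ?_) a <;> simp [degW]
  have e2 : C.wordW x (0 : Fin (r + 1)) = Fin.cons (C.h 0 x) fun _ => x := by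
    funext a; refine Fin.cases ?_ (fun a => ?_) a <;> simp [wordW]
  rw [e1, e2]

variable [CharZero 𝕜]

/-- For a family of words that is stable under permutations, the symmetrization in the recursion
for `p_∞` is redundant. -/
lemma sum_P_eq {r : ℕ} {T : Type*} [Fintype T] (c : T → ℤ) (D : T → Fin (r + 2) → ℤ)
    (w : T → Fin (r + 2) → V) (e : Equiv.Perm (Fin (r + 2)) → T ≃ T)
    (hc : ∀ σ t, koszulSign (D t) (σ.symm : Fin (r + 2) → Fin (r + 2)) * c t = c (e σ t))
    (hD : ∀ σ t, (fun a => D t (σ a)) = D (e σ t)) (hw : ∀ σ t, (fun a => w t (σ a)) = w (e σ t)) :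
    ∑ t, c t • C.P (r + 2) (D t) (w t) = -∑ t, c t • C.mergedH (r + 2) (D t) (w t) := by
  have h1 : ∀ t, c t • C.P (r + 2) (D t) (w t) = -((r + 2)! : 𝕜)⁻¹ •
      ∑ σ : Equiv.Perm (Fin (r + 2)), c (e σ t) •
        C.mergedH (r + 2) (D (e σ t)) (w (e σ t)) := by
    intro t
    rw [← opsP_eq, opsP_add_two, smul_comm, Finset.smul_sum]
    congr 1
    refine Finset.sum_congr rfl fun σ _ => ?_
    rw [smul_smul, hD, hw, mul_comm, hc]
  rw [Finset.sum_congr rfl fun t _ => h1 t, ← Finset.smul_sum, Finset.sum_comm,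
    Finset.sum_congr rfl fun σ _ => (e σ).sum_comp
      (fun t => c t • C.mergedH (r + 2) (D t) (w t)), Finset.sum_const, Finset.card_univ,
    Fintype.card_perm, Fintype.card_fin, ← Nat.cast_smul_eq_nsmul 𝕜, smul_smul, neg_mul,
    inv_mul_cancel₀ (Nat.cast_ne_zero.2 (Nat.factorial_ne_zero _)), neg_smul, one_smul]

/-- A word with two equal letters of odd degree. -/
lemma Psi_eq_zero_of_odd {r : ℕ} (D : Fin (r + 2) → ℤ) (x : Fin (r + 2) → V)
    (hx : ∀ a, x a ∈ C.U (D a)) {j k : Fin (r + 2)} (hjk : j ≠ k) (hDj : D j = -1)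
    (hDk : D k = -1) (hxjk : x j = x k) : C.Psi (r + 2) D x = 0 := by
  obtain ⟨σ, hσ0, hσ1⟩ := exists_perm_zero_one hjk
  have h1 := C.Psi_symm _ D x hx σ
  have h2 := C.Psi_symm _ (fun a => D (σ a)) (fun a => x (σ a)) (fun a => hx _)
    (Equiv.swap 0 1)
  have e1 : (fun a => D (σ (Equiv.swap (0 : Fin (r + 2)) 1 a))) = fun a => D (σ a) :=
    comp_swap_zero_one (fun a => D (σ a)) (by simp [hσ0, hσ1, hDj, hDk])
  have e2 : (fun a => x (σ (Equiv.swap (0 : Fin (r + 2)) 1 a))) = fun a => x (σ a) :=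
    comp_swap_zero_one (fun a => x (σ a)) (by simp [hσ0, hσ1, hxjk])
  rw [e1, e2, koszulSign_swap_zero_one, hσ0, hσ1,
    hDj, hDk] at h2
  have h3 : C.Psi (r + 2) (fun a => D (σ a)) (fun a => x (σ a)) = 0 := by
    have : (2 : 𝕜) • C.Psi (r + 2) (fun a => D (σ a)) (fun a => x (σ a)) = 0 := by
      rw [two_smul]
      nth_rewrite 1 [h2]
      simp
    simpa using this
  rw [h3] at h1
  have h4 := congrArg (fun z => koszulSign D (σ.symm : Fin (r + 2) → Fin (r + 2)) • z) h1
  simp only [smul_zero, smul_smul, koszulSign_mul_self, one_smul] at h4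
  exact h4.symm

/-- The recursion for `p_∞` on words with one letter from the kernel of `π = i p`. -/
lemma sum_P_update_sub_proj {r : ℕ} {x : V} (hx : x ∈ C.U 0) :
    ∑ s, C.P (r + 2) (fun _ => 0) (Function.update (fun _ => x) s (x - C.proj x)) =
      -((r + 2) • C.Psi (r + 2) (Fin.cons (-1) fun _ => 0) (Fin.cons (C.h 0 x) fun _ => x)) := by
  have h := C.sum_P_eq (r := r) (T := Fin (r + 2)) (fun _ => 1) (fun _ _ => 0)
    (fun s => Function.update (fun _ => x) s (x - C.proj x)) (fun σ => σ.symm)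
    (fun σ t => by rw [koszulSign_zero, mul_one]) (fun _ _ => rfl) (fun σ t => by
      funext a
      by_cases ha : a = σ.symm t
      · subst ha; simp
      · have : σ a ≠ t := fun h => ha (by rw [← h]; simp)
        simp [ha, this])
  simp only [one_smul] at h
  rw [h]
  congr 1
  let f : ℕ → W := fun n => if hn : n < r + 2 then
    C.Psi (r + 2) (degW ⟨n, hn⟩) (C.wordW x ⟨n, hn⟩) else 0
  have hf : ∀ j : Fin (r + 2), f j = C.Psi (r + 2) (degW j) (C.wordW x j) := fun j => by
    simp [f]
  have h0 : f 0 = C.Psi (r + 2) (Fin.cons (-1) fun _ => 0) (Fin.cons (C.h 0 x) fun _ => x) := by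
    rw [← Psi_wordW_zero]; exact hf 0
  rw [← h0, ← sum_telescope f (r + 2), ← Fin.sum_univ_eq_sum_range
    (fun j => f j + ∑ s ∈ Finset.range (r + 2), if j < s then f j - f (j + 1) else 0)]
  unfold mergedH
  rw [Finset.sum_comm]
  refine Finset.sum_congr rfl fun j _ => ?_
  simp only [Finset.sum_const_zero, sgn_zero, one_smul, homotopyDeg_zero, word_update,
    merged_eq]
  rw [← Fin.sum_univ_eq_sum_range (fun s => if (j : ℕ) < s then f j - f (j + 1) else 0)]
  have hcase : ∀ s : Fin (r + 2), C.Psi (r + 2) (degW j) (Function.update (C.wordW x j) s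
      (C.letter (fun _ => 0) j s (x - C.proj x))) =
      (if s = j then f j else 0) + if (j : ℕ) < s then f j - f (j + 1) else 0 := by
    intro s
    rcases lt_trichotomy s j with hs | hs | hs
    · rw [if_neg hs.ne, if_neg (by simpa using hs.le)]
      rw [add_zero]
      refine MultilinearMap.map_coord_zero _ s ?_
      simp [letter, hs, proj_apply, C.i_p_i_p]
    · subst hs
      rw [if_pos rfl, if_neg (lt_irrefl _), add_zero, hf]
      congr 1
      rw [Function.update_eq_self_iff]
      simp [letter, wordW, proj_apply, C.h_i_p]
    · rw [if_neg hs.ne', if_pos (by simpa using hs), zero_add]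
      have hj1 : (j : ℕ) + 1 < r + 2 := by
        have := s.2; have := Fin.lt_def.1 hs; omega
      have e1 : f (j + 1) = C.Psi (r + 2) (degW ⟨j + 1, hj1⟩) (C.wordW x ⟨j + 1, hj1⟩) :=
        dif_pos hj1
      rw [e1, hf, ← C.Psi_shift hx (j := j) (j' := ⟨j + 1, hj1⟩) rfl hs]
      have e2 : C.wordW x j = Function.update (C.wordW x j) s x := by
        rw [eq_comm, Function.update_eq_self_iff]
        simp [wordW, hs.ne', hs.not_gt]
      nth_rewrite 2 [e2]
      rw [← MultilinearMap.map_update_sub]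
      simp [letter, hs.ne', hs.not_gt]
  rw [Finset.sum_congr rfl fun s _ => hcase s, Finset.sum_add_distrib]
  simp

end Contraction
namespace Contraction

variable {𝕜 V W : Type*} [Field 𝕜] [AddCommGroup V] [Module 𝕜 V] [AddCommGroup W]
  [Module 𝕜 W] (C : Contraction 𝕜 V W)

/-- The degrees of the letters of `pairWord`. -/
def pairDeg {R : ℕ} (t : Fin R × Fin R) : Fin R → ℤ :=
  fun a => if a = t.1 then 1 else if a = t.2 then -1 else 0

/-- The word `x, …, x` with the letters at the places `t.1` and `t.2` replaced by `y` and `z`. -/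
def pairWord {R : ℕ} (x y z : V) (t : Fin R × Fin R) : Fin R → V :=
  fun a => if a = t.1 then y else if a = t.2 then z else x

/-- The sign of moving a letter `y` of degree `1` at the place `t.1` and a letter of degree `-1` at
the place `t.2` to the front, with `y` first; it is `0` if these places coincide. -/
def pairSign {R : ℕ} (t : Fin R × Fin R) : ℤ :=
  if t.1 < t.2 then 1 else if t.2 < t.1 then -1 else 0

lemma pairWord_mem {R : ℕ} {x y z : V} (hx : x ∈ C.U 0) (hy : y ∈ C.U 1) (hz : z ∈ C.U (-1))
    (t : Fin R × Fin R) (a : Fin R) : pairWord x y z t a ∈ C.U (pairDeg t a) := by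
  unfold pairWord pairDeg
  split_ifs <;> assumption

lemma koszulSign_pairDeg {R : ℕ} (t : Fin R × Fin R) (f : Fin R → Fin R)
    (hf : Function.Injective f) :
    koszulSign (pairDeg t) f * pairSign t = pairSign (f t.1, f t.2) := by
  obtain ⟨s, s'⟩ := t
  have h1 : sgn (-1) = -1 := by rw [sgn_neg, sgn_one]
  rcases lt_trichotomy s s' with h | h | h
  · rw [koszulSign_pair _ f s s' h (fun a ha ha' => by simp [pairDeg, ha, ha'])]
    have e : pairDeg (s, s') s * pairDeg (s, s') s' = -1 := by simp [pairDeg, h.ne']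
    rw [e, h1]
    unfold pairSign
    rcases lt_or_gt_of_ne (hf.ne h.ne) with h' | h' <;> simp [h, h', h'.not_gt]
  · subst h; simp [pairSign]
  · rw [koszulSign_pair _ f s' s h (fun a ha ha' => by simp [pairDeg, ha, ha'])]
    have e : pairDeg (s, s') s' * pairDeg (s, s') s = -1 := by simp [pairDeg, h.ne]
    rw [e, h1]
    unfold pairSign
    rcases lt_or_gt_of_ne (hf.ne h.ne) with h' | h' <;> simp [h, h', h.not_gt, h'.not_gt]

lemma P_update {r : ℕ} {x z : V} (hx : x ∈ C.U 0) (hz : z ∈ C.U 0) (s : Fin (r + 1)) :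
    C.P (r + 1) (fun _ => 0) (Function.update (fun _ => x) s z) =
      C.P (r + 1) (fun _ => 0) (Fin.cons z fun _ => x) := by
  have h := C.P_symm (r + 1) (fun _ => 0) (Function.update (fun _ => x) s z) (fun a => by
    by_cases ha : a = s
    · subst ha; simpa using hz
    · simpa [ha] using hx) (Equiv.swap 0 s)
  rw [koszulSign_zero, one_smul] at h
  rw [← h]
  congr 1
  funext a
  refine Fin.cases ?_ (fun a => ?_) a
  · simp
  · rw [Fin.cons_succ, Function.update_of_ne]
    intro h
    have := congrArg (Equiv.swap 0 s) h
    rw [Equiv.swap_apply_self, Equiv.swap_apply_right] at this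
    exact Fin.succ_ne_zero _ this

lemma P_pairWord {r : ℕ} {x y z : V} (hx : x ∈ C.U 0) (hy : y ∈ C.U 1) (hz : z ∈ C.U (-1))
    (t : Fin (r + 2) × Fin (r + 2)) :
    pairSign t • C.P (r + 2) (pairDeg t) (pairWord x y z t) = if t.1 = t.2 then 0 else
      C.P (r + 2) (Fin.cons 1 (Fin.cons (-1) fun _ => 0))
        (Fin.cons y (Fin.cons z fun _ => x)) := by
  obtain ⟨s, s'⟩ := t
  dsimp only
  split_ifs with h
  · subst h; simp [pairSign]
  obtain ⟨σ, h0, h1⟩ := exists_perm_zero_one h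
  have h2 := C.P_symm (r + 2) (pairDeg (s, s')) _ (C.pairWord_mem hx hy hz (s, s')) σ
  have h3 := koszulSign_pairDeg (s, s') σ.symm σ.symm.injective
  have e0 : σ.symm s = 0 := by rw [← h0]; simp
  have e1 : σ.symm s' = 1 := by rw [← h1]; simp
  have h4 : koszulSign (pairDeg (s, s')) (σ.symm : Fin (r + 2) → Fin (r + 2)) =
      pairSign (s, s') := by
    have h5 : pairSign (s, s') * pairSign (s, s') = 1 := by
      unfold pairSign
      rcases lt_or_gt_of_ne h with h' | h' <;> simp [h', h'.not_gt]
    simp only [e0, e1] at h3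
    have h6 : pairSign ((0 : Fin (r + 2)), (1 : Fin (r + 2))) = 1 := by simp [pairSign]
    rw [h6] at h3
    calc _ = koszulSign (pairDeg (s, s')) (σ.symm : Fin (r + 2) → Fin (r + 2)) *
          (pairSign (s, s') * pairSign (s, s')) := by rw [h5, mul_one]
      _ = _ := by rw [← mul_assoc, h3, one_mul]
  rw [← h4, ← h2]
  have hs : ∀ a : Fin r, σ a.succ.succ ≠ s ∧ σ a.succ.succ ≠ s' := by
    intro a
    constructor
    · rw [← h0]; exact σ.injective.ne (Fin.succ_ne_zero _)
    · rw [← h1, ← Fin.succ_zero_eq_one]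
      exact σ.injective.ne ((Fin.succ_injective _).ne (Fin.succ_ne_zero _))
  have e1 : (fun a => pairDeg (s, s') (σ a)) = Fin.cons 1 (Fin.cons (-1) fun _ => 0) := by
    funext a
    refine Fin.cases ?_ (fun a => Fin.cases ?_ (fun a => ?_) a) a
    · simp [pairDeg, h0]
    · simp [pairDeg, h1, Ne.symm h]
    · simp [pairDeg, hs]
  have e2 : (fun a => pairWord x y z (s, s') (σ a)) = Fin.cons y (Fin.cons z fun _ => x) := by
    funext a
    refine Fin.cases ?_ (fun a => Fin.cases ?_ (fun a => ?_) a) a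
    · simp [pairWord, h0]
    · simp [pairWord, h1, Ne.symm h]
    · simp [pairWord, hs]
  rw [e1, e2]

/-- Exchange of the letters `h x` and `z` at the places `j < s`. -/
lemma Psi_pairWord_swap {R : ℕ} {x z : V} (hx : x ∈ C.U 0) (hz : z ∈ C.U 0) {j s : Fin R}
    (hjs : j < s) :
    C.Psi R (degW j) (Function.update (C.wordW x j) s z) =
      C.Psi R (degW s) (fun a => if a < j then C.proj x else if a = j then z else
        if a = s then C.h 0 x else x) := by
  rw [← C.Psi_symm_single (degW j) (Function.update (C.wordW x j) s z) ?_ j ?_ (Equiv.swap j s)]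
  · have e1 : (fun a => degW j (Equiv.swap j s a)) = degW s := by
      funext a
      unfold degW
      by_cases h1 : a = j
      · subst h1; simp [hjs.ne, hjs.ne']
      · by_cases h2 : a = s
        · subst h2; simp
        · rw [Equiv.swap_apply_of_ne_of_ne h1 h2]; simp [h1, h2]
    have e2 : (fun a => Function.update (C.wordW x j) s z (Equiv.swap j s a)) =
        fun a => if a < j then C.proj x else if a = j then z else
        if a = s then C.h 0 x else x := by
      funext a
      by_cases h1 : a = j
      · subst h1; simp
      · by_cases h2 : a = s
        · subst h2; simp [wordW, hjs.ne, hjs.not_gt, h1]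
        · rw [Equiv.swap_apply_of_ne_of_ne h1 h2]; simp [h1, h2, wordW]
    rw [e1, e2]
  · intro a
    by_cases ha : a = s
    · subst ha; simpa [degW, hjs.ne'] using hz
    · rw [Function.update_of_ne ha]; exact C.wordW_mem hx j a
  · intro a ha; simp [degW, ha]

variable [CharZero 𝕜]

/-- Only the words with the homotopy at the place of `y` contribute: on the others, either `h` or
`π` meets `h x`, or there are two equal letters `h x` of odd degree. -/
lemma mergedH_pairWord {r : ℕ} {x y : V} (hx : x ∈ C.U 0) (hy : y ∈ C.U 1)
    (t : Fin (r + 2) × Fin (r + 2)) :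
    pairSign t • C.mergedH (r + 2) (pairDeg t) (pairWord x y (C.h 0 x) t) =
      if t.1 < t.2 then C.Psi (r + 2) (degW t.1) (Function.update (C.wordW x t.1) t.2 (C.h 1 y))
      else 0 := by
  obtain ⟨s, s'⟩ := t
  have hz : C.h 0 x ∈ C.U (-1) := C.h_mem _ _ hx
  by_cases hss : s = s'
  · subst hss; simp [pairSign]
  have hmem : ∀ j a, C.word (pairDeg (s, s')) (pairWord x y (C.h 0 x) (s, s')) j a ∈
      C.U (homotopyDeg (pairDeg (s, s')) j a) := by
    intro j a
    have h0 := C.pairWord_mem hx hy hz (s, s') a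
    rw [word_eq]
    unfold letter homotopyDeg
    dsimp only
    split_ifs with h1 h2 h2
    · exact absurd h1 h2.ne
    · exact C.h_mem _ _ h0
    · exact C.proj_mem _ _ h0
    · exact h0
  have key : ∀ j, j ≠ s → C.merged (r + 2) (homotopyDeg (pairDeg (s, s')) j)
      (C.word (pairDeg (s, s')) (pairWord x y (C.h 0 x) (s, s')) j) = 0 := by
    intro j hj
    rw [merged_eq]
    rcases lt_trichotomy s' j with h | h | h
    · refine MultilinearMap.map_coord_zero _ s' ?_
      simp [word_eq, letter, h, pairWord, Ne.symm hss, proj_apply, C.i_p_h]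
    · subst h
      refine MultilinearMap.map_coord_zero _ s' ?_
      simp only [word_eq, letter, lt_irrefl, if_false, if_true, pairWord, pairDeg,
        Ne.symm hss]
      exact C.h_h 0 x
    · refine C.Psi_eq_zero_of_odd _ _ (hmem j) h.ne ?_ ?_ ?_
      · simp [homotopyDeg, pairDeg, hj, h.ne]
      · simp [homotopyDeg, pairDeg, h.ne', Ne.symm hss]
      · simp [word_eq, letter, pairWord, pairDeg, hj, h.ne, h.ne', h.not_gt, Ne.symm hss]
  unfold mergedH
  rw [Finset.sum_eq_single s (fun j _ hj => by rw [key j hj, smul_zero]) (by simp)]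
  rcases lt_or_gt_of_ne hss with h | h
  · have e0 : ∑ a ∈ Finset.univ.filter (· < s), pairDeg (s, s') a = 0 :=
      Finset.sum_eq_zero fun a ha => by
        have ha := (Finset.mem_filter.1 ha).2
        simp [pairDeg, ha.ne, (ha.trans h).ne]
    have h1 : C.h 1 y ∈ C.U 0 := C.h_mem 1 y hy
    rw [e0, sgn_zero, one_smul, if_pos h, C.Psi_pairWord_swap hx h1 h, merged_eq]
    have hs : pairSign (s, s') = 1 := by simp [pairSign, h]
    rw [hs, one_smul]
    have e1 : homotopyDeg (pairDeg (s, s')) s = degW s' := by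
      funext a
      unfold homotopyDeg pairDeg degW
      by_cases h1 : a = s
      · subst h1; simp [h.ne]
      · simp [h1]
    have e2 : C.word (pairDeg (s, s')) (pairWord x y (C.h 0 x) (s, s')) s =
        fun a => if a < s then C.proj x else if a = s then C.h 1 y else
        if a = s' then C.h 0 x else x := by
      rw [word_eq]
      funext a
      unfold letter pairWord pairDeg
      by_cases h1 : a < s
      · simp [h1, h1.ne, (h1.trans h).ne]
      · by_cases h2 : a = s
        · subst h2; simp
        · simp [h1, h2]
    rw [e1, e2]
  · rw [if_neg h.not_gt, merged_eq]
    have : C.Psi (r + 2) (homotopyDeg (pairDeg (s, s')) s)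
      (C.word (pairDeg (s, s')) (pairWord x y (C.h 0 x) (s, s')) s) = 0 := by
      refine MultilinearMap.map_coord_zero _ s' ?_
      simp [word_eq, letter, h, pairWord, h.ne, proj_apply, C.i_p_h]
    rw [this, smul_zero, smul_zero]

/-- The recursion for `p_∞` on words with one letter in the image of the homotopy. -/
lemma sum_P_update_h {r : ℕ} {x y : V} (hx : x ∈ C.U 0) (hy : y ∈ C.U 1) :
    ∑ s, C.P (r + 2) (fun _ => 0) (Function.update (fun _ => x) s (C.h 1 y)) =
      ∑ t : Fin (r + 2) × Fin (r + 2),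
        pairSign t • C.P (r + 2) (pairDeg t) (pairWord x y (C.h 0 x) t) := by
  rw [C.sum_P_eq pairSign pairDeg (pairWord x y (C.h 0 x))
    (fun σ => Equiv.prodCongr σ.symm σ.symm)
    (fun σ t => koszulSign_pairDeg t σ.symm σ.symm.injective)
    (fun σ t => by funext a; simp [pairDeg, Equiv.eq_symm_apply])
    (fun σ t => by funext a; simp [pairWord, Equiv.eq_symm_apply])]
  rw [Finset.sum_congr rfl fun t _ => C.mergedH_pairWord hx hy t]
  have h := C.sum_P_eq (r := r) (T := Fin (r + 2)) (fun _ => 1) (fun _ _ => 0)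
    (fun s => Function.update (fun _ => x) s (C.h 1 y)) (fun σ => σ.symm)
    (fun σ t => by rw [koszulSign_zero, mul_one]) (fun _ _ => rfl) (fun σ t => by
      funext a
      by_cases ha : a = σ.symm t
      · subst ha; simp
      · have : σ a ≠ t := fun h => ha (by rw [← h]; simp)
        simp [ha, this])
  simp only [one_smul] at h
  rw [h, Fintype.sum_prod_type]
  congr 1
  unfold mergedH
  rw [Finset.sum_comm]
  refine Finset.sum_congr rfl fun j _ => Finset.sum_congr rfl fun s _ => ?_
  simp only [Finset.sum_const_zero, sgn_zero, one_smul, homotopyDeg_zero, word_update,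
    merged_eq]
  split_ifs with hjs
  · simp [letter, hjs.not_gt, hjs.ne']
  · refine MultilinearMap.map_coord_zero _ s ?_
    rcases (not_lt.1 hjs).lt_or_eq with hs | hs
    · simp [letter, hs, proj_apply, C.i_p_h]
    · subst hs
      simp only [letter, lt_irrefl, if_false, if_true, Function.update_self]
      exact C.h_h 1 y

/-- One argument `(1 - i p) x`, in a fixed place: the average of `sum_P_update_sub_proj`. -/
lemma P_cons_sub_proj {r : ℕ} {x : V} (hx : x ∈ C.U 0) :
    C.P (r + 2) (fun _ => 0) (Fin.cons (x - C.proj x) fun _ => x) =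
      -C.Psi (r + 2) (Fin.cons (-1) fun _ => 0) (Fin.cons (C.h 0 x) fun _ => x) := by
  have h := C.sum_P_update_sub_proj (r := r) hx
  rw [Finset.sum_congr rfl fun s _ =>
    C.P_update hx (sub_mem hx (C.proj_mem _ _ hx)) s, Finset.sum_const, ← smul_neg,
    Finset.card_univ, Fintype.card_fin, ← Nat.cast_smul_eq_nsmul 𝕜,
    ← Nat.cast_smul_eq_nsmul 𝕜] at h
  exact smul_right_injective _ (Nat.cast_ne_zero.2 (by omega : r + 2 ≠ 0)) h

/-- One argument `h y`, in a fixed place: the average of `sum_P_update_h`. -/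
lemma P_cons_h {r : ℕ} {x y : V} (hx : x ∈ C.U 0) (hy : y ∈ C.U 1) :
    C.P (r + 2) (fun _ => 0) (Fin.cons (C.h 1 y) fun _ => x) =
      (r + 1) • C.P (r + 2) (Fin.cons 1 (Fin.cons (-1) fun _ => 0))
        (Fin.cons y (Fin.cons (C.h 0 x) fun _ => x)) := by
  have h := C.sum_P_update_h (r := r) hx hy
  have h1 : C.h 1 y ∈ C.U 0 := C.h_mem 1 y hy
  have h2 : ∀ s : Fin (r + 2), ∑ s' : Fin (r + 2), (if s = s' then 0 else
      C.P (r + 2) (Fin.cons 1 (Fin.cons (-1) fun _ => 0))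
        (Fin.cons y (Fin.cons (C.h 0 x) fun _ => x))) =
      (r + 1) • C.P (r + 2) (Fin.cons 1 (Fin.cons (-1) fun _ => 0))
        (Fin.cons y (Fin.cons (C.h 0 x) fun _ => x)) := by
    intro s
    rw [Finset.sum_ite, Finset.sum_const_zero, zero_add, Finset.sum_const]
    congr 1
    simp only [eq_comm (a := s)]
    rw [Finset.filter_ne', Finset.card_erase_of_mem (Finset.mem_univ _)]
    simp
  rw [Finset.sum_congr rfl fun s _ => C.P_update hx h1 s, Finset.sum_const,
    Finset.sum_congr rfl fun t _ => C.P_pairWord hx hy (C.h_mem 0 x hx) t,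
    Fintype.sum_prod_type, Finset.sum_congr rfl fun s _ => h2 s, Finset.sum_const] at h
  rw [Finset.card_univ, Fintype.card_fin, ← Nat.cast_smul_eq_nsmul 𝕜,
    ← Nat.cast_smul_eq_nsmul 𝕜] at h
  exact smul_right_injective _ (Nat.cast_ne_zero.2 (by omega : r + 2 ≠ 0)) h

end Contraction

lemma IsGradedSymm.update {𝕜 V V' : Type*} [Field 𝕜] [AddCommGroup V] [Module 𝕜 V]
    [AddCommGroup V'] {U : ℤ → Submodule 𝕜 V} {F : Ops V V'} (hF : IsGradedSymm U F) {r : ℕ}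
    {x z : V} (hx : x ∈ U 0) (hz : z ∈ U 0) (s : Fin (r + 1)) :
    F (r + 1) (fun _ => 0) (Function.update (fun _ => x) s z) =
      F (r + 1) (fun _ => 0) (Fin.cons z fun _ => x) := by
  have h := hF (r + 1) (fun _ => 0) (Function.update (fun _ => x) s z) (fun a => by
    by_cases ha : a = s
    · subst ha; simpa using hz
    · simpa [ha] using hx) (Equiv.swap 0 s)
  rw [koszulSign_zero, one_smul] at h
  rw [← h]
  congr 1
  funext a
  refine Fin.cases ?_ (fun a => ?_) a
  · simp
  · rw [Fin.cons_succ, Function.update_of_ne]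
    intro h
    have := congrArg (Equiv.swap 0 s) h
    rw [Equiv.swap_apply_self, Equiv.swap_apply_right] at this
    exact Fin.succ_ne_zero _ this

lemma sum_range_diag {M : Type*} [AddCommMonoid M] (N : ℕ) (f : ℕ → ℕ → M)
    (hf : ∀ k l, N ≤ k + l → f k l = 0) :
    ∑ m ∈ Finset.range N, ∑ k ∈ Finset.range (m + 1), f k (m - k) =
      ∑ l ∈ Finset.range N, ∑ k ∈ Finset.range N, f k l := by
  rw [Finset.sum_range_diag_flip, Finset.sum_comm]
  refine Finset.sum_congr rfl fun k hk => ?_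
  refine Finset.sum_subset (fun l hl => ?_) fun l _ hl' => hf k l ?_
  · simp only [Finset.mem_range] at hl ⊢; omega
  · simp only [Finset.mem_range] at hl'; omega

lemma map_cons_sum {𝕜 V V' : Type*} [Field 𝕜] [AddCommGroup V] [Module 𝕜 V]
    [AddCommGroup V'] [Module 𝕜 V'] {l : ℕ} (f : MultilinearMap 𝕜 (fun _ : Fin (l + 1) => V) V')
    {ι : Type*} (s : Finset ι) (c : ι → 𝕜) (z : ι → V) (w : Fin l → V) :
    f (Fin.cons (∑ k ∈ s, c k • z k) w) = ∑ k ∈ s, c k • f (Fin.cons (z k) w) := by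
  have := congrArg (fun g => g w) (map_sum f.curryLeft (fun k => c k • z k) s)
  simp only [map_smul, sum_apply] at this
  exact this

lemma inv_factorial_smul_choose {𝕜 M : Type*} [Field 𝕜] [CharZero 𝕜] [AddCommGroup M]
    [Module 𝕜 M] {m k : ℕ} (hk : k ≤ m) (z : M) :
    (m ! : 𝕜)⁻¹ • m.choose k • z = (k ! : 𝕜)⁻¹ • ((m - k)! : 𝕜)⁻¹ • z := by
  rw [← Nat.cast_smul_eq_nsmul 𝕜, smul_smul, smul_smul]
  congr 1
  have h1 : ∀ n : ℕ, (n ! : 𝕜) ≠ 0 := fun n => Nat.cast_ne_zero.2 (Nat.factorial_ne_zero n)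
  have h2 := congrArg (Nat.cast (R := 𝕜)) (Nat.choose_mul_factorial_mul_factorial hk)
  push_cast at h2
  field_simp [h1]
  linear_combination h2

namespace Contraction

variable {𝕜 V W : Type*} [Field 𝕜] [AddCommGroup V] [Module 𝕜 V] [AddCommGroup W]
  [Module 𝕜 W] (C : Contraction 𝕜 V W)

/-- The derivative of `C.Q` at `x`, in the direction `y` of degree `d`. -/
def dQ (d : ℤ) (y x : V) : V :=
  ∑ k ∈ Finset.range C.N, ((k + 1)! : 𝕜)⁻¹ •
    C.q (k + 2) (Fin.cons d fun _ => 0) (Fin.cons y fun _ => x)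

/-- The derivative of the curvature `C.F` at `x`, in the direction `y` of degree `d`. -/
def dF (d : ℤ) (y x : V) : V := C.q 1 (fun _ => d) (fun _ => y) + C.dQ d y x

/-- The second derivative of the curvature `C.F` at `x`, in the directions `z` and `y` of degrees
`1` and `-1`. -/
def ddF (z y x : V) : V :=
  ∑ l ∈ Finset.range C.N, (l ! : 𝕜)⁻¹ •
    C.q (l + 2) (Fin.cons 1 (Fin.cons (-1) fun _ => 0)) (Fin.cons z (Fin.cons y fun _ => x))

/-- The map `x ↦ ∑ 1 / r! p_r (x, …, x)`. -/
def Phi (x : V) : W := ∑ l ∈ Finset.range C.N, ((l + 1)! : 𝕜)⁻¹ •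
  C.P (l + 1) (fun _ => 0) fun _ => x

/-- The derivative of `C.Phi` at `x`, in the direction `z` of degree `0`. -/
def dPhi (z x : V) : W := ∑ l ∈ Finset.range C.N, (l ! : 𝕜)⁻¹ •
  C.P (l + 1) (fun _ => 0) (Fin.cons z fun _ => x)

lemma cons_zero_zero {r : ℕ} : (Fin.cons 0 fun _ => 0 : Fin (r + 1) → ℤ) = fun _ => 0 := by
  funext a; refine Fin.cases ?_ (fun a => ?_) a <;> simp

lemma mem_Fil_sum (k l : ℕ) : ∑ a : Fin (l + 1), (Fin.cons k fun _ => 1 : Fin (l + 1) → ℕ) a =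
    k + l := by
  simp [Fin.sum_cons]

lemma cons_mem_Fil {k l : ℕ} {z : V} (x : V) (hz : z ∈ C.Fil k) (a : Fin (l + 1)) :
    (Fin.cons z fun _ => x : Fin (l + 1) → V) a ∈
      C.Fil ((Fin.cons k fun _ => 1 : Fin (l + 1) → ℕ) a) := by
  refine Fin.cases ?_ (fun a => ?_) a
  · exact hz
  · exact C.mem_Fil_one _

lemma cons_cons_mem_Fil {k l : ℕ} {z : V} (y x : V) (hz : z ∈ C.Fil k) (a : Fin (l + 2)) :
    (Fin.cons z (Fin.cons y fun _ => x) : Fin (l + 2) → V) a ∈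
      C.Fil ((Fin.cons k fun _ => 1 : Fin (l + 2) → ℕ) a) := by
  refine Fin.cases ?_ (fun a => ?_) a
  · exact hz
  · exact C.mem_Fil_one _

lemma dF_eq (d : ℤ) (y x : V) : C.dF d y x = ∑ k ∈ Finset.range C.N, (k ! : 𝕜)⁻¹ •
    C.q (k + 1) (Fin.cons d fun _ => 0) (Fin.cons y fun _ => x) := by
  have h := Finset.sum_range_succ' (fun k => (k ! : 𝕜)⁻¹ •
    C.q (k + 1) (Fin.cons d fun _ => 0) (Fin.cons y fun _ => x)) C.N
  rw [Finset.sum_range_succ, C.q_eq_zero (by omega), smul_zero, add_zero] at h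
  rw [h, dF, add_comm]
  congr 1
  rw [Nat.factorial_zero, Nat.cast_one, inv_one, one_smul]
  have e1 : (fun _ => d : Fin 1 → ℤ) = Fin.cons d fun _ => 0 := by
    funext a; rw [Subsingleton.elim a 0]; rfl
  have e2 : (fun _ => y : Fin 1 → V) = Fin.cons y fun _ => x := by
    funext a; rw [Subsingleton.elim a 0]; rfl
  rw [e1, e2]

lemma F_eq_sum (x : V) : C.F x = ∑ k ∈ Finset.range C.N, (k ! : 𝕜)⁻¹ •
    C.q k (fun _ => 0) (fun _ => x) := by
  have h := Finset.sum_range_succ' (fun k => (k ! : 𝕜)⁻¹ •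
    C.q k (fun _ => 0) (fun _ => x)) C.N
  rw [Finset.sum_range_succ, C.q_eq_zero le_rfl, smul_zero, add_zero, C.q_zero] at h
  rw [h, F_eq, Finset.sum_range_succ, C.q_eq_zero (Nat.le_succ _)]
  simp

lemma dPhi_add (z z' x : V) : C.dPhi (z + z') x = C.dPhi z x + C.dPhi z' x := by
  unfold dPhi
  rw [← Finset.sum_add_distrib]
  refine Finset.sum_congr rfl fun l _ => ?_
  rw [MultilinearMap.cons_add, smul_add]

lemma dPhi_zero (x : V) : C.dPhi 0 x = 0 := by
  unfold dPhi
  exact Finset.sum_eq_zero fun l _ => by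
    rw [MultilinearMap.map_coord_zero _ 0 (by simp), smul_zero]

/-- The Bianchi identity. -/
lemma dF_dF [CharZero 𝕜] {x y : V} (hx : x ∈ C.U 0) (hy : y ∈ C.U (-1)) :
    C.dF 0 (C.dF (-1) y x) x + C.ddF (C.F x) y x = 0 := by
  let f : ℕ → ℕ → V := fun k l => (k ! : 𝕜)⁻¹ • (l ! : 𝕜)⁻¹ •
    (C.q (l + 1) (fun _ => 0) (Fin.cons (C.q (k + 1) (Fin.cons (-1) fun _ => 0)
      (Fin.cons y fun _ => x)) fun _ => x) +
    C.q (l + 2) (Fin.cons 1 (Fin.cons (-1) fun _ => 0))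
      (Fin.cons (C.q k (fun _ => 0) fun _ => x) (Fin.cons y fun _ => x)))
  have hf : ∀ k l, C.N ≤ k + l → f k l = 0 := by
    intro k l hkl
    have h1 : C.q (l + 1) (fun _ => 0) (Fin.cons (C.q (k + 1) (Fin.cons (-1) fun _ => 0)
      (Fin.cons y fun _ => x)) fun _ => x) = 0 := by
      refine C.eq_zero_of_mem_Fil (k := (k + 1) + l) (by omega) ?_
      rw [← mem_Fil_sum]
      exact C.q_fil _ _ _ _ (C.cons_mem_Fil x (C.q_fil_card _ _ _))
    have h2 : C.q (l + 2) (Fin.cons 1 (Fin.cons (-1) fun _ => 0))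
      (Fin.cons (C.q k (fun _ => 0) fun _ => x) (Fin.cons y fun _ => x)) = 0 := by
      refine C.eq_zero_of_mem_Fil (k := k + (l + 1)) (by omega) ?_
      rw [← mem_Fil_sum]
      exact C.q_fil _ _ _ _ (C.cons_cons_mem_Fil y x (C.q_fil_card _ _ _))
    simp only [f, h1, h2, add_zero, smul_zero]
  have hsum : ∀ m, ∑ k ∈ Finset.range (m + 1), f k (m - k) = 0 := by
    intro m
    have h1 := C.q_jacobi (m + 1) (Fin.cons (-1) fun _ => 0) (Fin.cons y fun _ => x) (by
      intro a
      refine Fin.cases ?_ (fun a => ?_) a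
      · exact hy
      · exact hx)
    have h2 := mergeSum_cons_const (V := V) (fun r D x => C.q r D x) (fun r D x => C.q r D x)
      (fun _ => True) m (-1) y x
    unfold mergeSum at h2
    simp only [if_true] at h2
    rw [h1] at h2
    have h3 := congrArg (fun z => (m ! : 𝕜)⁻¹ • z) h2
    simp only [smul_zero, Finset.smul_sum] at h3
    rw [h3]
    refine Finset.sum_congr rfl fun k hk => ?_
    rw [inv_factorial_smul_choose (Nat.lt_succ_iff.1 (Finset.mem_range.1 hk)),
      show (-1 : ℤ) + 1 = 0 by norm_num, cons_zero_zero]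
  have h := sum_range_diag C.N f hf
  rw [Finset.sum_congr rfl fun m _ => hsum m, Finset.sum_const_zero] at h
  rw [h, C.dF_eq 0, C.dF_eq (-1), C.F_eq_sum, ddF, ← Finset.sum_add_distrib]
  refine Finset.sum_congr rfl fun l _ => ?_
  simp only [f, smul_add, Finset.sum_add_distrib]
  rw [cons_zero_zero]
  rw [map_cons_sum, map_cons_sum, Finset.smul_sum, Finset.smul_sum]
  congr 1 <;> exact Finset.sum_congr rfl fun k _ => smul_comm _ _ _

/-- The map induced by `p_∞` is constant along the vector field `-F'_x (h x)`, up to the curvature: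
this is the compatibility of `p_∞` with the codifferentials, applied to the homotopy. -/
lemma dPhi_dF [CharZero 𝕜] {x : V} (hx : x ∈ C.U 0) :
    C.dPhi (C.dF (-1) (C.h 0 x) x) x + C.dPhi (C.h 1 (C.F x)) x = 0 := by
  have hz : C.h 0 x ∈ C.U (-1) := C.h_mem 0 x hx
  let a : ℕ → ℕ → W := fun k l => (k ! : 𝕜)⁻¹ • (l ! : 𝕜)⁻¹ •
    C.P (l + 1) (fun _ => 0) (Fin.cons (C.q (k + 1) (Fin.cons (-1) fun _ => 0)
      (Fin.cons (C.h 0 x) fun _ => x)) fun _ => x)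
  let b : ℕ → ℕ → W := fun k l => ((k + 1)! : 𝕜)⁻¹ • (l ! : 𝕜)⁻¹ •
    C.P (l + 1) (fun _ => 0) (Fin.cons (C.h 1 (C.q (k + 1) (fun _ => 0) fun _ => x)) fun _ => x)
  have ha : ∀ k l, C.N ≤ k + l → a k l = 0 := by
    intro k l hkl
    have h1 := C.P_eq_zero (fun _ => 0) (Fin.cons (k + 1) fun _ => 1) _ (C.cons_mem_Fil
      (k := k + 1) (l := l) x (C.q_fil_card (k + 1) (Fin.cons (-1) fun _ => 0)
        (Fin.cons (C.h 0 x) fun _ => x))) (by rw [mem_Fil_sum]; omega)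
    simp only [a, h1, smul_zero]
  have hb : ∀ k l, C.N ≤ k + l → b k l = 0 := by
    intro k l hkl
    have h1 := C.P_eq_zero (fun _ => 0) (Fin.cons (k + 1) fun _ => 1) _ (C.cons_mem_Fil
      (k := k + 1) (l := l) x (C.h_fil 1 _ _ (C.q_fil_card (k + 1) (fun _ => 0)
        (fun _ => x)))) (by rw [mem_Fil_sum]; omega)
    simp only [b, h1, smul_zero]
  have hph : ∀ z, C.p (C.h 1 z) = 0 := fun z => by
    apply C.i_injective; rw [C.i_p_h, map_zero]
  have hb0 : ∀ k, b k 0 = 0 := fun k => by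
    have h1 := (C.opsP_eq 1 (fun _ => 0) (Fin.cons (C.h 1 (C.q (k + 1) (fun _ => 0)
      fun _ => x)) fun _ => x)).symm.trans (C.opsP_one _ _)
    rw [Fin.cons_zero, hph] at h1
    simp only [b]
    rw [h1, smul_zero, smul_zero]
  -- the terms with a differential in front
  have h0 : ∀ m, a 0 m + b 0 m = (m ! : 𝕜)⁻¹ •
      C.P (m + 1) (fun _ => 0) (Fin.cons (x - C.proj x) fun _ => x) := by
    intro m
    have h1 := C.homotopy 0 x
    have e1 : (Fin.cons (-1) fun _ => 0 : Fin (0 + 1) → ℤ) = fun _ => 0 - 1 := by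
      funext a; exact Fin.cases rfl (fun a => a.elim0) a
    have e2 : (Fin.cons (C.h 0 x) fun _ => x : Fin (0 + 1) → V) = fun _ => C.h 0 x := by
      funext a; exact Fin.cases rfl (fun a => a.elim0) a
    simp only [a, b, Nat.factorial_zero, zero_add, Nat.factorial_one, Nat.cast_one, inv_one,
      one_smul]
    rw [← smul_add, ← MultilinearMap.cons_add, proj_apply, ← h1]
    rw [e1, e2]
    rfl
  have hsum : ∀ m, ∑ k ∈ Finset.range (m + 1), (a k (m - k) + b k (m - k)) = 0 := by
    intro m
    cases m with
    | zero =>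
      rw [Finset.sum_range_one, h0, ← opsP_eq, opsP_one, Fin.cons_zero]
      have : C.p (x - C.proj x) = 0 := by
        apply C.i_injective
        rw [map_sub, map_sub, proj_apply, C.i_p_i_p, sub_self, map_zero]
      rw [this, smul_zero]
    | succ r =>
      have h1 := C.P_cons_sub_proj (r := r) hx
      rw [← merged_eq] at h1
      unfold merged at h1
      rw [mergeSum_cons_const, Finset.sum_range_succ', if_neg (by omega), if_neg (by omega),
        add_zero, smul_zero, add_zero] at h1
      have h2 : (((r + 1)! : 𝕜)⁻¹ • C.P (r + 1 + 1) (fun _ => 0)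
          (Fin.cons (x - C.proj x) fun _ => x)) = -(∑ k ∈ Finset.range (r + 1),
            a (k + 1) (r - k) + ∑ k ∈ Finset.range r, b (k + 1) (r - k)) := by
        rw [h1, smul_neg, Finset.smul_sum]
        simp only [smul_add, Finset.sum_add_distrib]
        congr 2
        · refine Finset.sum_congr rfl fun k hk => ?_
          have hk := Finset.mem_range.1 hk
          rw [if_pos (by omega), inv_factorial_smul_choose (by omega)]
          simp only [a]
          rw [show (-1 : ℤ) + 1 = 0 by norm_num, cons_zero_zero, ← opsP_eq, Nat.add_sub_add_right]
          rfl
        · rw [Finset.sum_range_succ', if_neg (by omega), smul_zero, smul_zero, add_zero]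
          refine Finset.sum_congr rfl fun k hk => ?_
          have hk := Finset.mem_range.1 hk
          rw [if_pos (by omega), inv_factorial_smul_choose (by omega)]
          simp only [b]
          have e : r - k = r - (k + 1) + 1 := by omega
          have e' : r + 1 - (k + 1 + 1) = r - (k + 1) := by omega
          have hq : C.q (k + 1 + 1) (fun _ => 0) (fun _ => x) ∈ C.U 1 := by
            simpa using C.q_mem (k + 1 + 1) (fun _ => 0) (fun _ => x) fun _ => hx
          rw [e, e', C.P_cons_h hx hq, opsP_eq, Nat.factorial_succ (r - (k + 1)), Nat.cast_mul,
            mul_inv_rev, mul_smul, ← Nat.cast_smul_eq_nsmul 𝕜 (r - (k + 1) + 1),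
            inv_smul_smul₀ (Nat.cast_ne_zero.2 (Nat.succ_ne_zero _))]
          rfl
      rw [Finset.sum_add_distrib, Finset.sum_range_succ', Finset.sum_range_succ (fun k => b k _),
        Finset.sum_range_succ' (fun k => b k _)]
      simp only [Nat.add_sub_add_right, Nat.sub_zero, Nat.sub_self, hb0, add_zero]
      rw [← h0] at h2
      rw [← eq_neg_iff_add_eq_zero.1 h2]
      abel
  have h := sum_range_diag C.N (fun k l => a k l + b k l) (fun k l hkl => by
    simp only [ha k l hkl, hb k l hkl, add_zero])
  rw [Finset.sum_congr rfl fun m _ => hsum m, Finset.sum_const_zero] at h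
  rw [h, C.dF_eq (-1), F_eq, Finset.sum_range_succ, C.q_eq_zero (Nat.le_succ _), smul_zero,
    add_zero, map_sum]
  simp only [map_smul]
  unfold dPhi
  rw [← Finset.sum_add_distrib]
  refine Finset.sum_congr rfl fun l _ => ?_
  rw [map_cons_sum, map_cons_sum, Finset.smul_sum, Finset.smul_sum, ← Finset.sum_add_distrib]
  exact Finset.sum_congr rfl fun k _ => by
    rw [smul_comm, smul_comm (l ! : 𝕜)⁻¹]

end Contraction

/-! ### Polynomial paths in a vector space -/

/-- Induction for statements that are additive in every variable. -/
lemma multi_induction {r : ℕ} {E : Type*} [AddCommMonoid E] (G : Fin r → Set E)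
    {p : (Fin r → E) → Prop} (zero : ∀ x a, x a = 0 → p x)
    (add : ∀ x a y z, p (Function.update x a y) → p (Function.update x a z) →
      p (Function.update x a (y + z)))
    (mem : ∀ x, (∀ a, x a ∈ G a) → p x) (x : Fin r → E)
    (hx : ∀ a, x a ∈ AddSubmonoid.closure (G a)) : p x := by
  classical
  suffices h : ∀ s : Finset (Fin r), ∀ x : Fin r → E, (∀ a ∈ s, x a ∈ AddSubmonoid.closure (G a)) →
      (∀ a ∉ s, x a ∈ G a) → p x from h Finset.univ x (fun a _ => hx a) (by simp)
  intro s
  induction s using Finset.induction_on with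
  | empty => exact fun x _ h => mem x fun a => h a (by simp)
  | insert a s ha ih =>
    intro x h1 h2
    have key : ∀ y ∈ AddSubmonoid.closure (G a), p (Function.update x a y) := by
      intro y hy
      induction hy using AddSubmonoid.closure_induction with
      | mem y hy =>
        refine ih _ (fun b hb => ?_) fun b hb => ?_
        · have hba : b ≠ a := fun h => ha (h ▸ hb)
          rw [Function.update_of_ne hba]
          exact h1 b (Finset.mem_insert_of_mem hb)
        · by_cases hba : b = a
          · subst hba; simpa using hy
          · rw [Function.update_of_ne hba]
            exact h2 b (by simp [hba, hb])
      | zero => exact zero _ a (by simp)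
      | add y z _ _ hy hz => exact add _ _ _ _ hy hz
    simpa using key _ (h1 a (Finset.mem_insert_self a s))

lemma mem_closure_tmul {𝕜 M A : Type*} [CommSemiring 𝕜] [AddCommMonoid M] [Module 𝕜 M]
    [AddCommMonoid A] [Module 𝕜 A] (x : M ⊗[𝕜] A) :
    x ∈ AddSubmonoid.closure {x : M ⊗[𝕜] A | ∃ v w, x = v ⊗ₜ w} := by
  induction x with
  | zero => exact zero_mem _
  | tmul v w => exact AddSubmonoid.subset_closure ⟨v, w, rfl⟩
  | add x y hx hy => exact add_mem hx hy

section Flow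

variable (𝕜 : Type*) [Field 𝕜]

/-- The algebra of polynomials in `s = X 0` and `e = X 1`, where `e` stands for the exponential
function `exp (-s)`. -/
abbrev FlowAlg : Type _ := MvPolynomial (Fin 2) 𝕜

/-- The derivation `d / ds`, with `de / ds = -e`. -/
def flowD : Derivation 𝕜 (FlowAlg 𝕜) (FlowAlg 𝕜) :=
  MvPolynomial.mkDerivation 𝕜 ![1, -MvPolynomial.X 1]

lemma flowD_monomial (i j : ℕ) :
    flowD 𝕜 (MvPolynomial.X 0 ^ i * MvPolynomial.X 1 ^ j) =
      (i : 𝕜) • (MvPolynomial.X 0 ^ (i - 1) * MvPolynomial.X 1 ^ j) -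
        (j : 𝕜) • (MvPolynomial.X 0 ^ i * MvPolynomial.X 1 ^ j) := by
  have h0 : flowD 𝕜 (MvPolynomial.X 0) = 1 := by simp [flowD]
  have h1 : flowD 𝕜 (MvPolynomial.X 1) = -MvPolynomial.X 1 := by simp [flowD]
  rw [Derivation.leibniz, Derivation.leibniz_pow, Derivation.leibniz_pow, h0, h1]
  simp only [smul_eq_mul, mul_one, nsmul_eq_mul, MvPolynomial.smul_eq_C_mul, map_natCast]
  cases j with
  | zero => simp
  | succ j => rw [Nat.add_sub_cancel, pow_succ]; ring

/-- A primitive of `s ^ i * e ^ j`. -/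
def flowPrim : ℕ → ℕ → FlowAlg 𝕜
  | i, 0 => ((i : 𝕜) + 1)⁻¹ • MvPolynomial.X 0 ^ (i + 1)
  | 0, j + 1 => -((j : 𝕜) + 1)⁻¹ • MvPolynomial.X 1 ^ (j + 1)
  | i + 1, j + 1 => -((j : 𝕜) + 1)⁻¹ • (MvPolynomial.X 0 ^ (i + 1) * MvPolynomial.X 1 ^ (j + 1) -
      ((i : 𝕜) + 1) • flowPrim i (j + 1))

/-- The linear map sending `s ^ i * e ^ j` to its primitive `flowPrim i j`. -/
def flowInt : FlowAlg 𝕜 →ₗ[𝕜] FlowAlg 𝕜 :=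
  (MvPolynomial.basisMonomials (Fin 2) 𝕜).constr 𝕜 fun m => flowPrim 𝕜 (m 0) (m 1)

lemma basisMonomials_eq_X (m : Fin 2 →₀ ℕ) : MvPolynomial.basisMonomials (Fin 2) 𝕜 m =
    MvPolynomial.X 0 ^ m 0 * MvPolynomial.X 1 ^ m 1 := by
  rw [MvPolynomial.coe_basisMonomials]
  dsimp only
  rw [MvPolynomial.monomial_eq, Finsupp.prod_fintype _ _ (by simp), Fin.prod_univ_two, map_one,
    one_mul]

lemma flowInt_monomial (i j : ℕ) : flowInt 𝕜 (MvPolynomial.X 0 ^ i * MvPolynomial.X 1 ^ j) =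
    flowPrim 𝕜 i j := by
  have h := (MvPolynomial.basisMonomials (Fin 2) 𝕜).constr_basis 𝕜
    (fun m => flowPrim 𝕜 (m 0) (m 1)) (Finsupp.single 0 i + Finsupp.single 1 j)
  rw [basisMonomials_eq_X] at h
  simpa [flowInt] using h

/-- The primitive that vanishes at the point `s = 0`, `e = 1`. -/
def flowIntZero : FlowAlg 𝕜 →ₗ[𝕜] FlowAlg 𝕜 :=
  flowInt 𝕜 - Algebra.linearMap 𝕜 _ ∘ₗ
    (MvPolynomial.aeval (![0, 1] : Fin 2 → 𝕜)).toLinearMap ∘ₗ flowInt 𝕜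

lemma aeval_flowIntZero (a : FlowAlg 𝕜) :
    MvPolynomial.aeval (![0, 1] : Fin 2 → 𝕜) (flowIntZero 𝕜 a) = 0 := by
  simp [flowIntZero]

variable [CharZero 𝕜]

lemma flowD_flowPrim (i j : ℕ) : flowD 𝕜 (flowPrim 𝕜 i j) =
    MvPolynomial.X 0 ^ i * MvPolynomial.X 1 ^ j := by
  have hne : ∀ n : ℕ, (n : 𝕜) + 1 ≠ 0 := fun n => Nat.cast_add_one_ne_zero n
  cases j with
  | zero =>
    have h := flowD_monomial 𝕜 (i + 1) 0
    rw [pow_zero, mul_one] at h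
    rw [flowPrim, Derivation.map_smul, h, Nat.cast_zero, zero_smul, sub_zero, Nat.add_sub_cancel,
      Nat.cast_add, Nat.cast_one, inv_smul_smul₀ (hne i)]
    simp
  | succ j =>
    induction i with
    | zero =>
      have h := flowD_monomial 𝕜 0 (j + 1)
      rw [pow_zero, one_mul] at h
      rw [flowPrim, Derivation.map_smul, h, Nat.cast_zero, zero_smul, zero_sub, neg_smul,
        smul_neg, neg_neg,
        Nat.cast_add, Nat.cast_one, inv_smul_smul₀ (hne j)]
      simp
    | succ i ih =>
      rw [flowPrim, Derivation.map_smul, map_sub, Derivation.map_smul, ih, flowD_monomial,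
        Nat.add_sub_cancel,
        Nat.cast_add, Nat.cast_one, Nat.cast_add, Nat.cast_one, sub_sub_cancel_left, neg_smul,
        smul_neg, neg_neg, inv_smul_smul₀ (hne j)]

lemma flowD_flowInt (a : FlowAlg 𝕜) : flowD 𝕜 (flowInt 𝕜 a) = a := by
  have h : (flowD 𝕜).toLinearMap ∘ₗ flowInt 𝕜 = LinearMap.id := by
    refine (MvPolynomial.basisMonomials (Fin 2) 𝕜).ext fun m => ?_
    rw [basisMonomials_eq_X]
    simp [flowInt_monomial, flowD_flowPrim]
  exact LinearMap.congr_fun h a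

lemma flowInt_flowD (a : FlowAlg 𝕜) :
    flowInt 𝕜 (flowD 𝕜 a) = a - MvPolynomial.C (MvPolynomial.constantCoeff a) := by
  have hne : ∀ n : ℕ, (n : 𝕜) + 1 ≠ 0 := fun n => Nat.cast_add_one_ne_zero n
  have h : flowInt 𝕜 ∘ₗ (flowD 𝕜).toLinearMap = LinearMap.id - (Algebra.linearMap 𝕜 _) ∘ₗ
      (MvPolynomial.aeval (fun _ : Fin 2 => (0 : 𝕜))).toLinearMap := by
    refine (MvPolynomial.basisMonomials (Fin 2) 𝕜).ext fun m => ?_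
    rw [basisMonomials_eq_X]
    generalize m 0 = i
    generalize m 1 = j
    simp only [LinearMap.comp_apply, Derivation.coeFn_coe, flowD_monomial, map_sub, map_smul,
      flowInt_monomial, LinearMap.sub_apply, LinearMap.id_apply, AlgHom.toLinearMap_apply,
      Algebra.linearMap_apply, map_mul, map_pow, MvPolynomial.aeval_X]
    cases j with
    | zero =>
      cases i with
      | zero => simp
      | succ i =>
        rw [Nat.add_sub_cancel, flowPrim, Nat.cast_add, Nat.cast_one, smul_inv_smul₀ (hne i)]
        simp
    | succ j =>
      cases i with
      | zero =>
        rw [flowPrim]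
        simp [smul_smul, hne j]
      | succ i =>
        rw [Nat.add_sub_cancel]
        have e := flowPrim.eq_3 𝕜 i j
        rw [e]
        rw [Nat.cast_add, Nat.cast_one, Nat.cast_add, Nat.cast_one, neg_smul, smul_neg,
          smul_inv_smul₀ (hne j)]
        simp
  have := LinearMap.congr_fun h a
  simpa [MvPolynomial.aeval_zero', MvPolynomial.algebraMap_eq] using this

lemma flowD_flowIntZero (a : FlowAlg 𝕜) : flowD 𝕜 (flowIntZero 𝕜 a) = a := by
  simp [flowIntZero, flowD_flowInt]

end Flow

section Path

variable {𝕜 : Type*} [Field 𝕜] {V V' : Type*} [AddCommGroup V] [Module 𝕜 V] [AddCommGroup V']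
  [Module 𝕜 V']

/-- The value of a polynomial path at a point. -/
def pathEval (p : Fin 2 → 𝕜) : V ⊗[𝕜] FlowAlg 𝕜 →ₗ[𝕜] V :=
  (TensorProduct.rid 𝕜 V).toLinearMap ∘ₗ (MvPolynomial.aeval p).toLinearMap.lTensor V

/-- The derivative of a polynomial path. -/
def pathD : V ⊗[𝕜] FlowAlg 𝕜 →ₗ[𝕜] V ⊗[𝕜] FlowAlg 𝕜 := (flowD 𝕜).toLinearMap.lTensor V

@[simp] lemma pathEval_tmul (p : Fin 2 → 𝕜) (v : V) (a : FlowAlg 𝕜) :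
    pathEval p (v ⊗ₜ a) = MvPolynomial.aeval p a • v := by
  simp [pathEval]

@[simp] lemma pathD_tmul (v : V) (a : FlowAlg 𝕜) : pathD (v ⊗ₜ[𝕜] a) = v ⊗ₜ flowD 𝕜 a := by
  simp [pathD]

lemma pathEval_rTensor (g : V →ₗ[𝕜] V') (p : Fin 2 → 𝕜) (x : V ⊗[𝕜] FlowAlg 𝕜) :
    pathEval p (g.rTensor _ x) = g (pathEval p x) := by
  induction x with
  | zero => simp
  | tmul v a => simp
  | add x y hx hy => simp only [map_add, hx, hy]

lemma pathD_rTensor (g : V →ₗ[𝕜] V') (x : V ⊗[𝕜] FlowAlg 𝕜) :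
    pathD (g.rTensor _ x) = g.rTensor _ (pathD x) := by
  induction x with
  | zero => simp
  | tmul v a => simp
  | add x y hx hy => simp only [map_add, hx, hy]

lemma rTensor_lTensor_comm (g : V →ₗ[𝕜] V') (l : FlowAlg 𝕜 →ₗ[𝕜] FlowAlg 𝕜)
    (x : V ⊗[𝕜] FlowAlg 𝕜) : g.rTensor _ (l.lTensor V x) = l.lTensor V' (g.rTensor _ x) := by
  induction x with
  | zero => simp
  | tmul v a => simp
  | add x y hx hy => simp only [map_add, hx, hy]

lemma eq_zero_of_pathEval [Infinite 𝕜] (x : V ⊗[𝕜] FlowAlg 𝕜) (hx : ∀ p, pathEval p x = 0) :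
    x = 0 := by
  classical
  let b := Module.Basis.ofVectorSpace 𝕜 V
  apply (TensorProduct.equivFinsuppOfBasisLeft (N := FlowAlg 𝕜) b).injective
  rw [map_zero]
  ext1 i
  rw [TensorProduct.equivFinsuppOfBasisLeft_apply, Finsupp.zero_apply]
  refine MvPolynomial.funext fun p => ?_
  have h : MvPolynomial.eval p (TensorProduct.lid 𝕜 _ ((b.coord i).rTensor _ x)) =
      b.coord i (pathEval p x) := by
    clear hx
    induction x with
    | zero => simp
    | tmul v a => simp [MvPolynomial.aeval_eq_eval, mul_comm]
    | add x y hx hy => simp only [map_add, hx, hy]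
  rw [h, hx, map_zero, map_zero]

lemma pathEval_lTensor_mem [Infinite 𝕜] (S : Submodule 𝕜 V) (l : FlowAlg 𝕜 →ₗ[𝕜] FlowAlg 𝕜)
    {x : V ⊗[𝕜] FlowAlg 𝕜} (hx : ∀ p, pathEval p x ∈ S) (p : Fin 2 → 𝕜) :
    pathEval p (l.lTensor V x) ∈ S := by
  have h : S.mkQ.rTensor _ x = 0 := by
    refine eq_zero_of_pathEval _ fun p => ?_
    rw [pathEval_rTensor]
    simpa using hx p
  rw [← Submodule.Quotient.mk_eq_zero, ← Submodule.mkQ_apply, ← pathEval_rTensor,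
    rTensor_lTensor_comm, h, map_zero, map_zero]

/-- A path whose derivative lies in a subspace is constant modulo this subspace. -/
lemma pathEval_sub_mem [CharZero 𝕜] (S : Submodule 𝕜 V) {x : V ⊗[𝕜] FlowAlg 𝕜}
    (hx : ∀ p, pathEval p (pathD x) ∈ S) (p p' : Fin 2 → 𝕜) : pathEval p x - pathEval p' x ∈ S := by
  have h1 := fun p => pathEval_lTensor_mem S (flowInt 𝕜) hx p
  have h2 : pathEval p x - pathEval p' x = pathEval p ((flowInt 𝕜).lTensor V (pathD x)) -
      pathEval p' ((flowInt 𝕜).lTensor V (pathD x)) := by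
    clear hx h1
    induction x with
    | zero => simp
    | tmul v a => simp [flowInt_flowD, sub_smul]
    | add x y hx hy =>
      simp only [map_add]
      rw [add_sub_add_comm, hx, hy, ← add_sub_add_comm]
  rw [h2]
  exact sub_mem (h1 p) (h1 p')

lemma flowD_prod {ι : Type*} [DecidableEq ι] (s : Finset ι) (w : ι → FlowAlg 𝕜) :
    flowD 𝕜 (∏ a ∈ s, w a) = ∑ a ∈ s, ∏ b ∈ s, Function.update w a (flowD 𝕜 (w a)) b := by
  induction s using Finset.induction_on with
  | empty => simp
  | insert a s ha ih =>
    rw [Finset.prod_insert ha, Derivation.leibniz, ih, Finset.sum_insert ha,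
      Finset.prod_insert ha, Function.update_self, smul_eq_mul, smul_eq_mul, add_comm,
      Finset.mul_sum, mul_comm]
    congr 1
    · congr 1
      exact Finset.prod_congr rfl fun b hb =>
        (Function.update_of_ne (fun h => ha (by rwa [← h])) _ _).symm
    · refine Finset.sum_congr rfl fun c hc => ?_
      rw [Finset.prod_insert ha, Function.update_of_ne (fun h => ha (by rwa [h]))]

/-- Multilinear maps act on polynomial paths pointwise, with the Leibniz rule. -/
lemma exists_path_multilinear {r : ℕ} (f : MultilinearMap 𝕜 (fun _ : Fin r => V) V')
    (x : Fin r → V ⊗[𝕜] FlowAlg 𝕜) : ∃ y : V' ⊗[𝕜] FlowAlg 𝕜,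
      (∀ p, pathEval p y = f fun a => pathEval p (x a)) ∧
      ∀ p, pathEval p (pathD y) = ∑ a, f (Function.update (fun b => pathEval p (x b)) a
        (pathEval p (pathD (x a)))) := by
  refine multi_induction (p := fun x => ∃ y : V' ⊗[𝕜] FlowAlg 𝕜,
      (∀ p, pathEval p y = f fun a => pathEval p (x a)) ∧
      ∀ p, pathEval p (pathD y) = ∑ a, f (Function.update (fun b => pathEval p (x b)) a
        (pathEval p (pathD (x a)))))
      (fun _ => {x : V ⊗[𝕜] FlowAlg 𝕜 | ∃ v w, x = v ⊗ₜ w}) ?_ ?_ ?_ x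
    fun a => mem_closure_tmul _
  · intro x a ha
    refine ⟨0, fun p => ?_, fun p => ?_⟩
    · rw [map_zero, f.map_coord_zero a (by simp [ha])]
    · rw [map_zero, map_zero, eq_comm]
      refine Finset.sum_eq_zero fun b _ => ?_
      by_cases hab : a = b
      · subst hab
        exact f.map_coord_zero a (by simp [ha])
      · exact f.map_coord_zero a (by simp [ha, hab])
  · rintro x a y z ⟨Y, hY, hY'⟩ ⟨Z, hZ, hZ'⟩
    have e : ∀ (p : Fin 2 → 𝕜) (y : V ⊗[𝕜] FlowAlg 𝕜),
        (fun b => pathEval p (Function.update x a y b)) =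
        Function.update (fun b => pathEval p (x b)) a (pathEval p y) := by
      intro p y
      funext b
      by_cases hb : b = a
      · subst hb; simp
      · simp [hb]
    refine ⟨Y + Z, fun p => ?_, fun p => ?_⟩
    · rw [map_add, hY, hZ, e, e, e, map_add, f.map_update_add]
    · rw [map_add, map_add, hY', hZ', ← Finset.sum_add_distrib]
      refine Finset.sum_congr rfl fun b _ => ?_
      rw [e, e, e]
      by_cases hb : b = a
      · subst hb
        simp only [Function.update_self, Function.update_idem, map_add, f.map_update_add]
      · have hc : ∀ y, Function.update (Function.update (fun b => pathEval p (x b)) a y) b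
            (pathEval p (pathD (x b))) = Function.update (Function.update
            (fun b => pathEval p (x b)) b (pathEval p (pathD (x b)))) a y :=
          fun y => Function.update_comm (Ne.symm hb) _ _ _
        simp only [Function.update_of_ne hb, map_add, hc, f.map_update_add]
  · intro x hx
    choose v w hvw using hx
    refine ⟨f v ⊗ₜ ∏ a, w a, fun p => ?_, fun p => ?_⟩
    · simp only [hvw, pathEval_tmul, map_prod]
      exact (f.map_smul_univ _ _).symm
    · rw [pathD_tmul, pathEval_tmul, flowD_prod, map_sum, Finset.sum_smul]
      refine Finset.sum_congr rfl fun a _ => ?_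
      rw [map_prod, ← f.map_smul_univ]
      congr 1
      funext b
      by_cases hb : b = a
      · subst hb; simp [hvw]
      · simp [hb, hvw]

end Path

/-! ### The flow that contracts a Maurer–Cartan element to its rectification -/

section PathDiag

variable {𝕜 : Type*} [Field 𝕜] [CharZero 𝕜] {V V' : Type*} [AddCommGroup V] [Module 𝕜 V]
  [AddCommGroup V'] [Module 𝕜 V']

lemma exists_path_diagonal (U : ℤ → Submodule 𝕜 V)
    (f : (r : ℕ) → (Fin r → ℤ) → MultilinearMap 𝕜 (fun _ : Fin r => V) V')
    (hf : IsGradedSymm U fun r D x => f r D x) (N : ℕ) (x : V ⊗[𝕜] FlowAlg 𝕜)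
    (hx : ∀ p, pathEval p x ∈ U 0) (hx' : ∀ p, pathEval p (pathD x) ∈ U 0) :
    ∃ y : V' ⊗[𝕜] FlowAlg 𝕜,
      (∀ p, pathEval p y = ∑ r ∈ Finset.range N, ((r + 1)! : 𝕜)⁻¹ •
        f (r + 1) (fun _ => 0) fun _ => pathEval p x) ∧
      ∀ p, pathEval p (pathD y) = ∑ r ∈ Finset.range N, (r ! : 𝕜)⁻¹ •
        f (r + 1) (fun _ => 0) (Fin.cons (pathEval p (pathD x)) fun _ => pathEval p x) := by
  choose y hy hy' using fun r =>
    exists_path_multilinear (f (r + 1) (fun _ => 0)) (fun _ : Fin (r + 1) => x)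
  refine ⟨∑ r ∈ Finset.range N, ((r + 1)! : 𝕜)⁻¹ • y r, fun p => ?_, fun p => ?_⟩
  · rw [map_sum]
    exact Finset.sum_congr rfl fun r _ => by rw [map_smul, hy]
  · rw [map_sum, map_sum]
    refine Finset.sum_congr rfl fun r _ => ?_
    rw [map_smul, map_smul, hy', Finset.sum_congr rfl fun s _ => hf.update (hx p) (hx' p) s,
      Finset.sum_const, Finset.card_univ, Fintype.card_fin, ← Nat.cast_smul_eq_nsmul 𝕜,
      smul_smul, Nat.factorial_succ, Nat.cast_mul, mul_inv_rev, mul_assoc,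
      inv_mul_cancel₀ (Nat.cast_ne_zero.2 (Nat.succ_ne_zero r)), mul_one]

end PathDiag

namespace Contraction

variable {𝕜 V W : Type*} [Field 𝕜] [AddCommGroup V] [Module 𝕜 V] [AddCommGroup W]
  [Module 𝕜 W] (C : Contraction 𝕜 V W)

/-- The differential on the elements of degree `-1`. -/
def dNeg : V →ₗ[𝕜] V :=
  (MultilinearMap.ofSubsingleton 𝕜 V V (0 : Fin 1)).symm (C.q 1 fun _ => -1)

lemma dNeg_apply (x : V) : C.dNeg x = C.q 1 (fun _ => -1) fun _ => x := rfl

lemma h_dNeg_h (x : V) : C.h 0 (C.dNeg (C.h 0 x)) = C.h 0 x := by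
  have h := C.homotopy (-1) (C.h 0 x)
  have h1 : C.h (-1) (C.h 0 x) = 0 := C.h_h 0 x
  rw [h1, C.i_p_h, sub_zero, MultilinearMap.map_coord_zero _ 0 rfl, zero_add] at h
  exact h

lemma dNeg_h_mem {x : V} (hx : x ∈ C.U 0) : C.dNeg (C.h 0 x) ∈ C.U 0 := by
  have := C.q_mem 1 (fun _ => -1) (fun _ => C.h 0 x) fun _ => C.h_mem 0 x hx
  simpa [dNeg_apply] using this

lemma dNeg_h_fil {k : ℕ} {x : V} (hx : x ∈ C.Fil k) : C.dNeg (C.h 0 x) ∈ C.Fil k := by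
  have := C.q_fil 1 (fun _ => -1) (fun _ => k) (fun _ => C.h 0 x) fun _ => C.h_fil 0 k x hx
  simpa [dNeg_apply] using this

lemma dQ_mem {x y : V} (hx : x ∈ C.U 0) (hy : y ∈ C.U (-1)) : C.dQ (-1) y x ∈ C.U 0 := by
  refine Submodule.sum_mem _ fun k _ => Submodule.smul_mem _ _ ?_
  have := C.q_mem (k + 2) (Fin.cons (-1) fun _ => 0) (Fin.cons y fun _ => x) (by
    intro a
    refine Fin.cases ?_ (fun a => ?_) a
    · exact hy
    · exact hx)
  simpa [Fin.sum_cons] using this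

lemma dQ_sub_mem (d : ℤ) {x y x' y' : V} {k : ℕ} (hx : x - x' ∈ C.Fil k) (hy : y - y' ∈ C.Fil k) :
    C.dQ d y x - C.dQ d y' x' ∈ C.Fil (k + 1) := by
  unfold dQ
  rw [← Finset.sum_sub_distrib]
  refine Submodule.sum_mem _ fun r _ => ?_
  rw [← smul_sub]
  refine Submodule.smul_mem _ _ (C.Fil_anti (by omega) (C.q_sub_mem _ _ _ k ?_ _))
  intro a
  refine Fin.cases ?_ (fun a => ?_) a
  · exact hy
  · exact hx

lemma dQ_smul (d : ℤ) (c : 𝕜) (y x : V) : C.dQ d (c • y) x = c • C.dQ d y x := by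
  unfold dQ
  rw [Finset.smul_sum]
  refine Finset.sum_congr rfl fun k _ => ?_
  rw [MultilinearMap.cons_smul, smul_comm]

lemma dF_neg (d : ℤ) (y x : V) : C.dF d (-y) x = -C.dF d y x := by
  have h := C.dQ_smul d (-1) y x
  have h' := (C.q 1 fun _ => d).map_update_smul (fun _ => y) 0 (-1) y
  rw [neg_one_smul, neg_one_smul] at h
  have e : ∀ z : V, Function.update (fun _ : Fin 1 => y) 0 z = fun _ => z := fun z => by
    funext a; rw [Subsingleton.elim a 0]; simp
  rw [neg_one_smul, neg_one_smul, e, e] at h'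
  rw [dF, dF, h, h', neg_add]

lemma ddF_mem {k : ℕ} {z : V} (y x : V) (hz : z ∈ C.Fil k) : C.ddF z y x ∈ C.Fil (k + 1) := by
  refine Submodule.sum_mem _ fun l _ => Submodule.smul_mem _ _ ?_
  have h := C.q_fil (l + 2) (Fin.cons 1 (Fin.cons (-1) fun _ => 0)) _ _
    (C.cons_cons_mem_Fil y x hz)
  rw [mem_Fil_sum] at h
  exact C.Fil_anti (by omega) h

/-- Multiplication of a path by `e`. -/
def mulE : V ⊗[𝕜] FlowAlg 𝕜 →ₗ[𝕜] V ⊗[𝕜] FlowAlg 𝕜 :=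
  (LinearMap.mulLeft 𝕜 (MvPolynomial.X 1)).lTensor V

lemma pathEval_mulE (p : Fin 2 → 𝕜) (x : V ⊗[𝕜] FlowAlg 𝕜) :
    pathEval p (mulE x) = p 1 • pathEval p x := by
  induction x with
  | zero => simp
  | tmul v a => simp [mulE, mul_smul]
  | add x y hx hy => simp only [map_add, hx, hy, smul_add]

lemma pathD_mulE (x : V ⊗[𝕜] FlowAlg 𝕜) : pathD (mulE x) = mulE (pathD x) - mulE x := by
  induction x with
  | zero => simp
  | tmul v a =>
    have h1 : flowD 𝕜 (MvPolynomial.X 1) = -MvPolynomial.X 1 := by simp [flowD]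
    have h2 : flowD 𝕜 (MvPolynomial.X 1 * a) =
        MvPolynomial.X 1 * flowD 𝕜 a - MvPolynomial.X 1 * a := by
      rw [Derivation.leibniz, h1, smul_eq_mul, smul_eq_mul]; ring
    simp only [mulE, LinearMap.lTensor_tmul, LinearMap.mulLeft_apply, pathD_tmul, h2,
      TensorProduct.tmul_sub]
  | add x y hx hy => simp only [map_add, hx, hy]; abel

/-- The primitive with value `α` at the point `s = 0`, `e = 1`. -/
def primitive (α : V) (R : V ⊗[𝕜] FlowAlg 𝕜) : V ⊗[𝕜] FlowAlg 𝕜 :=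
  α ⊗ₜ 1 + (flowIntZero 𝕜).lTensor V R

lemma pathEval_primitive (α : V) (R : V ⊗[𝕜] FlowAlg 𝕜) :
    pathEval ![0, 1] (primitive α R) = α := by
  have h : (MvPolynomial.aeval (![0, 1] : Fin 2 → 𝕜)).toLinearMap ∘ₗ flowIntZero 𝕜 = 0 :=
    LinearMap.ext fun a => aeval_flowIntZero 𝕜 a
  unfold primitive
  rw [map_add, pathEval_tmul, map_one, one_smul, pathEval, LinearMap.comp_apply,
    ← LinearMap.lTensor_comp_apply, h]
  simp

/-- The path `x` that starts at `α` and is determined by `R`: it satisfies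
`x' = e • (R - d h (primitive α R))`. -/
def flowPath (α : V) (R : V ⊗[𝕜] FlowAlg 𝕜) : V ⊗[𝕜] FlowAlg 𝕜 :=
  primitive α (mulE R) - (C.dNeg ∘ₗ C.h 0).rTensor _ (primitive α (mulE R)) +
    mulE ((C.dNeg ∘ₗ C.h 0).rTensor _ (primitive α R))

lemma pathEval_flowPath (α : V) (R : V ⊗[𝕜] FlowAlg 𝕜) (p : Fin 2 → 𝕜) :
    pathEval p (C.flowPath α R) = pathEval p (primitive α (mulE R)) -
      C.dNeg (C.h 0 (pathEval p (primitive α (mulE R)))) +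
      p 1 • C.dNeg (C.h 0 (pathEval p (primitive α R))) := by
  unfold flowPath
  simp only [map_add, map_sub, pathEval_mulE, pathEval_rTensor, LinearMap.comp_apply]

lemma exists_flowStep (α : V) (R : V ⊗[𝕜] FlowAlg 𝕜) : ∃ R' : V ⊗[𝕜] FlowAlg 𝕜, ∀ p,
    pathEval p R' = -C.dQ (-1) (C.h 0 (pathEval p (primitive α R)))
      (pathEval p (C.flowPath α R)) := by
  choose y hy _ using fun k =>
    exists_path_multilinear (C.q (k + 2) (Fin.cons (-1) fun _ => 0))
      (Fin.cons ((C.h 0).rTensor _ (primitive α R)) fun _ => C.flowPath α R)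
  refine ⟨-∑ k ∈ Finset.range C.N, ((k + 1)! : 𝕜)⁻¹ • y k, fun p => ?_⟩
  rw [map_neg, map_sum, dQ]
  congr 1
  refine Finset.sum_congr rfl fun k _ => ?_
  rw [map_smul, hy]
  congr 2
  funext a
  refine Fin.cases ?_ (fun a => ?_) a
  · rw [Fin.cons_zero, Fin.cons_zero, pathEval_rTensor]
  · rfl

/-- One step of the Picard iteration. -/
def flowStep (α : V) (R : V ⊗[𝕜] FlowAlg 𝕜) : V ⊗[𝕜] FlowAlg 𝕜 := (C.exists_flowStep α R).choose

lemma pathEval_flowStep (α : V) (R : V ⊗[𝕜] FlowAlg 𝕜) (p : Fin 2 → 𝕜) :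
    pathEval p (C.flowStep α R) = -C.dQ (-1) (C.h 0 (pathEval p (primitive α R)))
      (pathEval p (C.flowPath α R)) := (C.exists_flowStep α R).choose_spec p

lemma pathEval_mulE_mem (S : Submodule 𝕜 V) {x y : V ⊗[𝕜] FlowAlg 𝕜}
    (hx : ∀ p, pathEval p x - pathEval p y ∈ S) (p : Fin 2 → 𝕜) :
    pathEval p (mulE x) - pathEval p (mulE y) ∈ S := by
  rw [pathEval_mulE, pathEval_mulE, ← smul_sub]
  exact Submodule.smul_mem _ _ (hx p)

/-- Along the flow `h x` is proportional to `e`, so it vanishes at the limit point. -/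
lemma h_flowPath (α : V) (R : V ⊗[𝕜] FlowAlg 𝕜) (p : Fin 2 → 𝕜) :
    C.h 0 (pathEval p (C.flowPath α R)) = p 1 • C.h 0 (pathEval p (primitive α R)) := by
  rw [pathEval_flowPath, map_add, map_sub, h_dNeg_h, map_smul, h_dNeg_h, sub_self, zero_add]

/-- The nonlinear components of `p_∞` apply the homotopy to one of their arguments. -/
lemma Phi_of_h_eq_zero {x : V} (hx : C.h 0 x = 0) : C.Phi x = C.p x := by
  have h2 : ∀ r, C.P (r + 2) (fun _ => 0) (fun _ => x) = 0 := by
    intro r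
    rw [← opsP_eq, opsP_add_two, Finset.sum_eq_zero, smul_zero]
    intro σ _
    have : C.mergedH (r + 2) (fun _ => 0) (fun _ => x) = 0 := by
      refine Finset.sum_eq_zero fun j _ => ?_
      rw [merged_eq, MultilinearMap.map_coord_zero _ j, smul_zero]
      simp [word_eq, letter, hx]
    rw [this, smul_zero]
  unfold Phi
  cases h : C.N with
  | zero =>
    have : ∀ y : V, y = 0 := fun y => C.eq_zero_of_mem_Fil h.le (C.mem_Fil_zero y)
    rw [this x]; simp
  | succ n =>
    rw [Finset.sum_range_succ', Finset.sum_eq_zero fun r _ => by rw [h2, smul_zero], ← opsP_eq,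
      opsP_one]
    simp

lemma diagonalSum_opsP (x : V) : diagonalSum 𝕜 C.opsP x = C.Phi x := by
  rw [diagonalSum_eq_sum _ _ C.N]
  · exact Finset.sum_congr rfl fun r _ => by rw [opsP_eq]
  · intro r hr
    rw [opsP_eq]
    exact C.P_eq_zero _ (fun _ => 1) _ (fun _ => C.mem_Fil_one _) (by simp; omega)

variable [CharZero 𝕜]

lemma pathD_primitive (α : V) (R : V ⊗[𝕜] FlowAlg 𝕜) : pathD (primitive α R) = R := by
  have h : (flowD 𝕜).toLinearMap ∘ₗ flowIntZero 𝕜 = LinearMap.id :=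
    LinearMap.ext fun a => flowD_flowIntZero 𝕜 a
  unfold primitive
  rw [map_add, pathD_tmul, Derivation.map_one_eq_zero, TensorProduct.tmul_zero, zero_add, pathD,
    ← LinearMap.lTensor_comp_apply, h, LinearMap.lTensor_id, LinearMap.id_apply]

lemma pathEval_primitive_mem (S : Submodule 𝕜 V) {α : V} (hα : α ∈ S) {R : V ⊗[𝕜] FlowAlg 𝕜}
    (hR : ∀ p, pathEval p R ∈ S) (p : Fin 2 → 𝕜) : pathEval p (primitive α R) ∈ S := by
  unfold primitive
  rw [map_add, pathEval_tmul, map_one, one_smul]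
  exact add_mem hα (pathEval_lTensor_mem S _ hR p)

lemma pathEval_primitive_sub_mem (S : Submodule 𝕜 V) (α : V) {R R' : V ⊗[𝕜] FlowAlg 𝕜}
    (hR : ∀ p, pathEval p R - pathEval p R' ∈ S) (p : Fin 2 → 𝕜) :
    pathEval p (primitive α R) - pathEval p (primitive α R') ∈ S := by
  rw [← map_sub]
  unfold primitive
  rw [add_sub_add_left_eq_sub, ← map_sub]
  exact pathEval_lTensor_mem S _ (fun p => by rw [map_sub]; exact hR p) p

lemma pathEval_pathD_flowPath (α : V) (R : V ⊗[𝕜] FlowAlg 𝕜) (p : Fin 2 → 𝕜) :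
    pathEval p (pathD (C.flowPath α R)) =
      p 1 • (pathEval p R - C.dNeg (C.h 0 (pathEval p (primitive α R)))) := by
  unfold flowPath
  simp only [map_add, map_sub, pathD_mulE, pathD_rTensor, pathD_primitive, pathEval_mulE,
    pathEval_rTensor, LinearMap.comp_apply, map_smul]
  rw [smul_sub]
  abel

lemma flowPath_mem {α : V} (hα : α ∈ C.U 0) {R : V ⊗[𝕜] FlowAlg 𝕜}
    (hR : ∀ p, pathEval p R ∈ C.U 0) (p : Fin 2 → 𝕜) : pathEval p (C.flowPath α R) ∈ C.U 0 := by
  have h1 := pathEval_primitive_mem _ hα hR p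
  have h2 := pathEval_primitive_mem _ hα (R := mulE R)
    (fun p => by rw [pathEval_mulE]; exact Submodule.smul_mem _ _ (hR p)) p
  rw [pathEval_flowPath]
  exact add_mem (sub_mem h2 (C.dNeg_h_mem h2)) (Submodule.smul_mem _ _ (C.dNeg_h_mem h1))

lemma flowStep_mem {α : V} (hα : α ∈ C.U 0) {R : V ⊗[𝕜] FlowAlg 𝕜}
    (hR : ∀ p, pathEval p R ∈ C.U 0) (p : Fin 2 → 𝕜) : pathEval p (C.flowStep α R) ∈ C.U 0 := by
  rw [pathEval_flowStep]
  exact neg_mem (C.dQ_mem (C.flowPath_mem hα hR p)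
    (C.h_mem 0 _ (pathEval_primitive_mem _ hα hR p)))

lemma flowStep_sub_mem (α : V) {k : ℕ} {R R' : V ⊗[𝕜] FlowAlg 𝕜}
    (hR : ∀ p, pathEval p R - pathEval p R' ∈ C.Fil k) (p : Fin 2 → 𝕜) :
    pathEval p (C.flowStep α R) - pathEval p (C.flowStep α R') ∈ C.Fil (k + 1) := by
  have h1 := pathEval_primitive_sub_mem _ α hR p
  have h2 := pathEval_primitive_sub_mem _ α (pathEval_mulE_mem _ hR) p
  rw [pathEval_flowStep, pathEval_flowStep, neg_sub_neg, ← neg_sub]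
  refine neg_mem (C.dQ_sub_mem _ ?_ ?_)
  · rw [pathEval_flowPath, pathEval_flowPath, add_sub_add_comm, sub_sub_sub_comm, ← smul_sub,
      ← map_sub C.dNeg, ← map_sub (C.h 0), ← map_sub C.dNeg, ← map_sub (C.h 0)]
    exact add_mem (sub_mem h2 (C.dNeg_h_fil h2)) (Submodule.smul_mem _ _ (C.dNeg_h_fil h1))
  · rw [← map_sub]; exact C.h_fil _ _ _ h1

lemma exists_flowStep_fixed {α : V} (hα : α ∈ C.U 0) : ∃ R : V ⊗[𝕜] FlowAlg 𝕜,
    (∀ p, pathEval p R ∈ C.U 0) ∧ C.flowStep α R = R := by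
  refine ⟨(C.flowStep α)^[C.N] 0, ?_, ?_⟩
  · generalize C.N = n
    induction n with
    | zero => simp
    | succ n ih => rw [Function.iterate_succ_apply']; exact C.flowStep_mem hα ih
  · have key : ∀ n p, pathEval p ((C.flowStep α)^[n + 1] 0) -
        pathEval p ((C.flowStep α)^[n] 0) ∈ C.Fil n := by
      intro n
      induction n with
      | zero => exact fun p => C.mem_Fil_zero _
      | succ n ih =>
        intro p
        rw [Function.iterate_succ_apply' _ (n + 1), Function.iterate_succ_apply' _ n]
        rw [Function.iterate_succ_apply' _ n] at ih
        exact C.flowStep_sub_mem α ih p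
    rw [← Function.iterate_succ_apply' (C.flowStep α)]
    refine sub_eq_zero.1 (eq_zero_of_pathEval _ fun p => ?_)
    rw [map_sub]
    exact C.eq_zero_of_mem_Fil le_rfl (key C.N p)

/-- The flow of the vector field `-F'_x (h x)`, in a form that includes the limit point, where
`h x = 0`. -/
lemma exists_flow {α : V} (hα : α ∈ C.U 0) : ∃ x : V ⊗[𝕜] FlowAlg 𝕜,
    (∀ p, pathEval p x ∈ C.U 0) ∧
    (∀ p, pathEval p (pathD x) = -C.dF (-1) (C.h 0 (pathEval p x)) (pathEval p x)) ∧
    pathEval ![0, 1] x = α ∧ C.h 0 (pathEval ![0, 0] x) = 0 := by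
  obtain ⟨R, hR, hfix⟩ := C.exists_flowStep_fixed hα
  refine ⟨C.flowPath α R, C.flowPath_mem hα hR, fun p => ?_, ?_, ?_⟩
  · have h1 := C.pathEval_flowStep α R p
    rw [hfix] at h1
    rw [pathEval_pathD_flowPath, h_flowPath, dF, dQ_smul, ← dNeg_apply, map_smul, h1, ← smul_add,
      ← smul_neg]
    congr 1
    abel
  · rw [pathEval_flowPath, pathEval_primitive, pathEval_primitive]
    simp
  · rw [h_flowPath]
    simp

/-- The rectification of a Maurer–Cartan element `α` is the limit point of the flow that starts at
`α`: it is a Maurer–Cartan element in the kernel of `h`, and it differs from `α` by an element of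
any ideal that contains the image of `h`. -/
theorem rectification {α : V} (hα : α ∈ C.U 0) (hF : C.F α = 0) :
    diagonalSum 𝕜 C.opsI (diagonalSum 𝕜 C.opsP α) ∈ C.U 0 ∧
    C.F (diagonalSum 𝕜 C.opsI (diagonalSum 𝕜 C.opsP α)) = 0 ∧
    C.h 0 (diagonalSum 𝕜 C.opsI (diagonalSum 𝕜 C.opsP α)) = 0 ∧
    ∀ S : Submodule 𝕜 V, (∀ x, C.h 0 x ∈ S) →
      (∀ (r : ℕ) (D : Fin r → ℤ) (x : Fin r → V) (a : Fin r), x a ∈ S → C.q r D x ∈ S) →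
      diagonalSum 𝕜 C.opsI (diagonalSum 𝕜 C.opsP α) - α ∈ S := by
  obtain ⟨x, hx, hx', hx1, hx0⟩ := C.exists_flow hα
  have hh : ∀ p, C.h 0 (pathEval p x) ∈ C.U (-1) := fun p => C.h_mem 0 _ (hx p)
  have hxD : ∀ p, pathEval p (pathD x) ∈ C.U 0 := by
    intro p
    rw [hx', dF]
    refine neg_mem (add_mem ?_ (C.dQ_mem (hx p) (hh p)))
    simpa using C.q_mem 1 (fun _ => -1) (fun _ => C.h 0 (pathEval p x)) fun _ => hh p
  -- the curvature vanishes along the flow, since it satisfies a linear differential equation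
  have hFx : ∀ p, C.F (pathEval p x) = 0 := by
    obtain ⟨y, hy, hy'⟩ := exists_path_diagonal C.U C.q C.q_symm (C.N + 1) x hx hxD
    have hyF : ∀ p, pathEval p y = C.F (pathEval p x) := fun p => by rw [hy, F_eq]
    have hyF' : ∀ p, pathEval p (pathD y) =
        C.ddF (C.F (pathEval p x)) (C.h 0 (pathEval p x)) (pathEval p x) := by
      intro p
      rw [hy', hx', Finset.sum_range_succ, C.q_eq_zero (by omega), smul_zero, add_zero]
      have h2 := C.dF_eq 0 (-C.dF (-1) (C.h 0 (pathEval p x)) (pathEval p x)) (pathEval p x)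
      simp only [cons_zero_zero] at h2
      rw [← h2, dF_neg, ← eq_neg_of_add_eq_zero_right (C.dF_dF (hx p) (hh p))]
    have hmem : ∀ k p, C.F (pathEval p x) ∈ C.Fil k := by
      intro k
      induction k with
      | zero => exact fun p => C.mem_Fil_zero _
      | succ k ih =>
        intro p
        have h1 := pathEval_sub_mem (C.Fil (k + 1)) (x := y) (fun p => by
          rw [hyF']; exact C.ddF_mem _ _ (ih p)) p ![0, 1]
        rwa [hyF, hyF, hx1, hF, sub_zero] at h1
    exact fun p => C.eq_zero_of_mem_Fil le_rfl (hmem C.N p)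
  -- hence the map induced by `p_∞` is constant along the flow
  have hPhi : C.Phi (pathEval ![0, 0] x) = C.Phi α := by
    obtain ⟨y, hy, hy'⟩ := exists_path_diagonal C.U C.P C.P_symm C.N x hx hxD
    have h1 := pathEval_sub_mem ⊥ (x := y) (fun p => by
      rw [hy', hx', Submodule.mem_bot]
      have h2 := C.dPhi_dF (hx p)
      rw [hFx, map_zero, dPhi_zero, add_zero] at h2
      have h3 := C.dPhi_add (C.dF (-1) (C.h 0 (pathEval p x)) (pathEval p x))
        (-C.dF (-1) (C.h 0 (pathEval p x)) (pathEval p x)) (pathEval p x)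
      rw [add_neg_cancel, dPhi_zero, h2, zero_add] at h3
      exact h3.symm) ![0, 0] ![0, 1]
    rw [hy, hy, hx1, Submodule.mem_bot] at h1
    exact sub_eq_zero.1 h1
  have hβ : diagonalSum 𝕜 C.opsI (diagonalSum 𝕜 C.opsP α) = pathEval ![0, 0] x := by
    refine C.fixedPoint_unique (w := C.i (C.p (pathEval ![0, 0] x))) ?_ ?_
    · rw [diagonalSum_opsP, ← hPhi, C.Phi_of_h_eq_zero hx0]
      exact C.diagonalSum_opsI _
    · have h1 := C.homotopy 0 (pathEval ![0, 0] x)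
      have h2 := hFx ![0, 0]
      rw [hx0, MultilinearMap.map_coord_zero _ 0 rfl, zero_add] at h1
      rw [F] at h2
      rw [eq_neg_of_add_eq_zero_right h2, map_neg, sub_neg_eq_add]
      have h3 : C.h (0 + 1) = C.h 1 := rfl
      rw [← h3, h1]
      abel
  rw [hβ]
  refine ⟨hx _, hFx _, hx0, fun S hS hq => ?_⟩
  have h1 := pathEval_sub_mem S (x := x) (fun p => by
    rw [hx', dF]
    refine neg_mem (add_mem (hq _ _ _ 0 (hS _)) (Submodule.sum_mem _ fun k _ =>
      Submodule.smul_mem _ _ (hq _ _ _ 0 ?_)))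
    rw [Fin.cons_zero]
    exact hS _) ![0, 0] ![0, 1]
  rwa [hx1] at h1

end Contraction

/-! ### The exterior algebra -/

section Exterior

variable {𝕜 : Type*} [Field 𝕜] {n : ℕ}

/-- Contraction of exterior forms with the basis vector number `j`. -/
def extContract (j : Fin n) : Module.End 𝕜 (ExteriorAlgebra 𝕜 (Fin n → 𝕜)) :=
  CliffordAlgebra.contractLeft (Q := (0 : QuadraticForm 𝕜 (Fin n → 𝕜))) (LinearMap.proj j)

/-- Multiplication of exterior forms with the basis vector number `j`. -/
def extMul (j : Fin n) : Module.End 𝕜 (ExteriorAlgebra 𝕜 (Fin n → 𝕜)) :=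
  LinearMap.mulLeft 𝕜 (ExteriorAlgebra.ι 𝕜 (Pi.single j 1))

lemma extContract_ι_mul (j : Fin n) (v : Fin n → 𝕜) (w : ExteriorAlgebra 𝕜 (Fin n → 𝕜)) :
    extContract j (ExteriorAlgebra.ι 𝕜 v * w) =
      v j • w - ExteriorAlgebra.ι 𝕜 v * extContract j w :=
  CliffordAlgebra.contractLeft_ι_mul _ _ _

lemma extContract_algebraMap (j : Fin n) (c : 𝕜) :
    extContract j (algebraMap 𝕜 (ExteriorAlgebra 𝕜 (Fin n → 𝕜)) c) = 0 :=
  CliffordAlgebra.contractLeft_algebraMap _ _ _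

lemma extContract_comm (i j : Fin n) (w : ExteriorAlgebra 𝕜 (Fin n → 𝕜)) :
    extContract i (extContract j w) = -extContract j (extContract i w) :=
  CliffordAlgebra.contractLeft_comm _ _ _

lemma extMul_apply (j : Fin n) (w : ExteriorAlgebra 𝕜 (Fin n → 𝕜)) :
    extMul j w = ExteriorAlgebra.ι 𝕜 (Pi.single j 1) * w := rfl

lemma ι_mul_ι_mul (v v' : Fin n → 𝕜) (w : ExteriorAlgebra 𝕜 (Fin n → 𝕜)) :
    ExteriorAlgebra.ι 𝕜 v * (ExteriorAlgebra.ι 𝕜 v' * w) =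
      -(ExteriorAlgebra.ι 𝕜 v' * (ExteriorAlgebra.ι 𝕜 v * w)) := by
  rw [← mul_assoc, ← mul_assoc, eq_neg_of_add_eq_zero_left (ExteriorAlgebra.ι_add_mul_swap v v'),
    neg_mul]

lemma ι_eq_sum (v : Fin n → 𝕜) : ExteriorAlgebra.ι 𝕜 v =
    ∑ j, v j • ExteriorAlgebra.ι 𝕜 (Pi.single j 1) := by
  have h := (Pi.basisFun 𝕜 (Fin n)).sum_repr v
  simp only [Pi.basisFun_apply, Pi.basisFun_repr] at h
  conv_lhs => rw [← h]
  rw [map_sum]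
  simp only [map_smul]

lemma extContract_extMul (i j : Fin n) (w : ExteriorAlgebra 𝕜 (Fin n → 𝕜)) :
    extContract i (extMul j w) = (if i = j then w else 0) - extMul j (extContract i w) := by
  rw [extMul_apply, extContract_ι_mul, Pi.single_apply, extMul_apply]
  split_ifs <;> simp

@[elab_as_elim]
lemma ext_induction {p : ExteriorAlgebra 𝕜 (Fin n → 𝕜) → Prop}
    (algebraMap : ∀ c, p (algebraMap 𝕜 _ c)) (add : ∀ x y, p x → p y → p (x + y))
    (ι_mul : ∀ v x, p x → p (ExteriorAlgebra.ι 𝕜 v * x)) (x : ExteriorAlgebra 𝕜 (Fin n → 𝕜)) :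
    p x :=
  CliffordAlgebra.left_induction (Q := (0 : QuadraticForm 𝕜 (Fin n → 𝕜))) algebraMap add
    (fun x m hx => ι_mul m x hx) x

lemma extProj_apply (e : ℕ) (w : ExteriorAlgebra 𝕜 (Fin n → 𝕜)) : extProj 𝕜 n e w =
    (DirectSum.decompose (fun i : ℕ => ⋀[𝕜]^i (Fin n → 𝕜)) w e : ExteriorAlgebra 𝕜 (Fin n → 𝕜)) :=
  rfl

lemma extProj_mem (e : ℕ) (w : ExteriorAlgebra 𝕜 (Fin n → 𝕜)) :
    extProj 𝕜 n e w ∈ ⋀[𝕜]^e (Fin n → 𝕜) := by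
  rw [extProj_apply]; exact Subtype.mem _

lemma extProj_of_mem {e : ℕ} {w : ExteriorAlgebra 𝕜 (Fin n → 𝕜)}
    (hw : w ∈ ⋀[𝕜]^e (Fin n → 𝕜)) : extProj 𝕜 n e w = w := by
  rw [extProj_apply]; exact DirectSum.decompose_of_mem_same _ hw

lemma extProj_of_mem_ne {e e' : ℕ} {w : ExteriorAlgebra 𝕜 (Fin n → 𝕜)}
    (hw : w ∈ ⋀[𝕜]^e (Fin n → 𝕜)) (h : e ≠ e') : extProj 𝕜 n e' w = 0 := by
  rw [extProj_apply]; exact DirectSum.decompose_of_mem_ne _ hw h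

lemma extProj_extProj (e e' : ℕ) (w : ExteriorAlgebra 𝕜 (Fin n → 𝕜)) :
    extProj 𝕜 n e (extProj 𝕜 n e' w) = if e = e' then extProj 𝕜 n e w else 0 := by
  split_ifs with h
  · subst h; exact extProj_of_mem (extProj_mem e w)
  · exact extProj_of_mem_ne (extProj_mem e' w) (Ne.symm h)

lemma ι_mem_one (v : Fin n → 𝕜) : ExteriorAlgebra.ι 𝕜 v ∈ ⋀[𝕜]^1 (Fin n → 𝕜) := by
  change _ ∈ LinearMap.range (ExteriorAlgebra.ι 𝕜) ^ 1
  rw [pow_one]; exact ⟨v, rfl⟩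

lemma extProj_succ_ι_mul (e : ℕ) (v : Fin n → 𝕜) (w : ExteriorAlgebra 𝕜 (Fin n → 𝕜)) :
    extProj 𝕜 n (e + 1) (ExteriorAlgebra.ι 𝕜 v * w) = ExteriorAlgebra.ι 𝕜 v * extProj 𝕜 n e w := by
  rw [add_comm]
  exact DirectSum.coe_decompose_mul_add_of_left_mem (fun i : ℕ => ⋀[𝕜]^i (Fin n → 𝕜)) (ι_mem_one v)

lemma extProj_zero_ι_mul (v : Fin n → 𝕜) (w : ExteriorAlgebra 𝕜 (Fin n → 𝕜)) :
    extProj 𝕜 n 0 (ExteriorAlgebra.ι 𝕜 v * w) = 0 :=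
  DirectSum.coe_decompose_mul_of_left_mem_of_not_le (fun i : ℕ => ⋀[𝕜]^i (Fin n → 𝕜))
    (ι_mem_one v) (by norm_num)

lemma extProj_algebraMap (e : ℕ) (c : 𝕜) : extProj 𝕜 n e (algebraMap 𝕜 _ c) =
    if e = 0 then algebraMap 𝕜 _ c else 0 := by
  have h : algebraMap 𝕜 (ExteriorAlgebra 𝕜 (Fin n → 𝕜)) c ∈ ⋀[𝕜]^0 (Fin n → 𝕜) := by
    rw [Algebra.algebraMap_eq_smul_one]
    exact Submodule.smul_mem _ _ (SetLike.GradedOne.one_mem)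
  split_ifs with he
  · subst he; exact extProj_of_mem h
  · exact extProj_of_mem_ne h (Ne.symm he)

lemma extProj_extContract (e : ℕ) (j : Fin n) (w : ExteriorAlgebra 𝕜 (Fin n → 𝕜)) :
    extProj 𝕜 n e (extContract j w) = extContract j (extProj 𝕜 n (e + 1) w) := by
  induction w using ext_induction generalizing e with
  | algebraMap c => simp [extContract_algebraMap, extProj_algebraMap]
  | add x y hx hy => simp only [map_add, hx, hy]
  | ι_mul v x hx =>
    rw [extContract_ι_mul, extProj_succ_ι_mul, extContract_ι_mul, map_sub, map_smul]
    congr 1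
    cases e with
    | zero =>
      rw [extProj_zero_ι_mul]
      have : extContract j (extProj 𝕜 n 0 x) = 0 := by
        clear hx
        induction x using ext_induction with
        | algebraMap c => simp [extContract_algebraMap, extProj_algebraMap]
        | add x y hx hy => simp only [map_add, hx, hy, add_zero]
        | ι_mul v x hx => rw [extProj_zero_ι_mul, map_zero]
      rw [this, mul_zero]
    | succ e => rw [extProj_succ_ι_mul, hx]

lemma extContract_extProj_zero (j : Fin n) (w : ExteriorAlgebra 𝕜 (Fin n → 𝕜)) :
    extContract j (extProj 𝕜 n 0 w) = 0 := by
  induction w using ext_induction with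
  | algebraMap c => simp [extContract_algebraMap, extProj_algebraMap]
  | add x y hx hy => simp only [map_add, hx, hy, add_zero]
  | ι_mul v x hx => rw [extProj_zero_ι_mul, map_zero]

lemma extProj_zero_eq (w : ExteriorAlgebra 𝕜 (Fin n → 𝕜)) :
    extProj 𝕜 n 0 w = algebraMap 𝕜 _ (ExteriorAlgebra.algebraMapInv w) := by
  induction w using ext_induction with
  | algebraMap c => simp [extProj_algebraMap, ExteriorAlgebra.algebraMap_leftInverse _ _]
  | add x y hx hy => simp only [map_add, hx, hy]
  | ι_mul v x hx => rw [extProj_zero_ι_mul, map_mul]; simp [ExteriorAlgebra.algebraMapInv]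

/-- The number operator of the exterior algebra. -/
lemma sum_extMul_extContract (e : ℕ) (w : ExteriorAlgebra 𝕜 (Fin n → 𝕜)) :
    ∑ j, extMul j (extContract j (extProj 𝕜 n e w)) = (e : 𝕜) • extProj 𝕜 n e w := by
  induction w using ext_induction generalizing e with
  | algebraMap c =>
    rw [extProj_algebraMap]
    split_ifs with h
    · simp [extContract_algebraMap, h]
    · simp
  | add x y hx hy => simp only [map_add, smul_add, Finset.sum_add_distrib, hx, hy]
  | ι_mul v x hx =>
    cases e with
    | zero => simp [extProj_zero_ι_mul]
    | succ e =>
      rw [extProj_succ_ι_mul]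
      have h1 : ∀ j, extMul j (extContract j (ExteriorAlgebra.ι 𝕜 v * extProj 𝕜 n e x)) =
          v j • (ExteriorAlgebra.ι 𝕜 (Pi.single j 1) * extProj 𝕜 n e x) +
          ExteriorAlgebra.ι 𝕜 v * extMul j (extContract j (extProj 𝕜 n e x)) := by
        intro j
        rw [extContract_ι_mul, map_sub, map_smul, extMul_apply, extMul_apply, extMul_apply,
          ι_mul_ι_mul v, sub_eq_add_neg]
      rw [Finset.sum_congr rfl fun j _ => h1 j, Finset.sum_add_distrib, ← Finset.mul_sum, hx e]
      have h2 : ∑ j, v j • (ExteriorAlgebra.ι 𝕜 (Pi.single j 1) * extProj 𝕜 n e x) =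
          ExteriorAlgebra.ι 𝕜 v * extProj 𝕜 n e x := by
        rw [ι_eq_sum v, Finset.sum_mul]
        simp
      rw [h2, Nat.cast_succ, add_smul, one_smul, mul_smul_comm, add_comm]

lemma extProj_eq_zero {e : ℕ} (he : n < e) (w : ExteriorAlgebra 𝕜 (Fin n → 𝕜)) :
    extProj 𝕜 n e w = 0 := by
  have h := extProj_mem e w
  rw [← ExteriorAlgebra.ιMulti_span_fixedDegree] at h
  have h2 : Submodule.span 𝕜 (Set.range (ExteriorAlgebra.ιMulti 𝕜 e (M := Fin n → 𝕜))) = ⊥ := by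
    rw [Submodule.span_eq_bot]
    rintro _ ⟨v, rfl⟩
    refine AlternatingMap.map_linearDependent _ _ fun hv => ?_
    have := hv.fintype_card_le_finrank
    simp at this
    omega
  rw [h2] at h
  exact h

lemma sum_extProj (w : ExteriorAlgebra 𝕜 (Fin n → 𝕜)) :
    ∑ e ∈ Finset.range (n + 1), extProj 𝕜 n e w = w := by
  classical
  have h := DirectSum.sum_support_decompose (fun i : ℕ => ⋀[𝕜]^i (Fin n → 𝕜)) w
  conv_rhs => rw [← h]
  symm
  refine Finset.sum_subset ?_ ?_
  · intro e he
    rw [Finset.mem_range]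
    by_contra hne
    rw [DFinsupp.mem_support_iff] at he
    exact he (Subtype.ext (extProj_eq_zero (by omega) w))
  · intro e _ he
    rw [DFinsupp.notMem_support_iff] at he
    rw [he]
    rfl

end Exterior


/-! ### Contractions and Lie derivatives of polynomial forms -/

lemma eq_zero_of_eq_neg (𝕜 : Type*) {M : Type*} [Field 𝕜] [CharZero 𝕜] [AddCommGroup M]
    [Module 𝕜 M] {x : M} (h : x = -x) : x = 0 := by
  have h2 : (2 : 𝕜) • x = 0 := by
    rw [two_smul]; nth_rewrite 1 [h]; exact neg_add_cancel x
  simpa using h2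

lemma sum_antisymm {𝕜 M ι : Type*} [Field 𝕜] [CharZero 𝕜] [AddCommGroup M] [Module 𝕜 M]
    [Fintype ι] (f : ι → ι → M) (hf : ∀ i j, f i j = -f j i) : ∑ i, ∑ j, f i j = 0 := by
  have h : ∑ i, ∑ j, f i j = -∑ i, ∑ j, f i j := by
    conv_lhs => rw [Finset.sum_comm]
    rw [← Finset.sum_neg_distrib]
    refine Finset.sum_congr rfl fun i _ => ?_
    rw [← Finset.sum_neg_distrib]
    exact Finset.sum_congr rfl fun j _ => hf j i
  exact eq_zero_of_eq_neg 𝕜 h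

section Forms

variable (𝕜 : Type*) [Field 𝕜] {n : ℕ}

/-- The algebra of linear operators on `Ω_n`. -/
abbrev FormEnd (n : ℕ) : Type _ := Module.End 𝕜 (Form 𝕜 n)

/-- The differential as an operator. -/
def opD (n : ℕ) : FormEnd 𝕜 n := formD 𝕜 n

/-- Contraction with the radial vector field centred at the vertex `i`. -/
def opC (i : Fin (n + 1)) : FormEnd 𝕜 n := radialContraction 𝕜 n i

/-- The Poincaré homotopy centred at the vertex `i`. -/
def opH (i : Fin (n + 1)) : FormEnd 𝕜 n := vertexHomotopy 𝕜 n i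

/-- The projection to the forms of degree `e`. -/
def opProj (n e : ℕ) : FormEnd 𝕜 n := formProj 𝕜 n e

/-- Evaluation at the vertex `i`, followed by the inclusion of the constants. -/
def opEv (i : Fin (n + 1)) : FormEnd 𝕜 n := (evalAt 𝕜 (vertex 𝕜 n i)).smulRight 1

/-- The Lie derivative along the radial vector field centred at the vertex `i`. -/
def opL (i : Fin (n + 1)) : FormEnd 𝕜 n := opD 𝕜 n * opC 𝕜 i + opC 𝕜 i * opD 𝕜 n

/-- The radial vector field centred at the vertex `i`, as a derivation. -/
def euler (i : Fin (n + 1)) : Derivation 𝕜 (MvPolynomial (Fin n) 𝕜) (MvPolynomial (Fin n) 𝕜) :=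
  ∑ j, (MvPolynomial.X j - MvPolynomial.C (vertex 𝕜 n i j)) • MvPolynomial.pderiv j

/-- The number operator of the exterior algebra. -/
def extNum (n : ℕ) : Module.End 𝕜 (ExteriorAlgebra 𝕜 (Fin n → 𝕜)) :=
  ∑ j, extMul j * extContract j

variable {𝕜}

lemma euler_apply (i : Fin (n + 1)) (f : MvPolynomial (Fin n) 𝕜) : euler 𝕜 i f =
    ∑ j, (MvPolynomial.X j - MvPolynomial.C (vertex 𝕜 n i j)) * MvPolynomial.pderiv j f := by
  unfold euler
  rw [← Derivation.coeFnAddMonoidHom_apply, map_sum, Finset.sum_apply]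
  rfl

lemma euler_X (i : Fin (n + 1)) (j : Fin n) : euler 𝕜 i (MvPolynomial.X j) =
    MvPolynomial.X j - MvPolynomial.C (vertex 𝕜 n i j) := by
  rw [euler_apply, Finset.sum_eq_single j]
  · simp
  · intro k _ hk
    rw [MvPolynomial.pderiv_X_of_ne (Ne.symm hk), mul_zero]
  · simp

lemma extNum_apply (w : ExteriorAlgebra 𝕜 (Fin n → 𝕜)) :
    extNum 𝕜 n w = ∑ j, extMul j (extContract j w) := by
  simp [extNum, LinearMap.sum_apply]

lemma extNum_extProj (e : ℕ) (w : ExteriorAlgebra 𝕜 (Fin n → 𝕜)) :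
    extNum 𝕜 n (extProj 𝕜 n e w) = (e : 𝕜) • extProj 𝕜 n e w := by
  rw [extNum_apply, sum_extMul_extContract]

lemma extProj_extNum (e : ℕ) (w : ExteriorAlgebra 𝕜 (Fin n → 𝕜)) :
    extProj 𝕜 n e (extNum 𝕜 n w) = (e : 𝕜) • extProj 𝕜 n e w := by
  rw [← extNum_extProj, extNum_apply, extNum_apply, map_sum]
  refine Finset.sum_congr rfl fun j _ => ?_
  cases e with
  | zero => rw [extMul_apply, extProj_zero_ι_mul, extContract_extProj_zero, map_zero]
  | succ e => rw [extMul_apply, extProj_succ_ι_mul, extProj_extContract]; rfl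

lemma opD_tmul (f : MvPolynomial (Fin n) 𝕜) (w : ExteriorAlgebra 𝕜 (Fin n → 𝕜)) :
    opD 𝕜 n (f ⊗ₜ w) = ∑ j, MvPolynomial.pderiv j f ⊗ₜ extMul j w := by
  simp [opD, formD, LinearMap.sum_apply]
  rfl

lemma opC_tmul (i : Fin (n + 1)) (f : MvPolynomial (Fin n) 𝕜)
    (w : ExteriorAlgebra 𝕜 (Fin n → 𝕜)) : opC 𝕜 i (f ⊗ₜ w) =
      ∑ j, ((MvPolynomial.X j - MvPolynomial.C (vertex 𝕜 n i j)) * f) ⊗ₜ extContract j w := by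
  simp only [opC, radialContraction, LinearMap.sum_apply, TensorProduct.map_tmul]
  rfl

lemma opProj_tmul (e : ℕ) (f : MvPolynomial (Fin n) 𝕜) (w : ExteriorAlgebra 𝕜 (Fin n → 𝕜)) :
    opProj 𝕜 n e (f ⊗ₜ w) = f ⊗ₜ extProj 𝕜 n e w := rfl

lemma evalAt_tmul (x : Fin n → 𝕜) (f : MvPolynomial (Fin n) 𝕜)
    (w : ExteriorAlgebra 𝕜 (Fin n → 𝕜)) : evalAt 𝕜 x (f ⊗ₜ w) =
      MvPolynomial.aeval x f * ExteriorAlgebra.algebraMapInv w := rfl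

lemma opEv_apply (i : Fin (n + 1)) (w : Form 𝕜 n) :
    opEv 𝕜 i w = evalAt 𝕜 (vertex 𝕜 n i) w • 1 := rfl

/-- Operators agree if they agree on products of a polynomial and an exterior form. -/
lemma formEnd_ext {M : Type*} [AddCommMonoid M] [Module 𝕜 M] {A B : Form 𝕜 n →ₗ[𝕜] M}
    (h : ∀ f w, A (f ⊗ₜ w) = B (f ⊗ₜ w)) : A = B := TensorProduct.ext' h

lemma algebraMapInv_ι_mul (v : Fin n → 𝕜) (w : ExteriorAlgebra 𝕜 (Fin n → 𝕜)) :
    ExteriorAlgebra.algebraMapInv (ExteriorAlgebra.ι 𝕜 v * w) = 0 := by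
  rw [map_mul]; simp [ExteriorAlgebra.algebraMapInv]

lemma evalAt_opD (x : Fin n → 𝕜) (w : Form 𝕜 n) : evalAt 𝕜 x (opD 𝕜 n w) = 0 := by
  have h : evalAt 𝕜 x ∘ₗ opD 𝕜 n = 0 := formEnd_ext fun f w => by
    rw [LinearMap.comp_apply, opD_tmul, map_sum]
    exact Finset.sum_eq_zero fun j _ => by
      rw [evalAt_tmul, extMul_apply, algebraMapInv_ι_mul, mul_zero]
  exact LinearMap.congr_fun h w

lemma evalAt_opC (i : Fin (n + 1)) (w : Form 𝕜 n) :
    evalAt 𝕜 (vertex 𝕜 n i) (opC 𝕜 i w) = 0 := by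
  have h : evalAt 𝕜 (vertex 𝕜 n i) ∘ₗ opC 𝕜 i = 0 := formEnd_ext fun f w => by
    rw [LinearMap.comp_apply, opC_tmul, map_sum]
    exact Finset.sum_eq_zero fun j _ => by
      rw [evalAt_tmul, map_mul, map_sub]; simp
  exact LinearMap.congr_fun h w

lemma evalAt_opProj_zero (x : Fin n → 𝕜) (w : Form 𝕜 n) :
    evalAt 𝕜 x (opProj 𝕜 n 0 w) = evalAt 𝕜 x w := by
  have h : evalAt 𝕜 x ∘ₗ opProj 𝕜 n 0 = evalAt 𝕜 x := formEnd_ext fun f w => by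
    rw [LinearMap.comp_apply, opProj_tmul, evalAt_tmul, evalAt_tmul, extProj_zero_eq,
      ExteriorAlgebra.algebraMap_leftInverse]
  exact LinearMap.congr_fun h w

lemma opEv_mul_opC (i : Fin (n + 1)) : opEv 𝕜 i * opC 𝕜 i = 0 :=
  LinearMap.ext fun w => by rw [Module.End.mul_apply, opEv_apply, evalAt_opC, zero_smul]; rfl

lemma opC_mul_opProj_zero (i : Fin (n + 1)) : opC 𝕜 i * opProj 𝕜 n 0 = 0 :=
  formEnd_ext fun f w => by
    rw [Module.End.mul_apply, opProj_tmul, opC_tmul]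
    simp [extContract_extProj_zero]

lemma opProj_mul_opC (e : ℕ) (i : Fin (n + 1)) :
    opProj 𝕜 n e * opC 𝕜 i = opC 𝕜 i * opProj 𝕜 n (e + 1) :=
  formEnd_ext fun f w => by
    rw [Module.End.mul_apply, Module.End.mul_apply, opProj_tmul, opC_tmul, opC_tmul, map_sum]
    exact Finset.sum_congr rfl fun j _ => by rw [opProj_tmul, extProj_extContract]

lemma opProj_succ_mul_opD (e : ℕ) : opProj 𝕜 n (e + 1) * opD 𝕜 n = opD 𝕜 n * opProj 𝕜 n e :=
  formEnd_ext fun f w => by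
    rw [Module.End.mul_apply, Module.End.mul_apply, opProj_tmul, opD_tmul, opD_tmul, map_sum]
    exact Finset.sum_congr rfl fun j _ => by
      rw [opProj_tmul, extMul_apply, extProj_succ_ι_mul, extMul_apply]

lemma opProj_mul_opProj (e e' : ℕ) :
    opProj 𝕜 n e * opProj 𝕜 n e' = if e = e' then opProj 𝕜 n e else 0 :=
  formEnd_ext fun f w => by
    rw [Module.End.mul_apply, opProj_tmul, opProj_tmul, extProj_extProj]
    split_ifs <;> simp [opProj_tmul]

lemma opProj_eq_zero {e : ℕ} (he : n < e) : opProj 𝕜 n e = 0 :=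
  formEnd_ext fun f w => by rw [opProj_tmul, extProj_eq_zero he]; simp

lemma sum_opProj : ∑ e ∈ Finset.range (n + 1), opProj 𝕜 n e = 1 :=
  formEnd_ext fun f w => by
    rw [LinearMap.sum_apply]
    simp only [opProj_tmul]
    rw [← TensorProduct.tmul_sum, sum_extProj]
    rfl

lemma sum_Icc_opProj : ∑ e ∈ Finset.Icc 1 n, opProj 𝕜 n e = 1 - opProj 𝕜 n 0 := by
  refine eq_sub_of_add_eq (G := FormEnd 𝕜 n) ?_
  rw [← sum_opProj, Finset.sum_range_succ' _ n,
    ← Finset.sum_image (f := fun e => opProj 𝕜 n e) (g := fun e => e + 1)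
      (fun a _ b _ h => Nat.succ_injective h)]
  refine congrArg (fun z => z + opProj 𝕜 n 0) (Finset.sum_congr ?_ fun _ _ => rfl)
  ext e
  simp only [Finset.mem_Icc, Finset.mem_image, Finset.mem_range]
  constructor
  · intro h; exact ⟨e - 1, by omega, by omega⟩
  · rintro ⟨a, ha, rfl⟩; omega

lemma opL_tmul (i : Fin (n + 1)) (f : MvPolynomial (Fin n) 𝕜)
    (w : ExteriorAlgebra 𝕜 (Fin n → 𝕜)) :
    opL 𝕜 i (f ⊗ₜ w) = euler 𝕜 i f ⊗ₜ w + f ⊗ₜ extNum 𝕜 n w := by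
  have h : ∀ a b : Fin n, (MvPolynomial.pderiv a ((MvPolynomial.X b -
      MvPolynomial.C (vertex 𝕜 n i b)) * f)) ⊗ₜ[𝕜] extMul a (extContract b w) +
      ((MvPolynomial.X b - MvPolynomial.C (vertex 𝕜 n i b)) * MvPolynomial.pderiv a f) ⊗ₜ[𝕜]
        extContract b (extMul a w) =
      if a = b then f ⊗ₜ extMul a (extContract a w) +
        ((MvPolynomial.X a - MvPolynomial.C (vertex 𝕜 n i a)) * MvPolynomial.pderiv a f) ⊗ₜ w
      else 0 := by
    intro a b
    rw [extContract_extMul, Derivation.leibniz, map_sub, MvPolynomial.pderiv_C, sub_zero,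
      smul_eq_mul, smul_eq_mul]
    by_cases hab : a = b
    · subst hab
      simp only [MvPolynomial.pderiv_X_self, mul_one, if_true, TensorProduct.add_tmul,
        TensorProduct.tmul_sub]
      abel
    · rw [MvPolynomial.pderiv_X_of_ne (Ne.symm hab), if_neg (Ne.symm hab), if_neg hab, mul_zero,
        add_zero, zero_sub, TensorProduct.tmul_neg, add_neg_cancel]
  rw [opL, LinearMap.add_apply, Module.End.mul_apply, Module.End.mul_apply, opC_tmul, opD_tmul,
    map_sum, map_sum]
  simp only [opD_tmul, opC_tmul]
  rw [Finset.sum_comm, ← Finset.sum_add_distrib]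
  simp only [← Finset.sum_add_distrib, h, Finset.sum_ite_eq, Finset.mem_univ, if_true]
  rw [Finset.sum_add_distrib, ← TensorProduct.tmul_sum, ← TensorProduct.sum_tmul, extNum_apply,
    euler_apply, add_comm]

lemma pderiv_comm (a b : Fin n) (f : MvPolynomial (Fin n) 𝕜) :
    MvPolynomial.pderiv a (MvPolynomial.pderiv b f) =
      MvPolynomial.pderiv b (MvPolynomial.pderiv a f) := by
  have h : ⁅MvPolynomial.pderiv (R := 𝕜) a, MvPolynomial.pderiv b⁆ = 0 :=
    MvPolynomial.derivation_ext fun j => by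
      rw [Derivation.commutator_apply, MvPolynomial.pderiv_X, MvPolynomial.pderiv_X]
      simp [Pi.single_apply, apply_ite]
  have h2 := congrArg (fun D => D f) h
  rw [Derivation.commutator_apply] at h2
  exact sub_eq_zero.1 h2

lemma opC_mul_opC (i j : Fin (n + 1)) : opC 𝕜 i * opC 𝕜 j = -(opC 𝕜 j * opC 𝕜 i) :=
  formEnd_ext fun f w => by
    rw [LinearMap.neg_apply, Module.End.mul_apply, Module.End.mul_apply, opC_tmul, opC_tmul,
      map_sum, map_sum]
    simp only [opC_tmul]
    rw [Finset.sum_comm, ← Finset.sum_neg_distrib]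
    refine Finset.sum_congr rfl fun a _ => ?_
    rw [← Finset.sum_neg_distrib]
    refine Finset.sum_congr rfl fun b _ => ?_
    rw [extContract_comm, TensorProduct.tmul_neg, mul_left_comm]

variable [CharZero 𝕜]

lemma opD_mul_opD : opD 𝕜 n * opD 𝕜 n = 0 :=
  formEnd_ext fun f w => by
    rw [Module.End.mul_apply, opD_tmul, map_sum]
    simp only [opD_tmul]
    refine sum_antisymm (𝕜 := 𝕜) _ fun a b => ?_
    rw [extMul_apply, extMul_apply, extMul_apply, extMul_apply, ι_mul_ι_mul,
      TensorProduct.tmul_neg, pderiv_comm]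

lemma opC_sq (i : Fin (n + 1)) : opC 𝕜 i * opC 𝕜 i = 0 :=
  eq_zero_of_eq_neg (M := FormEnd 𝕜 n) 𝕜 (opC_mul_opC i i)

lemma opL_mul_opC (i : Fin (n + 1)) : opL 𝕜 i * opC 𝕜 i = opC 𝕜 i * opL 𝕜 i := by
  rw [opL, add_mul, mul_add, mul_assoc, opC_sq, ← mul_assoc (opC 𝕜 i) (opC 𝕜 i), opC_sq,
    ← mul_assoc]
  simp

lemma opL_mul_opD (i : Fin (n + 1)) : opL 𝕜 i * opD 𝕜 n = opD 𝕜 n * opL 𝕜 i := by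
  rw [opL, add_mul, mul_add, ← mul_assoc (opD 𝕜 n) (opD 𝕜 n), opD_mul_opD,
    mul_assoc (opC 𝕜 i) (opD 𝕜 n), opD_mul_opD, ← mul_assoc]
  simp

end Forms


/-! ### The Poincaré homotopies -/

section Forms

variable {𝕜 : Type*} [Field 𝕜] {n : ℕ}

lemma dilate_X (i : Fin (n + 1)) (j : Fin n) : dilate 𝕜 n i (MvPolynomial.X j) =
    Polynomial.C (MvPolynomial.C (vertex 𝕜 n i j)) +
      Polynomial.X * Polynomial.C (MvPolynomial.X j - MvPolynomial.C (vertex 𝕜 n i j)) := by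
  rw [dilate, MvPolynomial.aeval_X, map_sub]; ring

/-- The coefficient of `u^c` in the dilation of `f` is homogeneous of degree `c` with respect to
the vertex. -/
lemma euler_coeff_dilate (i : Fin (n + 1)) (f : MvPolynomial (Fin n) 𝕜) (c : ℕ) :
    euler 𝕜 i ((dilate 𝕜 n i f).coeff c) = (c : MvPolynomial (Fin n) 𝕜) *
      (dilate 𝕜 n i f).coeff c := by
  induction f using MvPolynomial.induction_on generalizing c with
  | C a =>
    have h : dilate 𝕜 n i (MvPolynomial.C a) = Polynomial.C (MvPolynomial.C a) := by
      rw [dilate, MvPolynomial.aeval_C]; rfl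
    rw [h, Polynomial.coeff_C]
    split_ifs with hc
    · subst hc
      rw [← MvPolynomial.algebraMap_eq, Derivation.map_algebraMap]; simp
    · simp
  | add f g hf hg => rw [map_add, Polynomial.coeff_add, map_add, hf, hg, mul_add]
  | mul_X f j hf =>
    rw [map_mul, dilate_X, mul_add, Polynomial.coeff_add, map_add, Polynomial.coeff_mul_C,
      ← mul_assoc, Polynomial.coeff_mul_C, Derivation.leibniz, Derivation.leibniz, hf,
      ← MvPolynomial.algebraMap_eq, Derivation.map_algebraMap]
    cases c with
    | zero => simp
    | succ c =>
      rw [Polynomial.coeff_mul_X, hf, map_sub, euler_X, Derivation.map_algebraMap]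
      simp only [smul_eq_mul, MvPolynomial.algebraMap_eq]
      push_cast
      ring

lemma dilate_euler (i : Fin (n + 1)) (f : MvPolynomial (Fin n) 𝕜) :
    dilate 𝕜 n i (euler 𝕜 i f) = Polynomial.X * Polynomial.derivative (dilate 𝕜 n i f) := by
  induction f using MvPolynomial.induction_on with
  | C a =>
    rw [← MvPolynomial.algebraMap_eq, Derivation.map_algebraMap, AlgHom.commutes]
    rw [show algebraMap 𝕜 (Polynomial (MvPolynomial (Fin n) 𝕜)) a =
      Polynomial.C (MvPolynomial.C a) from rfl]
    simp
  | add f g hf hg => simp only [map_add, hf, hg, mul_add]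
  | mul_X f j hf =>
    rw [Derivation.leibniz, map_add, smul_eq_mul, smul_eq_mul, map_mul, map_mul, hf, euler_X,
      map_sub, map_mul, Polynomial.derivative_mul, dilate_X]
    have h : dilate 𝕜 n i (MvPolynomial.C (vertex 𝕜 n i j)) =
        Polynomial.C (MvPolynomial.C (vertex 𝕜 n i j)) := by
      rw [dilate, MvPolynomial.aeval_C]; rfl
    rw [h]
    simp only [map_sub, Polynomial.derivative_add, Polynomial.derivative_mul,
      Polynomial.derivative_C, Polynomial.derivative_X]
    ring

lemma eval_one_dilate (i : Fin (n + 1)) (f : MvPolynomial (Fin n) 𝕜) :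
    (dilate 𝕜 n i f).eval 1 = f := by
  have h : (Polynomial.evalRingHom (1 : MvPolynomial (Fin n) 𝕜)).comp
      (dilate 𝕜 n i).toRingHom = RingHom.id _ := by
    refine MvPolynomial.ringHom_ext (fun a => ?_) fun j => ?_
    · simp only [RingHom.comp_apply, AlgHom.toRingHom_eq_coe, RingHom.coe_coe]
      rw [← MvPolynomial.algebraMap_eq, AlgHom.commutes]
      rw [show algebraMap 𝕜 (Polynomial (MvPolynomial (Fin n) 𝕜)) a =
        Polynomial.C (MvPolynomial.C a) from rfl]
      simp
    · simp only [RingHom.comp_apply, AlgHom.toRingHom_eq_coe, RingHom.coe_coe]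
      rw [dilate_X]; simp
  exact RingHom.congr_fun h f

lemma coeff_zero_dilate (i : Fin (n + 1)) (f : MvPolynomial (Fin n) 𝕜) :
    (dilate 𝕜 n i f).coeff 0 = MvPolynomial.C (MvPolynomial.aeval (vertex 𝕜 n i) f) := by
  rw [Polynomial.coeff_zero_eq_eval_zero]
  have h : (Polynomial.evalRingHom (0 : MvPolynomial (Fin n) 𝕜)).comp
      (dilate 𝕜 n i).toRingHom = MvPolynomial.C.comp
        (MvPolynomial.aeval (R := 𝕜) (vertex 𝕜 n i)).toRingHom := by
    refine MvPolynomial.ringHom_ext (fun a => ?_) fun j => ?_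
    · simp only [RingHom.comp_apply, AlgHom.toRingHom_eq_coe, RingHom.coe_coe]
      rw [← MvPolynomial.algebraMap_eq, AlgHom.commutes, AlgHom.commutes]
      rw [show algebraMap 𝕜 (Polynomial (MvPolynomial (Fin n) 𝕜)) a =
        Polynomial.C (MvPolynomial.C a) from rfl]
      simp
    · simp only [RingHom.comp_apply, AlgHom.toRingHom_eq_coe, RingHom.coe_coe]
      rw [dilate_X]; simp
  exact RingHom.congr_fun h f

lemma radialIntegral_apply (i : Fin (n + 1)) (e : ℕ) (f : MvPolynomial (Fin n) 𝕜) :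
    radialIntegral 𝕜 n i e f = (dilate 𝕜 n i f).sum fun c g => ((c + e : ℕ) : 𝕜)⁻¹ • g := rfl

variable [CharZero 𝕜]

/-- In terms of the dilation `f_u` of `f`, the operator is `f ↦ ∫₀¹ u ^ (e - 1) f_u du`; the identity
is the fundamental theorem of calculus. -/
lemma euler_radialIntegral (i : Fin (n + 1)) {e : ℕ} (he : 1 ≤ e)
    (f : MvPolynomial (Fin n) 𝕜) :
    euler 𝕜 i (radialIntegral 𝕜 n i e f) + (e : 𝕜) • radialIntegral 𝕜 n i e f = f := by
  rw [radialIntegral_apply, Polynomial.sum_def, map_sum, Finset.smul_sum, ← Finset.sum_add_distrib]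
  conv_rhs => rw [← eval_one_dilate i f, Polynomial.eval_eq_sum, Polynomial.sum_def]
  refine Finset.sum_congr rfl fun c _ => ?_
  rw [Derivation.map_smul, euler_coeff_dilate, one_pow, mul_one, smul_comm, ← smul_add,
    ← nsmul_eq_mul, ← Nat.cast_smul_eq_nsmul 𝕜, ← add_smul, smul_smul, ← Nat.cast_add,
    inv_mul_cancel₀ (Nat.cast_ne_zero.2 (by omega)), one_smul]

lemma radialIntegral_euler (i : Fin (n + 1)) {e : ℕ} (he : 1 ≤ e)
    (f : MvPolynomial (Fin n) 𝕜) :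
    radialIntegral 𝕜 n i e (euler 𝕜 i f + (e : 𝕜) • f) = f := by
  have h : dilate 𝕜 n i (euler 𝕜 i f + (e : 𝕜) • f) = Polynomial.X *
      Polynomial.derivative (dilate 𝕜 n i f) + (e : 𝕜) • dilate 𝕜 n i f := by
    rw [map_add, map_smul, dilate_euler]
  have h2 : ∀ c, (dilate 𝕜 n i (euler 𝕜 i f + (e : 𝕜) • f)).coeff c =
      ((c + e : ℕ) : 𝕜) • (dilate 𝕜 n i f).coeff c := by
    intro c
    rw [h, Polynomial.coeff_add, Polynomial.coeff_smul, Nat.cast_add, add_smul]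
    congr 1
    cases c with
    | zero => simp
    | succ c =>
      rw [Polynomial.coeff_X_mul, Polynomial.coeff_derivative, Nat.cast_smul_eq_nsmul,
        nsmul_eq_mul]
      push_cast; ring
  rw [radialIntegral_apply]
  have h3 : (dilate 𝕜 n i (euler 𝕜 i f + (e : 𝕜) • f)).support ⊆ (dilate 𝕜 n i f).support := by
    intro c hc
    rw [Polynomial.mem_support_iff, h2] at hc
    exact Polynomial.mem_support_iff.2 fun h => hc (by rw [h, smul_zero])
  rw [Polynomial.sum_eq_of_subset _ (fun c => smul_zero _) h3]
  conv_rhs => rw [← eval_one_dilate i f, Polynomial.eval_eq_sum, Polynomial.sum_def]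
  refine Finset.sum_congr rfl fun c _ => ?_
  rw [h2, smul_smul, inv_mul_cancel₀ (Nat.cast_ne_zero.2 (by omega)), one_smul, one_pow, mul_one]

lemma eq_C_of_euler_eq_zero (i : Fin (n + 1)) {f : MvPolynomial (Fin n) 𝕜}
    (hf : euler 𝕜 i f = 0) : f = MvPolynomial.C (MvPolynomial.aeval (vertex 𝕜 n i) f) := by
  have h := dilate_euler i f
  rw [hf, map_zero, eq_comm, mul_eq_zero, or_iff_right Polynomial.X_ne_zero] at h
  have h2 := Polynomial.eq_C_of_natDegree_eq_zero
    (Polynomial.derivative_eq_zero.1 h)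
  have h3 := eval_one_dilate i f
  rw [h2, Polynomial.eval_C, coeff_zero_dilate] at h3
  exact h3.symm

variable (𝕜) in
/-- The inverse of the Lie derivative `opL i` on the forms of positive degree. -/
def radialInv (i : Fin (n + 1)) : FormEnd 𝕜 n :=
  ∑ e ∈ Finset.Icc 1 n, TensorProduct.map (radialIntegral 𝕜 n i e) (extProj 𝕜 n e)

omit [CharZero 𝕜] in
lemma radialInv_tmul (i : Fin (n + 1)) (f : MvPolynomial (Fin n) 𝕜)
    (w : ExteriorAlgebra 𝕜 (Fin n → 𝕜)) : radialInv 𝕜 i (f ⊗ₜ w) =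
      ∑ e ∈ Finset.Icc 1 n, radialIntegral 𝕜 n i e f ⊗ₜ extProj 𝕜 n e w := by
  rw [radialInv, LinearMap.sum_apply]; rfl

omit [CharZero 𝕜] in
lemma opH_eq (i : Fin (n + 1)) : opH 𝕜 i = opC 𝕜 i * radialInv 𝕜 i := by
  rw [opH, vertexHomotopy, radialInv, Finset.mul_sum]; rfl

omit [CharZero 𝕜] in
lemma opProj_mul_radialInv (e : ℕ) (i : Fin (n + 1)) :
    opProj 𝕜 n e * radialInv 𝕜 i = radialInv 𝕜 i * opProj 𝕜 n e :=
  formEnd_ext fun f w => by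
    rw [Module.End.mul_apply, Module.End.mul_apply, opProj_tmul, radialInv_tmul, radialInv_tmul,
      map_sum]
    refine Finset.sum_congr rfl fun e' _ => ?_
    rw [opProj_tmul, extProj_extProj, extProj_extProj]
    by_cases h : e = e'
    · subst h; rfl
    · rw [if_neg h, if_neg (Ne.symm h)]

omit [CharZero 𝕜] in
lemma sub_opProj_zero_tmul (f : MvPolynomial (Fin n) 𝕜) (w : ExteriorAlgebra 𝕜 (Fin n → 𝕜)) :
    (1 - opProj 𝕜 n 0) (f ⊗ₜ w) = ∑ e ∈ Finset.Icc 1 n, f ⊗ₜ extProj 𝕜 n e w := by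
  rw [← sum_Icc_opProj, LinearMap.sum_apply]; rfl

lemma opL_mul_radialInv (i : Fin (n + 1)) : opL 𝕜 i * radialInv 𝕜 i = 1 - opProj 𝕜 n 0 :=
  formEnd_ext fun f w => by
    rw [Module.End.mul_apply, radialInv_tmul, map_sum, sub_opProj_zero_tmul]
    refine Finset.sum_congr rfl fun e he => ?_
    rw [opL_tmul, extNum_extProj, TensorProduct.tmul_smul, TensorProduct.smul_tmul',
      ← TensorProduct.add_tmul, euler_radialIntegral i (Finset.mem_Icc.1 he).1]

lemma radialInv_mul_opL (i : Fin (n + 1)) : radialInv 𝕜 i * opL 𝕜 i = 1 - opProj 𝕜 n 0 :=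
  formEnd_ext fun f w => by
    rw [Module.End.mul_apply, opL_tmul, map_add, radialInv_tmul, radialInv_tmul,
      sub_opProj_zero_tmul, ← Finset.sum_add_distrib]
    refine Finset.sum_congr rfl fun e he => ?_
    rw [extProj_extNum, TensorProduct.tmul_smul, TensorProduct.smul_tmul',
      ← TensorProduct.add_tmul, ← map_smul, ← map_add,
      radialIntegral_euler i (Finset.mem_Icc.1 he).1]

lemma opC_mul_opH (i : Fin (n + 1)) : opC 𝕜 i * opH 𝕜 i = 0 := by
  rw [opH_eq, ← mul_assoc, opC_sq]; exact zero_mul (M₀ := FormEnd 𝕜 n) _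

omit [CharZero 𝕜] in
lemma opProj_mul_opH (e : ℕ) (i : Fin (n + 1)) :
    opProj 𝕜 n e * opH 𝕜 i = opH 𝕜 i * opProj 𝕜 n (e + 1) := by
  rw [opH_eq, ← mul_assoc, opProj_mul_opC, mul_assoc, opProj_mul_radialInv, mul_assoc]

omit [CharZero 𝕜] in
lemma opH_mul_opProj_zero (i : Fin (n + 1)) : opH 𝕜 i * opProj 𝕜 n 0 = 0 := by
  rw [opH_eq, mul_assoc, ← opProj_mul_radialInv, ← mul_assoc, opC_mul_opProj_zero]
  exact zero_mul (M₀ := FormEnd 𝕜 n) _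

omit [CharZero 𝕜] in
lemma opProj_zero_mul_opEv (i : Fin (n + 1)) : opProj 𝕜 n 0 * opEv 𝕜 i = opEv 𝕜 i :=
  LinearMap.ext fun w => by
    rw [Module.End.mul_apply, opEv_apply, map_smul, Algebra.TensorProduct.one_def, opProj_tmul,
      extProj_zero_eq, map_one, map_one]

omit [CharZero 𝕜] in
lemma opH_mul_opEv (i j : Fin (n + 1)) : opH 𝕜 i * opEv 𝕜 j = 0 := by
  rw [← opProj_zero_mul_opEv, ← mul_assoc, opH_mul_opProj_zero]
  exact zero_mul (M₀ := FormEnd 𝕜 n) _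

omit [CharZero 𝕜] in
lemma evalAt_opH (i : Fin (n + 1)) (w : Form 𝕜 n) :
    evalAt 𝕜 (vertex 𝕜 n i) (opH 𝕜 i w) = 0 := by
  rw [opH_eq, Module.End.mul_apply, evalAt_opC]

omit [CharZero 𝕜] in
lemma opEv_mul_opH (i : Fin (n + 1)) : opEv 𝕜 i * opH 𝕜 i = 0 := by
  rw [opH_eq, ← mul_assoc, opEv_mul_opC]; exact zero_mul (M₀ := FormEnd 𝕜 n) _

omit [CharZero 𝕜] in
lemma evalAt_opEv (x : Fin n → 𝕜) (i : Fin (n + 1)) (w : Form 𝕜 n) :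
    evalAt 𝕜 x (opEv 𝕜 i w) = evalAt 𝕜 (vertex 𝕜 n i) w := by
  rw [opEv_apply, map_smul, Algebra.TensorProduct.one_def, evalAt_tmul, map_one, map_one, mul_one,
    smul_eq_mul, mul_one]

lemma opL_mul_opH (i : Fin (n + 1)) : opL 𝕜 i * opH 𝕜 i = opC 𝕜 i :=
  LinearMap.ext fun w => by
    have h1 := LinearMap.congr_fun (opL_mul_radialInv (𝕜 := 𝕜) i) w
    have h2 := LinearMap.congr_fun (opC_mul_opProj_zero (𝕜 := 𝕜) i) w
    rw [Module.End.mul_apply] at h2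
    rw [opH_eq, ← mul_assoc, opL_mul_opC, mul_assoc, Module.End.mul_apply, h1,
      LinearMap.sub_apply, map_sub, h2, Module.End.one_apply, LinearMap.zero_apply, sub_zero]

lemma opH_mul_opL (i : Fin (n + 1)) : opH 𝕜 i * opL 𝕜 i = opC 𝕜 i :=
  LinearMap.ext fun w => by
    have h1 := LinearMap.congr_fun (radialInv_mul_opL (𝕜 := 𝕜) i) w
    have h2 := LinearMap.congr_fun (opC_mul_opProj_zero (𝕜 := 𝕜) i) w
    rw [Module.End.mul_apply] at h2
    rw [opH_eq, mul_assoc, Module.End.mul_apply, h1,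
      LinearMap.sub_apply, map_sub, h2, Module.End.one_apply, LinearMap.zero_apply, sub_zero]

lemma opH_mul_opC (i : Fin (n + 1)) : opH 𝕜 i * opC 𝕜 i = 0 := by
  rw [← opL_mul_opH, ← mul_assoc, opH_mul_opL, opC_mul_opH]

/-- The function part of a form. -/
def fnPart (n : ℕ) : Form 𝕜 n →ₗ[𝕜] MvPolynomial (Fin n) 𝕜 :=
  (TensorProduct.rid 𝕜 _).toLinearMap ∘ₗ
    (ExteriorAlgebra.algebraMapInv (R := 𝕜) (M := Fin n → 𝕜)).toLinearMap.lTensor _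

omit [CharZero 𝕜] in
lemma fnPart_tmul (f : MvPolynomial (Fin n) 𝕜) (w : ExteriorAlgebra 𝕜 (Fin n → 𝕜)) :
    fnPart n (f ⊗ₜ w) = ExteriorAlgebra.algebraMapInv w • f := rfl

omit [CharZero 𝕜] in
lemma opProj_zero_eq (w : Form 𝕜 n) : opProj 𝕜 n 0 w = fnPart n w ⊗ₜ 1 := by
  induction w using TensorProduct.induction_on with
  | zero => simp
  | tmul f w =>
    rw [opProj_tmul, fnPart_tmul, extProj_zero_eq, Algebra.algebraMap_eq_smul_one,
      TensorProduct.tmul_smul, TensorProduct.smul_tmul']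
  | add x y hx hy => rw [map_add, map_add, hx, hy, TensorProduct.add_tmul]

omit [CharZero 𝕜] in
lemma evalAt_eq (x : Fin n → 𝕜) (w : Form 𝕜 n) :
    evalAt 𝕜 x w = MvPolynomial.aeval x (fnPart n w) := by
  rw [← evalAt_opProj_zero, opProj_zero_eq, evalAt_tmul, map_one, mul_one]

omit [CharZero 𝕜] in
lemma extNum_one : extNum 𝕜 n 1 = 0 := by
  rw [extNum_apply]
  refine Finset.sum_eq_zero fun j _ => ?_
  rw [← map_one (algebraMap 𝕜 _), extContract_algebraMap, map_zero]

/-- A form with vanishing Lie derivative along the radial vector field is a constant. -/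
lemma eq_zero_of_opL (i : Fin (n + 1)) {w : Form 𝕜 n} (h : opL 𝕜 i w = 0)
    (h0 : evalAt 𝕜 (vertex 𝕜 n i) w = 0) : w = 0 := by
  have h1 := LinearMap.congr_fun (radialInv_mul_opL (𝕜 := 𝕜) i) w
  rw [Module.End.mul_apply, h, map_zero, LinearMap.sub_apply, Module.End.one_apply, eq_comm,
    sub_eq_zero, opProj_zero_eq] at h1
  have h2 : euler 𝕜 i (fnPart n w) = 0 := by
    rw [h1, opL_tmul, extNum_one, TensorProduct.tmul_zero, add_zero] at h
    have := congrArg (fnPart n) h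
    simpa [fnPart_tmul] using this
  have h3 := eq_C_of_euler_eq_zero i h2
  rw [← evalAt_eq, h0, map_zero] at h3
  rw [h1, h3, TensorProduct.zero_tmul]

/-- The homotopy formula for the dilation centred at the vertex `i`. -/
lemma opD_opH (i : Fin (n + 1)) (w : Form 𝕜 n) :
    opD 𝕜 n (opH 𝕜 i w) + opH 𝕜 i (opD 𝕜 n w) = w - opEv 𝕜 i w := by
  rw [← sub_eq_zero]
  refine eq_zero_of_opL i ?_ ?_
  · have h1 := LinearMap.congr_fun (opL_mul_opH (𝕜 := 𝕜) i)
    have h2 := LinearMap.congr_fun (opL_mul_opD (𝕜 := 𝕜) i)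
    have h3 : opL 𝕜 i (opEv 𝕜 i w) = 0 := by
      rw [opEv_apply, map_smul, Algebra.TensorProduct.one_def, opL_tmul, extNum_one]
      simp
    simp only [Module.End.mul_apply] at h1 h2
    rw [map_sub, map_add, map_sub, h1, h2, h1, h3, opL]
    simp [Module.End.mul_apply]
  · rw [map_sub, map_add, map_sub, evalAt_opD, evalAt_opH, evalAt_opEv]; simp

end Forms


/-! ### Commutation of the Poincaré homotopies at different vertices -/

section Forms

variable {𝕜 : Type*} [Field 𝕜] {n : ℕ}

lemma extNum_extContract (j : Fin n) (w : ExteriorAlgebra 𝕜 (Fin n → 𝕜)) :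
    extNum 𝕜 n (extContract j w) = extContract j (extNum 𝕜 n w) - extContract j w := by
  rw [extNum_apply, extNum_apply, map_sum]
  simp only [extContract_extMul]
  rw [Finset.sum_sub_distrib]
  have h2 : ∑ x : Fin n, (if j = x then extContract x w else 0) = extContract j w := by simp
  have h3 : ∑ x : Fin n, extMul x (extContract x (extContract j w)) =
      -∑ x : Fin n, extMul x (extContract j (extContract x w)) := by
    rw [← Finset.sum_neg_distrib]
    exact Finset.sum_congr rfl fun x _ => by rw [extContract_comm, map_neg]
  rw [h3]
  simp only [h2]
  abel

lemma opL_opC (i j : Fin (n + 1)) (w : Form 𝕜 n) :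
    opL 𝕜 i (opC 𝕜 j w) = opC 𝕜 j (opL 𝕜 i w) + opC 𝕜 i w - opC 𝕜 j w := by
  induction w using TensorProduct.induction_on with
  | zero => simp
  | add x y hx hy => simp only [map_add, hx, hy]; abel
  | tmul f w =>
    rw [opL_tmul, map_add, opC_tmul, opC_tmul, opC_tmul, opC_tmul, map_sum,
      ← Finset.sum_add_distrib, ← Finset.sum_add_distrib, ← Finset.sum_sub_distrib]
    refine Finset.sum_congr rfl fun a _ => ?_
    rw [opL_tmul, Derivation.leibniz, map_sub, euler_X, ← MvPolynomial.algebraMap_eq,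
      Derivation.map_algebraMap, extNum_extContract, smul_eq_mul, smul_eq_mul, sub_zero,
      TensorProduct.add_tmul, TensorProduct.tmul_sub, mul_comm f]
    abel

lemma opH_opProj_zero (i : Fin (n + 1)) (w : Form 𝕜 n) : opH 𝕜 i (opProj 𝕜 n 0 w) = 0 :=
  LinearMap.congr_fun (opH_mul_opProj_zero i) w

lemma opProj_opH (e : ℕ) (i : Fin (n + 1)) (w : Form 𝕜 n) :
    opProj 𝕜 n e (opH 𝕜 i w) = opH 𝕜 i (opProj 𝕜 n (e + 1) w) :=
  LinearMap.congr_fun (opProj_mul_opH e i) w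

variable [CharZero 𝕜]

lemma opL_opD (i : Fin (n + 1)) (w : Form 𝕜 n) :
    opL 𝕜 i (opD 𝕜 n w) = opD 𝕜 n (opL 𝕜 i w) := LinearMap.congr_fun (opL_mul_opD i) w

lemma opL_opH (i : Fin (n + 1)) (w : Form 𝕜 n) : opL 𝕜 i (opH 𝕜 i w) = opC 𝕜 i w :=
  LinearMap.congr_fun (opL_mul_opH i) w

lemma opH_opL (i : Fin (n + 1)) (w : Form 𝕜 n) : opH 𝕜 i (opL 𝕜 i w) = opC 𝕜 i w :=
  LinearMap.congr_fun (opH_mul_opL i) w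

lemma opH_opC (i : Fin (n + 1)) (w : Form 𝕜 n) : opH 𝕜 i (opC 𝕜 i w) = 0 :=
  LinearMap.congr_fun (opH_mul_opC i) w

lemma opL_opL (i j : Fin (n + 1)) (w : Form 𝕜 n) :
    opL 𝕜 i (opL 𝕜 j w) = opL 𝕜 j (opL 𝕜 i w) + opL 𝕜 i w - opL 𝕜 j w := by
  have h : ∀ k (w : Form 𝕜 n),
      opL 𝕜 k w = opD 𝕜 n (opC 𝕜 k w) + opC 𝕜 k (opD 𝕜 n w) := fun k w => rfl
  rw [h j w, map_add, opL_opD, opL_opC, opL_opC, opL_opD, h j (opL 𝕜 i w), h i w, map_sub, map_add]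
  abel

variable (𝕜) in
/-- The inverse of `opL i - 1` on the forms of degree at least `2`. -/
def radialInvSub (i : Fin (n + 1)) : FormEnd 𝕜 n :=
  ∑ e ∈ Finset.Icc 2 n, TensorProduct.map (radialIntegral 𝕜 n i (e - 1)) (extProj 𝕜 n e)

lemma opL_radialInvSub (i : Fin (n + 1)) (w : Form 𝕜 n) :
    opL 𝕜 i (radialInvSub 𝕜 i w) - radialInvSub 𝕜 i w =
      w - opProj 𝕜 n 0 w - opProj 𝕜 n 1 w := by
  induction w using TensorProduct.induction_on with
  | zero => simp
  | add x y hx hy =>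
    simp only [map_add]
    rw [add_sub_add_comm, hx, hy]; abel
  | tmul f w =>
    have h2 : f ⊗ₜ[𝕜] w - opProj 𝕜 n 0 (f ⊗ₜ w) - opProj 𝕜 n 1 (f ⊗ₜ w) =
        ∑ e ∈ Finset.Icc 2 n, opProj 𝕜 n e (f ⊗ₜ w) := by
      have h := LinearMap.congr_fun (sum_Icc_opProj (𝕜 := 𝕜) (n := n)) (f ⊗ₜ w)
      rw [LinearMap.sub_apply, Module.End.one_apply, LinearMap.sum_apply] at h
      rw [← h]
      rcases Nat.eq_zero_or_pos n with hn | hn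
      · subst hn; simp [opProj_eq_zero (𝕜 := 𝕜) Nat.zero_lt_one]
      · rw [← Finset.sum_Ioc_add_eq_sum_Icc hn, add_sub_cancel_right,
          ← Finset.Icc_add_one_left_eq_Ioc]
        rfl
    rw [h2, radialInvSub, LinearMap.sum_apply, map_sum, ← Finset.sum_sub_distrib]
    refine Finset.sum_congr rfl fun e he => ?_
    have he := (Finset.mem_Icc.1 he).1
    have h3 : ((e - 1 : ℕ) : 𝕜) = e - 1 := by
      rw [Nat.cast_sub (by omega), Nat.cast_one]
    have h4 := euler_radialIntegral (𝕜 := 𝕜) i (e := e - 1) (by omega) f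
    rw [TensorProduct.map_tmul, opL_tmul, extNum_extProj, TensorProduct.tmul_smul,
      TensorProduct.smul_tmul', ← TensorProduct.add_tmul, ← TensorProduct.sub_tmul, opProj_tmul]
    conv_rhs => rw [← h4, h3, sub_smul, one_smul, ← add_sub_assoc]

/-- Both composites of two Poincaré homotopies can be computed from the same potential `z` of a form
`w`, as `L_i L_j - L_i = L_j L_i - L_j` for the Lie derivatives. -/
lemma opH_opH (i j : Fin (n + 1)) (w : Form 𝕜 n) :
    opH 𝕜 i (opH 𝕜 j w) = -opH 𝕜 j (opH 𝕜 i w) := by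
  set z := radialInvSub 𝕜 i (radialInv 𝕜 j w) with hz
  have h0 : ∀ (a b : Fin (n + 1)) v, opH 𝕜 a (opH 𝕜 b (opL 𝕜 b (opL 𝕜 a v - v))) =
      opC 𝕜 a (opC 𝕜 b v) := by
    intro a b v
    rw [opH_opL, map_sub]
    have h := opL_opC a b v
    have h2 : opC 𝕜 b (opL 𝕜 a v) - opC 𝕜 b v = opL 𝕜 a (opC 𝕜 b v) - opC 𝕜 a v := by
      rw [h]; abel
    rw [h2, map_sub, opH_opL, opH_opC, sub_zero]
  have h1 : opL 𝕜 j (opL 𝕜 i z - z) = w - opProj 𝕜 n 0 w - opProj 𝕜 n 1 w := by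
    have h2 := LinearMap.congr_fun (opL_mul_radialInv (𝕜 := 𝕜) j) w
    have h3 := fun e => LinearMap.congr_fun (opProj_mul_radialInv (𝕜 := 𝕜) e j) w
    have h4 := fun e w => LinearMap.congr_fun (opL_mul_radialInv (𝕜 := 𝕜) j) (opProj 𝕜 n e w)
    have h5 := fun e => LinearMap.congr_fun (opProj_mul_opProj (𝕜 := 𝕜) (n := n) 0 e) w
    simp only [Module.End.mul_apply, LinearMap.sub_apply, Module.End.one_apply] at h2 h3 h4 h5
    rw [hz, opL_radialInvSub, h3, h3, map_sub, map_sub, h2, h4, h4, h5, h5]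
    simp
  have h2 : opL 𝕜 i (opL 𝕜 j z - z) = w - opProj 𝕜 n 0 w - opProj 𝕜 n 1 w := by
    rw [← h1, map_sub, map_sub, opL_opL]; abel
  have h3 : ∀ a b, opH 𝕜 a (opH 𝕜 b (w - opProj 𝕜 n 0 w - opProj 𝕜 n 1 w)) =
      opH 𝕜 a (opH 𝕜 b w) := by
    intro a b
    rw [map_sub, map_sub, map_sub, map_sub, opH_opProj_zero, map_zero, sub_zero,
      ← opProj_opH 0, opH_opProj_zero, sub_zero]
  rw [← h3, ← h3 j i, ← h1, h0, h1, ← h2, h0]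
  exact LinearMap.congr_fun (opC_mul_opC i j) z

/-- Obtained from the anticommutation of the homotopies by the homotopy formula. -/
lemma opEv_opH_comm (i j : Fin (n + 1)) (w : Form 𝕜 n) :
    opEv 𝕜 i (opH 𝕜 j w) = -opEv 𝕜 j (opH 𝕜 i w) := by
  have h : ∀ a b (w : Form 𝕜 n), opD 𝕜 n (opH 𝕜 a (opH 𝕜 b w)) =
      opH 𝕜 b w - opEv 𝕜 a (opH 𝕜 b w) - opH 𝕜 a w + opH 𝕜 a (opH 𝕜 b (opD 𝕜 n w)) := by
    intro a b w
    have h1 := opD_opH a (opH 𝕜 b w)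
    have h2 := opD_opH b w
    have h3 := LinearMap.congr_fun (opH_mul_opEv (𝕜 := 𝕜) a b) w
    rw [Module.End.mul_apply, LinearMap.zero_apply] at h3
    have h4 : opH 𝕜 a (opD 𝕜 n (opH 𝕜 b w)) = opH 𝕜 a w - opH 𝕜 a (opH 𝕜 b (opD 𝕜 n w)) := by
      rw [eq_sub_of_add_eq h2, map_sub, map_sub, h3, sub_zero]
    rw [eq_sub_of_add_eq h1, h4]; abel
  have h1 := h i j w
  have h2 := h j i w
  rw [opH_opH i j w, opH_opH i j (opD 𝕜 n w), map_neg, h2] at h1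
  have h3 := sub_eq_zero.2 h1
  rw [eq_neg_iff_add_eq_zero, ← h3]
  abel

end Forms


/-! ### The algebra of Dupont's homotopy -/

/-- The operators on forms that enter Dupont's homotopy, with their relations: the differential
`d`, multiplication by the barycentric coordinates (`T`) and their differentials (`N`), the
contractions (`C`), homotopies (`H`) and evaluations (`E`) for the dilations centred at the
vertices, and the projections (`P`) to the homogeneous parts. -/
structure DupontSystem (𝕜 : Type*) [Field 𝕜] (ι : Type*) [Fintype ι] [DecidableEq ι] (R : Type*)
    [Ring R] [Algebra 𝕜 R] where
  /-- the maximal degree -/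
  n : ℕ
  /-- the differential -/
  d : R
  /-- multiplication by a coordinate -/
  T : ι → R
  /-- multiplication by the differential of a coordinate -/
  N : ι → R
  /-- contraction with a radial vector field -/
  C : ι → R
  /-- the Poincaré homotopy of a vertex -/
  H : ι → R
  /-- evaluation at a vertex -/
  E : ι → R
  /-- projection to the part of a given degree -/
  P : ℕ → R
  d_d : d * d = 0
  d_T : ∀ i, d * T i = N i + T i * d
  d_N : ∀ i, d * N i = -(N i * d)
  C_T : ∀ j i, C j * T i = T i * C j
  C_N : ∀ j i, C j * N i = T i - (if i = j then 1 else 0) - N i * C j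
  T_T : ∀ i j, T i * T j = T j * T i
  T_N : ∀ i j, T i * N j = N j * T i
  sum_T : ∑ i, T i = 1
  sum_N : ∑ i, N i = 0
  H_H : ∀ i j, H i * H j = -(H j * H i)
  d_H : ∀ i, d * H i + H i * d = 1 - E i
  H_E : ∀ i j, H i * E j = 0
  L_H : ∀ i, (d * C i + C i * d) * H i = C i
  E_T : ∀ j i, E j * T i = if i = j then E j else 0
  E_N : ∀ j i, E j * N i = 0
  E_H : ∀ i, E i * H i = 0
  P_H : ∀ e i, P e * H i = H i * P (e + 1)
  H_P_zero : ∀ i, H i * P 0 = 0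
  sum_P : ∑ e ∈ Finset.range (n + 1), P e = 1
  P_T : ∀ e i, P e * T i = T i * P e
  P_N : ∀ e i, P (e + 1) * N i = N i * P e
  P_zero_N : ∀ i, P 0 * N i = 0
  inj : ∀ i x, (d * C i + C i * d) * x = 0 → E i * x = 0 → x = 0

namespace DupontSystem

variable {𝕜 : Type*} [Field 𝕜] {ι : Type*} [Fintype ι] [DecidableEq ι] {R : Type*}
  [Ring R] [Algebra 𝕜 R] (S : DupontSystem 𝕜 ι R)

/-- The operation `A ↦ ∑ t_i A h^i`. -/
def nestT : R →ₗ[𝕜] R := ∑ i, LinearMap.mulLeft 𝕜 (S.T i) ∘ₗ LinearMap.mulRight 𝕜 (S.H i)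

/-- The operation `A ↦ ∑ dt_i A h^i`. -/
def nestN : R →ₗ[𝕜] R := ∑ i, LinearMap.mulLeft 𝕜 (S.N i) ∘ₗ LinearMap.mulRight 𝕜 (S.H i)

lemma nestT_apply (A : R) : S.nestT A = ∑ i, S.T i * (A * S.H i) := by
  simp [nestT, LinearMap.sum_apply]

lemma nestN_apply (A : R) : S.nestN A = ∑ i, S.N i * (A * S.H i) := by
  simp [nestN, LinearMap.sum_apply]

/-- Dupont's homotopy. -/
def h : R := ∑ k ∈ Finset.range (S.n + 1), (-1 : R) ^ k * S.nestT (S.nestN^[k] 1)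

/-- The projection onto the span of the basic forms. -/
def proj : R := ∑ i, S.T i * S.E i +
  ∑ k ∈ Finset.range S.n, S.nestT (S.nestN^[k] (∑ i, S.N i * S.E i))

/-- The Lie derivatives. -/
def L (i : ι) : R := S.d * S.C i + S.C i * S.d

lemma nestT_nestN (A : R) : S.nestT (S.nestN A) = -S.nestN (S.nestT A) := by
  simp only [nestT_apply, nestN_apply, Finset.sum_mul, Finset.mul_sum]
  rw [Finset.sum_comm, ← Finset.sum_neg_distrib]
  refine Finset.sum_congr rfl fun i _ => ?_
  rw [← Finset.sum_neg_distrib]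
  refine Finset.sum_congr rfl fun j _ => ?_
  rw [← mul_assoc (S.T j), ← mul_assoc (S.T j), S.T_N, mul_assoc (S.N i * _) _ (S.H j),
    mul_assoc A, S.H_H]
  simp only [mul_neg, mul_assoc]

lemma nestT_nestT [CharZero 𝕜] (A : R) : S.nestT (S.nestT A) = 0 := by
  simp only [nestT_apply, Finset.sum_mul, Finset.mul_sum]
  refine sum_antisymm (𝕜 := 𝕜) _ fun i j => ?_
  rw [← mul_assoc (S.T i), ← mul_assoc (S.T i), S.T_T, mul_assoc (S.T j * _) _ (S.H i),
    mul_assoc A, S.H_H]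
  simp only [mul_neg, mul_assoc]

lemma nestN_mul_H (A : R) (j : ι) : S.nestN (A * S.H j) = -(S.nestN A * S.H j) := by
  rw [nestN_apply, nestN_apply, Finset.sum_mul, ← Finset.sum_neg_distrib]
  refine Finset.sum_congr rfl fun i _ => ?_
  rw [mul_assoc A, S.H_H]; simp only [mul_neg, mul_assoc]

lemma nestT_mul_H (A : R) (j : ι) : S.nestT (A * S.H j) = -(S.nestT A * S.H j) := by
  rw [nestT_apply, nestT_apply, Finset.sum_mul, ← Finset.sum_neg_distrib]
  refine Finset.sum_congr rfl fun i _ => ?_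
  rw [mul_assoc A, S.H_H]; simp only [mul_neg, mul_assoc]

lemma H_mul_self [CharZero 𝕜] (j : ι) : S.H j * S.H j = 0 :=
  eq_zero_of_eq_neg 𝕜 (S.H_H j j)

lemma nestN_mul_P (A : R) (e : ℕ) : S.nestN A * S.P (e + 1) = S.nestN (A * S.P e) := by
  rw [nestN_apply, nestN_apply, Finset.sum_mul]
  exact Finset.sum_congr rfl fun i _ => by simp only [mul_assoc, S.P_H]

lemma nestT_mul_P (A : R) (e : ℕ) : S.nestT A * S.P (e + 1) = S.nestT (A * S.P e) := by
  rw [nestT_apply, nestT_apply, Finset.sum_mul]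
  exact Finset.sum_congr rfl fun i _ => by simp only [mul_assoc, S.P_H]

lemma nestN_mul_P_zero (A : R) : S.nestN A * S.P 0 = 0 := by
  rw [nestN_apply, Finset.sum_mul]
  exact Finset.sum_eq_zero fun i _ => by rw [mul_assoc, mul_assoc, S.H_P_zero]; simp

lemma nestT_mul_P_zero (A : R) : S.nestT A * S.P 0 = 0 := by
  rw [nestT_apply, Finset.sum_mul]
  exact Finset.sum_eq_zero fun i _ => by rw [mul_assoc, mul_assoc, S.H_P_zero]; simp

lemma iterate_nestN_mul_P (k : ℕ) (A : R) (e : ℕ) (he : e < k) : S.nestN^[k] A * S.P e = 0 := by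
  induction k generalizing e with
  | zero => omega
  | succ k ih =>
    rw [Function.iterate_succ_apply']
    cases e with
    | zero => exact S.nestN_mul_P_zero _
    | succ e => rw [nestN_mul_P, ih e (by omega), map_zero]

lemma eq_zero_of_mul_P {A : R} (h : ∀ e ≤ S.n, A * S.P e = 0) : A = 0 := by
  rw [← mul_one A, ← S.sum_P, Finset.mul_sum]
  exact Finset.sum_eq_zero fun e he => h e (by simpa [Nat.lt_succ_iff] using he)

lemma iterate_nestN_eq_zero (A : R) : S.nestN^[S.n + 1] A = 0 :=
  S.eq_zero_of_mul_P fun e he => S.iterate_nestN_mul_P _ _ _ (by omega)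

/-- The two operations anticommute. -/
lemma nestT_iterate_nestN (k : ℕ) (A : R) :
    S.nestT (S.nestN^[k] A) = (-1 : R) ^ k * S.nestN^[k] (S.nestT A) := by
  induction k generalizing A with
  | zero => simp
  | succ k ih =>
    rw [Function.iterate_succ_apply, Function.iterate_succ_apply, ih, nestT_nestN, pow_succ,
      ← Module.End.pow_apply, map_neg]
    simp [Module.End.pow_apply]

lemma iterate_nestN_mul_H (k : ℕ) (A : R) (j : ι) :
    S.nestN^[k] (A * S.H j) = (-1 : R) ^ k * (S.nestN^[k] A * S.H j) := by
  induction k generalizing A with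
  | zero => simp
  | succ k ih =>
    rw [Function.iterate_succ_apply, nestN_mul_H, Function.iterate_succ_apply, pow_succ,
      ← Module.End.pow_apply, map_neg, Module.End.pow_apply, ih]
    simp

/-! #### The homotopy formula -/

lemma d_nestT (A : R) : S.d * S.nestT A + S.nestT A * S.d =
    S.nestN A + S.nestT (S.d * A - A * S.d) + A - ∑ i, S.T i * (A * S.E i) := by
  have h1 : A = ∑ i, S.T i * A := by rw [← Finset.sum_mul, S.sum_T, one_mul]
  have h2 : ∀ i, S.d * (S.T i * (A * S.H i)) + S.T i * (A * S.H i) * S.d =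
      S.N i * (A * S.H i) + S.T i * ((S.d * A - A * S.d) * S.H i) + S.T i * A -
        S.T i * (A * S.E i) := by
    intro i
    have h3 : S.H i * S.d = 1 - S.E i - S.d * S.H i := eq_sub_of_add_eq' (S.d_H i)
    rw [← mul_assoc S.d, S.d_T, mul_assoc (S.T i), mul_assoc A, h3]
    noncomm_ring
  rw [nestT_apply, nestN_apply, nestT_apply, Finset.mul_sum, Finset.sum_mul,
    ← Finset.sum_add_distrib]
  conv_rhs => arg 1; arg 2; rw [h1]
  rw [← Finset.sum_add_distrib, ← Finset.sum_add_distrib, ← Finset.sum_sub_distrib]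
  exact Finset.sum_congr rfl fun i _ => h2 i

lemma d_nestN (A : R) : S.d * S.nestN A - S.nestN A * S.d =
    -S.nestN (S.d * A - A * S.d) + ∑ i, S.N i * (A * S.E i) := by
  have h1 : (0 : R) = ∑ i, S.N i * A := by rw [← Finset.sum_mul, S.sum_N, zero_mul]
  have h2 : ∀ i, S.d * (S.N i * (A * S.H i)) - S.N i * (A * S.H i) * S.d =
      -(S.N i * ((S.d * A - A * S.d) * S.H i)) + S.N i * (A * S.E i) - S.N i * A := by
    intro i
    have h3 : S.H i * S.d = 1 - S.E i - S.d * S.H i := eq_sub_of_add_eq' (S.d_H i)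
    rw [← mul_assoc S.d, S.d_N, mul_assoc (S.N i), mul_assoc A, h3]
    noncomm_ring
  rw [← sub_zero (-_ + _), h1, nestN_apply, nestN_apply, Finset.mul_sum, Finset.sum_mul,
    ← Finset.sum_sub_distrib, ← Finset.sum_neg_distrib, ← Finset.sum_add_distrib,
    ← Finset.sum_sub_distrib]
  exact Finset.sum_congr rfl fun i _ => h2 i

lemma nestN_mul_E (A : R) (j : ι) : S.nestN A * S.E j = 0 := by
  rw [nestN_apply, Finset.sum_mul]
  exact Finset.sum_eq_zero fun i _ => by rw [mul_assoc, mul_assoc, S.H_E]; simp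

lemma d_iterate_nestN (k : ℕ) : S.d * S.nestN^[k + 1] 1 - S.nestN^[k + 1] 1 * S.d =
    (-1 : R) ^ k * S.nestN^[k] (∑ i, S.N i * S.E i) := by
  induction k with
  | zero => simp [d_nestN]
  | succ k ih =>
    have h0 : ∑ i, S.N i * (S.nestN^[k + 1] 1 * S.E i) = 0 :=
      Finset.sum_eq_zero fun i _ => by
        rw [Function.iterate_succ_apply', nestN_mul_E, mul_zero]
    rw [Function.iterate_succ_apply', d_nestN, ih, h0, Function.iterate_succ_apply' _ k, add_zero]
    rcases neg_one_pow_eq_or R k with h | h <;> simp [h, pow_succ]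

/-- The homotopy formula for Dupont's homotopy. -/
lemma homotopy : S.d * S.h + S.h * S.d = 1 - S.proj := by
  have h0 : ∀ k x y, (-1 : R) ^ k * x * y = (-1 : R) ^ k * (x * y) := fun k x y => mul_assoc _ _ _
  have h1 : ∀ k, S.d * ((-1 : R) ^ k * S.nestT (S.nestN^[k] 1)) +
      (-1 : R) ^ k * S.nestT (S.nestN^[k] 1) * S.d =
      ((-1 : R) ^ k * S.nestN^[k] 1 - (-1 : R) ^ (k + 1) * S.nestN^[k + 1] 1) +
      (-1 : R) ^ k * S.nestT (S.d * S.nestN^[k] 1 - S.nestN^[k] 1 * S.d) -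
      (-1 : R) ^ k * ∑ i, S.T i * (S.nestN^[k] 1 * S.E i) := by
    intro k
    have h2 : S.d * ((-1 : R) ^ k * S.nestT (S.nestN^[k] 1)) =
        (-1 : R) ^ k * (S.d * S.nestT (S.nestN^[k] 1)) := by
      rcases neg_one_pow_eq_or R k with h | h <;> simp [h]
    rw [h2, h0, ← mul_add, d_nestT, Function.iterate_succ_apply', pow_succ]
    noncomm_ring
  rw [h, Finset.mul_sum, Finset.sum_mul, ← Finset.sum_add_distrib, Finset.sum_congr rfl
    fun k _ => h1 k, Finset.sum_sub_distrib, Finset.sum_add_distrib, Finset.sum_range_sub',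
    iterate_nestN_eq_zero, Finset.sum_range_succ', Finset.sum_range_succ', proj]
  have h3 : ∀ k, (-1 : R) ^ (k + 1) * S.nestT (S.d * S.nestN^[k + 1] 1 - S.nestN^[k + 1] 1 * S.d) =
      -S.nestT (S.nestN^[k] (∑ i, S.N i * S.E i)) := by
    intro k
    rw [d_iterate_nestN]
    rcases neg_one_pow_eq_or R k with h | h <;> simp [h, pow_succ]
  have h4 : ∀ k, (-1 : R) ^ (k + 1) * ∑ i, S.T i * (S.nestN^[k + 1] 1 * S.E i) = 0 := by
    intro k
    rw [Finset.sum_eq_zero, mul_zero]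
    intro i _
    rw [Function.iterate_succ_apply', nestN_mul_E, mul_zero]
  rw [Finset.sum_congr rfl fun k _ => h3 k, Finset.sum_congr rfl fun k _ => h4 k]
  simp
  abel

/-! #### The side conditions -/

lemma sum_single (f : ι → R) (j : ι) (A : R) :
    ∑ i, (if i = j then A else 0) * f i = A * f j := by
  simp [ite_mul]

lemma C_nestT (j : ι) (A : R) : S.C j * S.nestT A = S.nestT (S.C j * A) := by
  rw [nestT_apply, nestT_apply, Finset.mul_sum]
  exact Finset.sum_congr rfl fun i _ => by rw [← mul_assoc, S.C_T, mul_assoc, mul_assoc]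

lemma C_nestN (j : ι) (A : R) :
    S.C j * S.nestN A = S.nestT A - A * S.H j - S.nestN (S.C j * A) := by
  rw [nestN_apply, nestT_apply, nestN_apply, Finset.mul_sum, ← one_mul (A * S.H j),
    ← sum_single (fun i => A * S.H i) j 1, ← Finset.sum_sub_distrib, ← Finset.sum_sub_distrib]
  refine Finset.sum_congr rfl fun i _ => ?_
  rw [← mul_assoc, S.C_N, sub_mul, sub_mul]
  simp only [mul_assoc]

lemma L_T (j i : ι) : S.L j * S.T i = S.T i * S.L j + S.T i - if i = j then 1 else 0 := by
  rw [L, add_mul, mul_assoc, mul_assoc, S.C_T, S.d_T, ← mul_assoc, S.d_T, mul_add (S.C j), S.C_N,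
    ← mul_assoc (S.C j), S.C_T]
  noncomm_ring

lemma L_N (j i : ι) : S.L j * S.N i = S.N i * S.L j + S.N i := by
  have h : S.d * (if i = j then 1 else 0) = (if i = j then 1 else 0) * S.d := by
    split_ifs <;> simp
  rw [L, add_mul, mul_assoc, mul_assoc, S.C_N, S.d_N, mul_sub, mul_sub, S.d_T, h, ← mul_assoc,
    S.d_N, mul_neg, ← mul_assoc, S.C_N]
  noncomm_ring

lemma L_nestT (j : ι) (A : R) :
    S.L j * S.nestT A = S.nestT (S.L j * A + A) - A * S.H j := by
  rw [nestT_apply, nestT_apply, Finset.mul_sum, ← one_mul (A * S.H j),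
    ← sum_single (fun i => A * S.H i) j 1, ← Finset.sum_sub_distrib]
  refine Finset.sum_congr rfl fun i _ => ?_
  rw [← mul_assoc, S.L_T, sub_mul]
  noncomm_ring

lemma L_nestN (j : ι) (A : R) : S.L j * S.nestN A = S.nestN (S.L j * A + A) := by
  rw [nestN_apply, nestN_apply, Finset.mul_sum]
  refine Finset.sum_congr rfl fun i _ => ?_
  rw [← mul_assoc, S.L_N]
  noncomm_ring

lemma L_iterate_nestN (j : ι) (k : ℕ) : S.L j * S.nestN^[k] 1 =
    S.nestN^[k] (S.L j) + (k : R) * S.nestN^[k] 1 := by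
  induction k with
  | zero => simp
  | succ k ih =>
    rw [Function.iterate_succ_apply', L_nestN, ih, Function.iterate_succ_apply', map_add, map_add,
      ← nsmul_eq_mul, map_nsmul, add_assoc, ← succ_nsmul, nsmul_eq_mul]

lemma iterate_nestN_zero (k : ℕ) : S.nestN^[k] 0 = 0 := by
  rw [← Module.End.pow_apply, map_zero]

variable [CharZero 𝕜]

lemma nestT_C_iterate_nestN (j : ι) (k : ℕ) : S.nestT (S.C j * S.nestN^[k] 1) =
    (-1 : R) ^ k * S.nestT (S.nestN^[k] (S.C j)) +
      (k : R) * (S.nestT (S.nestN^[k - 1] 1) * S.H j) := by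
  induction k with
  | zero => simp
  | succ k ih =>
    rw [Function.iterate_succ_apply', C_nestN, map_sub, map_sub, nestT_nestT, nestT_mul_H,
      nestT_nestN, ih, map_add, zero_sub, neg_neg, sub_neg_eq_add, Nat.add_sub_cancel,
      Function.iterate_succ_apply', nestT_nestN]
    have h1 : S.nestN ((k : R) * (S.nestT (S.nestN^[k - 1] 1) * S.H j)) =
        (k : R) * (S.nestT (S.nestN^[k] 1) * S.H j) := by
      cases k with
      | zero => simp
      | succ k =>
        rw [← nsmul_eq_mul, map_nsmul, nestN_mul_H, nsmul_eq_mul, Nat.add_sub_cancel,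
          Function.iterate_succ_apply', nestT_nestN, neg_mul]
    rw [h1]
    rcases neg_one_pow_eq_or R k with h | h <;> simp [h, pow_succ, add_mul] <;> abel

lemma L_nestT_mul_H (j : ι) (k : ℕ) :
    S.L j * S.nestT (S.nestN^[k] 1) * S.H j =
      -((-1 : R) ^ k * S.nestT (S.nestN^[k] (S.C j))) +
        (k + 1 : R) * (S.nestT (S.nestN^[k] 1) * S.H j) := by
  have h1 : S.nestT (S.nestN^[k] (S.L j)) * S.H j =
      -((-1 : R) ^ k * S.nestT (S.nestN^[k] (S.C j))) := by
    have h2 : S.L j * S.H j = S.C j := S.L_H j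
    rw [← h2, iterate_nestN_mul_H]
    rcases neg_one_pow_eq_or R k with h | h <;> simp [h, nestT_mul_H]
  rw [L_nestT, L_iterate_nestN, map_add, map_add, sub_mul, add_mul, add_mul, h1,
    mul_assoc _ (S.H j),
    H_mul_self, mul_zero, sub_zero, ← nsmul_eq_mul, map_nsmul, add_assoc, ← add_mul, ← succ_nsmul,
    smul_mul_assoc, nsmul_eq_mul]
  push_cast
  rfl

omit [CharZero 𝕜] in
lemma E_nestT (j : ι) (A : R) : S.E j * S.nestT A = S.E j * (A * S.H j) := by
  rw [nestT_apply, Finset.mul_sum]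
  simp only [← mul_assoc, S.E_T]
  simp [ite_mul]

omit [CharZero 𝕜] in
lemma E_nestN (j : ι) (A : R) : S.E j * S.nestN A = 0 := by
  rw [nestN_apply, Finset.mul_sum]
  exact Finset.sum_eq_zero fun i _ => by rw [← mul_assoc, S.E_N, zero_mul]

omit [CharZero 𝕜] in
lemma E_h (j : ι) : S.E j * S.h = 0 := by
  rw [h, Finset.mul_sum]
  refine Finset.sum_eq_zero fun k _ => ?_
  have h1 : S.E j * S.nestT (S.nestN^[k] 1) = 0 := by
    rw [E_nestT]
    cases k with
    | zero => simp [S.E_H]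
    | succ k => rw [Function.iterate_succ_apply', ← mul_assoc, E_nestN, zero_mul]
  rcases neg_one_pow_eq_or R k with h | h <;> simp [h, h1]

omit [CharZero 𝕜] in
lemma nestT_mul_H_eq_zero (j : ι) : S.nestT (S.nestN^[S.n] 1) * S.H j = 0 := by
  refine S.eq_zero_of_mul_P fun e he => ?_
  cases e with
  | zero => rw [mul_assoc, S.H_P_zero, mul_zero]
  | succ e =>
    rw [mul_assoc, ← S.P_H, ← mul_assoc]
    cases e with
    | zero => rw [nestT_mul_P_zero, zero_mul]
    | succ e => rw [nestT_mul_P, iterate_nestN_mul_P _ _ _ _ (by omega), map_zero, zero_mul]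

/-- The homotopy of Dupont anticommutes with each `h^j`. An operator is determined by its composites with
the Lie derivative and the evaluation at the vertex `j`; for `h^j h + h h^j` the former is a
telescoping sum. -/
lemma H_h (j : ι) : S.H j * S.h = -(S.h * S.H j) := by
  rw [eq_neg_iff_add_eq_zero]
  refine S.inj j _ ?_ ?_
  · have h1 : S.C j * S.h = ∑ k ∈ Finset.range (S.n + 1), (S.nestT (S.nestN^[k] (S.C j)) +
        (-1 : R) ^ k * (k : R) * (S.nestT (S.nestN^[k - 1] 1) * S.H j)) := by
      rw [h, Finset.mul_sum]
      refine Finset.sum_congr rfl fun k _ => ?_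
      have h2 := S.nestT_C_iterate_nestN j k
      rw [← C_nestT] at h2
      rcases neg_one_pow_eq_or R k with h | h <;> simp only [h] at h2 ⊢ <;>
        simp [h2, add_comm]
    have h2 : S.L j * (S.h * S.H j) = ∑ k ∈ Finset.range (S.n + 1),
        (-S.nestT (S.nestN^[k] (S.C j)) +
          (-1 : R) ^ k * (k + 1 : R) * (S.nestT (S.nestN^[k] 1) * S.H j)) := by
      rw [h, Finset.sum_mul, Finset.mul_sum]
      refine Finset.sum_congr rfl fun k _ => ?_
      have h2 := S.L_nestT_mul_H j k
      rw [mul_assoc] at h2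
      rcases neg_one_pow_eq_or R k with h | h <;> simp only [h] at h2 ⊢ <;>
        (simp only [one_mul, neg_mul, mul_neg, h2]; try noncomm_ring)
    change S.L j * _ = 0
    have h3 : S.L j * S.H j = S.C j := S.L_H j
    rw [mul_add, ← mul_assoc, h3, h1, h2, ← Finset.sum_add_distrib]
    have h4 : ∀ k, S.nestT (S.nestN^[k] (S.C j)) +
        (-1 : R) ^ k * (k : R) * (S.nestT (S.nestN^[k - 1] 1) * S.H j) +
        (-S.nestT (S.nestN^[k] (S.C j)) +
          (-1 : R) ^ k * (k + 1 : R) * (S.nestT (S.nestN^[k] 1) * S.H j)) =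
        (-1 : R) ^ k * ((k + 1 : ℕ) : R) * (S.nestT (S.nestN^[k + 1 - 1] 1) * S.H j) -
        (-1 : R) ^ (k - 1) * (k : R) * (S.nestT (S.nestN^[k - 1] 1) * S.H j) := by
      intro k
      rw [Nat.add_sub_cancel]
      cases k with
      | zero => simp
      | succ k =>
        rw [Nat.add_sub_cancel, pow_succ]
        push_cast
        noncomm_ring
    rw [Finset.sum_congr rfl fun k _ => h4 k]
    have h5 := Finset.sum_range_sub (fun k => (-1 : R) ^ (k - 1) * (k : R) *
      (S.nestT (S.nestN^[k - 1] 1) * S.H j)) (S.n + 1)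
    simp only [Nat.add_sub_cancel] at h5 ⊢
    rw [h5, nestT_mul_H_eq_zero]
    simp
  · rw [mul_add, ← mul_assoc, S.E_H, ← mul_assoc, E_h]; simp

lemma nestT_mul_h (A : R) : S.nestT A * S.h = -S.nestT (A * S.h) := by
  rw [nestT_apply, nestT_apply, Finset.sum_mul, ← Finset.sum_neg_distrib]
  exact Finset.sum_congr rfl fun i _ => by
    rw [mul_assoc, mul_assoc, H_h]; simp only [mul_neg, mul_assoc]

lemma nestN_mul_h (A : R) : S.nestN A * S.h = -S.nestN (A * S.h) := by
  rw [nestN_apply, nestN_apply, Finset.sum_mul, ← Finset.sum_neg_distrib]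
  exact Finset.sum_congr rfl fun i _ => by
    rw [mul_assoc, mul_assoc, H_h]; simp only [mul_neg, mul_assoc]

lemma iterate_nestN_mul_h (k : ℕ) (A : R) :
    S.nestN^[k] A * S.h = (-1 : R) ^ k * S.nestN^[k] (A * S.h) := by
  induction k with
  | zero => simp
  | succ k ih =>
    rw [Function.iterate_succ_apply', nestN_mul_h, ih, Function.iterate_succ_apply', pow_succ]
    rcases neg_one_pow_eq_or R k with h | h <;> simp [h]

/-- The homotopy squares to zero: it anticommutes with the `h^i`, so that in each summand of the
left factor it can be moved inside, where it meets a second factor `∑ t_i _ h^i`. -/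
lemma h_h : S.h * S.h = 0 := by
  have h1 : ∀ k, S.nestT (S.nestN^[k] 1) * S.h = 0 := by
    intro k
    have h2 : S.nestT (S.nestN^[k] S.h) = 0 := by
      rw [nestT_iterate_nestN, h, map_sum]
      rw [Finset.sum_eq_zero, iterate_nestN_zero, mul_zero]
      intro l _
      rcases neg_one_pow_eq_or R l with h | h <;> simp [h, nestT_nestT]
    rw [nestT_mul_h, iterate_nestN_mul_h, one_mul]
    rcases neg_one_pow_eq_or R k with h | h <;> simp [h, h2]
  nth_rewrite 1 [h]
  rw [Finset.sum_mul]
  exact Finset.sum_eq_zero fun k _ => by rw [mul_assoc, h1, mul_zero]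

/-- The projection is built from evaluations at vertices, which kill the image of the homotopy. -/
lemma proj_h : S.proj * S.h = 0 := by
  have h0 : (∑ i, S.N i * S.E i) * S.h = 0 := by
    rw [Finset.sum_mul]
    exact Finset.sum_eq_zero fun i _ => by rw [mul_assoc, E_h, mul_zero]
  rw [proj, add_mul, Finset.sum_mul, Finset.sum_mul, Finset.sum_eq_zero, Finset.sum_eq_zero,
    add_zero]
  · intro k _
    rw [nestT_mul_h, iterate_nestN_mul_h, h0, iterate_nestN_zero]; simp
  · intro i _
    rw [mul_assoc, E_h, mul_zero]

/-- Both composites with the projection agree with `h - h d h`, by the homotopy formula. -/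
lemma h_proj : S.h * S.proj = 0 := by
  have h1 : S.proj = 1 - (S.d * S.h + S.h * S.d) := by rw [S.homotopy]; abel
  have h2 := S.proj_h
  rw [h1, sub_mul, add_mul, one_mul, mul_assoc, h_h, mul_zero, zero_add] at h2
  rw [h1, mul_sub, mul_add, mul_one, ← mul_assoc S.h S.h, h_h, zero_mul, add_zero, ← mul_assoc, h2]

omit [CharZero 𝕜] in
lemma proj_d : S.proj * S.d = S.d * S.proj := by
  have h1 : S.proj = 1 - (S.d * S.h + S.h * S.d) := by rw [S.homotopy]; abel
  rw [h1, sub_mul, mul_sub, add_mul, mul_add, mul_assoc S.h, ← mul_assoc S.d S.d, S.d_d, mul_assoc]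
  simp

lemma proj_proj : S.proj * S.proj = S.proj := by
  have h1 : S.proj = 1 - (S.d * S.h + S.h * S.d) := by rw [S.homotopy]; abel
  nth_rewrite 2 [h1]
  rw [mul_sub, mul_add, ← mul_assoc, proj_d, mul_assoc, ← mul_assoc _ S.h, proj_h]
  simp

omit [CharZero 𝕜] in
lemma P_nestT (e : ℕ) (A : R) (hA : S.P e * A = A * S.P e) :
    S.P e * S.nestT A = S.nestT A * S.P (e + 1) := by
  rw [nestT_mul_P, nestT_apply, nestT_apply, Finset.mul_sum]
  exact Finset.sum_congr rfl fun i _ => by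
    rw [← mul_assoc, S.P_T, mul_assoc, ← mul_assoc (S.P e), hA]

omit [CharZero 𝕜] in
lemma P_iterate_nestN (k e : ℕ) : S.P e * S.nestN^[k] 1 = S.nestN^[k] 1 * S.P e := by
  induction k generalizing e with
  | zero => simp
  | succ k ih =>
    rw [Function.iterate_succ_apply']
    cases e with
    | zero =>
      rw [nestN_mul_P_zero, nestN_apply, Finset.mul_sum]
      exact Finset.sum_eq_zero fun i _ => by rw [← mul_assoc, S.P_zero_N, zero_mul]
    | succ e =>
      rw [nestN_mul_P, nestN_apply, nestN_apply, Finset.mul_sum]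
      exact Finset.sum_congr rfl fun i _ => by
        rw [← mul_assoc, S.P_N, mul_assoc, ← mul_assoc (S.P e), ih]

omit [CharZero 𝕜] in
lemma P_h (e : ℕ) : S.P e * S.h = S.h * S.P (e + 1) := by
  rw [h, Finset.mul_sum, Finset.sum_mul]
  refine Finset.sum_congr rfl fun k _ => ?_
  rw [mul_assoc, ← S.P_nestT e _ (S.P_iterate_nestN k e)]
  rcases neg_one_pow_eq_or R k with h | h <;> simp [h]

omit [CharZero 𝕜] in
lemma h_P_zero : S.h * S.P 0 = 0 := by
  rw [h, Finset.sum_mul]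
  exact Finset.sum_eq_zero fun k _ => by rw [mul_assoc, nestT_mul_P_zero, mul_zero]

end DupontSystem


/-! ### The operators on polynomial forms -/

section Forms

variable {𝕜 : Type*} [Field 𝕜] {n : ℕ}

lemma pderiv_tPoly (i : Fin (n + 1)) (j : Fin n) :
    MvPolynomial.pderiv j (tPoly 𝕜 n i) = MvPolynomial.C (dtVec 𝕜 n i j) := by
  refine Fin.cases ?_ (fun i => ?_) i
  · simp [tPoly, dtVec, MvPolynomial.pderiv_X, Pi.single_apply]
  · simp [tPoly, dtVec, MvPolynomial.pderiv_X, Pi.single_apply, apply_ite, eq_comm]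

lemma aeval_tPoly (i j : Fin (n + 1)) :
    MvPolynomial.aeval (vertex 𝕜 n j) (tPoly 𝕜 n i) = if i = j then 1 else 0 := by
  refine Fin.cases ?_ (fun i => ?_) i
  · refine Fin.cases ?_ (fun j => ?_) j
    · simp [tPoly, vertex, (Fin.succ_ne_zero _).symm]
    · simp [tPoly, vertex, (Fin.succ_ne_zero _).symm, Fin.succ_inj]
  · simp [tPoly, vertex, eq_comm]

lemma sum_sub_mul_dtVec (i j : Fin (n + 1)) :
    ∑ a, (MvPolynomial.X a - MvPolynomial.C (vertex 𝕜 n j a)) *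
      MvPolynomial.C (dtVec 𝕜 n i a) = tPoly 𝕜 n i - if i = j then 1 else 0 := by
  refine Fin.cases ?_ (fun i => ?_) i
  · have h : ∀ a, dtVec 𝕜 n 0 a = -1 := by
      intro a; simp [dtVec, Finset.sum_apply, Pi.single_apply]
    have h1 : ∀ a, (MvPolynomial.X a - MvPolynomial.C (vertex 𝕜 n j a)) *
        MvPolynomial.C (dtVec 𝕜 n 0 a) = MvPolynomial.C (vertex 𝕜 n j a) - MvPolynomial.X a := by
      intro a; rw [h, map_neg, map_one]; ring
    have h2 : (if (0 : Fin (n + 1)) = j then (1 : MvPolynomial (Fin n) 𝕜) else 0) =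
        1 - MvPolynomial.C (∑ a, vertex 𝕜 n j a) := by
      refine Fin.cases ?_ (fun j => ?_) j
      · simp [vertex, (Fin.succ_ne_zero _).symm]
      · simp [vertex, (Fin.succ_ne_zero _).symm, Fin.succ_inj]
    rw [Finset.sum_congr rfl fun a _ => h1 a, Finset.sum_sub_distrib, ← map_sum, h2, tPoly]
    simp only [Fin.cases_zero]
    ring
  · rw [Finset.sum_eq_single i]
    · by_cases hij : i.succ = j
      · subst hij; simp [tPoly, dtVec, vertex]
      · simp [tPoly, dtVec, vertex, hij, Ne.symm hij]
    · intro b _ hb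
      simp [dtVec, hb]
    · simp

lemma sum_tPoly : ∑ i, tPoly 𝕜 n i = 1 := by
  rw [Fin.sum_univ_succ]; simp [tPoly]

lemma sum_dtVec : ∑ i, dtVec 𝕜 n i = 0 := by
  rw [Fin.sum_univ_succ]; simp [dtVec]

lemma t_mul_tmul (i : Fin (n + 1)) (f : MvPolynomial (Fin n) 𝕜)
    (w : ExteriorAlgebra 𝕜 (Fin n → 𝕜)) : t 𝕜 n i * f ⊗ₜ w = (tPoly 𝕜 n i * f) ⊗ₜ w := by
  rw [t, Algebra.TensorProduct.tmul_mul_tmul, one_mul]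

lemma dt_mul_tmul (i : Fin (n + 1)) (f : MvPolynomial (Fin n) 𝕜)
    (w : ExteriorAlgebra 𝕜 (Fin n → 𝕜)) :
    dt 𝕜 n i * f ⊗ₜ w = f ⊗ₜ (ExteriorAlgebra.ι 𝕜 (dtVec 𝕜 n i) * w) := by
  rw [dt, Algebra.TensorProduct.tmul_mul_tmul, one_mul]

variable (𝕜) in
/-- Multiplication by `t_i`. -/
def opT (i : Fin (n + 1)) : FormEnd 𝕜 n := LinearMap.mulLeft 𝕜 (t 𝕜 n i)

variable (𝕜) in
/-- Multiplication by `dt_i`. -/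
def opN (i : Fin (n + 1)) : FormEnd 𝕜 n := LinearMap.mulLeft 𝕜 (dt 𝕜 n i)

lemma opT_tmul (i : Fin (n + 1)) (f : MvPolynomial (Fin n) 𝕜)
    (w : ExteriorAlgebra 𝕜 (Fin n → 𝕜)) : opT 𝕜 i (f ⊗ₜ w) = (tPoly 𝕜 n i * f) ⊗ₜ w :=
  t_mul_tmul i f w

lemma opN_tmul (i : Fin (n + 1)) (f : MvPolynomial (Fin n) 𝕜)
    (w : ExteriorAlgebra 𝕜 (Fin n → 𝕜)) :
    opN 𝕜 i (f ⊗ₜ w) = f ⊗ₜ (ExteriorAlgebra.ι 𝕜 (dtVec 𝕜 n i) * w) :=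
  dt_mul_tmul i f w

lemma opD_mul_opT (i : Fin (n + 1)) : opD 𝕜 n * opT 𝕜 i = opN 𝕜 i + opT 𝕜 i * opD 𝕜 n :=
  formEnd_ext fun f w => by
    rw [LinearMap.add_apply, Module.End.mul_apply, Module.End.mul_apply, opT_tmul, opD_tmul,
      opD_tmul, opN_tmul, map_sum]
    conv_rhs => rw [ι_eq_sum, Finset.sum_mul, TensorProduct.tmul_sum]
    rw [← Finset.sum_add_distrib]
    refine Finset.sum_congr rfl fun j _ => ?_
    rw [opT_tmul, Derivation.leibniz, pderiv_tPoly, smul_eq_mul, smul_eq_mul, mul_comm f,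
      TensorProduct.add_tmul, add_comm, smul_mul_assoc, TensorProduct.tmul_smul,
      TensorProduct.smul_tmul', ← MvPolynomial.smul_eq_C_mul]
    rfl

lemma opD_mul_opN (i : Fin (n + 1)) : opD 𝕜 n * opN 𝕜 i = -(opN 𝕜 i * opD 𝕜 n) :=
  formEnd_ext fun f w => by
    rw [LinearMap.neg_apply, Module.End.mul_apply, Module.End.mul_apply, opN_tmul, opD_tmul,
      opD_tmul, map_sum, ← Finset.sum_neg_distrib]
    refine Finset.sum_congr rfl fun j _ => ?_
    rw [opN_tmul, extMul_apply, extMul_apply, ι_mul_ι_mul, TensorProduct.tmul_neg]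

lemma opC_mul_opT (j i : Fin (n + 1)) : opC 𝕜 j * opT 𝕜 i = opT 𝕜 i * opC 𝕜 j :=
  formEnd_ext fun f w => by
    rw [Module.End.mul_apply, Module.End.mul_apply, opT_tmul, opC_tmul, opC_tmul, map_sum]
    exact Finset.sum_congr rfl fun j _ => by rw [opT_tmul, mul_left_comm]

lemma opC_mul_opN (j i : Fin (n + 1)) : opC 𝕜 j * opN 𝕜 i =
    opT 𝕜 i - (if i = j then 1 else 0) - opN 𝕜 i * opC 𝕜 j :=
  formEnd_ext fun f w => by
    have h : (if i = j then (1 : FormEnd 𝕜 n) else 0) (f ⊗ₜ[𝕜] w) =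
        ((if i = j then (1 : MvPolynomial (Fin n) 𝕜) else 0) * f) ⊗ₜ w := by
      split_ifs <;> simp
    rw [LinearMap.sub_apply, LinearMap.sub_apply, h, Module.End.mul_apply, Module.End.mul_apply,
      opT_tmul, ← TensorProduct.sub_tmul, ← sub_mul, ← sum_sub_mul_dtVec, opN_tmul, opC_tmul,
      opC_tmul, map_sum, Finset.sum_mul, TensorProduct.sum_tmul, ← Finset.sum_sub_distrib]
    refine Finset.sum_congr rfl fun a _ => ?_
    rw [extContract_ι_mul, opN_tmul, TensorProduct.tmul_sub, TensorProduct.tmul_smul,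
      TensorProduct.smul_tmul', mul_assoc _ (MvPolynomial.C _), ← MvPolynomial.smul_eq_C_mul,
      mul_smul_comm]

lemma opEv_mul_opT (j i : Fin (n + 1)) :
    opEv 𝕜 j * opT 𝕜 i = if i = j then opEv 𝕜 j else 0 :=
  formEnd_ext fun f w => by
    rw [Module.End.mul_apply, opT_tmul, opEv_apply, evalAt_tmul, map_mul, aeval_tPoly]
    split_ifs
    · rw [one_mul, opEv_apply, evalAt_tmul]
    · simp

lemma opEv_mul_opN (j i : Fin (n + 1)) : opEv 𝕜 j * opN 𝕜 i = 0 :=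
  formEnd_ext fun f w => by
    rw [Module.End.mul_apply, opN_tmul, opEv_apply, evalAt_tmul, algebraMapInv_ι_mul, mul_zero,
      zero_smul]
    rfl

lemma opProj_mul_opT (e : ℕ) (i : Fin (n + 1)) :
    opProj 𝕜 n e * opT 𝕜 i = opT 𝕜 i * opProj 𝕜 n e :=
  formEnd_ext fun f w => by
    rw [Module.End.mul_apply, Module.End.mul_apply, opT_tmul, opProj_tmul, opProj_tmul, opT_tmul]

lemma opProj_succ_mul_opN (e : ℕ) (i : Fin (n + 1)) :
    opProj 𝕜 n (e + 1) * opN 𝕜 i = opN 𝕜 i * opProj 𝕜 n e :=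
  formEnd_ext fun f w => by
    rw [Module.End.mul_apply, Module.End.mul_apply, opN_tmul, opProj_tmul, opProj_tmul, opN_tmul,
      extProj_succ_ι_mul]

lemma opProj_zero_mul_opN (i : Fin (n + 1)) : opProj 𝕜 n 0 * opN 𝕜 i = 0 :=
  formEnd_ext fun f w => by
    rw [Module.End.mul_apply, opN_tmul, opProj_tmul, extProj_zero_ι_mul, TensorProduct.tmul_zero]
    rfl

lemma opT_mul_opT (i j : Fin (n + 1)) : opT 𝕜 i * opT 𝕜 j = opT 𝕜 j * opT 𝕜 i :=
  formEnd_ext fun f w => by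
    rw [Module.End.mul_apply, Module.End.mul_apply, opT_tmul, opT_tmul, opT_tmul, opT_tmul,
      mul_left_comm]

lemma opT_mul_opN (i j : Fin (n + 1)) : opT 𝕜 i * opN 𝕜 j = opN 𝕜 j * opT 𝕜 i :=
  formEnd_ext fun f w => by
    rw [Module.End.mul_apply, Module.End.mul_apply, opT_tmul, opN_tmul, opN_tmul, opT_tmul]

lemma sum_opT : ∑ i, opT 𝕜 (n := n) i = 1 :=
  formEnd_ext fun f w => by
    rw [LinearMap.sum_apply]
    simp only [opT_tmul]
    rw [← TensorProduct.sum_tmul, ← Finset.sum_mul, sum_tPoly, one_mul]; rfl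

lemma sum_opN : ∑ i, opN 𝕜 (n := n) i = 0 :=
  formEnd_ext fun f w => by
    rw [LinearMap.sum_apply]
    simp only [opN_tmul]
    rw [← TensorProduct.tmul_sum, ← Finset.sum_mul, ← map_sum, sum_dtVec]; simp

variable [CharZero 𝕜]

variable (𝕜 n) in
/-- The operators that enter Dupont's homotopy. -/
def dupontSystem : DupontSystem 𝕜 (Fin (n + 1)) (FormEnd 𝕜 n) where
  n := n
  d := opD 𝕜 n
  T := opT 𝕜
  N := opN 𝕜
  C := opC 𝕜
  H := opH 𝕜
  E := opEv 𝕜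
  P := opProj 𝕜 n
  d_d := opD_mul_opD
  d_T := opD_mul_opT
  d_N := opD_mul_opN
  C_T := opC_mul_opT
  C_N := opC_mul_opN
  T_T := opT_mul_opT
  T_N := opT_mul_opN
  sum_T := sum_opT
  sum_N := sum_opN
  H_H i j := LinearMap.ext fun w => opH_opH i j w
  d_H i := LinearMap.ext fun w => opD_opH i w
  H_E := opH_mul_opEv
  L_H := opL_mul_opH
  E_T := opEv_mul_opT
  E_N := opEv_mul_opN
  E_H := opEv_mul_opH
  P_H := opProj_mul_opH
  H_P_zero := opH_mul_opProj_zero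
  sum_P := sum_opProj
  P_T := opProj_mul_opT
  P_N := opProj_succ_mul_opN
  P_zero_N := opProj_zero_mul_opN
  inj i x h h0 := LinearMap.ext fun w => eq_zero_of_opL i (LinearMap.congr_fun h w) (by
    have h1 : opEv 𝕜 i (x w) = 0 := LinearMap.congr_fun h0 w
    have h2 := congrArg (evalAt 𝕜 (vertex 𝕜 n i)) h1
    rwa [evalAt_opEv, map_zero] at h2)

end Forms


/-! ### Sums over faces and alternating sums over tuples of vertices -/

section Alternating

variable (𝕜 : Type*) [Field 𝕜]

/-- Antisymmetry of a function of tuples. -/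
def Alternates {k : ℕ} {α M : Type*} [AddCommGroup M] (F : (Fin k → α) → M) : Prop :=
  ∀ (x : Fin k → α) (σ : Equiv.Perm (Fin k)), F (x ∘ σ) = (Equiv.Perm.sign σ : ℤ) • F x

variable {𝕜} {α M : Type*} [AddCommGroup M]

lemma Alternates.of_adjacent {k : ℕ} (F : (Fin (k + 1) → α) → M)
    (h : ∀ (x : Fin (k + 1) → α) (i : Fin k), F (x ∘ Equiv.swap i.castSucc i.succ) = -F x) :
    Alternates F := by
  intro x σ
  have hσ : σ ∈ Submonoid.closure
      (Set.range fun i : Fin k => Equiv.swap i.castSucc i.succ) := by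
    rw [Equiv.Perm.mclosure_swap_castSucc_succ]; trivial
  induction hσ using Submonoid.closure_induction generalizing x with
  | mem σ hσ =>
    obtain ⟨i, rfl⟩ := hσ
    rw [h, Equiv.Perm.sign_swap (Fin.castSucc_lt_succ).ne]
    simp
  | one => simp
  | mul σ τ _ _ hσ hτ =>
    rw [Equiv.Perm.coe_mul, ← Function.comp_assoc, hτ, hσ, map_mul, mul_comm, Units.val_mul,
      mul_smul]

lemma Alternates.eq_zero [CharZero 𝕜] [Module 𝕜 M] {k : ℕ} {F : (Fin k → α) → M}
    (hF : Alternates F) {x : Fin k → α} (hx : ¬Function.Injective x) : F x = 0 := by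
  simp only [Function.Injective, not_forall] at hx
  obtain ⟨a, b, hab, hne⟩ := hx
  have h1 : x ∘ Equiv.swap a b = x := by
    funext c
    simp only [Function.comp_apply, Equiv.swap_apply_def]
    split_ifs with h h
    · rw [h, hab]
    · rw [h, hab]
    · rfl
  have h2 := hF x (Equiv.swap a b)
  rw [h1, Equiv.Perm.sign_swap hne] at h2
  exact eq_zero_of_eq_neg 𝕜 (by simpa using h2)

/-- A function of tuples of vertices that vanishes on tuples with repetitions is summed by summing
over the orderings of the vertices of the faces. -/
lemma sum_tuples {n k : ℕ} (F : (Fin (k + 1) → Fin (n + 1)) → M)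
    (hF : ∀ x, ¬Function.Injective x → F x = 0) :
    ∑ x, F x = ∑ θ : Face n k, ∑ σ : Equiv.Perm (Fin (k + 1)), F (θ.1 ∘ σ) := by
  rw [← Fintype.sum_prod_type' 
    (f := fun (θ : Face n k) (σ : Equiv.Perm (Fin (k + 1))) => F (θ.1 ∘ σ))]
  symm
  refine Fintype.sum_of_injective (fun p : Face n k × Equiv.Perm (Fin (k + 1)) => p.1.1 ∘ p.2)
    ?_ _ _ ?_ fun _ => rfl
  · rintro ⟨⟨θ, hθ⟩, σ⟩ ⟨⟨θ', hθ'⟩, σ'⟩ h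
    have h : θ ∘ σ = θ' ∘ σ' := h
    have h1 : θ = θ' := by
      refine (hθ.range_inj hθ').1 ?_
      rw [← σ.surjective.range_comp, h, σ'.surjective.range_comp]
    subst h1
    have h2 : σ = σ' := Equiv.ext fun a => hθ.injective (congrFun h a)
    rw [h2]
  · intro x hx
    by_contra hne
    refine hx ⟨⟨⟨x ∘ Tuple.sort x, ?_⟩, (Tuple.sort x)⁻¹⟩, ?_⟩
    · have hinj : Function.Injective x := by
        by_contra h; exact hne (hF x h)
      exact (Tuple.monotone_sort x).strictMono_of_injective
        (hinj.comp (Tuple.sort x).injective)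
    · funext a; simp

/-- A permutation is given by the image `p` of `0` and by a permutation of the other places. -/
lemma sum_perm_succ {k : ℕ} (F : Equiv.Perm (Fin (k + 1)) → M) :
    ∑ σ, F σ = ∑ p : Fin (k + 1), ∑ e : Equiv.Perm (Fin k),
      F (p.cycleRange.symm * Equiv.Perm.decomposeFin.symm (0, e)) := by
  rw [← Fintype.sum_prod_type' (f := fun p e => F _)]
  symm
  refine Function.Bijective.sum_comp (e := fun q : Fin (k + 1) × Equiv.Perm (Fin k) =>
    q.1.cycleRange.symm * Equiv.Perm.decomposeFin.symm (0, q.2)) ?_ F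
  rw [Fintype.bijective_iff_injective_and_card]
  refine ⟨?_, by simp [Fintype.card_perm, Nat.factorial_succ]⟩
  rintro ⟨p, e⟩ ⟨p', e'⟩ h
  have h0 := Equiv.congr_fun h 0
  simp only [Equiv.Perm.mul_apply, Equiv.Perm.decomposeFin_symm_apply_zero,
    Fin.cycleRange_symm_zero] at h0
  subst h0
  have h1 := mul_left_cancel h
  have h2 := Equiv.Perm.decomposeFin.symm.injective h1
  simpa using h2

end Alternating

section Chain

variable {𝕜 : Type*} [Field 𝕜] {n : ℕ}

/-- The operator `b_{x_k} h^{x_{k-1}} ⋯ h^{x_0}`. -/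
def chain (b : Fin (n + 1) → FormEnd 𝕜 n) : (k : ℕ) → (Fin (k + 1) → Fin (n + 1)) → FormEnd 𝕜 n
  | 0, x => b (x 0)
  | k + 1, x => chain b k (Fin.tail x) * opH 𝕜 (x 0)

lemma chain_opH (k : ℕ) (x : Fin (k + 1) → Fin (n + 1)) :
    chain (opH 𝕜) k x = (List.ofFn fun a => vertexHomotopy 𝕜 n (x a)).reverse.prod := by
  induction k with
  | zero => simp [chain]; rfl
  | succ k ih =>
    rw [chain, ih, List.ofFn_succ (f := fun a => vertexHomotopy 𝕜 n (x a)), List.reverse_cons,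
      List.prod_append, List.prod_singleton]
    rfl

/-- The product `dt_{x_0} ⋯ dt_{x_{k-1}}`. -/
def dtWord {k : ℕ} (x : Fin k → Fin (n + 1)) : Form 𝕜 n :=
  (List.ofFn fun l => dt 𝕜 n (x l)).prod

lemma dtWord_succ {k : ℕ} (x : Fin (k + 1) → Fin (n + 1)) :
    dtWord (𝕜 := 𝕜) x = dt 𝕜 n (x 0) * dtWord (Fin.tail x) := by
  rw [dtWord, List.ofFn_succ, List.prod_cons]; rfl

lemma dt_mul_dt (i j : Fin (n + 1)) : dt 𝕜 n i * dt 𝕜 n j = -(dt 𝕜 n j * dt 𝕜 n i) := by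
  have h := ι_mul_ι_mul (dtVec 𝕜 n i) (dtVec 𝕜 n j) 1
  rw [mul_one, mul_one] at h
  rw [dt, dt, Algebra.TensorProduct.tmul_mul_tmul, Algebra.TensorProduct.tmul_mul_tmul, h,
    TensorProduct.tmul_neg]

lemma tail_comp_swap_succ {k : ℕ} (x : Fin (k + 2) → Fin (n + 1)) (i j : Fin (k + 1)) :
    Fin.tail (x ∘ Equiv.swap i.succ j.succ) = Fin.tail x ∘ Equiv.swap i j := by
  funext a
  simp only [Fin.tail, Function.comp_apply, Equiv.swap_apply_def, Fin.succ_inj]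
  split_ifs <;> rfl

lemma comp_swap_succ_zero {k : ℕ} (x : Fin (k + 2) → Fin (n + 1)) (i j : Fin (k + 1)) :
    (x ∘ Equiv.swap i.succ j.succ) 0 = x 0 := by
  rw [Function.comp_apply, Equiv.swap_apply_of_ne_of_ne (Fin.succ_ne_zero _).symm
    (Fin.succ_ne_zero _).symm]

lemma tuple_comp_swap_zero_one {k : ℕ} (x : Fin (k + 2) → Fin (n + 1)) :
    (x ∘ Equiv.swap 0 1) 0 = x 1 ∧ (x ∘ Equiv.swap 0 1) 1 = x 0 ∧
      Fin.tail (Fin.tail (x ∘ Equiv.swap 0 1)) = Fin.tail (Fin.tail x) := by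
  refine ⟨by simp, by simp, ?_⟩
  funext a
  simp only [Fin.tail, Function.comp_apply]
  rw [Equiv.swap_apply_of_ne_of_ne (Fin.succ_ne_zero _)]
  exact fun h => Fin.succ_ne_zero a (Fin.succ_injective _ h)

lemma dtWord_alternates {k : ℕ} : Alternates (dtWord (𝕜 := 𝕜) (n := n) (k := k)) := by
  cases k with
  | zero =>
    intro x σ
    rw [Subsingleton.elim σ 1]; simp
  | succ k =>
    refine Alternates.of_adjacent _ ?_
    induction k with
    | zero => exact fun x i => i.elim0
    | succ k ih =>
      intro x i
      refine Fin.cases ?_ (fun i => ?_) i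
      · obtain ⟨h0, h1, h2⟩ := tuple_comp_swap_zero_one x
        have e : Equiv.swap (0 : Fin (k + 1)).castSucc (0 : Fin (k + 1)).succ =
          Equiv.swap (0 : Fin (k + 2)) 1 := rfl
        rw [e, dtWord_succ, dtWord_succ, dtWord_succ x, dtWord_succ (Fin.tail x), h0, h2,
          ← mul_assoc, ← mul_assoc]
        change dt 𝕜 n (x 1) * dt 𝕜 n ((x ∘ Equiv.swap 0 1) 1) * _ = _
        rw [h1, dt_mul_dt]
        exact neg_mul (α := Form 𝕜 n) _ _
      · have e : Equiv.swap i.succ.castSucc i.succ.succ =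
          Equiv.swap i.castSucc.succ i.succ.succ := rfl
        rw [e, dtWord_succ, comp_swap_succ_zero, tail_comp_swap_succ, ih]
        exact (mul_neg (α := Form 𝕜 n) _ _).trans (congrArg Neg.neg (dtWord_succ x).symm)

/-- The operators anticommute with the homotopies in adjacent places, so they alternate in the tuple
of vertices. -/
lemma chain_alternates (b : Fin (n + 1) → FormEnd 𝕜 n)
    (hb : ∀ i j, b i * opH 𝕜 j = -(b j * opH 𝕜 i))
    (hH : ∀ i j : Fin (n + 1), opH 𝕜 i * opH 𝕜 j = -(opH 𝕜 j * opH 𝕜 i)) (k : ℕ) :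
    Alternates (chain b k) := by
  refine Alternates.of_adjacent _ ?_
  induction k with
  | zero => exact fun x i => i.elim0
  | succ k ih =>
    intro x i
    refine Fin.cases ?_ (fun i => ?_) i
    · obtain ⟨h0, h1, h2⟩ := tuple_comp_swap_zero_one x
      have e : Equiv.swap (0 : Fin (k + 1)).castSucc (0 : Fin (k + 1)).succ =
        Equiv.swap (0 : Fin (k + 2)) 1 := rfl
      cases k with
      | zero =>
        rw [e, chain, chain, h0]
        change b ((x ∘ Equiv.swap 0 1) 1) * _ = _
        rw [h1, hb]; rfl
      | succ k =>
        rw [e, chain, chain, chain, chain, h0, h2, mul_assoc, mul_assoc]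
        change _ * (opH 𝕜 ((x ∘ Equiv.swap 0 1) 1) * _) = _
        rw [h1, hH]
        exact LinearMap.comp_neg _ _
    · have e : Equiv.swap i.succ.castSucc i.succ.succ =
        Equiv.swap i.castSucc.succ i.succ.succ := rfl
      cases k with
      | zero => exact i.elim0
      | succ k =>
        rw [e, chain, comp_swap_succ_zero, tail_comp_swap_succ, ih]
        exact LinearMap.neg_comp _ _

/-- The basic form of a face is the alternating sum of the products `t_{x_0} dt_{x_1} ⋯ dt_{x_k}`
over all the orderings `x` of its vertices. -/
lemma basicForm_eq_sum_perm {k : ℕ} (θ : Fin (k + 1) → Fin (n + 1)) :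
    basicForm 𝕜 θ = ∑ σ : Equiv.Perm (Fin (k + 1)),
      (Equiv.Perm.sign σ : ℤ) • (t 𝕜 n ((θ ∘ σ) 0) * dtWord (Fin.tail (θ ∘ σ))) := by
  rw [sum_perm_succ, basicForm, Finset.smul_sum]
  refine Finset.sum_congr rfl fun p _ => ?_
  have h : ∀ e : Equiv.Perm (Fin k),
      ((Equiv.Perm.sign (p.cycleRange.symm * Equiv.Perm.decomposeFin.symm (0, e)) : ℤˣ) : ℤ) •
        (t 𝕜 n ((θ ∘ ⇑(p.cycleRange.symm * Equiv.Perm.decomposeFin.symm (0, e))) 0) *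
          dtWord (𝕜 := 𝕜) (Fin.tail
            (θ ∘ ⇑(p.cycleRange.symm * Equiv.Perm.decomposeFin.symm (0, e))))) =
      sgn (p : ℕ) • (t 𝕜 n (θ p) * dtWord fun l => θ (p.succAbove l)) := by
    intro e
    have h1 : (θ ∘ ⇑(p.cycleRange.symm * Equiv.Perm.decomposeFin.symm (0, e))) 0 = θ p := by
      simp
    have h2 : Fin.tail (θ ∘ ⇑(p.cycleRange.symm * Equiv.Perm.decomposeFin.symm (0, e))) =
        (fun l => θ (p.succAbove l)) ∘ e := by
      funext l
      simp [Fin.tail]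
    have h3 : ((Equiv.Perm.sign (p.cycleRange.symm * Equiv.Perm.decomposeFin.symm (0, e)) : ℤˣ) :
        ℤ) = sgn (p : ℕ) * (Equiv.Perm.sign e : ℤ) := by
      rw [map_mul, Equiv.Perm.sign_symm, Fin.sign_cycleRange, Equiv.Perm.decomposeFin.symm_sign]
      simp [sgn, Int.negOnePow_def]
    rw [h1, h2, h3, dtWord_alternates, mul_smul_comm, smul_smul, mul_assoc, ← Units.val_mul,
      Int.units_mul_self, Units.val_one, mul_one]
  rw [Finset.sum_congr rfl fun e _ => h e, Finset.sum_const, Finset.card_univ, Fintype.card_perm,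
    Fintype.card_fin, ← Nat.cast_smul_eq_nsmul 𝕜]
  rfl

variable [CharZero 𝕜]

lemma sum_face_basicForm {k : ℕ} (B : (Fin (k + 1) → Fin (n + 1)) → FormEnd 𝕜 n)
    (hB : Alternates B) :
    ∑ θ : Face n k, LinearMap.mulLeft 𝕜 (basicForm 𝕜 θ.1) ∘ₗ B θ.1 =
      ∑ x : Fin (k + 1) → Fin (n + 1),
        LinearMap.mulLeft 𝕜 (t 𝕜 n (x 0) * dtWord (Fin.tail x)) ∘ₗ B x := by
  rw [sum_tuples (fun x : Fin (k + 1) → Fin (n + 1) =>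
    LinearMap.mulLeft 𝕜 (t 𝕜 n (x 0) * dtWord (Fin.tail x)) ∘ₗ B x)]
  · refine Finset.sum_congr rfl fun θ _ => ?_
    refine LinearMap.ext fun w => ?_
    rw [LinearMap.comp_apply, LinearMap.mulLeft_apply, basicForm_eq_sum_perm, Finset.sum_mul,
      LinearMap.sum_apply]
    refine Finset.sum_congr rfl fun σ _ => ?_
    rw [LinearMap.comp_apply, LinearMap.mulLeft_apply, hB, smul_mul_assoc, LinearMap.smul_apply,
      mul_smul_comm]
  · intro x hx
    rw [hB.eq_zero (𝕜 := 𝕜) hx, LinearMap.comp_zero]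

end Chain


section Chain

variable {𝕜 : Type*} [Field 𝕜] {n : ℕ}

lemma sum_cons {α M : Type*} [Fintype α] [AddCommMonoid M] {k : ℕ} (F : (Fin (k + 1) → α) → M) :
    ∑ x, F x = ∑ i, ∑ y : Fin k → α, F (Fin.cons i y) := by
  rw [← Fintype.sum_prod_type' (f := fun (i : α) (y : Fin k → α) => F (Fin.cons i y))]
  exact (Fintype.sum_equiv (Fin.consEquiv fun _ => α) _ _ fun _ => rfl).symm

lemma sum_t_chain (b : Fin (n + 1) → FormEnd 𝕜 n) :
    ∑ x : Fin 1 → Fin (n + 1),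
        LinearMap.mulLeft 𝕜 (t 𝕜 n (x 0) * dtWord (Fin.tail x)) ∘ₗ chain b 0 x =
      ∑ i, opT 𝕜 i * b i := by
  rw [sum_cons]
  refine Finset.sum_congr rfl fun i _ => ?_
  rw [Fintype.sum_unique]
  simp [chain, dtWord, opT]
  rfl

lemma sgn_smul_eq {R : Type*} [Ring R] (k : ℕ) (x : R) : sgn k • x = (-1) ^ k * x := by
  have h : sgn k = (-1) ^ k := by simp [sgn, Int.negOnePow_def]
  rcases neg_one_pow_eq_or ℤ k with h1 | h1 <;>
    rcases Nat.even_or_odd k with h2 | h2 <;> rw [h] <;> simp_all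

variable [CharZero 𝕜]

lemma sum_dtWord_chain (b : Fin (n + 1) → FormEnd 𝕜 n) (k : ℕ) :
    ∑ y : Fin (k + 1) → Fin (n + 1), LinearMap.mulLeft 𝕜 (dtWord (𝕜 := 𝕜) y) * chain b k y =
      (dupontSystem 𝕜 n).nestN^[k] (∑ i, opN 𝕜 i * b i) := by
  induction k with
  | zero =>
    rw [sum_cons, Function.iterate_zero_apply]
    refine Finset.sum_congr rfl fun i _ => ?_
    rw [Fintype.sum_unique, dtWord_succ]
    simp [chain, dtWord, opN]
  | succ k ih =>
    rw [sum_cons, Function.iterate_succ_apply', ← ih, DupontSystem.nestN_apply]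
    refine Finset.sum_congr rfl fun i _ => ?_
    rw [Finset.sum_mul, Finset.mul_sum]
    refine Finset.sum_congr rfl fun y _ => ?_
    rw [dtWord_succ, chain, Fin.tail_cons, Fin.cons_zero, LinearMap.mulLeft_mul]
    rfl

/-- A sum over all tuples of vertices, evaluated one vertex at a time. -/
lemma sum_t_dtWord_chain (b : Fin (n + 1) → FormEnd 𝕜 n) (k : ℕ) :
    ∑ x : Fin (k + 2) → Fin (n + 1),
        LinearMap.mulLeft 𝕜 (t 𝕜 n (x 0) * dtWord (Fin.tail x)) ∘ₗ chain b (k + 1) x =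
      (dupontSystem 𝕜 n).nestT ((dupontSystem 𝕜 n).nestN^[k] (∑ i, opN 𝕜 i * b i)) := by
  rw [sum_cons, ← sum_dtWord_chain, DupontSystem.nestT_apply]
  refine Finset.sum_congr rfl fun i _ => ?_
  rw [Finset.sum_mul, Finset.mul_sum]
  refine Finset.sum_congr rfl fun y _ => ?_
  rw [chain, Fin.tail_cons, Fin.cons_zero, LinearMap.mulLeft_mul]
  rfl


lemma opH_mul_opH (i j : Fin (n + 1)) : opH 𝕜 i * opH 𝕜 j = -(opH 𝕜 j * opH 𝕜 i) :=
  LinearMap.ext fun w => opH_opH i j w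

lemma opEv_mul_opH_comm (i j : Fin (n + 1)) : opEv 𝕜 i * opH 𝕜 j = -(opEv 𝕜 j * opH 𝕜 i) :=
  LinearMap.ext fun w => opEv_opH_comm i j w

/-- Dupont's homotopy, as a sum of iterated applications of `A ↦ ∑ dt_i A h^i`. -/
lemma dupontH_eq : dupontH 𝕜 n = (dupontSystem 𝕜 n).h := by
  rw [dupontH, DupontSystem.h]
  refine Finset.sum_congr rfl fun k _ => ?_
  have h1 := sum_face_basicForm (k := k) (chain (opH 𝕜) k)
    (chain_alternates (n := n) (𝕜 := 𝕜) _ opH_mul_opH opH_mul_opH k)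
  have h2 : ∑ x : Fin (k + 1) → Fin (n + 1),
      LinearMap.mulLeft 𝕜 (t 𝕜 n (x 0) * dtWord (Fin.tail x)) ∘ₗ chain (opH 𝕜) k x =
      (dupontSystem 𝕜 n).nestT ((dupontSystem 𝕜 n).nestN^[k] 1) := by
    cases k with
    | zero =>
      rw [sum_t_chain, Function.iterate_zero_apply, DupontSystem.nestT_apply]
      refine Finset.sum_congr rfl fun i _ => ?_
      rw [one_mul]; rfl
    | succ k =>
      rw [sum_t_dtWord_chain, Function.iterate_succ_apply, DupontSystem.nestN_apply]
      simp only [one_mul]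
      rfl
  rw [← Finset.smul_sum, ← h2, ← h1]
  simp only [chain_opH]
  exact sgn_smul_eq (R := FormEnd 𝕜 n) k _

/-- The projection of Dupont's contraction, given the description of integration over faces by the
homotopies. -/
lemma dupontP_eq (hint : ∀ (k : ℕ) (θ : Face n k) (w : Form 𝕜 n),
    integral 𝕜 k (pullback 𝕜 θ.1 w) • (1 : Form 𝕜 n) = chain (opEv 𝕜) k θ.1 w) :
    (basicForms 𝕜 n).subtype ∘ₗ dupontP 𝕜 n = (dupontSystem 𝕜 n).proj := by
  have h1 : ∀ k, ∑ θ : Face n k, (basicForms 𝕜 n).subtype ∘ₗ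
      (integral 𝕜 k ∘ₗ (pullback 𝕜 θ.1).toLinearMap).smulRight
        (⟨basicForm 𝕜 θ.1, Submodule.subset_span ⟨k, θ, rfl⟩⟩ : basicForms 𝕜 n) =
      ∑ x : Fin (k + 1) → Fin (n + 1),
        LinearMap.mulLeft 𝕜 (t 𝕜 n (x 0) * dtWord (Fin.tail x)) ∘ₗ chain (opEv 𝕜) k x := by
    intro k
    rw [← sum_face_basicForm (k := k) (chain (opEv 𝕜) k)
      (chain_alternates (n := n) (𝕜 := 𝕜) _ opEv_mul_opH_comm opH_mul_opH k)]
    refine Finset.sum_congr rfl fun θ _ => LinearMap.ext fun w => ?_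
    rw [LinearMap.comp_apply, LinearMap.comp_apply, ← hint, LinearMap.mulLeft_apply,
      mul_smul_comm, mul_one]
    rfl
  rw [dupontP]
  have h2 : (basicForms 𝕜 n).subtype ∘ₗ ∑ k ∈ Finset.range (n + 1), ∑ θ : Face n k,
      (integral 𝕜 k ∘ₗ (pullback 𝕜 θ.1).toLinearMap).smulRight
        (⟨basicForm 𝕜 θ.1, Submodule.subset_span ⟨k, θ, rfl⟩⟩ : basicForms 𝕜 n) =
      ∑ k ∈ Finset.range (n + 1), ∑ θ : Face n k, (basicForms 𝕜 n).subtype ∘ₗ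
      (integral 𝕜 k ∘ₗ (pullback 𝕜 θ.1).toLinearMap).smulRight
        (⟨basicForm 𝕜 θ.1, Submodule.subset_span ⟨k, θ, rfl⟩⟩ : basicForms 𝕜 n) := by
    refine LinearMap.ext fun w => ?_
    simp [LinearMap.sum_apply]
  rw [h2, Finset.sum_congr rfl fun k _ => h1 k, Finset.sum_range_succ', sum_t_chain, add_comm,
    DupontSystem.proj]
  congr 1
  exact Finset.sum_congr rfl fun k _ => sum_t_dtWord_chain _ _

end Chain


/-! ### Pullback of forms along maps of simplices -/

section Pullback

variable {𝕜 : Type*} [Field 𝕜] {k n : ℕ}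

variable (𝕜) in
/-- Pullback of functions. -/
def pullFun (θ : Fin (k + 1) → Fin (n + 1)) : MvPolynomial (Fin n) 𝕜 →ₐ[𝕜] MvPolynomial (Fin k) 𝕜 :=
  MvPolynomial.aeval fun j : Fin n => ∑ b, if θ b = j.succ then tPoly 𝕜 k b else 0

variable (𝕜) in
/-- Pullback of the basic `1`-forms. -/
def pullVec (θ : Fin (k + 1) → Fin (n + 1)) (j : Fin n) : Fin k → 𝕜 :=
  ∑ b, if θ b = j.succ then dtVec 𝕜 k b else 0

variable (𝕜) in
/-- Pullback on the exterior algebra. -/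
def pullExt (θ : Fin (k + 1) → Fin (n + 1)) :
    ExteriorAlgebra 𝕜 (Fin n → 𝕜) →ₐ[𝕜] ExteriorAlgebra 𝕜 (Fin k → 𝕜) :=
  ExteriorAlgebra.map (Fintype.linearCombination 𝕜 (pullVec 𝕜 θ))

lemma pullback_tmul (θ : Fin (k + 1) → Fin (n + 1)) (f : MvPolynomial (Fin n) 𝕜)
    (w : ExteriorAlgebra 𝕜 (Fin n → 𝕜)) :
    pullback 𝕜 θ (f ⊗ₜ w) = pullFun 𝕜 θ f ⊗ₜ pullExt 𝕜 θ w := rfl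

lemma pullFun_X (θ : Fin (k + 1) → Fin (n + 1)) (j : Fin n) :
    pullFun 𝕜 θ (MvPolynomial.X j) = ∑ b, if θ b = j.succ then tPoly 𝕜 k b else 0 :=
  MvPolynomial.aeval_X _ _

lemma pullExt_ι (θ : Fin (k + 1) → Fin (n + 1)) (v : Fin n → 𝕜) :
    pullExt 𝕜 θ (ExteriorAlgebra.ι 𝕜 v) =
      ExteriorAlgebra.ι 𝕜 (Fintype.linearCombination 𝕜 (pullVec 𝕜 θ) v) :=
  ExteriorAlgebra.map_apply_ι _ _

lemma pullExt_extMul (θ : Fin (k + 1) → Fin (n + 1)) (j : Fin n)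
    (w : ExteriorAlgebra 𝕜 (Fin n → 𝕜)) : pullExt 𝕜 θ (extMul j w) =
      ∑ a, pullVec 𝕜 θ j a • extMul a (pullExt 𝕜 θ w) := by
  rw [extMul_apply, map_mul, pullExt_ι, Fintype.linearCombination_apply_single, one_smul,
    ι_eq_sum, Finset.sum_mul]
  exact Finset.sum_congr rfl fun a _ => smul_mul_assoc _ _ _

lemma extContract_pullExt (θ : Fin (k + 1) → Fin (n + 1)) (a : Fin k)
    (w : ExteriorAlgebra 𝕜 (Fin n → 𝕜)) : extContract a (pullExt 𝕜 θ w) =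
      ∑ j, pullVec 𝕜 θ j a • pullExt 𝕜 θ (extContract j w) := by
  induction w using ext_induction with
  | algebraMap c =>
    rw [AlgHom.commutes, extContract_algebraMap]
    simp [extContract_algebraMap]
  | add x y hx hy => simp only [map_add, hx, hy, smul_add, Finset.sum_add_distrib]
  | ι_mul v x hx =>
    rw [map_mul, pullExt_ι, extContract_ι_mul, hx]
    simp only [extContract_ι_mul, map_sub, map_smul, map_mul, pullExt_ι, smul_sub]
    rw [Finset.sum_sub_distrib, Finset.mul_sum]
    congr 1
    · rw [Fintype.linearCombination_apply, Finset.sum_apply, Finset.sum_smul]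
      exact Finset.sum_congr rfl fun j _ => by
        rw [Pi.smul_apply, smul_eq_mul, mul_comm, mul_smul]
    · exact Finset.sum_congr rfl fun j _ => mul_smul_comm _ _ _

lemma pderiv_pullFun (θ : Fin (k + 1) → Fin (n + 1)) (a : Fin k) (f : MvPolynomial (Fin n) 𝕜) :
    MvPolynomial.pderiv a (pullFun 𝕜 θ f) =
      ∑ j, pullVec 𝕜 θ j a • pullFun 𝕜 θ (MvPolynomial.pderiv j f) := by
  induction f using MvPolynomial.induction_on with
  | C c =>
    rw [← MvPolynomial.algebraMap_eq, AlgHom.commutes, Derivation.map_algebraMap]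
    simp
  | add f g hf hg => simp only [map_add, hf, hg, smul_add, Finset.sum_add_distrib]
  | mul_X f j hf =>
    have h1 : MvPolynomial.pderiv a (pullFun 𝕜 θ (MvPolynomial.X j)) =
        MvPolynomial.C (pullVec 𝕜 θ j a) := by
      rw [pullFun_X, map_sum, pullVec, Finset.sum_apply, map_sum]
      refine Finset.sum_congr rfl fun b _ => ?_
      split_ifs
      · exact pderiv_tPoly b a
      · simp
    have h2 : ∀ l, pullVec 𝕜 θ l a • pullFun 𝕜 θ (MvPolynomial.pderiv l (f * MvPolynomial.X j)) =
        (if l = j then pullVec 𝕜 θ l a • pullFun 𝕜 θ f else 0) +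
        pullFun 𝕜 θ (MvPolynomial.X j) *
          pullVec 𝕜 θ l a • pullFun 𝕜 θ (MvPolynomial.pderiv l f) := by
      intro l
      rw [Derivation.leibniz, map_add, smul_add, smul_eq_mul, smul_eq_mul, map_mul, map_mul,
        mul_smul_comm]
      congr 1
      split_ifs with h
      · subst h; rw [MvPolynomial.pderiv_X_self]; simp
      · rw [MvPolynomial.pderiv_X_of_ne (Ne.symm h)]; simp
    rw [map_mul, Derivation.leibniz, h1, hf, Finset.sum_congr rfl fun l _ => h2 l,
      Finset.sum_add_distrib, ← Finset.mul_sum, smul_eq_mul, smul_eq_mul,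
      mul_comm _ (MvPolynomial.C _),
      ← MvPolynomial.smul_eq_C_mul]
    simp

lemma pullback_opD (θ : Fin (k + 1) → Fin (n + 1)) (w : Form 𝕜 n) :
    pullback 𝕜 θ (opD 𝕜 n w) = opD 𝕜 k (pullback 𝕜 θ w) := by
  induction w using TensorProduct.induction_on with
  | zero => simp
  | add x y hx hy => simp only [map_add, hx, hy]
  | tmul f w =>
    rw [opD_tmul, map_sum, pullback_tmul, opD_tmul]
    simp only [pullback_tmul, pullExt_extMul, pderiv_pullFun, TensorProduct.tmul_sum,
      TensorProduct.sum_tmul]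
    rw [Finset.sum_comm]
    exact Finset.sum_congr rfl fun a _ => Finset.sum_congr rfl fun j _ => by
      rw [TensorProduct.smul_tmul]

lemma sum_sub_mul_pullVec (θ : Fin (k + 1) → Fin (n + 1)) (a : Fin (k + 1)) (j : Fin n) :
    ∑ b, (MvPolynomial.X b - MvPolynomial.C (vertex 𝕜 k a b)) *
        MvPolynomial.C (pullVec 𝕜 θ j b) =
      pullFun 𝕜 θ (MvPolynomial.X j - MvPolynomial.C (vertex 𝕜 n (θ a) j)) := by
  have h1 : ∀ b, MvPolynomial.C (σ := Fin k) (pullVec 𝕜 θ j b) =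
      ∑ c, if θ c = j.succ then MvPolynomial.C (dtVec 𝕜 k c b) else 0 := by
    intro b
    rw [pullVec, Finset.sum_apply, map_sum]
    refine Finset.sum_congr rfl fun c _ => ?_
    split_ifs <;> simp
  simp only [h1, Finset.mul_sum]
  have h0 : pullFun 𝕜 θ (MvPolynomial.C (vertex 𝕜 n (θ a) j)) =
      MvPolynomial.C (vertex 𝕜 n (θ a) j) := AlgHom.commutes (pullFun 𝕜 θ) _
  rw [Finset.sum_comm, map_sub, pullFun_X, h0]
  have h2 : MvPolynomial.C (σ := Fin k) (vertex 𝕜 n (θ a) j) =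
      ∑ c, if θ c = j.succ then (if c = a then 1 else 0) else 0 := by
    rw [Finset.sum_eq_single a]
    · simp [vertex, apply_ite]
    · intro c _ hc; simp [hc]
    · simp
  rw [h2, ← Finset.sum_sub_distrib]
  refine Finset.sum_congr rfl fun c _ => ?_
  by_cases h : θ c = j.succ
  · simp only [if_pos h]
    rw [sum_sub_mul_dtVec]
  · simp [if_neg h]

lemma pullback_opC (θ : Fin (k + 1) → Fin (n + 1)) (a : Fin (k + 1)) (w : Form 𝕜 n) :
    pullback 𝕜 θ (opC 𝕜 (θ a) w) = opC 𝕜 a (pullback 𝕜 θ w) := by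
  induction w using TensorProduct.induction_on with
  | zero => simp
  | add x y hx hy => simp only [map_add, hx, hy]
  | tmul f w =>
    rw [opC_tmul, map_sum, pullback_tmul, opC_tmul]
    simp only [pullback_tmul, extContract_pullExt, map_mul, ← sum_sub_mul_pullVec,
      TensorProduct.tmul_sum, Finset.sum_mul, TensorProduct.sum_tmul]
    rw [Finset.sum_comm]
    exact Finset.sum_congr rfl fun b _ => Finset.sum_congr rfl fun j _ => by
      rw [TensorProduct.tmul_smul, TensorProduct.smul_tmul', mul_assoc,
        ← MvPolynomial.smul_eq_C_mul, mul_smul_comm]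

lemma evalAt_pullback (θ : Fin (k + 1) → Fin (n + 1)) (a : Fin (k + 1)) (w : Form 𝕜 n) :
    evalAt 𝕜 (vertex 𝕜 k a) (pullback 𝕜 θ w) = evalAt 𝕜 (vertex 𝕜 n (θ a)) w := by
  have h1 : ∀ f, MvPolynomial.aeval (vertex 𝕜 k a) (pullFun 𝕜 θ f) =
      MvPolynomial.aeval (vertex 𝕜 n (θ a)) f := by
    intro f
    refine AlgHom.congr_fun (φ₁ := (MvPolynomial.aeval (vertex 𝕜 k a)).comp (pullFun 𝕜 θ)) ?_ f
    refine MvPolynomial.algHom_ext fun j => ?_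
    rw [AlgHom.comp_apply, pullFun_X, map_sum, MvPolynomial.aeval_X, Finset.sum_eq_single a]
    · split_ifs with h
      · rw [aeval_tPoly]; simp [vertex, h]
      · simp [vertex, h]
    · intro b _ hb
      split_ifs
      · rw [aeval_tPoly, if_neg hb]
      · simp
    · simp
  have h2 : ∀ w, ExteriorAlgebra.algebraMapInv (pullExt 𝕜 θ w) =
      ExteriorAlgebra.algebraMapInv (R := 𝕜) w := by
    intro w
    refine AlgHom.congr_fun (φ₁ := ExteriorAlgebra.algebraMapInv.comp (pullExt 𝕜 θ)) ?_ w
    refine ExteriorAlgebra.hom_ext (LinearMap.ext fun v => ?_)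
    change ExteriorAlgebra.algebraMapInv (pullExt 𝕜 θ (ExteriorAlgebra.ι 𝕜 v)) =
      ExteriorAlgebra.algebraMapInv (ExteriorAlgebra.ι 𝕜 v)
    rw [pullExt_ι]; simp [ExteriorAlgebra.algebraMapInv]
  induction w using TensorProduct.induction_on with
  | zero => simp
  | add x y hx hy => simp only [map_add, hx, hy]
  | tmul f w => rw [pullback_tmul, evalAt_tmul, evalAt_tmul, h1, h2]

lemma pullFun_tPoly (θ : Fin (k + 1) → Fin (n + 1)) (i : Fin (n + 1)) :
    pullFun 𝕜 θ (tPoly 𝕜 n i) = ∑ b, if θ b = i then tPoly 𝕜 k b else 0 := by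
  refine Fin.cases ?_ (fun i => ?_) i
  · rw [tPoly, Fin.cases_zero, map_sub, map_one, map_sum]
    simp only [pullFun_X]
    rw [Finset.sum_comm, sub_eq_iff_eq_add, ← sum_tPoly (n := k), ← Finset.sum_add_distrib]
    refine Finset.sum_congr rfl fun b _ => ?_
    rcases Fin.eq_zero_or_eq_succ (θ b) with h | ⟨c, h⟩
    · simp [h, (Fin.succ_ne_zero _).symm]
    · simp [h, Fin.succ_inj]
  · rw [tPoly, Fin.cases_succ, pullFun_X]

lemma pullVec_eq (θ : Fin (k + 1) → Fin (n + 1)) (i : Fin (n + 1)) :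
    Fintype.linearCombination 𝕜 (pullVec 𝕜 θ) (dtVec 𝕜 n i) =
      ∑ b, if θ b = i then dtVec 𝕜 k b else 0 := by
  refine Fin.cases ?_ (fun i => ?_) i
  · rw [dtVec, Fin.cases_zero, map_neg, map_sum]
    simp only [Fintype.linearCombination_apply_single, one_smul, pullVec]
    rw [Finset.sum_comm, eq_comm, eq_neg_iff_add_eq_zero]
    refine Eq.trans ?_ (sum_dtVec (𝕜 := 𝕜) (n := k))
    rw [← Finset.sum_add_distrib]
    refine Finset.sum_congr rfl fun b _ => ?_
    rcases Fin.eq_zero_or_eq_succ (θ b) with h | ⟨c, h⟩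
    · simp [h, (Fin.succ_ne_zero _).symm]
    · simp [h, Fin.succ_inj]
  · rw [dtVec, Fin.cases_succ, Fintype.linearCombination_apply_single, one_smul, pullVec]

lemma pullback_pullback {m : ℕ} (η : Fin (m + 1) → Fin (k + 1)) (θ : Fin (k + 1) → Fin (n + 1))
    (w : Form 𝕜 n) : pullback 𝕜 η (pullback 𝕜 θ w) = pullback 𝕜 (θ ∘ η) w := by
  have h1 : (pullFun 𝕜 η).comp (pullFun 𝕜 θ) = pullFun 𝕜 (θ ∘ η) := by
    refine MvPolynomial.algHom_ext fun j => ?_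
    rw [AlgHom.comp_apply, pullFun_X, pullFun_X, map_sum]
    have h : ∀ b, pullFun 𝕜 η (if θ b = j.succ then tPoly 𝕜 k b else 0) =
        ∑ c, if η c = b then (if θ b = j.succ then tPoly 𝕜 m c else 0) else 0 := by
      intro b
      split_ifs
      · exact pullFun_tPoly η b
      · simp
    rw [Finset.sum_congr rfl fun b _ => h b, Finset.sum_comm]
    simp
  have h2 : (pullExt 𝕜 η).comp (pullExt 𝕜 θ) = pullExt 𝕜 (θ ∘ η) := by
    refine ExteriorAlgebra.hom_ext ((Pi.basisFun 𝕜 (Fin n)).ext fun j => ?_)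
    change pullExt 𝕜 η (pullExt 𝕜 θ (ExteriorAlgebra.ι 𝕜 _)) =
      pullExt 𝕜 _ (ExteriorAlgebra.ι 𝕜 _)
    rw [pullExt_ι, pullExt_ι, pullExt_ι, Pi.basisFun_apply]
    congr 1
    rw [Fintype.linearCombination_apply_single, Fintype.linearCombination_apply_single, one_smul,
      one_smul, pullVec, pullVec, map_sum]
    have h : ∀ b, Fintype.linearCombination 𝕜 (pullVec 𝕜 η)
        (if θ b = j.succ then dtVec 𝕜 k b else 0) =
        ∑ c, if η c = b then (if θ b = j.succ then dtVec 𝕜 m c else 0) else 0 := by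
      intro b
      split_ifs
      · exact pullVec_eq η b
      · simp
    rw [Finset.sum_congr rfl fun b _ => h b, Finset.sum_comm]
    simp
  induction w using TensorProduct.induction_on with
  | zero => simp
  | add x y hx hy => simp only [map_add, hx, hy]
  | tmul f w =>
    rw [pullback_tmul, pullback_tmul, pullback_tmul, ← h1, ← h2]; rfl

variable [CharZero 𝕜]

lemma pullback_opH (θ : Fin (k + 1) → Fin (n + 1)) (a : Fin (k + 1)) (w : Form 𝕜 n) :
    pullback 𝕜 θ (opH 𝕜 (θ a) w) = opH 𝕜 a (pullback 𝕜 θ w) := by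
  have h : ∀ w, pullback 𝕜 θ (opL 𝕜 (θ a) w) = opL 𝕜 a (pullback 𝕜 θ w) := by
    intro w
    change pullback 𝕜 θ (opD 𝕜 n (opC 𝕜 _ w) + opC 𝕜 _ (opD 𝕜 n w)) =
      opD 𝕜 k (opC 𝕜 _ _) + opC 𝕜 _ (opD 𝕜 k _)
    rw [map_add, pullback_opD, pullback_opC, pullback_opC, pullback_opD]
  rw [← sub_eq_zero]
  refine eq_zero_of_opL a ?_ ?_
  · rw [map_sub, ← h, opL_opH, opL_opH, pullback_opC, sub_self]
  · rw [map_sub, evalAt_pullback, evalAt_opH, evalAt_opH, sub_self]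

end Pullback


/-! ### Integration over simplices -/

section Integral

variable {𝕜 : Type*} [Field 𝕜] {k n : ℕ}

variable (𝕜) in
/-- Integration of functions over the `k`-simplex. -/
def intFun (k : ℕ) : MvPolynomial (Fin k) 𝕜 →ₗ[𝕜] 𝕜 :=
  (MvPolynomial.basisMonomials (Fin k) 𝕜).constr 𝕜
    fun a => ((∏ j, (a j)! : ℕ) : 𝕜) / (((∑ j, a j) + k)! : 𝕜)

variable (𝕜) in
/-- The coefficient of `dt_1 ⋯ dt_k`. -/
def topCoeff (k : ℕ) : ExteriorAlgebra 𝕜 (Fin k → 𝕜) →ₗ[𝕜] 𝕜 :=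
  ExteriorAlgebra.liftAlternating (Pi.single k Matrix.detRowAlternating)

lemma integral_tmul (f : MvPolynomial (Fin k) 𝕜) (w : ExteriorAlgebra 𝕜 (Fin k → 𝕜)) :
    integral 𝕜 k (f ⊗ₜ w) = intFun 𝕜 k f * topCoeff 𝕜 k w := rfl

lemma intFun_monomial (a : Fin k →₀ ℕ) : intFun 𝕜 k (MvPolynomial.monomial a 1) =
    ((∏ j, (a j)! : ℕ) : 𝕜) / (((∑ j, a j) + k)! : 𝕜) := by
  rw [intFun, ← congrFun (MvPolynomial.coe_basisMonomials (Fin k) 𝕜) a, Module.Basis.constr_basis]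

lemma topCoeff_ιMulti (m : ℕ) (v : Fin m → Fin k → 𝕜) (h : m ≠ k) :
    topCoeff 𝕜 k (ExteriorAlgebra.ιMulti 𝕜 m v) = 0 := by
  rw [topCoeff, ExteriorAlgebra.liftAlternating_apply_ιMulti, Pi.single_eq_of_ne h]; rfl

lemma topCoeff_ιMulti_self (v : Fin k → Fin k → 𝕜) :
    topCoeff 𝕜 k (ExteriorAlgebra.ιMulti 𝕜 k v) = Matrix.det v := by
  rw [topCoeff, ExteriorAlgebra.liftAlternating_apply_ιMulti, Pi.single_eq_same]; rfl

lemma extProj_ιMulti (e m : ℕ) (v : Fin m → Fin k → 𝕜) :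
    extProj 𝕜 k e (ExteriorAlgebra.ιMulti 𝕜 m v) =
      if m = e then ExteriorAlgebra.ιMulti 𝕜 m v else 0 := by
  have h : ExteriorAlgebra.ιMulti 𝕜 m v ∈ ⋀[𝕜]^m (Fin k → 𝕜) :=
    ExteriorAlgebra.ιMulti_range 𝕜 m ⟨v, rfl⟩
  split_ifs with he
  · subst he; exact extProj_of_mem h
  · exact extProj_of_mem_ne h he

lemma topCoeff_extProj (e : ℕ) (w : ExteriorAlgebra 𝕜 (Fin k → 𝕜)) :
    topCoeff 𝕜 k (extProj 𝕜 k e w) = if e = k then topCoeff 𝕜 k w else 0 := by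
  have h : topCoeff 𝕜 k ∘ₗ extProj 𝕜 k e = if e = k then topCoeff 𝕜 k else 0 := by
    refine ExteriorAlgebra.lhom_ext fun m => AlternatingMap.ext fun v => ?_
    rw [LinearMap.compAlternatingMap_apply, LinearMap.compAlternatingMap_apply,
      LinearMap.comp_apply, extProj_ιMulti]
    by_cases hm : m = e
    · subst hm
      rw [if_pos rfl]
      split_ifs with h
      · rfl
      · rw [topCoeff_ιMulti m v h]; rfl
    · rw [if_neg hm, map_zero]
      split_ifs with h
      · rw [topCoeff_ιMulti m v (by omega)]
      · rfl
  rw [← LinearMap.comp_apply, h]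
  split_ifs <;> rfl

lemma extProj_pullExt (θ : Fin (k + 1) → Fin (n + 1)) (e : ℕ)
    (w : ExteriorAlgebra 𝕜 (Fin n → 𝕜)) :
    extProj 𝕜 k e (pullExt 𝕜 θ w) = pullExt 𝕜 θ (extProj 𝕜 n e w) := by
  have h : extProj 𝕜 k e ∘ₗ (pullExt 𝕜 θ).toLinearMap =
      (pullExt 𝕜 θ).toLinearMap ∘ₗ extProj 𝕜 n e := by
    refine ExteriorAlgebra.lhom_ext fun m => AlternatingMap.ext fun v => ?_
    change extProj 𝕜 k e (pullExt 𝕜 θ (ExteriorAlgebra.ιMulti 𝕜 m v)) =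
      pullExt 𝕜 θ (extProj 𝕜 n e (ExteriorAlgebra.ιMulti 𝕜 m v))
    rw [pullExt, ExteriorAlgebra.map_apply_ιMulti, extProj_ιMulti, extProj_ιMulti]
    split_ifs
    · rw [ExteriorAlgebra.map_apply_ιMulti]
    · rw [map_zero]
  exact LinearMap.congr_fun h w

lemma opProj_pullback (θ : Fin (k + 1) → Fin (n + 1)) (e : ℕ) (w : Form 𝕜 n) :
    opProj 𝕜 k e (pullback 𝕜 θ w) = pullback 𝕜 θ (opProj 𝕜 n e w) := by
  induction w using TensorProduct.induction_on with
  | zero => simp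
  | add x y hx hy => simp only [map_add, hx, hy]
  | tmul f w => rw [pullback_tmul, opProj_tmul, opProj_tmul, pullback_tmul, extProj_pullExt]

lemma integral_opProj (e : ℕ) (w : Form 𝕜 k) :
    integral 𝕜 k (opProj 𝕜 k e w) = if e = k then integral 𝕜 k w else 0 := by
  induction w using TensorProduct.induction_on with
  | zero => simp
  | add x y hx hy => rw [map_add, map_add, hx, hy, map_add]; split_ifs <;> simp
  | tmul f w =>
    rw [opProj_tmul, integral_tmul, integral_tmul, topCoeff_extProj]
    split_ifs <;> simp

/-- The opposite face of the vertex `0` of the `k+1`-simplex. -/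
abbrev oppFace (k : ℕ) : Fin (k + 1) → Fin (k + 1 + 1) := Fin.succ

lemma pullFun_oppFace (j : Fin (k + 1)) :
    pullFun 𝕜 (oppFace k) (MvPolynomial.X j) = tPoly 𝕜 k j := by
  rw [pullFun_X]; simp [Fin.succ_inj]

lemma pullVec_oppFace (j : Fin (k + 1)) : pullVec 𝕜 (oppFace k) j = dtVec 𝕜 k j := by
  rw [pullVec]; simp [Fin.succ_inj]

/-- The contraction of a top form, restricted to the face opposite to the vertex `0`. -/
lemma topCoeff_pullExt_extContract (j : Fin (k + 1))
    (w : ExteriorAlgebra 𝕜 (Fin (k + 1) → 𝕜)) :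
    topCoeff 𝕜 k (pullExt 𝕜 (oppFace k) (extContract j w)) = topCoeff 𝕜 (k + 1) w := by
  set A : ExteriorAlgebra 𝕜 (Fin (k + 1) → 𝕜) →ₗ[𝕜] 𝕜 :=
    topCoeff 𝕜 k ∘ₗ (pullExt 𝕜 (oppFace k)).toLinearMap ∘ₗ extContract j with hA
  have hA' : ∀ w, A w = topCoeff 𝕜 k (pullExt 𝕜 (oppFace k) (extContract j w)) := fun _ => rfl
  have h0 : ∀ m, m ≠ k + 1 → ∀ v : Fin m → Fin (k + 1) → 𝕜,
      A (ExteriorAlgebra.ιMulti 𝕜 m v) = 0 := by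
    intro m hm v
    cases m with
    | zero =>
      have h : ExteriorAlgebra.ιMulti 𝕜 0 v = algebraMap 𝕜 _ 1 := by
        rw [ExteriorAlgebra.ιMulti_zero_apply, map_one]
      rw [hA', h, extContract_algebraMap, map_zero, map_zero]
    | succ m =>
      have h := extProj_ιMulti (𝕜 := 𝕜) (m + 1) (m + 1) v
      rw [if_pos rfl] at h
      rw [hA', ← h, ← extProj_extContract, ← extProj_pullExt, topCoeff_extProj,
        if_neg (by omega)]
  suffices h : A = topCoeff 𝕜 (k + 1) by rw [← hA', h]
  refine ExteriorAlgebra.lhom_ext fun m => ?_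
  by_cases hm : m = k + 1
  swap
  · refine AlternatingMap.ext fun v => ?_
    rw [LinearMap.compAlternatingMap_apply, LinearMap.compAlternatingMap_apply, h0 m hm,
      topCoeff_ιMulti m v hm]
  subst hm
  -- the vector `(1, …, 1)` restricts to `0` on the face, and completes `dt_2, …, dt_{k+1}` to a
  -- unimodular basis
  set u : Fin (k + 1) → 𝕜 := fun _ => 1 with hu
  set v : Fin (k + 1) → Fin (k + 1) → 𝕜 := Fin.cons u fun i => Pi.single i.succ 1 with hv
  have hdet : Matrix.det v = 1 := by
    have h1 : Matrix.BlockTriangular (Matrix.of v) id := by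
      intro a b hab
      have hab : b < a := hab
      obtain ⟨a, rfl⟩ := Fin.exists_succ_eq.2 (Fin.ne_zero_of_lt hab)
      simp [hv, hab.ne]
    have h2 := Matrix.det_of_isUpperTriangular h1
    rw [show Matrix.det v = Matrix.det (Matrix.of v) from rfl, h2]
    refine Finset.prod_eq_one fun a _ => ?_
    refine Fin.cases ?_ (fun a => ?_) a
    · simp [hv, hu]
    · simp [hv]
  have hAv : A (ExteriorAlgebra.ιMulti 𝕜 (k + 1) v) = 1 := by
    have hσ : Fintype.linearCombination 𝕜 (pullVec 𝕜 (oppFace k)) u = 0 := by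
      rw [Fintype.linearCombination_apply, ← sum_dtVec (𝕜 := 𝕜) (n := k)]
      exact Finset.sum_congr rfl fun j _ => by rw [pullVec_oppFace, hu, one_smul]
    have hd : ((Fintype.linearCombination 𝕜 (pullVec 𝕜 (oppFace k))) ∘ Matrix.vecTail v) =
        (1 : Matrix (Fin k) (Fin k) 𝕜) := by
      funext i
      have h1 : Matrix.vecTail v i = Pi.single i.succ 1 := rfl
      rw [Function.comp_apply, h1, Fintype.linearCombination_apply_single, one_smul,
        pullVec_oppFace, dtVec, Fin.cases_succ]
      funext l
      rw [Matrix.one_apply, Pi.single_apply]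
      simp [eq_comm]
    have hv0 : v 0 = u := rfl
    rw [hA', ExteriorAlgebra.ιMulti_succ_apply, extContract_ι_mul, map_sub, map_mul, pullExt_ι,
      hv0, hσ, map_zero, zero_mul, sub_zero, map_smul, pullExt, ExteriorAlgebra.map_apply_ιMulti,
      map_smul, topCoeff_ιMulti_self]
    refine (congrArg (fun c => u j • Matrix.det c) hd).trans ?_
    simp [hu]
  have h1 := (A.compAlternatingMap (ExteriorAlgebra.ιMulti 𝕜 (k + 1))).eq_smul_basis_det
    (Pi.basisFun 𝕜 (Fin (k + 1)))
  rw [Pi.basisFun_det] at h1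
  have h2 := congrArg (fun f => f v) h1
  simp only [LinearMap.compAlternatingMap_apply, AlternatingMap.smul_apply, hAv] at h2
  rw [show Matrix.detRowAlternating v = Matrix.det v from rfl, hdet, smul_eq_mul, mul_one] at h2
  rw [h1]
  refine AlternatingMap.ext fun v' => ?_
  rw [AlternatingMap.smul_apply, LinearMap.compAlternatingMap_apply,
    LinearMap.compAlternatingMap_apply, ← h2, one_smul, topCoeff_ιMulti_self]
  rfl

variable [CharZero 𝕜]

/-- Dirichlet's formula for the integral of a product of powers of all the barycentric
coordinates. -/
lemma intFun_tPoly_zero_pow (p : ℕ) (b : Fin k →₀ ℕ) :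
    intFun 𝕜 k (tPoly 𝕜 k 0 ^ p * MvPolynomial.monomial b 1) =
      ((p ! * ∏ j, (b j)! : ℕ) : 𝕜) / ((p + (∑ j, b j) + k)! : 𝕜) := by
  induction p generalizing b with
  | zero => rw [pow_zero, one_mul, intFun_monomial]; simp
  | succ p ih =>
    have h0 : tPoly 𝕜 k 0 ^ (p + 1) * MvPolynomial.monomial b 1 =
        tPoly 𝕜 k 0 ^ p * MvPolynomial.monomial b 1 -
          ∑ j, tPoly 𝕜 k 0 ^ p * MvPolynomial.monomial (b + Finsupp.single j 1) 1 := by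
      have h1 : ∀ j, MvPolynomial.monomial (b + Finsupp.single j 1) (1 : 𝕜) =
          MvPolynomial.monomial b 1 * MvPolynomial.X j := by
        intro j
        rw [MvPolynomial.X, MvPolynomial.monomial_mul, mul_one]
      rw [← Finset.mul_sum, Finset.sum_congr rfl fun j _ => h1 j, ← Finset.mul_sum, pow_succ]
      nth_rewrite 2 [tPoly]
      rw [Fin.cases_zero]
      ring
    have h2 : ∀ j, (∑ i, (b + Finsupp.single j 1 : Fin k →₀ ℕ) i) = (∑ i, b i) + 1 := by
      intro j
      simp [Finset.sum_add_distrib, Finsupp.single_apply]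
    have h3 : ∀ j, ∏ i, ((b + Finsupp.single j 1 : Fin k →₀ ℕ) i)! = (b j + 1) * ∏ i, (b i)! := by
      intro j
      rw [← Finset.mul_prod_erase _ _ (Finset.mem_univ j),
        ← Finset.mul_prod_erase Finset.univ (fun i => (b i)!) (Finset.mem_univ j), ← mul_assoc]
      congr 1
      · simp [Nat.factorial_succ]
      · refine Finset.prod_congr rfl fun i hi => ?_
        rw [Finsupp.add_apply, Finsupp.single_eq_of_ne (Finset.ne_of_mem_erase hi), add_zero]
    rw [h0, map_sub, map_sum, ih, Finset.sum_congr rfl fun j _ => ih _]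
    simp only [h2, h3]
    have h4 : (p + ((∑ i, b i) + 1) + k) = (p + (∑ i, b i) + k) + 1 := by ring
    have h5 : (p + 1 + (∑ i, b i) + k) = (p + (∑ i, b i) + k) + 1 := by ring
    rw [h4, h5, ← Finset.sum_div]
    set N := p + (∑ i, b i) + k with hN
    have h6 : (∑ j, ((p ! * ((b j + 1) * ∏ i, (b i)!) : ℕ) : 𝕜)) =
        ((p ! * ∏ i, (b i)! : ℕ) : 𝕜) * (((∑ i, b i) + k : ℕ) : 𝕜) := by
      have : ∀ j, ((p ! * ((b j + 1) * ∏ i, (b i)!) : ℕ) : 𝕜) =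
          ((p ! * ∏ i, (b i)! : ℕ) : 𝕜) * ((b j + 1 : ℕ) : 𝕜) := by
        intro j; push_cast; ring
      rw [Finset.sum_congr rfl fun j _ => this j, ← Finset.mul_sum, ← Nat.cast_sum,
        Finset.sum_add_distrib]
      simp
    have h7 : ((N + 1 : ℕ) : 𝕜) ≠ 0 := Nat.cast_ne_zero.2 (Nat.succ_ne_zero _)
    have h8 : (N ! : 𝕜) ≠ 0 := Nat.cast_ne_zero.2 (Nat.factorial_ne_zero _)
    have h9 : ((N + 1 : ℕ) : 𝕜) = p + 1 + (((∑ i, b i) + k : ℕ) : 𝕜) := by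
      rw [hN]; push_cast; ring
    rw [h6, Nat.factorial_succ N, Nat.factorial_succ p, Nat.cast_mul (N + 1), div_sub_div _ _ h8
      (mul_ne_zero h7 h8), div_eq_div_iff (mul_ne_zero h8 (mul_ne_zero h7 h8)) (mul_ne_zero h7 h8),
      h9]
    push_cast
    ring

omit [CharZero 𝕜] in
lemma radialIntegral_zero_monomial (e : ℕ) (a : Fin n →₀ ℕ) :
    radialIntegral 𝕜 n 0 e (MvPolynomial.monomial a 1) =
      (((∑ j, a j) + e : ℕ) : 𝕜)⁻¹ • MvPolynomial.monomial a 1 := by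
  have h : dilate 𝕜 n 0 (MvPolynomial.monomial a 1) =
      Polynomial.monomial (∑ j, a j) (MvPolynomial.monomial a 1) := by
    rw [dilate, MvPolynomial.aeval_monomial, map_one, one_mul, Finsupp.prod_fintype _ _ (by simp)]
    have h1 : ∀ j : Fin n, vertex 𝕜 n 0 j = 0 := fun j => by
      simp [vertex, (Fin.succ_ne_zero _).symm]
    simp only [h1, map_zero, mul_zero, add_zero, mul_pow]
    rw [Finset.prod_mul_distrib, Finset.prod_pow_eq_pow_sum, ← Polynomial.C_mul_X_pow_eq_monomial,
      mul_comm]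
    congr 1
    rw [MvPolynomial.monomial_eq, map_one, one_mul, Finsupp.prod_fintype _ _ (by simp), map_prod]
    exact Finset.prod_congr rfl fun j _ => by rw [map_pow]
  rw [radialIntegral_apply, h, Polynomial.sum_monomial_index
    (f := fun c g => ((c + e : ℕ) : 𝕜)⁻¹ • g) _ (smul_zero _)]

lemma intFun_pullFun_radialIntegral (f : MvPolynomial (Fin (k + 1)) 𝕜) :
    intFun 𝕜 k (pullFun 𝕜 (oppFace k) (radialIntegral 𝕜 (k + 1) 0 (k + 1) f)) =
      intFun 𝕜 (k + 1) f := by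
  refine LinearMap.congr_fun (f := intFun 𝕜 k ∘ₗ (pullFun 𝕜 (oppFace k)).toLinearMap ∘ₗ
    radialIntegral 𝕜 (k + 1) 0 (k + 1)) ?_ f
  refine (MvPolynomial.basisMonomials (Fin (k + 1)) 𝕜).ext fun a => ?_
  rw [MvPolynomial.coe_basisMonomials]
  change intFun 𝕜 k (pullFun 𝕜 (oppFace k) (radialIntegral 𝕜 (k + 1) 0 (k + 1) _)) = _
  have h1 : pullFun 𝕜 (oppFace k) (MvPolynomial.monomial a 1) = tPoly 𝕜 k 0 ^ a 0 *
      MvPolynomial.monomial a.tail 1 := by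
    rw [MvPolynomial.monomial_eq, map_one, one_mul, Finsupp.prod_fintype _ _ (by simp), map_prod,
      Fin.prod_univ_succ, map_pow, pullFun_oppFace, MvPolynomial.monomial_eq, map_one, one_mul,
      Finsupp.prod_fintype _ _ (by simp)]
    congr 1
    refine Finset.prod_congr rfl fun j _ => ?_
    rw [map_pow, pullFun_oppFace, Finsupp.tail_apply]
    rfl
  rw [radialIntegral_zero_monomial, map_smul, map_smul, h1, intFun_tPoly_zero_pow, intFun_monomial,
    Fin.prod_univ_succ, Fin.sum_univ_succ]
  simp only [Finsupp.tail_apply]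
  rw [← add_assoc _ k 1, Nat.factorial_succ, smul_eq_mul, Nat.cast_mul (_ + 1), inv_mul_eq_div,
    div_div, mul_comm (_ ! : 𝕜)]

/-- Integration over a simplex is integration over the face opposite to the vertex `0` after
integration along the rays from that vertex. -/
lemma integral_oppFace_opH (w : Form 𝕜 (k + 1)) :
    integral 𝕜 k (pullback 𝕜 (oppFace k) (opH 𝕜 0 w)) = integral 𝕜 (k + 1) w := by
  induction w using TensorProduct.induction_on with
  | zero => simp
  | add x y hx hy => simp only [map_add, hx, hy]
  | tmul f w =>
    have h1 : ∀ e, integral 𝕜 k (pullback 𝕜 (oppFace k) (opC 𝕜 0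
        (radialIntegral 𝕜 (k + 1) 0 e f ⊗ₜ extProj 𝕜 (k + 1) e w))) =
        if e = k + 1 then intFun 𝕜 (k + 1) f * topCoeff 𝕜 (k + 1) w else 0 := by
      intro e
      rw [opC_tmul, map_sum, map_sum]
      simp only [pullback_tmul, integral_tmul, topCoeff_pullExt_extContract, topCoeff_extProj]
      rw [← Finset.sum_mul]
      split_ifs with he
      · subst he
        congr 1
        rw [← map_sum, ← map_sum, ← Finset.sum_mul, map_mul, ← intFun_pullFun_radialIntegral]
        congr 1
        have h2 : pullFun 𝕜 (oppFace k) (∑ j : Fin (k + 1), (MvPolynomial.X j -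
            MvPolynomial.C (vertex 𝕜 (k + 1) 0 j))) = 1 := by
          rw [map_sum, ← sum_tPoly]
          refine Finset.sum_congr rfl fun j _ => ?_
          have h3 : vertex 𝕜 (k + 1) 0 j = 0 := by simp [vertex, (Fin.succ_ne_zero _).symm]
          rw [h3, map_zero, sub_zero, pullFun_oppFace]
        rw [h2, one_mul]
      · rw [mul_zero]
    rw [opH_eq, Module.End.mul_apply, radialInv_tmul, map_sum, map_sum, map_sum,
      Finset.sum_congr rfl fun e _ => h1 e, Finset.sum_ite_eq', integral_tmul, if_pos]
    simp

lemma integral_zero_eq (u : Form 𝕜 0) : integral 𝕜 0 u = evalAt 𝕜 (vertex 𝕜 0 0) u := by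
  have h1 : intFun 𝕜 0 = (MvPolynomial.aeval (vertex 𝕜 0 0)).toLinearMap := by
    refine (MvPolynomial.basisMonomials (Fin 0) 𝕜).ext fun a => ?_
    rw [MvPolynomial.coe_basisMonomials, intFun_monomial, Subsingleton.elim a 0]
    simp
  have h2 : ∀ w, topCoeff 𝕜 0 w = ExteriorAlgebra.algebraMapInv w := by
    intro w
    induction w using ext_induction with
    | algebraMap c =>
      rw [ExteriorAlgebra.algebraMap_leftInverse, Algebra.algebraMap_eq_smul_one, map_smul,
        ← ExteriorAlgebra.ιMulti_zero_apply (R := 𝕜) (0 : Fin 0 → Fin 0 → 𝕜),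
        topCoeff_ιMulti_self]
      exact (congrArg (fun z => c • z) Matrix.det_isEmpty).trans (mul_one c)
    | add x y hx hy => rw [map_add, map_add, hx, hy]
    | ι_mul v x _ => rw [Subsingleton.elim v 0, map_zero, zero_mul, map_zero, map_zero]
  induction u using TensorProduct.induction_on with
  | zero => simp
  | add x y hx hy => rw [map_add, map_add, hx, hy]
  | tmul f w => rw [integral_tmul, evalAt_tmul, h1, h2]; rfl

/-- Integration over a face is an iterated integration along rays from its vertices. -/
lemma integral_pullback_smul_one (x : Fin (k + 1) → Fin (n + 1)) (w : Form 𝕜 n) :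
    integral 𝕜 k (pullback 𝕜 x w) • (1 : Form 𝕜 n) = chain (opEv 𝕜) k x w := by
  induction k generalizing w with
  | zero =>
    rw [integral_zero_eq, evalAt_pullback]; rfl
  | succ k ih =>
    rw [chain, Module.End.mul_apply, ← ih]
    congr 1
    have h : Fin.tail x = x ∘ oppFace k := rfl
    rw [h, ← pullback_pullback, pullback_opH, integral_oppFace_opH]

/-- The composite of Dupont's projection and the inclusion of the basic forms. -/
lemma subtype_comp_dupontP :
    (basicForms 𝕜 n).subtype ∘ₗ dupontP 𝕜 n = (dupontSystem 𝕜 n).proj :=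
  dupontP_eq fun _ θ w => integral_pullback_smul_one θ.1 w

end Integral


/-! ### Graded commutativity of the algebra of forms -/

section Graded

variable {𝕜 : Type*} [Field 𝕜] {n : ℕ}

lemma ι_mul_extProj (v : Fin n → 𝕜) (e : ℕ) (x : ExteriorAlgebra 𝕜 (Fin n → 𝕜)) :
    ExteriorAlgebra.ι 𝕜 v * extProj 𝕜 n e x =
      sgn e • (extProj 𝕜 n e x * ExteriorAlgebra.ι 𝕜 v) := by
  induction x using ext_induction generalizing e with
  | algebraMap c =>
    rw [extProj_algebraMap]
    split_ifs with h
    · subst h; simp [Algebra.commutes]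
    · simp
  | add x y hx hy => rw [map_add, mul_add, hx, hy, add_mul, smul_add]
  | ι_mul u x hx =>
    cases e with
    | zero => simp [extProj_zero_ι_mul]
    | succ e =>
      rw [extProj_succ_ι_mul, ι_mul_ι_mul, hx, Nat.cast_succ, sgn_add_one, neg_smul, mul_smul_comm,
        mul_assoc]

lemma extProj_mul_extProj_comm (e e' : ℕ) (x y : ExteriorAlgebra 𝕜 (Fin n → 𝕜)) :
    extProj 𝕜 n e x * extProj 𝕜 n e' y =
      sgn (e * e') • (extProj 𝕜 n e' y * extProj 𝕜 n e x) := by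
  induction x using ext_induction generalizing e with
  | algebraMap c =>
    rw [extProj_algebraMap]
    split_ifs with h
    · subst h; simp [Algebra.commutes]
    · simp
  | add x y hx hy => rw [map_add, add_mul, hx, hy, mul_add, smul_add]
  | ι_mul u x hx =>
    cases e with
    | zero => simp [extProj_zero_ι_mul]
    | succ e =>
      have h : sgn ((e + 1 : ℕ) * e') = sgn (e * e') * sgn e' := by
        rw [← sgn_add]; congr 1; push_cast; ring
      rw [extProj_succ_ι_mul, mul_assoc, hx, mul_smul_comm, ← mul_assoc, ι_mul_extProj,
        smul_mul_assoc, smul_smul, mul_assoc, h]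

/-- The forms of degree `e`. -/
def IsDeg (e : ℕ) (w : Form 𝕜 n) : Prop := formProj 𝕜 n e w = w

lemma formProj_tmul (e : ℕ) (f : MvPolynomial (Fin n) 𝕜) (w : ExteriorAlgebra 𝕜 (Fin n → 𝕜)) :
    formProj 𝕜 n e (f ⊗ₜ w) = f ⊗ₜ extProj 𝕜 n e w := rfl

lemma formProj_formProj (e e' : ℕ) (w : Form 𝕜 n) :
    formProj 𝕜 n e (formProj 𝕜 n e' w) = if e = e' then formProj 𝕜 n e w else 0 := by
  have h := LinearMap.congr_fun (opProj_mul_opProj (𝕜 := 𝕜) (n := n) e e') w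
  split_ifs at h ⊢ <;> exact h

lemma isDeg_formProj (e : ℕ) (w : Form 𝕜 n) : IsDeg e (formProj 𝕜 n e w) := by
  rw [IsDeg, formProj_formProj, if_pos rfl]

lemma IsDeg.formProj_of_ne {e e' : ℕ} {w : Form 𝕜 n} (hw : IsDeg e w) (h : e' ≠ e) :
    formProj 𝕜 n e' w = 0 := by
  rw [← hw, formProj_formProj, if_neg h]

/-- Induction for linear statements on forms of degree `e`. -/
lemma IsDeg.induction {e : ℕ} {p : Form 𝕜 n → Prop} (zero : p 0)
    (add : ∀ x y, p x → p y → p (x + y))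
    (tmul : ∀ (f : MvPolynomial (Fin n) 𝕜) (x : ExteriorAlgebra 𝕜 (Fin n → 𝕜)),
      p (f ⊗ₜ extProj 𝕜 n e x)) {w : Form 𝕜 n} (hw : IsDeg e w) : p w := by
  rw [← hw]
  clear hw
  induction w using TensorProduct.induction_on with
  | zero => rw [map_zero]; exact zero
  | add x y hx hy => rw [map_add]; exact add _ _ hx hy
  | tmul f w => exact tmul f w

lemma IsDeg.mul {e e' : ℕ} {w w' : Form 𝕜 n} (hw : IsDeg e w) (hw' : IsDeg e' w') :
    IsDeg (e + e') (w * w') := by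
  refine IsDeg.induction (p := fun w => IsDeg (e + e') (w * w')) ?_ ?_ (fun f x => ?_) hw
  · simp [IsDeg]
  · intro x y hx hy
    rw [IsDeg] at *
    rw [add_mul, map_add, hx, hy]
  refine IsDeg.induction (p := fun w' => IsDeg (e + e') (f ⊗ₜ extProj 𝕜 n e x * w')) ?_ ?_
    (fun g y => ?_) hw'
  · simp [IsDeg]
  · intro x y hx hy
    rw [IsDeg] at *
    rw [mul_add, map_add, hx, hy]
  · rw [IsDeg, Algebra.TensorProduct.tmul_mul_tmul, formProj_tmul, extProj_of_mem]
    exact SetLike.mul_mem_graded (extProj_mem e x) (extProj_mem e' y)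

lemma IsDeg.mul_comm {e e' : ℕ} {w w' : Form 𝕜 n} (hw : IsDeg e w) (hw' : IsDeg e' w') :
    w * w' = sgn (e * e') • (w' * w) := by
  refine IsDeg.induction (p := fun w => w * w' = sgn (e * e') • (w' * w)) ?_ ?_
    (fun f x => ?_) hw
  · simp
  · intro x y hx hy
    rw [add_mul, mul_add, hx, hy, smul_add]
  refine IsDeg.induction (p := fun w' => f ⊗ₜ extProj 𝕜 n e x * w' =
    sgn (e * e') • (w' * f ⊗ₜ extProj 𝕜 n e x)) ?_ ?_ (fun g y => ?_) hw'
  · simp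
  · intro x y hx hy
    rw [add_mul, mul_add, hx, hy, smul_add]
  · rw [Algebra.TensorProduct.tmul_mul_tmul, Algebra.TensorProduct.tmul_mul_tmul,
      extProj_mul_extProj_comm, _root_.mul_comm f, TensorProduct.tmul_smul]

lemma IsDeg.formD {e : ℕ} {w : Form 𝕜 n} (hw : IsDeg e w) : IsDeg (e + 1) (formD 𝕜 n w) := by
  have h := LinearMap.congr_fun (opProj_succ_mul_opD (𝕜 := 𝕜) (n := n) e) w
  exact h.trans (congrArg (DHG.formD 𝕜 n) hw)

lemma IsDeg.formD_mul {e : ℕ} {w : Form 𝕜 n} (hw : IsDeg e w) (w' : Form 𝕜 n) :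
    DHG.formD 𝕜 n (w * w') = DHG.formD 𝕜 n w * w' + sgn e • (w * DHG.formD 𝕜 n w') := by
  refine IsDeg.induction (p := fun w => DHG.formD 𝕜 n (w * w') =
    DHG.formD 𝕜 n w * w' + sgn e • (w * DHG.formD 𝕜 n w')) ?_ ?_ (fun f x => ?_) hw
  · simp
  · intro x y hx hy
    rw [add_mul, map_add, hx, hy, map_add, add_mul, add_mul, smul_add]; abel
  · induction w' using TensorProduct.induction_on with
    | zero => simp
    | add x y hx hy => rw [mul_add, map_add, hx, hy, map_add, mul_add, mul_add, smul_add]; abel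
    | tmul g y =>
      change opD 𝕜 n _ = opD 𝕜 n _ * _ + _ • (_ * opD 𝕜 n _)
      rw [Algebra.TensorProduct.tmul_mul_tmul, opD_tmul, opD_tmul, opD_tmul, Finset.sum_mul,
        Finset.mul_sum, Finset.smul_sum, ← Finset.sum_add_distrib]
      refine Finset.sum_congr rfl fun j _ => ?_
      rw [Algebra.TensorProduct.tmul_mul_tmul, Algebra.TensorProduct.tmul_mul_tmul,
        Derivation.leibniz, smul_eq_mul, smul_eq_mul, extMul_apply, extMul_apply, extMul_apply,
        ← mul_assoc, ← mul_assoc, ι_mul_extProj, smul_mul_assoc, TensorProduct.add_tmul, add_comm,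
        TensorProduct.tmul_smul, TensorProduct.tmul_smul, TensorProduct.tmul_smul,
        _root_.mul_comm g]

/-! #### Products of homogeneous forms -/

variable {r : ℕ}

lemma prod_ofFn_succ {R : Type*} [Monoid R] (w : Fin (r + 1) → R) :
    (List.ofFn w).prod = w 0 * (List.ofFn fun a : Fin r => w a.succ).prod := by
  rw [List.ofFn_succ, List.prod_cons]

lemma isDeg_one : IsDeg 0 (1 : Form 𝕜 n) := by
  rw [IsDeg, Algebra.TensorProduct.one_def, formProj_tmul, extProj_zero_eq, map_one, map_one]

lemma isDeg_prod (e : Fin r → ℕ) (w : Fin r → Form 𝕜 n) (hw : ∀ a, IsDeg (e a) (w a)) :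
    IsDeg (∑ a, e a) (List.ofFn w).prod := by
  induction r with
  | zero => simpa using isDeg_one
  | succ r ih =>
    rw [prod_ofFn_succ, Fin.sum_univ_succ]
    exact (hw 0).mul (ih _ _ fun a => hw a.succ)

/-- The Koszul sign for moving the factors at the places `a` with `p a` to the front. -/
lemma prod_ite_mul_prod_ite (e : Fin r → ℕ) (w : Fin r → Form 𝕜 n) (hw : ∀ a, IsDeg (e a) (w a))
    (p : Fin r → Prop) [DecidablePred p] :
    (List.ofFn fun a => if p a then w a else 1).prod *
      (List.ofFn fun a => if p a then 1 else w a).prod =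
    koszulSign (fun a => (e a : ℤ)) (fun a => if p a then 0 else 1) • (List.ofFn w).prod := by
  induction r with
  | zero => simp [koszulSign]
  | succ r ih =>
    have h := ih (fun a => e a.succ) (fun a => w a.succ) (fun a => hw _) (fun a => p a.succ)
    set A := (List.ofFn fun a : Fin r => if p a.succ then w a.succ else 1).prod with hA
    set B := (List.ofFn fun a : Fin r => if p a.succ then 1 else w a.succ).prod with hB
    have hAdeg : IsDeg (∑ a : Fin r, if p a.succ then e a.succ else 0) A :=
      isDeg_prod _ _ fun a => by split_ifs; exacts [hw _, isDeg_one]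
    rw [prod_ofFn_succ, prod_ofFn_succ, prod_ofFn_succ w, ← hA, ← hB]
    have hk : koszulSign (fun a => (e a : ℤ)) (fun a => if p a then 0 else 1) =
        (if p 0 then 1 else sgn (e 0 * (∑ a : Fin r, if p a.succ then e a.succ else 0 : ℕ))) *
        koszulSign (fun a : Fin r => (e a.succ : ℤ)) (fun a => if p a.succ then 0 else 1) := by
      unfold koszulSign
      rw [Fin.prod_univ_succ]
      simp only [Fin.prod_univ_succ]
      congr 1
      · simp only [lt_irrefl, false_and, if_false, one_mul, Fin.succ_pos, true_and]
        by_cases h0 : p 0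
        · simp [h0]
        · simp only [if_neg h0]
          push_cast
          rw [Finset.mul_sum, sgn_sum]
          exact Finset.prod_congr rfl fun a _ => by by_cases h1 : p a.succ <;> simp [h1, sgn]
      · simp
    rw [hk]
    by_cases h0 : p 0
    · simp only [if_pos h0]
      rw [one_mul, one_mul, mul_assoc, h, mul_smul_comm]
    · simp only [if_neg h0]
      rw [one_mul, ← mul_assoc, hAdeg.mul_comm (hw 0), smul_mul_assoc, mul_assoc, h, mul_smul_comm,
        smul_smul, _root_.mul_comm (e 0 : ℤ)]

lemma prod_ofFn_sub {R : Type*} [Monoid R] (w : Fin r → R) (S : Finset (Fin r)) :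
    (List.ofFn (sub w S)).prod = (List.ofFn fun a => if a ∈ S then w a else 1).prod := by
  have h1 : List.ofFn (sub w S) = (((List.finRange r).filter (· ∈ S)).map w) := by
    have h2 : (List.finRange S.card).map (S.orderEmbOfFin rfl) =
        (List.finRange r).filter (· ∈ S) := by
      rw [Finset.listMap_orderEmbOfFin_finRange]
      refine List.Perm.eq_of_pairwise (le := (· ≤ ·)) (fun a b _ _ h h' => le_antisymm h h')
        (Finset.pairwise_sort S (· ≤ ·))
        ((List.pairwise_le_finRange r).sublist List.filter_sublist) ?_
      rw [List.perm_ext_iff_of_nodup (Finset.sort_nodup S _) ((List.nodup_finRange r).filter _)]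
      simp
    rw [← h2, List.ofFn_eq_map, List.map_map]; rfl
  have h3 : ∀ l : List (Fin r), ((l.filter (· ∈ S)).map w).prod =
      (l.map fun a => if a ∈ S then w a else 1).prod := by
    intro l
    induction l with
    | nil => rfl
    | cons a l ih => by_cases ha : a ∈ S <;> simp [ha, ih]
  rw [h1, h3, List.ofFn_eq_map]

lemma prod_sub_mul_prod_sub (e : Fin r → ℕ) (w : Fin r → Form 𝕜 n) (hw : ∀ a, IsDeg (e a) (w a))
    (S : Finset (Fin r)) : (List.ofFn (sub w S)).prod * (List.ofFn (sub w Sᶜ)).prod =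
      koszulSign (fun a => (e a : ℤ)) (frontKey S) • (List.ofFn w).prod := by
  rw [prod_ofFn_sub, prod_ofFn_sub]
  have h := prod_ite_mul_prod_ite e w hw (fun a => a ∈ S)
  simp only [Finset.mem_compl, ite_not]
  exact h

lemma koszulSign_swap (D : Fin (r + 1) → ℤ) (i : Fin r) :
    koszulSign D ((Equiv.swap i.castSucc i.succ).symm : Fin (r + 1) → Fin (r + 1)) =
      sgn (D i.castSucc * D i.succ) := by
  have h : ∀ a b : Fin (r + 1), (a < b ∧ Equiv.swap i.castSucc i.succ b <
      Equiv.swap i.castSucc i.succ a) ↔ a = i.castSucc ∧ b = i.succ := by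
    intro a b
    simp only [Equiv.swap_apply_def, Fin.ext_iff, Fin.lt_def]
    split_ifs <;> simp only [Fin.val_castSucc, Fin.val_succ] at * <;> omega
  unfold koszulSign
  simp only [Equiv.symm_swap, h]
  rw [Finset.prod_eq_single i.castSucc, Finset.prod_eq_single i.succ]
  · simp
  · intro b _ hb; simp [hb]
  · simp
  · intro a _ ha; simp [ha]
  · simp

lemma prod_swap (i : Fin r) (e : Fin (r + 1) → ℕ) (w : Fin (r + 1) → Form 𝕜 n)
    (hw : ∀ a, IsDeg (e a) (w a)) :
    (List.ofFn fun a => w (Equiv.swap i.castSucc i.succ a)).prod =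
      sgn (e i.castSucc * e i.succ) • (List.ofFn w).prod := by
  induction r with
  | zero => exact i.elim0
  | succ r ih =>
    refine Fin.cases ?_ (fun i => ?_) i
    · have e1 : Equiv.swap (0 : Fin (r + 1)).castSucc (0 : Fin (r + 1)).succ =
        Equiv.swap (0 : Fin (r + 2)) 1 := rfl
      have e2 : ∀ a : Fin r, Equiv.swap (0 : Fin (r + 2)) 1 a.succ.succ = a.succ.succ :=
        fun a => Equiv.swap_apply_of_ne_of_ne (Fin.succ_ne_zero _)
          fun h => Fin.succ_ne_zero a (Fin.succ_injective _ h)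
      rw [e1, prod_ofFn_succ, prod_ofFn_succ, prod_ofFn_succ w, prod_ofFn_succ fun a => w a.succ]
      simp only [e2, Equiv.swap_apply_left]
      change w 1 * (w (Equiv.swap 0 1 1) * _) = sgn (e 0 * e 1) • (w 0 * (w 1 * _))
      rw [Equiv.swap_apply_right, ← mul_assoc, ← mul_assoc, (hw 1).mul_comm (hw 0),
        smul_mul_assoc, _root_.mul_comm (e 0 : ℤ)]
    · have e1 : ∀ a : Fin (r + 1), Equiv.swap i.succ.castSucc i.succ.succ a.succ =
          (Equiv.swap i.castSucc i.succ a).succ := by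
        intro a
        have : i.succ.castSucc = i.castSucc.succ := rfl
        rw [this, Equiv.swap_apply_def, Equiv.swap_apply_def]
        simp only [Fin.succ_inj]
        split_ifs <;> rfl
      have e2 : Equiv.swap i.succ.castSucc i.succ.succ 0 = 0 :=
        Equiv.swap_apply_of_ne_of_ne (Fin.succ_ne_zero i.castSucc).symm
          (Fin.succ_ne_zero _).symm
      rw [prod_ofFn_succ, prod_ofFn_succ w]
      simp only [e1, e2]
      rw [ih i (fun a => e a.succ) (fun a => w a.succ) fun a => hw _, mul_smul_comm]
      rfl

/-- Products of homogeneous forms are graded symmetric. -/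
lemma prod_perm (σ : Equiv.Perm (Fin r)) (e : Fin r → ℕ) (w : Fin r → Form 𝕜 n)
    (hw : ∀ a, IsDeg (e a) (w a)) : (List.ofFn fun a => w (σ a)).prod =
      koszulSign (fun a => (e a : ℤ)) (σ.symm : Fin r → Fin r) • (List.ofFn w).prod := by
  cases r with
  | zero => simp [koszulSign]
  | succ r =>
    have hσ : σ ∈ Submonoid.closure
        (Set.range fun i : Fin r => Equiv.swap i.castSucc i.succ) := by
      rw [Equiv.Perm.mclosure_swap_castSucc_succ]; trivial
    induction hσ using Submonoid.closure_induction generalizing e w with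
    | mem σ hσ =>
      obtain ⟨i, rfl⟩ := hσ
      dsimp only
      rw [koszulSign_swap]
      exact prod_swap i e w hw
    | one =>
      have h1 : koszulSign (fun a => (e a : ℤ)) ((1 : Equiv.Perm (Fin (r + 1))).symm) = 1 := by
        refine Finset.prod_eq_one fun a _ => Finset.prod_eq_one fun b _ => if_neg ?_
        exact fun h => lt_asymm h.1 h.2
      rw [h1, one_smul]
      rfl
    | mul σ τ _ _ hσ hτ =>
      have h1 := hτ (fun a => e (σ a)) (fun a => w (σ a)) fun a => hw _
      rw [hσ e w hw, smul_smul] at h1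
      rw [koszulSign_mul, _root_.mul_comm]
      exact h1

/-- The Leibniz rule for products of homogeneous forms. -/
lemma formD_prod (e : Fin r → ℕ) (w : Fin r → Form 𝕜 n) (hw : ∀ a, IsDeg (e a) (w a)) :
    formD 𝕜 n (List.ofFn w).prod = ∑ a, (∏ b, if b < a then sgn (e b) else 1) •
      (List.ofFn (Function.update w a (formD 𝕜 n (w a)))).prod := by
  induction r with
  | zero =>
    rw [Finset.univ_eq_empty, Finset.sum_empty, List.ofFn_zero, List.prod_nil]
    have h := opD_tmul (𝕜 := 𝕜) (n := n) 1 1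
    rw [← Algebra.TensorProduct.one_def] at h
    change opD 𝕜 n 1 = 0
    rw [h]; simp
  | succ r ih =>
    rw [prod_ofFn_succ, (hw 0).formD_mul, ih _ _ fun a => hw a.succ, Fin.sum_univ_succ]
    congr 1
    · rw [prod_ofFn_succ]
      simp
    · rw [Finset.mul_sum, Finset.smul_sum]
      refine Finset.sum_congr rfl fun a _ => ?_
      have h1 : (fun b : Fin r => Function.update w a.succ (formD 𝕜 n (w a.succ)) b.succ) =
          Function.update (fun b : Fin r => w b.succ) a (formD 𝕜 n (w a.succ)) := by
        funext b
        simp only [Function.update_apply, Fin.succ_inj]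
      rw [prod_ofFn_succ, h1, Function.update_of_ne (Fin.succ_ne_zero a).symm, Fin.prod_univ_succ,
        mul_smul_comm, smul_smul]
      simp

end Graded


/-! ### Operations on the tensor product with forms -/

section TensorOps

variable {𝕜 : Type*} [Field 𝕜] {M : Type*} [AddCommGroup M] [Module 𝕜 M] {n r : ℕ}

lemma liftWord_prod_ι (f : MultilinearMap 𝕜 (fun _ : Fin r => M) M) (v : Fin r → M) :
    liftWord f (List.ofFn fun a => TensorAlgebra.ι 𝕜 (v a)).prod = f v := by
  rw [← TensorAlgebra.tprod_apply]
  change PiTensorProduct.lift f (DirectSum.component 𝕜 ℕ (fun k => ⨂[𝕜]^k M) r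
    (TensorAlgebra.toDirectSum (TensorAlgebra.tprod 𝕜 M r v))) = _
  rw [TensorAlgebra.toDirectSum_tensorPower_tprod]
  change PiTensorProduct.lift f (DirectSum.component 𝕜 ℕ (fun k => ⨂[𝕜]^k M) r
    (DirectSum.lof 𝕜 ℕ (fun k => ⨂[𝕜]^k M) r _)) = _
  rw [DirectSum.component.lof_self, PiTensorProduct.lift.tprod]

lemma prod_ofFn_tmul {A B : Type*} [Ring A] [Algebra 𝕜 A] [Ring B] [Algebra 𝕜 B]
    (v : Fin r → A) (w : Fin r → B) : (List.ofFn fun a => v a ⊗ₜ[𝕜] w a).prod =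
      (List.ofFn v).prod ⊗ₜ (List.ofFn w).prod := by
  induction r with
  | zero => simp [Algebra.TensorProduct.one_def]
  | succ r ih =>
    rw [prod_ofFn_succ, prod_ofFn_succ, prod_ofFn_succ w, ih, Algebra.TensorProduct.tmul_mul_tmul]

lemma extendScalars_tmul (f : MultilinearMap 𝕜 (fun _ : Fin r => M) M) (v : Fin r → M)
    (w : Fin r → Form 𝕜 n) :
    extendScalars f (fun a => v a ⊗ₜ w a) = f v ⊗ₜ (List.ofFn w).prod := by
  change (liftWord f).rTensor (Form 𝕜 n)
    (List.ofFn fun a => TensorAlgebra.ι 𝕜 (v a) ⊗ₜ w a).prod = _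
  rw [prod_ofFn_tmul, LinearMap.rTensor_tmul, liftWord_prod_ι]

lemma part_tmul (e : ℕ) (v : M) (w : Form 𝕜 n) :
    part e (v ⊗ₜ[𝕜] w) = v ⊗ₜ formProj 𝕜 n e w := rfl

lemma IsDeg.eq_zero {e : ℕ} {w : Form 𝕜 n} (hw : IsDeg e w) (he : n < e) : w = 0 := by
  rw [← hw]
  exact LinearMap.congr_fun (opProj_eq_zero (𝕜 := 𝕜) he) w

lemma sum_range_part (x : M ⊗[𝕜] Form 𝕜 n) : ∑ e ∈ Finset.range (n + 1), part e x = x := by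
  induction x with
  | zero => simp
  | add x y hx hy => simp only [map_add, Finset.sum_add_distrib, hx, hy]
  | tmul v w =>
    simp only [part_tmul]
    rw [← TensorProduct.tmul_sum]
    have h := LinearMap.congr_fun (sum_opProj (𝕜 := 𝕜) (n := n)) w
    rw [LinearMap.sum_apply] at h
    exact congrArg _ h

/-- An elementary tensor of total shifted degree `D` whose factors are homogeneous. -/
def homogTensors (deg : ℤ → Submodule 𝕜 M) (D : ℤ) : Set (M ⊗[𝕜] Form 𝕜 n) :=
  {x | ∃ (e : ℕ) (v : M) (w : Form 𝕜 n), v ∈ deg (D + 1 - e) ∧ IsDeg e w ∧ x = v ⊗ₜ w}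

lemma tmul_mem_totalDeg {deg : ℤ → Submodule 𝕜 M} {d : ℤ} {e : ℕ} {v : M} {w : Form 𝕜 n}
    (hv : v ∈ deg (d - e)) (hw : IsDeg e w) : v ⊗ₜ[𝕜] w ∈ totalDeg (n := n) deg d :=
  Submodule.mem_iSup_of_mem e (Submodule.apply_mem_map₂ _ hv ⟨w, hw⟩)

lemma mem_closure_homogTensors {deg : ℤ → Submodule 𝕜 M} {D : ℤ} {x : M ⊗[𝕜] Form 𝕜 n}
    (hx : x ∈ totalDeg deg (D + 1)) : x ∈ AddSubmonoid.closure (homogTensors deg D) := by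
  let S : Submodule 𝕜 (M ⊗[𝕜] Form 𝕜 n) :=
    { AddSubmonoid.closure (homogTensors (n := n) deg D) with
      smul_mem' := fun c y hy => by
        change c • y ∈ AddSubmonoid.closure (homogTensors deg D)
        induction hy using AddSubmonoid.closure_induction with
        | mem y hy =>
          obtain ⟨e, v, w, hv, hw, rfl⟩ := hy
          exact AddSubmonoid.subset_closure
            ⟨e, c • v, w, Submodule.smul_mem _ c hv, hw, by rw [TensorProduct.smul_tmul']⟩
        | zero => rw [smul_zero]; exact zero_mem _
        | add y z _ _ hy hz => rw [smul_add]; exact add_mem hy hz }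
  have h : totalDeg deg (D + 1) ≤ S := by
    refine iSup_le fun e => Submodule.map₂_le.2 fun v hv w hw => ?_
    obtain ⟨w, rfl⟩ := hw
    exact AddSubmonoid.subset_closure ⟨e, v, _, hv, isDeg_formProj e w, rfl⟩
  exact h hx

/-- `1 ⊗ u` with the Koszul sign on a homogeneous elementary tensor. -/
lemma oddMap_tmul (u : Form 𝕜 n →ₗ[𝕜] Form 𝕜 n) (D : ℤ) (v : M) {e : ℕ} {w : Form 𝕜 n}
    (hw : IsDeg e w) : oddMap u D (v ⊗ₜ[𝕜] w) = sgn (D - e) • v ⊗ₜ u w := by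
  unfold oddMap
  rw [LinearMap.sum_apply]
  by_cases he : n < e
  · rw [hw.eq_zero he, map_zero, TensorProduct.tmul_zero, smul_zero]
    simp
  rw [Finset.sum_eq_single (⟨e, by omega⟩ : Fin (n + 1))]
  · rw [LinearMap.smul_apply, LinearMap.comp_apply, part_tmul, hw, LinearMap.lTensor_tmul]
  · intro e' _ he'
    rw [LinearMap.smul_apply, LinearMap.comp_apply, part_tmul, hw.formProj_of_ne fun h =>
      he' (Fin.ext h), TensorProduct.tmul_zero, map_zero, smul_zero]
  · simp

/-- `shuffleSign` for arbitrary form degrees. -/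
def shuffle (D : Fin r → ℤ) (e : Fin r → ℕ) : ℤ :=
  ∏ a, ∏ b, if a < b then sgn (e a * (D b - e b)) else 1

/-- The part of the brackets on `M ⊗ Ω_n` that comes from the brackets `f` of `M`. -/
def scalarOps (f : (r : ℕ) → MultilinearMap 𝕜 (fun _ : Fin r => M) M) (r : ℕ) (D : Fin r → ℤ) :
    MultilinearMap 𝕜 (fun _ : Fin r => M ⊗[𝕜] Form 𝕜 n) (M ⊗[𝕜] Form 𝕜 n) :=
  ∑ e : Fin r → Fin (n + 1),
    shuffleSign D e • (extendScalars (f r)).compLinearMap fun a => part (e a)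

/-- The differential of forms, as an operation of arity `1` on `M ⊗ Ω_n`. -/
def diffOps : (r : ℕ) → (Fin r → ℤ) →
    MultilinearMap 𝕜 (fun _ : Fin r => M ⊗[𝕜] Form 𝕜 n) (M ⊗[𝕜] Form 𝕜 n)
  | 1, D => MultilinearMap.ofSubsingleton 𝕜 _ _ 0 (oddMap (formD 𝕜 n) (D 0))
  | 0, _ => 0
  | _ + 2, _ => 0

lemma diffOps_apply (D : Fin r → ℤ) (x : Fin r → M ⊗[𝕜] Form 𝕜 n) :
    diffOps r D x = ∑ a : Fin r, if r = 1 then oddMap (formD 𝕜 n) (D a) (x a) else 0 := by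
  match r, D, x with
  | 0, D, x => simp [diffOps]
  | 1, D, x => simp [diffOps]
  | r + 2, D, x => simp [diffOps]

lemma scalarOps_apply (f : (r : ℕ) → MultilinearMap 𝕜 (fun _ : Fin r => M) M) (D : Fin r → ℤ)
    (x : Fin r → M ⊗[𝕜] Form 𝕜 n) : scalarOps f r D x =
      ∑ e : Fin r → Fin (n + 1), shuffleSign D e •
        extendScalars (f r) fun a => part (e a) (x a) := by
  rw [scalarOps, sum_apply]
  rfl

lemma scalarOps_add_diffOps (f : (r : ℕ) → MultilinearMap 𝕜 (fun _ : Fin r => M) M)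
    (D : Fin r → ℤ) (x : Fin r → M ⊗[𝕜] Form 𝕜 n) :
    (scalarOps f r D + diffOps r D : MultilinearMap 𝕜 (fun _ => M ⊗[𝕜] Form 𝕜 n) _) x =
      tensorOps f r D x := by
  rw [add_apply, scalarOps_apply, diffOps_apply, tensorOps]

lemma scalarOps_tmul (f : (r : ℕ) → MultilinearMap 𝕜 (fun _ : Fin r => M) M) (D : Fin r → ℤ)
    (e : Fin r → ℕ) (v : Fin r → M) (w : Fin r → Form 𝕜 n) (hw : ∀ a, IsDeg (e a) (w a)) :
    scalarOps f r D (fun a => v a ⊗ₜ w a) =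
      shuffle D e • f r v ⊗ₜ (List.ofFn w).prod := by
  rw [scalarOps_apply]
  by_cases he : ∀ a, e a < n + 1
  · rw [Finset.sum_eq_single fun a => (⟨e a, he a⟩ : Fin (n + 1))]
    · have h : ∀ a, part (e a) (v a ⊗ₜ[𝕜] w a) = v a ⊗ₜ w a := fun a => by rw [part_tmul, hw a]
      simp only [h, extendScalars_tmul]
      rfl
    · intro e' _ he'
      obtain ⟨a, ha⟩ := Function.ne_iff.1 he'
      rw [MultilinearMap.map_coord_zero _ a, smul_zero]
      rw [part_tmul, (hw a).formProj_of_ne fun h => ha (Fin.ext h), TensorProduct.tmul_zero]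
    · simp
  · push Not at he
    obtain ⟨a, ha⟩ := he
    have h0 : w a = 0 := (hw a).eq_zero (by omega)
    have h1 : (List.ofFn w).prod = 0 := List.prod_eq_zero (List.mem_ofFn.2 ⟨a, h0⟩)
    rw [h1, TensorProduct.tmul_zero, smul_zero]
    refine Finset.sum_eq_zero fun e' _ => ?_
    rw [MultilinearMap.map_coord_zero _ a, smul_zero]
    rw [h0, TensorProduct.tmul_zero, map_zero]

lemma diffOps_cons (d : ℤ) (D : Fin r → ℤ) (y : M ⊗[𝕜] Form 𝕜 n) (x : Fin r → M ⊗[𝕜] Form 𝕜 n) :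
    diffOps (r + 1) (Fin.cons d D) (Fin.cons y x) =
      if r = 0 then oddMap (formD 𝕜 n) d y else 0 := by
  match r, D, x with
  | 0, D, x => simp [diffOps]
  | r + 1, D, x => simp [diffOps]

end TensorOps


/-! ### Signs of shuffled tensors -/

section ShuffleSigns

variable {r : ℕ}

lemma sgn_congr {a b : ℤ} (k : ℤ) (h : a = b + (k + k)) : sgn a = sgn b := by
  rw [h, sgn_add, sgn_add, sgn_mul_self, mul_one]

/-- Shuffling is compatible with the Koszul signs of permutations. -/
lemma shuffle_perm (D : Fin r → ℤ) (e : Fin r → ℕ) (σ : Equiv.Perm (Fin r)) :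
    shuffle (fun a => D (σ a)) (fun a => e (σ a)) *
      (koszulSign (fun a => D a - e a) (σ.symm : Fin r → Fin r) *
        koszulSign (fun a => (e a : ℤ)) (σ.symm : Fin r → Fin r)) =
      koszulSign D (σ.symm : Fin r → Fin r) * shuffle D e := by
  have h1 : shuffle (fun a => D (σ a)) (fun a => e (σ a)) =
      ∏ a, ∏ b, if σ.symm a < σ.symm b then sgn (e a * (D b - e b)) else 1 := by
    refine Eq.trans (Finset.prod_congr rfl fun a _ => ?_) (Equiv.prod_comp σ _)
    refine Eq.trans (Finset.prod_congr rfl fun b _ => ?_) (Equiv.prod_comp σ _)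
    simp
  rw [h1]
  unfold koszulSign shuffle
  simp only [← Finset.prod_mul_distrib]
  refine prod_prod_congr_pairs (fun a b hab => ?_) fun a => by simp
  have h2 := σ.symm.injective.ne hab.ne
  rcases lt_or_gt_of_ne h2 with h | h
  · simp [hab, hab.not_gt, h, h.not_gt]
  · simp only [hab, hab.not_gt, h, h.not_gt, true_and, if_true, if_false, false_and, one_mul,
      mul_one, ← sgn_add]
    exact sgn_congr (-(e a * (D b - e b))) (by ring)

lemma shuffle_cons (d : ℤ) (e₀ : ℕ) (D : Fin r → ℤ) (e : Fin r → ℕ) :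
    shuffle (Fin.cons d D : Fin (r + 1) → ℤ) (Fin.cons e₀ e : Fin (r + 1) → ℕ) =
      (∏ b, sgn (e₀ * (D b - e b))) * shuffle D e := by
  unfold shuffle
  simp [Fin.prod_univ_succ]

lemma shuffle_sub (D : Fin r → ℤ) (e : Fin r → ℕ) (S : Finset (Fin r)) :
    shuffle (sub D S) (sub e S) =
      ∏ a, ∏ b, if a ∈ S ∧ b ∈ S then if a < b then sgn (e a * (D b - e b)) else 1 else 1 := by
  rw [← prod_prod_orderEmb]
  simp [shuffle, sub]

lemma prod_sub {M : Type*} [CommMonoid M] (f : Fin r → M) (S : Finset (Fin r)) :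
    ∏ a, sub f S a = ∏ a, if a ∈ S then f a else 1 := by
  rw [Finset.prod_ite_mem, Finset.univ_inter, ← Finset.prod_coe_sort S,
    ← (S.orderIsoOfFin rfl).toEquiv.prod_comp]
  rfl

/-- Shuffling is compatible with the signs in the generalized Jacobi identities. -/
lemma shuffle_merge (D : Fin r → ℤ) (e : Fin r → ℕ) (S : Finset (Fin r)) :
    koszulSign D (frontKey S) * (shuffle (sub D S) (sub e S) *
      (shuffle (Fin.cons ((∑ a ∈ S, D a) + 1) (sub D Sᶜ) : Fin (Sᶜ.card + 1) → ℤ)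
        (Fin.cons (∑ a, sub e S a) (sub e Sᶜ) : Fin (Sᶜ.card + 1) → ℕ) *
        koszulSign (fun a => (e a : ℤ)) (frontKey S))) =
      koszulSign (fun a => D a - e a) (frontKey S) * shuffle D e := by
  have h1 : ∏ b, sgn ((∑ a, sub e S a : ℕ) * (sub D Sᶜ b - sub e Sᶜ b)) =
      ∏ a, ∏ b, if a ∈ S ∧ b ∉ S then sgn (e a * (D b - e b)) else 1 := by
    have h2 : (fun b => sgn ((∑ a, sub e S a : ℕ) * (sub D Sᶜ b - sub e Sᶜ b))) =
        sub (fun b => ∏ a, if a ∈ S then sgn (e a * (D b - e b)) else 1) Sᶜ := by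
      funext b
      push_cast
      rw [Finset.sum_mul, sgn_sum]
      exact prod_sub (fun a => sgn (e a * (D (Sᶜ.orderEmbOfFin rfl b) -
        e (Sᶜ.orderEmbOfFin rfl b)))) S
    rw [h2, prod_sub, Finset.prod_comm]
    refine Finset.prod_congr rfl fun b _ => ?_
    by_cases hb : b ∈ S <;> simp [hb]
  rw [shuffle_cons, h1, shuffle_sub, shuffle_sub]
  unfold koszulSign shuffle
  simp only [← Finset.prod_mul_distrib, frontKey_lt, Finset.mem_compl]
  refine prod_prod_congr_pairs (fun a b hab => ?_) fun a => by simp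
  by_cases ha : a ∈ S <;> by_cases hb : b ∈ S <;>
    simp only [hab, hab.not_gt, ha, hb, and_true, and_false, if_true, if_false,
      and_self, not_true_eq_false, not_false_eq_true, one_mul, mul_one, ← sgn_add]
  exact sgn_congr (e a * e b + (D a - e a) * e b) (by ring)


/-- The sign of shuffling after replacing a form of degree `e a` by its differential. -/
lemma shuffle_update (D : Fin r → ℤ) (e : Fin r → ℕ) (a : Fin r) :
    (∏ b, if b < a then sgn (D b) else 1) * (sgn (D a - e a) *
      shuffle (Function.update D a (D a + 1)) (Function.update e a (e a + 1))) =
      sgn (∑ b, (D b - e b)) * ((∏ b, if b < a then sgn (e b) else 1) * shuffle D e) := by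
  have hc : ∀ b, Function.update D a (D a + 1) b - (Function.update e a (e a + 1) b : ℕ) =
      D b - e b := by
    intro b
    by_cases hb : b = a
    · subst hb; simp
    · simp [hb]
  have h1 : shuffle (Function.update D a (D a + 1)) (Function.update e a (e a + 1)) =
      (∏ b, if a < b then sgn (D b - e b) else 1) * shuffle D e := by
    have h2 : ∀ b, (∏ b', if b < b' then sgn (Function.update e a (e a + 1) b *
        (D b' - e b')) else 1) =
        (if b = a then ∏ b', if a < b' then sgn (D b' - e b') else 1 else 1) *
          ∏ b', if b < b' then sgn (e b * (D b' - e b')) else 1 := by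
      intro b
      split_ifs with hb
      · subst hb
        rw [← Finset.prod_mul_distrib]
        refine Finset.prod_congr rfl fun b' _ => ?_
        split_ifs
        · rw [← sgn_add, Function.update_self]; congr 1; push_cast; ring
        · simp
      · simp [hb]
    unfold shuffle
    simp only [hc, h2, Finset.prod_mul_distrib]
    simp
  have h3 : sgn (D a - e a) = ∏ b, if b = a then sgn (D b - e b) else 1 := by simp
  rw [h1, sgn_sum, h3, ← mul_assoc, ← mul_assoc, ← mul_assoc]
  congr 1
  simp only [← Finset.prod_mul_distrib]
  refine Finset.prod_congr rfl fun b _ => ?_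
  rcases lt_trichotomy b a with h | h | h
  · simp only [h, h.ne, h.not_gt, if_true, if_false, mul_one, ← sgn_add]
    exact sgn_congr 0 (by ring)
  · subst h; simp
  · simp [h, h.ne', h.not_gt]

end ShuffleSigns

/-! ### Merging letters by a differential -/

section MergeDifferential

variable {V V' : Type*} [AddCommGroup V] [AddCommGroup V'] {𝕜 : Type*} [Field 𝕜] [Module 𝕜 V]
  {U : ℤ → Submodule 𝕜 V} {r : ℕ}

lemma ops_sub_univ {V V' : Type*} (F : Ops V V') (D : Fin r → ℤ) (x : Fin r → V) :
    F (Finset.univ : Finset (Fin r)).card (sub D Finset.univ) (sub x Finset.univ) = F r D x :=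
  ops_sub_eq F D x _ id strictMono_id (by simp)

/-- Merging a single letter by an operation `q` of degree `1` and putting it back in its place. -/
lemma mergeTerm_singleton {q : Ops V V} {F : Ops V V'} (hF : IsGradedSymm U F) (D : Fin r → ℤ)
    (x : Fin r → V) (hx : ∀ a, x a ∈ U (D a)) (a : Fin r)
    (hq : q 1 (fun _ => D a) (fun _ => x a) ∈ U (D a + 1)) :
    mergeTerm q F D x {a} = (∏ b, if b < a then sgn (D b) else 1) •
      F r (Function.update D a (D a + 1))
        (Function.update x a (q 1 (fun _ => D a) (fun _ => x a))) := by
  set D' := Function.update D a (D a + 1) with hD'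
  set x' := Function.update x a (q 1 (fun _ => D a) (fun _ => x a)) with hx'
  have hU : ∀ b, x' b ∈ U (D' b) := by
    intro b
    by_cases hb : b = a
    · subst hb; simpa [hD', hx'] using hq
    · simpa [hD', hx', hb] using hx b
  let c : Fin ({a} : Finset (Fin r))ᶜ.card → Fin r := ({a} : Finset (Fin r))ᶜ.orderEmbOfFin rfl
  have hc : ∀ b, c b ≠ a := fun b => by
    have := Finset.orderEmbOfFin_mem ({a} : Finset (Fin r))ᶜ rfl b
    rwa [Finset.mem_compl, Finset.mem_singleton] at this
  let g : Fin (({a} : Finset (Fin r))ᶜ.card + 1) → Fin r := Fin.cons a c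
  have hg : Function.Injective g :=
    Fin.cons_injective_iff.2 ⟨by rintro ⟨b, hb⟩; exact hc b hb,
      (({a} : Finset (Fin r))ᶜ.orderEmbOfFin rfl).injective⟩
  have hr : ({a} : Finset (Fin r))ᶜ.card + 1 = r := by
    have := Finset.card_compl_add_card ({a} : Finset (Fin r))
    simpa using this
  have hgu : Finset.univ.map ⟨g, hg⟩ = Finset.univ := by
    refine Finset.eq_univ_of_card _ ?_
    simp [hr]
  have h1 := hF.comp_injective D' x' hU g hg Finset.univ hgu
  rw [ops_sub_univ F D' x'] at h1
  have hqa : q ({a} : Finset (Fin r)).card (sub D {a}) (sub x {a}) =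
      q 1 (fun _ => D a) (fun _ => x a) :=
    ops_sub_eq q D x _ (fun _ : Fin 1 => a) (fun i j h => absurd h (by omega)) (by simp [eq_comm])
  have e1 : (Fin.cons ((∑ b ∈ ({a} : Finset (Fin r)), D b) + 1) (sub D {a}ᶜ) :
      Fin (({a} : Finset (Fin r))ᶜ.card + 1) → ℤ) = D' ∘ g := by
    funext b
    refine Fin.cases ?_ (fun b => ?_) b
    · simp [g, D']
    · simp [g, D', hc b, sub, c]
  have e2 : (Fin.cons (q 1 (fun _ => D a) (fun _ => x a)) (sub x {a}ᶜ) :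
      Fin (({a} : Finset (Fin r))ᶜ.card + 1) → V) = x' ∘ g := by
    funext b
    refine Fin.cases ?_ (fun b => ?_) b
    · simp [g, x']
    · simp [g, x', hc b, sub, c]
  unfold mergeTerm
  rw [hqa, e1, e2, h1, smul_smul]
  congr 1
  have h2 : koszulSign (D' ∘ g) g = ∏ b, if b < a then sgn ((D a + 1) * D b) else 1 := by
    unfold koszulSign
    rw [Fin.prod_univ_succ]
    have h3 : ∀ b b' : Fin ({a} : Finset (Fin r))ᶜ.card,
        ¬ (b.succ < b'.succ ∧ g b'.succ < g b.succ) := by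
      rintro b b' ⟨h, h'⟩
      have := (({a} : Finset (Fin r))ᶜ.orderEmbOfFin rfl).strictMono (Fin.succ_lt_succ_iff.1 h)
      exact lt_asymm this h'
    have h4 : ∀ b : Fin ({a} : Finset (Fin r))ᶜ.card, ¬ (b.succ < 0 ∧ g 0 < g b.succ) :=
      fun b h => absurd h.1 (Fin.not_lt_zero _)
    have h5 : ∏ b : Fin ({a} : Finset (Fin r))ᶜ.card,
        (if c b < a then sgn ((D a + 1) * D (c b)) else 1)
        = ∏ b, if b ∈ ({a} : Finset (Fin r))ᶜ then
          (if b < a then sgn ((D a + 1) * D b) else 1) else 1 :=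
      prod_sub (fun b => if b < a then sgn ((D a + 1) * D b) else 1) _
    simp only [Fin.prod_univ_succ, h3, h4, if_false, Finset.prod_const_one, mul_one]
    have h6 : ∏ b : Fin ({a} : Finset (Fin r))ᶜ.card,
        (if (0 : Fin (({a} : Finset (Fin r))ᶜ.card + 1)) < b.succ ∧ g b.succ < g 0 then
          sgn ((D' ∘ g) 0 * (D' ∘ g) b.succ) else 1) =
        ∏ b : Fin ({a} : Finset (Fin r))ᶜ.card,
          (if c b < a then sgn ((D a + 1) * D (c b)) else 1) := by
      refine Finset.prod_congr rfl fun b _ => ?_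
      simp [g, D', hc b, Fin.succ_pos]
    rw [h6, h5]
    simp only [lt_irrefl, false_and, if_false, one_mul]
    refine Finset.prod_congr rfl fun b _ => ?_
    by_cases hb : b = a
    · subst hb; simp
    · simp [hb]
  have h7 : koszulSign D (frontKey {a}) = ∏ b, if b < a then sgn (D b * D a) else 1 := by
    unfold koszulSign
    refine Finset.prod_congr rfl fun b _ => ?_
    rw [Finset.prod_eq_single a]
    · simp only [frontKey_lt, Finset.mem_singleton, true_and]
      by_cases hb : b < a
      · simp [hb, hb.ne]
      · simp [hb]
    · intro b' _ hb'
      simp [frontKey_lt, hb']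
    · simp
  rw [h2, h7, ← Finset.prod_mul_distrib]
  refine Finset.prod_congr rfl fun b _ => ?_
  split_ifs
  · rw [← sgn_add]
    exact sgn_congr (D a * D b) (by ring)
  · simp

end MergeDifferential


/-! ### The brackets of the tensor product with forms -/

section MergeMultilinear

variable {𝕜 V V' : Type*} [Field 𝕜] [AddCommGroup V] [Module 𝕜 V] [AddCommGroup V'] [Module 𝕜 V']
  {r : ℕ}

lemma map_cons_zsmul (F : MultilinearMap 𝕜 (fun _ : Fin (r + 1) => V) V') (c : ℤ) (y : V)
    (x : Fin r → V) : F (Fin.cons (c • y) x : Fin (r + 1) → V) =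
      c • F (Fin.cons y x : Fin (r + 1) → V) := by
  rw [← Int.cast_smul_eq_zsmul 𝕜, MultilinearMap.cons_smul, Int.cast_smul_eq_zsmul]

lemma sub_update_of_mem {α : Type*} (x : Fin r → α) (S : Finset (Fin r)) (i : Fin S.card) (y : α) :
    sub (Function.update x (S.orderEmbOfFin rfl i) y) S = Function.update (sub x S) i y :=
  Function.update_comp_eq_of_injective x (S.orderEmbOfFin rfl).injective i y

lemma sub_update_of_notMem {α : Type*} (x : Fin r → α) {S : Finset (Fin r)} {a : Fin r}
    (ha : a ∉ S) (y : α) : sub (Function.update x a y) S = sub x S := by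
  funext b
  refine Function.update_of_ne (fun h => ha ?_) _ _
  rw [← h]
  exact Finset.orderEmbOfFin_mem S rfl b

lemma exists_orderEmbOfFin {S : Finset (Fin r)} {a : Fin r} (ha : a ∈ S) :
    ∃ i, S.orderEmbOfFin rfl i = a := by
  have h := Finset.range_orderEmbOfFin S rfl
  exact (Set.ext_iff.1 h a).2 ha

variable (q : (r : ℕ) → (Fin r → ℤ) → MultilinearMap 𝕜 (fun _ : Fin r => V) V)
  (F : (r : ℕ) → (Fin r → ℤ) → MultilinearMap 𝕜 (fun _ : Fin r => V) V')

lemma mergeTerm_eq_zero (D : Fin r → ℤ) (x : Fin r → V) (a : Fin r) (ha : x a = 0)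
    (S : Finset (Fin r)) : mergeTerm (fun r D x => q r D x) (fun r D x => F r D x) D x S = 0 := by
  unfold mergeTerm
  dsimp only
  by_cases haS : a ∈ S
  · obtain ⟨i, rfl⟩ := exists_orderEmbOfFin haS
    rw [(q _ _).map_coord_zero (m := sub x S) i ha, (F _ _).map_coord_zero 0 rfl, smul_zero]
  · obtain ⟨i, rfl⟩ := exists_orderEmbOfFin (Finset.mem_compl.2 haS)
    rw [(F _ _).map_coord_zero i.succ, smul_zero]
    rwa [Fin.cons_succ]

lemma mergeTerm_update_add (D : Fin r → ℤ) (x : Fin r → V) (a : Fin r) (y z : V)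
    (S : Finset (Fin r)) :
    mergeTerm (fun r D x => q r D x) (fun r D x => F r D x) D (Function.update x a (y + z)) S =
      mergeTerm (fun r D x => q r D x) (fun r D x => F r D x) D (Function.update x a y) S +
      mergeTerm (fun r D x => q r D x) (fun r D x => F r D x) D (Function.update x a z) S := by
  unfold mergeTerm
  by_cases haS : a ∈ S
  · have haS' : a ∉ Sᶜ := by simpa using haS
    obtain ⟨i, rfl⟩ := exists_orderEmbOfFin haS
    simp only [sub_update_of_notMem _ haS', sub_update_of_mem, MultilinearMap.map_update_add,
      MultilinearMap.cons_add, smul_add]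
  · obtain ⟨i, rfl⟩ := exists_orderEmbOfFin (Finset.mem_compl.2 haS)
    simp only [sub_update_of_notMem _ haS, sub_update_of_mem, MultilinearMap.map_update_add,
      Fin.cons_update, smul_add]

end MergeMultilinear

/-- A nilpotent `L∞`-algebra: graded brackets as in `LInftyAlgebra`, and a finite filtration that is
compatible with the brackets. -/
structure NilpotentBrackets (𝕜 M : Type*) [Field 𝕜] [AddCommGroup M] [Module 𝕜 M] where
  /-- the elements of a given degree -/
  deg : ℤ → Submodule 𝕜 M
  /-- the brackets -/
  bracket : (r : ℕ) → MultilinearMap 𝕜 (fun _ : Fin r => M) M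
  /-- the filtration -/
  fil : ℕ → Submodule 𝕜 M
  /-- the length of the filtration -/
  N : ℕ
  bracket_zero : bracket 0 = 0
  bracket_mem : ∀ (r : ℕ) (D : Fin r → ℤ) (x : Fin r → M), (∀ a, x a ∈ deg (D a)) →
    bracket r x ∈ deg ((∑ a, D a) + 2 - r)
  bracket_perm : ∀ (r : ℕ) (D : Fin r → ℤ) (x : Fin r → M), (∀ a, x a ∈ deg (D a)) →
    ∀ σ : Equiv.Perm (Fin r), bracket r (fun a => x (σ a)) =
      koszulSign (fun a => D a - 1) (σ.symm : Fin r → Fin r) • bracket r x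
  jacobi : ∀ (r : ℕ) (D : Fin r → ℤ) (x : Fin r → M), (∀ a, x a ∈ deg (D a)) →
    ∑ S : Finset (Fin r), koszulSign (fun a => D a - 1) (frontKey S) •
      bracket (Sᶜ.card + 1) (Fin.cons (bracket S.card (sub x S)) (sub x Sᶜ)) = 0
  fil_one : fil 1 = ⊤
  fil_anti : Antitone fil
  fil_N : fil N = ⊥
  bracket_fil : ∀ (r : ℕ) (k : Fin r → ℕ) (x : Fin r → M), (∀ a, x a ∈ fil (k a)) →
    bracket r x ∈ fil (∑ a, k a)

namespace NilpotentBrackets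

variable {𝕜 M : Type*} [Field 𝕜] [AddCommGroup M] [Module 𝕜 M] (B : NilpotentBrackets 𝕜 M) {n r : ℕ}

variable (n) in
/-- The elements of shifted degree `D` of `M ⊗ Ω_n`. -/
def U (D : ℤ) : Submodule 𝕜 (M ⊗[𝕜] Form 𝕜 n) := totalDeg B.deg (D + 1)

/-- Multilinear statements on homogeneous elements need to be checked on elementary tensors only. -/
lemma tensor_induction (D : Fin r → ℤ) {p : (Fin r → M ⊗[𝕜] Form 𝕜 n) → Prop}
    (zero : ∀ x a, x a = 0 → p x)
    (add : ∀ x a y z, p (Function.update x a y) → p (Function.update x a z) →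
      p (Function.update x a (y + z)))
    (tmul : ∀ (e : Fin r → ℕ) (v : Fin r → M) (w : Fin r → Form 𝕜 n),
      (∀ a, v a ∈ B.deg (D a + 1 - e a)) → (∀ a, IsDeg (e a) (w a)) → p fun a => v a ⊗ₜ w a)
    (x : Fin r → M ⊗[𝕜] Form 𝕜 n) (hx : ∀ a, x a ∈ B.U n (D a)) : p x := by
  refine multi_induction (fun a => homogTensors B.deg (D a)) zero add (fun x hx => ?_) x
    fun a => mem_closure_homogTensors (hx a)
  choose e v w hv hw h using hx
  rw [funext h]
  exact tmul e v w hv hw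

lemma scalarOps_mem (D : Fin r → ℤ) (x : Fin r → M ⊗[𝕜] Form 𝕜 n) (hx : ∀ a, x a ∈ B.U n (D a)) :
    scalarOps B.bracket r D x ∈ B.U n (∑ a, D a + 1) := by
  refine B.tensor_induction D (p := fun x => scalarOps B.bracket r D x ∈ B.U n (∑ a, D a + 1))
    (fun x a ha => ?_) (fun x a y z hy hz => ?_) (fun e v w hv hw => ?_) x hx
  · rw [MultilinearMap.map_coord_zero _ a ha]; exact zero_mem _
  · rw [MultilinearMap.map_update_add]; exact add_mem hy hz
  · rw [scalarOps_tmul _ _ e _ _ hw]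
    refine zsmul_mem (tmul_mem_totalDeg (e := ∑ a, e a) ?_ (isDeg_prod e w hw)) _
    have h := B.bracket_mem r _ v hv
    have h1 : ∑ a, (D a + 1 - (e a : ℤ)) + 2 - r = ∑ a, D a + 1 + 1 - ((∑ a, e a : ℕ) : ℤ) := by
      rw [Finset.sum_sub_distrib, Finset.sum_add_distrib]
      simp
      ring
    rwa [h1] at h

lemma diffOps_mem (D : Fin r → ℤ) (x : Fin r → M ⊗[𝕜] Form 𝕜 n) (hx : ∀ a, x a ∈ B.U n (D a)) :
    diffOps r D x ∈ B.U n (∑ a, D a + 1) := by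
  refine B.tensor_induction D (p := fun x => diffOps r D x ∈ B.U n (∑ a, D a + 1))
    (fun x a ha => ?_) (fun x a y z hy hz => ?_) (fun e v w hv hw => ?_) x hx
  · rw [MultilinearMap.map_coord_zero _ a ha]; exact zero_mem _
  · rw [MultilinearMap.map_update_add]; exact add_mem hy hz
  · rw [diffOps_apply]
    refine sum_mem fun a _ => ?_
    split_ifs with hr
    · subst hr
      rw [oddMap_tmul _ _ _ (hw a)]
      refine zsmul_mem (tmul_mem_totalDeg (e := e a + 1) ?_ (hw a).formD) _
      have h := hv a
      have h1 : ∑ a, D a = D a := by rw [Fin.sum_univ_one]; congr; omega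
      rw [h1]
      push_cast
      convert h using 2
      ring
    · exact zero_mem _

lemma isGradedSymm_scalarOps :
    IsGradedSymm (B.U n) (fun r D x => scalarOps B.bracket r D x) := by
  intro r D x hx σ
  refine B.tensor_induction D (p := fun x => scalarOps B.bracket r (fun a => D (σ a))
    (fun a => x (σ a)) = koszulSign D (σ.symm : Fin r → Fin r) • scalarOps B.bracket r D x)
    (fun x a ha => ?_) (fun x a y z hy hz => ?_) (fun e v w hv hw => ?_) x hx
  · rw [MultilinearMap.map_coord_zero _ a ha, MultilinearMap.map_coord_zero _ (σ.symm a), smul_zero]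
    simpa using ha
  · have h : ∀ y, (fun b => Function.update x a y (σ b)) =
        Function.update (fun b => x (σ b)) (σ.symm a) y := fun y =>
      Function.update_comp_equiv x σ a y
    rw [h] at hy hz ⊢
    rw [MultilinearMap.map_update_add, MultilinearMap.map_update_add, hy, hz, smul_add]
  · rw [scalarOps_tmul _ _ e _ _ hw, scalarOps_tmul _ _ _ _ _ fun a => hw (σ a),
      B.bracket_perm r _ v hv σ, prod_perm σ e w hw, smul_smul, ← shuffle_perm, mul_smul, mul_smul,
      TensorProduct.tmul_smul, ← TensorProduct.smul_tmul']
    have h1 : (fun a => D a + 1 - (e a : ℤ) - 1) = fun a => D a - e a := by funext a; ring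
    rw [h1]
    exact congrArg _ (smul_comm _ _ _)

lemma isGradedSymm_diffOps :
    IsGradedSymm (B.U n) (fun r D x => diffOps (𝕜 := 𝕜) (M := M) (n := n) r D x) := by
  intro r D x _ σ
  match r, D, x, σ with
  | 0, D, x, σ => simp [diffOps]
  | 1, D, x, σ =>
    have h : koszulSign D (σ.symm : Fin 1 → Fin 1) = 1 := by simp [koszulSign]
    rw [h, one_smul, Subsingleton.elim σ 1]
    rfl
  | r + 2, D, x, σ => simp [diffOps]

/-! #### The generalized Jacobi identities -/

lemma sum_mergeTerm_scalarOps (D : Fin r → ℤ) (e : Fin r → ℕ) (v : Fin r → M)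
    (w : Fin r → Form 𝕜 n) (hv : ∀ a, v a ∈ B.deg (D a + 1 - e a)) (hw : ∀ a, IsDeg (e a) (w a)) :
    ∑ S : Finset (Fin r), mergeTerm (fun r D x => scalarOps B.bracket r D x)
      (fun r D x => scalarOps B.bracket r D x) D (fun a => v a ⊗ₜ w a) S = 0 := by
  have h : ∀ S : Finset (Fin r), mergeTerm (fun r D x => scalarOps B.bracket r D x)
      (fun r D x => scalarOps B.bracket r D x) D (fun a => v a ⊗ₜ w a) S =
      shuffle D e • (koszulSign (fun a => D a - e a) (frontKey S) •
        B.bracket (Sᶜ.card + 1) (Fin.cons (B.bracket S.card (sub v S)) (sub v Sᶜ))) ⊗ₜ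
          (List.ofFn w).prod := by
    intro S
    have h1 : scalarOps B.bracket S.card (sub D S) (sub (fun a => v a ⊗ₜ[𝕜] w a) S) =
        shuffle (sub D S) (sub e S) • B.bracket S.card (sub v S) ⊗ₜ (List.ofFn (sub w S)).prod :=
      scalarOps_tmul _ _ (sub e S) _ _ fun a => hw _
    have h2 : (Fin.cons (B.bracket S.card (sub v S) ⊗ₜ (List.ofFn (sub w S)).prod)
        (sub (fun a => v a ⊗ₜ[𝕜] w a) Sᶜ) : Fin (Sᶜ.card + 1) → M ⊗[𝕜] Form 𝕜 n) = fun a =>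
        (Fin.cons (B.bracket S.card (sub v S)) (sub v Sᶜ) : Fin (Sᶜ.card + 1) → M) a ⊗ₜ
        (Fin.cons (List.ofFn (sub w S)).prod (sub w Sᶜ) : Fin (Sᶜ.card + 1) → Form 𝕜 n) a := by
      funext a
      refine Fin.cases ?_ (fun a => ?_) a <;> rfl
    unfold mergeTerm
    dsimp only
    rw [h1, map_cons_zsmul, h2, scalarOps_tmul _ _
      (Fin.cons (∑ a, sub e S a) (sub e Sᶜ) : Fin (Sᶜ.card + 1) → ℕ), prod_ofFn_succ]
    · simp only [Fin.cons_zero, Fin.cons_succ]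
      rw [prod_sub_mul_prod_sub e w hw S, TensorProduct.tmul_smul, ← TensorProduct.smul_tmul',
        smul_smul, smul_smul, smul_smul, smul_smul, mul_comm (shuffle D e), ← shuffle_merge]
      simp only [mul_assoc]
    · refine Fin.cases ?_ fun a => ?_
      · exact isDeg_prod _ _ fun a => hw _
      · exact hw _
  simp only [h]
  rw [← Finset.smul_sum, ← TensorProduct.sum_tmul]
  have h3 := B.jacobi r _ v hv
  have h1 : (fun a => D a + 1 - (e a : ℤ) - 1) = fun a => D a - e a := by funext a; ring
  rw [h1] at h3
  rw [h3, TensorProduct.zero_tmul, smul_zero]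

lemma sum_mergeTerm_diffOps_scalarOps (D : Fin r → ℤ) (e : Fin r → ℕ) (v : Fin r → M)
    (w : Fin r → Form 𝕜 n) (hv : ∀ a, v a ∈ B.deg (D a + 1 - e a)) (hw : ∀ a, IsDeg (e a) (w a)) :
    ∑ S : Finset (Fin r), mergeTerm (fun r D x => diffOps r D x)
      (fun r D x => scalarOps B.bracket r D x) D (fun a => v a ⊗ₜ w a) S =
    sgn (∑ a, (D a - e a)) • shuffle D e • B.bracket r v ⊗ₜ formD 𝕜 n (List.ofFn w).prod := by
  have hx : ∀ a, v a ⊗ₜ w a ∈ B.U n (D a) := fun a => tmul_mem_totalDeg (hv a) (hw a)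
  have h0 : ∀ S ∉ Finset.univ.map ⟨fun a : Fin r => ({a} : Finset (Fin r)),
      Finset.singleton_injective⟩, mergeTerm (fun r D x => diffOps r D x)
      (fun r D x => scalarOps B.bracket r D x) D (fun a => v a ⊗ₜ[𝕜] w a) S = 0 := by
    intro S hS
    have hS : S.card ≠ 1 := by
      intro h
      obtain ⟨a, ha⟩ := Finset.card_eq_one.1 h
      exact hS (by simp [ha])
    unfold mergeTerm
    dsimp only
    rw [diffOps_apply, (scalarOps B.bracket _ _).map_coord_zero 0, smul_zero]
    simp [hS]
  rw [← Finset.sum_subset (Finset.subset_univ _) fun S _ hS => h0 S hS, Finset.sum_map,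
    formD_prod e w hw, TensorProduct.tmul_sum, Finset.smul_sum, Finset.smul_sum]
  refine Finset.sum_congr rfl fun a _ => ?_
  have hd : diffOps 1 (fun _ => D a) (fun _ => v a ⊗ₜ[𝕜] w a) =
      sgn (D a - e a) • v a ⊗ₜ formD 𝕜 n (w a) := oddMap_tmul _ _ _ (hw a)
  have h1 := mergeTerm_singleton (q := fun r D x => diffOps (𝕜 := 𝕜) (M := M) (n := n) r D x)
    (B.isGradedSymm_scalarOps (n := n)) D (fun a => v a ⊗ₜ[𝕜] w a) hx a (by
      have := B.diffOps_mem (n := n) (r := 1) (fun _ => D a) (fun _ => v a ⊗ₜ[𝕜] w a) fun _ => hx a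
      simpa using this)
  refine h1.trans ?_
  have h2 : Function.update (fun a => v a ⊗ₜ[𝕜] w a) a (v a ⊗ₜ formD 𝕜 n (w a)) =
      fun b => v b ⊗ₜ Function.update w a (formD 𝕜 n (w a)) b := by
    funext b
    by_cases hb : b = a
    · subst hb; simp
    · simp [hb]
  rw [hd, ← Int.cast_smul_eq_zsmul 𝕜 (sgn (D a - e a)), MultilinearMap.map_update_smul,
    Int.cast_smul_eq_zsmul, h2, scalarOps_tmul _ _ (Function.update e a (e a + 1)),
    TensorProduct.tmul_smul, smul_smul, smul_smul, mul_assoc, shuffle_update, mul_smul,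
    mul_comm _ (shuffle D e), mul_smul]
  intro b
  by_cases hb : b = a
  · subst hb; simpa using (hw b).formD
  · simpa [hb] using hw b

lemma sum_mergeTerm_diffOps (q : Ops (M ⊗[𝕜] Form 𝕜 n) (M ⊗[𝕜] Form 𝕜 n)) (D : Fin r → ℤ)
    (x : Fin r → M ⊗[𝕜] Form 𝕜 n) :
    ∑ S : Finset (Fin r), mergeTerm q (fun r D x => diffOps r D x) D x S =
      oddMap (formD 𝕜 n) (∑ a, D a + 1) (q r D x) := by
  unfold mergeTerm
  simp only [diffOps_cons]
  rw [Finset.sum_eq_single Finset.univ]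
  · rw [if_pos (by simp), ops_sub_univ q D x]
    have h : koszulSign D (frontKey Finset.univ) = 1 :=
      koszulSign_of_even _ _ fun a b _ h => absurd ((frontKey_lt _ _ _).1 h).2 (by simp)
    rw [h, one_smul]
  · intro S _ hS
    rw [if_neg, smul_zero]
    rw [Finset.card_eq_zero, Finset.compl_eq_empty_iff]
    exact hS
  · simp

/-- The brackets of `M ⊗ Ω_n`. -/
def tensorBrackets (r : ℕ) (D : Fin r → ℤ) :
    MultilinearMap 𝕜 (fun _ : Fin r => M ⊗[𝕜] Form 𝕜 n) (M ⊗[𝕜] Form 𝕜 n) :=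
  scalarOps B.bracket r D + diffOps r D

lemma tensorBrackets_apply (D : Fin r → ℤ) (x : Fin r → M ⊗[𝕜] Form 𝕜 n) :
    B.tensorBrackets r D x = scalarOps B.bracket r D x + diffOps r D x := rfl

lemma mergeTerm_tensorBrackets (D : Fin r → ℤ) (x : Fin r → M ⊗[𝕜] Form 𝕜 n) (S : Finset (Fin r)) :
    mergeTerm (fun r D x => B.tensorBrackets r D x) (fun r D x => B.tensorBrackets r D x) D x S =
      mergeTerm (fun r D x => scalarOps B.bracket r D x)
        (fun r D x => scalarOps B.bracket r D x) D x S +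
      mergeTerm (fun r D x => diffOps r D x) (fun r D x => scalarOps B.bracket r D x) D x S +
      (mergeTerm (fun r D x => scalarOps B.bracket r D x) (fun r D x => diffOps r D x) D x S +
      mergeTerm (fun r D x => diffOps r D x) (fun r D x => diffOps r D x) D x S) := by
  unfold mergeTerm
  simp only [tensorBrackets_apply, MultilinearMap.cons_add, smul_add]
  abel

variable [CharZero 𝕜]

lemma oddMap_formD_oddMap_formD (D : ℤ) (x : M ⊗[𝕜] Form 𝕜 n) :
    oddMap (formD 𝕜 n) (D + 1) (oddMap (formD 𝕜 n) D x) = 0 := by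
  induction x with
  | zero => simp
  | add x y hx hy => rw [map_add, map_add, hx, hy, add_zero]
  | tmul v w =>
    rw [← sum_range_part (v ⊗ₜ[𝕜] w), map_sum, map_sum]
    refine Finset.sum_eq_zero fun e _ => ?_
    have h := isDeg_formProj e w
    have h1 : formD 𝕜 n (formD 𝕜 n (formProj 𝕜 n e w)) = 0 :=
      LinearMap.congr_fun (opD_mul_opD (𝕜 := 𝕜)) _
    rw [part_tmul, oddMap_tmul _ _ _ h, map_zsmul, oddMap_tmul _ _ _ h.formD, h1]
    simp

lemma diffOps_diffOps (D : Fin r → ℤ) (x : Fin r → M ⊗[𝕜] Form 𝕜 n) :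
    oddMap (formD 𝕜 n) (∑ a, D a + 1) (diffOps r D x) = 0 := by
  rw [diffOps_apply, map_sum]
  refine Finset.sum_eq_zero fun a _ => ?_
  split_ifs with hr
  · subst hr
    have h1 : ∑ a, D a = D a := by rw [Fin.sum_univ_one]; congr; omega
    rw [h1, oddMap_formD_oddMap_formD]
  · rw [map_zero]

lemma jacobi_tensorBrackets (D : Fin r → ℤ) (x : Fin r → M ⊗[𝕜] Form 𝕜 n)
    (hx : ∀ a, x a ∈ B.U n (D a)) :
    ∑ S : Finset (Fin r), mergeTerm (fun r D x => B.tensorBrackets r D x)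
      (fun r D x => B.tensorBrackets r D x) D x S = 0 := by
  refine B.tensor_induction D (p := fun x => ∑ S : Finset (Fin r), mergeTerm
    (fun r D x => B.tensorBrackets r D x) (fun r D x => B.tensorBrackets r D x) D x S = 0)
    (fun x a ha => ?_) (fun x a y z hy hz => ?_) (fun e v w hv hw => ?_) x hx
  · exact Finset.sum_eq_zero fun S _ => mergeTerm_eq_zero _ _ D x a ha S
  · simp only [mergeTerm_update_add, Finset.sum_add_distrib, hy, hz, add_zero]
  · simp only [mergeTerm_tensorBrackets, Finset.sum_add_distrib]
    rw [B.sum_mergeTerm_scalarOps D e v w hv hw, B.sum_mergeTerm_diffOps_scalarOps D e v w hv hw,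
      sum_mergeTerm_diffOps, sum_mergeTerm_diffOps, diffOps_diffOps, scalarOps_tmul _ _ e _ _ hw,
      map_zsmul, oddMap_tmul _ _ _ (isDeg_prod e w hw)]
    have h : sgn (∑ a, D a + 1 - (∑ a, e a : ℕ)) = -sgn (∑ a, (D a - e a)) := by
      rw [← sgn_add_one, Finset.sum_sub_distrib]
      congr 1
      push_cast
      ring
    rw [h, neg_smul, smul_neg, smul_comm]
    simp

end NilpotentBrackets


/-! ### Dupont's contraction of the tensor product with forms -/

section DupontForms

variable {𝕜 : Type*} [Field 𝕜] {n : ℕ}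

lemma isDeg_zero (e : ℕ) : IsDeg e (0 : Form 𝕜 n) := map_zero _

variable [CharZero 𝕜]

lemma formProj_dupontH (e : ℕ) (w : Form 𝕜 n) :
    formProj 𝕜 n e (dupontH 𝕜 n w) = dupontH 𝕜 n (formProj 𝕜 n (e + 1) w) := by
  rw [dupontH_eq]
  exact LinearMap.congr_fun ((dupontSystem 𝕜 n).P_h e) w

lemma dupontH_formProj_zero (w : Form 𝕜 n) : dupontH 𝕜 n (formProj 𝕜 n 0 w) = 0 := by
  rw [dupontH_eq]
  exact LinearMap.congr_fun (dupontSystem 𝕜 n).h_P_zero w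

lemma IsDeg.dupontH {e : ℕ} {w : Form 𝕜 n} (hw : IsDeg (e + 1) w) :
    IsDeg e (DHG.dupontH 𝕜 n w) := by
  rw [IsDeg, formProj_dupontH, hw]

lemma IsDeg.dupontH_eq_zero {w : Form 𝕜 n} (hw : IsDeg 0 w) : DHG.dupontH 𝕜 n w = 0 := by
  rw [← hw, dupontH_formProj_zero]

/-- Dupont's homotopy reverses the parity of forms. -/
lemma IsDeg.exists_dupontH {e : ℕ} {w : Form 𝕜 n} (hw : IsDeg e w) :
    ∃ e' : ℕ, IsDeg e' (DHG.dupontH 𝕜 n w) ∧ sgn e' = -sgn e := by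
  cases e with
  | zero => exact ⟨1, by rw [hw.dupontH_eq_zero]; exact isDeg_zero 1, by simp⟩
  | succ e => exact ⟨e, hw.dupontH, by push_cast; rw [sgn_add_one, neg_neg]⟩

variable (𝕜 n) in
/-- The projection `i_n p_n` of Dupont's contraction. -/
def dupontProj : Form 𝕜 n →ₗ[𝕜] Form 𝕜 n := (basicForms 𝕜 n).subtype ∘ₗ dupontP 𝕜 n

lemma dupont_homotopy (w : Form 𝕜 n) :
    formD 𝕜 n (dupontH 𝕜 n w) + dupontH 𝕜 n (formD 𝕜 n w) = w - dupontProj 𝕜 n w := by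
  rw [dupontProj, subtype_comp_dupontP, dupontH_eq]
  exact LinearMap.congr_fun (dupontSystem 𝕜 n).homotopy w

lemma dupontH_dupontH (w : Form 𝕜 n) : dupontH 𝕜 n (dupontH 𝕜 n w) = 0 := by
  rw [dupontH_eq]
  exact LinearMap.congr_fun (dupontSystem 𝕜 n).h_h w

lemma dupontH_dupontProj (w : Form 𝕜 n) : dupontH 𝕜 n (dupontProj 𝕜 n w) = 0 := by
  rw [dupontProj, subtype_comp_dupontP, dupontH_eq]
  exact LinearMap.congr_fun (dupontSystem 𝕜 n).h_proj w

lemma dupontProj_dupontH (w : Form 𝕜 n) : dupontProj 𝕜 n (dupontH 𝕜 n w) = 0 := by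
  rw [dupontProj, subtype_comp_dupontP, dupontH_eq]
  exact LinearMap.congr_fun (dupontSystem 𝕜 n).proj_h w

lemma dupontProj_dupontProj (w : Form 𝕜 n) :
    dupontProj 𝕜 n (dupontProj 𝕜 n w) = dupontProj 𝕜 n w := by
  rw [dupontProj, subtype_comp_dupontP]
  exact LinearMap.congr_fun (dupontSystem 𝕜 n).proj_proj w

/-- The image of the homotopy vanishes at the vertices of the simplex. -/
lemma evalAt_dupontH (i : Fin (n + 1)) (w : Form 𝕜 n) :
    evalAt 𝕜 (vertex 𝕜 n i) (dupontH 𝕜 n w) = 0 := by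
  have h : opEv 𝕜 i (dupontH 𝕜 n w) = 0 := by
    rw [dupontH_eq]
    exact LinearMap.congr_fun ((dupontSystem 𝕜 n).E_h i) w
  have h2 := congrArg (evalAt 𝕜 (vertex 𝕜 n i)) h
  rwa [evalAt_opEv, map_zero] at h2

end DupontForms

section TensorContraction

variable {𝕜 : Type*} [Field 𝕜] {M : Type*} [AddCommGroup M] [Module 𝕜 M] {n r : ℕ}

/-- Linear statements on `M ⊗ Ω_n` need to be checked on tensors with homogeneous forms only. -/
lemma isDeg_induction {p : M ⊗[𝕜] Form 𝕜 n → Prop} (zero : p 0)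
    (add : ∀ x y, p x → p y → p (x + y))
    (tmul : ∀ (e : ℕ) (v : M) (w : Form 𝕜 n), IsDeg e w → p (v ⊗ₜ w)) (x : M ⊗[𝕜] Form 𝕜 n) :
    p x := by
  induction x with
  | zero => exact zero
  | add x y hx hy => exact add x y hx hy
  | tmul v w =>
    rw [← sum_range_part (v ⊗ₜ[𝕜] w)]
    exact Finset.sum_induction _ p add zero fun e _ => tmul e v _ (isDeg_formProj e w)

lemma mem_closure_map₂_mk {P : Submodule 𝕜 M} {x : M ⊗[𝕜] Form 𝕜 n}
    (hx : x ∈ Submodule.map₂ (TensorProduct.mk 𝕜 M (Form 𝕜 n)) P ⊤) :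
    x ∈ AddSubmonoid.closure {x : M ⊗[𝕜] Form 𝕜 n | ∃ v w, v ∈ P ∧ x = v ⊗ₜ w} := by
  rw [Submodule.map₂_eq_span_image2] at hx
  induction hx using Submodule.span_induction with
  | mem x hx =>
    obtain ⟨v, hv, w, _, rfl⟩ := hx
    exact AddSubmonoid.subset_closure ⟨v, w, hv, rfl⟩
  | zero => exact zero_mem _
  | add x y _ _ hx hy => exact add_mem hx hy
  | smul c y hy' hy =>
    clear hy'
    induction hy using AddSubmonoid.closure_induction with
    | mem y hy =>
      obtain ⟨v, w, hv, rfl⟩ := hy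
      exact AddSubmonoid.subset_closure
        ⟨c • v, w, Submodule.smul_mem _ c hv, by rw [TensorProduct.smul_tmul']⟩
    | zero => rw [smul_zero]; exact zero_mem _
    | add y z _ _ hy hz => rw [smul_add]; exact add_mem hy hz

lemma oddMap_mem_map₂_mk (P : Submodule 𝕜 M) (u : Form 𝕜 n →ₗ[𝕜] Form 𝕜 n) (D : ℤ)
    {x : M ⊗[𝕜] Form 𝕜 n} (hx : x ∈ Submodule.map₂ (TensorProduct.mk 𝕜 M (Form 𝕜 n)) P ⊤) :
    oddMap u D x ∈ Submodule.map₂ (TensorProduct.mk 𝕜 M (Form 𝕜 n)) P ⊤ := by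
  have h := mem_closure_map₂_mk hx
  clear hx
  induction h using AddSubmonoid.closure_induction with
  | mem x hx =>
    obtain ⟨v, w, hv, rfl⟩ := hx
    unfold oddMap
    rw [LinearMap.sum_apply]
    exact sum_mem fun e _ => zsmul_mem (Submodule.apply_mem_map₂ (TensorProduct.mk 𝕜 M _)
      hv (Submodule.mem_top : u (formProj 𝕜 n e w) ∈ ⊤)) _
  | zero => rw [map_zero]; exact zero_mem _
  | add x y _ _ hx hy => rw [map_add]; exact add_mem hx hy

lemma oddMap_dupontH_eq_zero [CharZero 𝕜] (D : ℤ) (v : M) {w : Form 𝕜 n}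
    (hw : dupontH 𝕜 n w = 0) : oddMap (dupontH 𝕜 n) D (v ⊗ₜ[𝕜] w) = 0 := by
  unfold oddMap
  rw [LinearMap.sum_apply]
  refine Finset.sum_eq_zero fun e _ => ?_
  have h : ∀ e, dupontH 𝕜 n (formProj 𝕜 n e w) = 0 := by
    intro e
    cases e with
    | zero => exact dupontH_formProj_zero w
    | succ e => rw [← formProj_dupontH, hw, map_zero]
  rw [LinearMap.smul_apply, LinearMap.comp_apply, part_tmul, LinearMap.lTensor_tmul, h,
    TensorProduct.tmul_zero, smul_zero]

lemma scalarOps_one_tmul (f : (r : ℕ) → MultilinearMap 𝕜 (fun _ : Fin r => M) M) (D : Fin 1 → ℤ)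
    {e : ℕ} (v : M) {w : Form 𝕜 n} (hw : IsDeg e w) :
    scalarOps f 1 D (fun _ => v ⊗ₜ w) = f 1 (fun _ => v) ⊗ₜ w := by
  rw [scalarOps_tmul f D (fun _ => e) (fun _ => v) (fun _ => w) fun _ => hw]
  simp [shuffle]

lemma diffOps_one (D : ℤ) (x : M ⊗[𝕜] Form 𝕜 n) :
    diffOps 1 (fun _ => D) (fun _ => x) = oddMap (formD 𝕜 n) D x := rfl

variable [CharZero 𝕜] (B : NilpotentBrackets 𝕜 M)

variable (n) in
/-- The contraction `(1 ⊗ p_n, 1 ⊗ i_n, 1 ⊗ h_n)`. -/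
def NilpotentBrackets.contraction :
    Contraction 𝕜 (M ⊗[𝕜] Form 𝕜 n) (M ⊗[𝕜] basicForms 𝕜 n) where
  U := B.U n
  Fil k := Submodule.map₂ (TensorProduct.mk 𝕜 M (Form 𝕜 n)) (B.fil k) ⊤
  N := B.N
  q := B.tensorBrackets
  h D := oddMap (dupontH 𝕜 n) D
  i := (basicForms 𝕜 n).subtype.lTensor M
  p := (dupontP 𝕜 n).lTensor M
  q_zero D := by
    ext x
    have h : x = fun a => (a.elim0 : M) ⊗ₜ (a.elim0 : Form 𝕜 n) := funext fun a => a.elim0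
    rw [B.tensorBrackets_apply, h, scalarOps_tmul _ _ (fun a => a.elim0) _ _ fun a => a.elim0,
      B.bracket_zero]
    simp [diffOps]
  q_mem r D x hx := add_mem (B.scalarOps_mem D x hx) (B.diffOps_mem D x hx)
  q_symm r D x hx σ := by
    have h1 := B.isGradedSymm_scalarOps r D x hx σ
    have h2 := B.isGradedSymm_diffOps r D x hx σ
    dsimp only at h1 h2 ⊢
    rw [B.tensorBrackets_apply, B.tensorBrackets_apply, h1, h2, smul_add]
  q_jacobi r D x hx := B.jacobi_tensorBrackets D x hx
  Fil_one := by rw [B.fil_one, TensorProduct.map₂_mk_top_top_eq_top]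
  Fil_anti _ _ h := Submodule.map₂_le_map₂ (B.fil_anti h) le_rfl
  Fil_N := by rw [B.fil_N, Submodule.map₂_bot_left]
  q_fil r D k x hx := by
    refine add_mem ?_ ?_
    · refine multi_induction (fun a => {x : M ⊗[𝕜] Form 𝕜 n | ∃ v w, v ∈ B.fil (k a) ∧ x = v ⊗ₜ w})
        (p := fun x => scalarOps B.bracket r D x ∈ Submodule.map₂ (TensorProduct.mk 𝕜 M (Form 𝕜 n))
          (B.fil (∑ a, k a)) ⊤)
        (fun x a ha => ?_) (fun x a y z hy hz => ?_) (fun x hx => ?_) x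
        fun a => mem_closure_map₂_mk (hx a)
      · rw [MultilinearMap.map_coord_zero _ a ha]; exact zero_mem _
      · rw [MultilinearMap.map_update_add]; exact add_mem hy hz
      · choose v w hv h using hx
        rw [funext h, scalarOps_apply]
        refine sum_mem fun e _ => zsmul_mem ?_ _
        simp only [part_tmul, extendScalars_tmul]
        exact Submodule.apply_mem_map₂ _ (B.bracket_fil r k v hv) trivial
    · rw [diffOps_apply]
      refine sum_mem fun a _ => ?_
      split_ifs with hr
      · subst hr
        have h1 : ∑ a, k a = k a := by rw [Fin.sum_univ_one]; congr; omega
        rw [h1]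
        exact oddMap_mem_map₂_mk _ _ _ (hx a)
      · exact zero_mem _
  h_mem D x hx := by
    have h := mem_closure_homogTensors hx
    clear hx
    induction h using AddSubmonoid.closure_induction with
    | mem x hx =>
      obtain ⟨e, v, w, hv, hw, rfl⟩ := hx
      rw [oddMap_tmul _ _ _ hw]
      refine zsmul_mem ?_ _
      cases e with
      | zero => rw [hw.dupontH_eq_zero, TensorProduct.tmul_zero]; exact zero_mem _
      | succ e =>
        refine tmul_mem_totalDeg ?_ hw.dupontH
        convert hv using 2
        push_cast
        ring
    | zero => rw [map_zero]; exact zero_mem _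
    | add x y _ _ hx hy => rw [map_add]; exact add_mem hx hy
  h_fil D k x hx := oddMap_mem_map₂_mk _ _ _ hx
  homotopy D x := by
    simp only [B.tensorBrackets_apply, diffOps_one]
    let s (D : ℤ) := (MultilinearMap.ofSubsingleton 𝕜 _ _ 0).symm
      (scalarOps (n := n) B.bracket 1 fun _ => D)
    have hs : ∀ D (x : M ⊗[𝕜] Form 𝕜 n), scalarOps B.bracket 1 (fun _ => D) (fun _ => x) = s D x :=
      fun D x => rfl
    simp only [hs]
    induction x using isDeg_induction with
    | zero => simp
    | add x y hx hy =>
      simp only [map_add] at hx hy ⊢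
      rw [add_sub_add_comm, ← hx, ← hy]
      abel
    | tmul e v w hw =>
      obtain ⟨e', he', hs'⟩ := hw.exists_dupontH
      have h1 : ∀ D, s D (v ⊗ₜ w) = B.bracket 1 (fun _ => v) ⊗ₜ w :=
        fun D => scalarOps_one_tmul _ _ _ hw
      have h2 : ∀ D, s D (v ⊗ₜ dupontH 𝕜 n w) = B.bracket 1 (fun _ => v) ⊗ₜ dupontH 𝕜 n w :=
        fun D => scalarOps_one_tmul _ _ _ he'
      rw [oddMap_tmul _ _ _ hw, map_zsmul, map_zsmul, h2, oddMap_tmul _ _ _ he', h1, map_add,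
        oddMap_tmul _ _ _ hw, oddMap_tmul _ _ _ hw, map_zsmul, oddMap_tmul _ _ _ hw.formD]
      have e1 : sgn (D - 1 - e') = sgn (D - e) := by
        rw [sgn_sub, hs', sgn_sub_one, sgn_sub, neg_mul_neg]
      have e2 : sgn (D + 1 - (e + 1 : ℕ)) = sgn (D - e) := by congr 1; push_cast; ring
      have e3 : sgn (D + 1 - e) = -sgn (D - e) := by rw [← sgn_add_one]; congr 1; ring
      rw [e1, e2, e3, smul_smul, smul_smul, sgn_mul_self, one_smul, one_smul, neg_smul]
      change _ = v ⊗ₜ[𝕜] w - v ⊗ₜ[𝕜] dupontProj 𝕜 n w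
      rw [← TensorProduct.tmul_sub, ← dupont_homotopy, TensorProduct.tmul_add]
      abel
  h_h D x := by
    induction x using isDeg_induction with
    | zero => simp
    | add x y hx hy => rw [map_add, map_add, hx, hy, add_zero]
    | tmul e v w hw =>
      obtain ⟨e', he', -⟩ := hw.exists_dupontH
      rw [oddMap_tmul _ _ _ hw, map_zsmul, oddMap_tmul _ _ _ he', dupontH_dupontH]
      simp
  h_i_p D x := by
    induction x with
    | zero => simp
    | add x y hx hy => rw [map_add, map_add, map_add, hx, hy, add_zero]
    | tmul v w => exact oddMap_dupontH_eq_zero D v (dupontH_dupontProj w)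
  i_p_h D x := by
    induction x using isDeg_induction with
    | zero => simp
    | add x y hx hy => rw [map_add, map_add, map_add, hx, hy, add_zero]
    | tmul e v w hw =>
      rw [oddMap_tmul _ _ _ hw, map_zsmul, map_zsmul]
      change _ • v ⊗ₜ dupontProj 𝕜 n (dupontH 𝕜 n w) = 0
      rw [dupontProj_dupontH, TensorProduct.tmul_zero, smul_zero]
  i_p_i_p x := by
    induction x with
    | zero => simp
    | add x y hx hy => simp only [map_add, hx, hy]
    | tmul v w => exact congrArg (v ⊗ₜ[𝕜] ·) (dupontProj_dupontProj w)
  i_injective := Module.Flat.lTensor_preserves_injective_linearMap _ (Submodule.subtype_injective _)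

end TensorContraction


/-! ### Naturality of the homotopy transfer -/

section Naturality

variable {𝕜 : Type*} [Field 𝕜] {V V' W W' : Type*} [AddCommGroup V] [Module 𝕜 V]
  [AddCommGroup V'] [Module 𝕜 V'] [AddCommGroup W] [Module 𝕜 W] [AddCommGroup W'] [Module 𝕜 W']
  {q : Ops V V} {q' : Ops V' V'} {h : ℤ → V → V} {h' : ℤ → V' → V'} {i : W → V} {i' : W' → V'}
  {p : V → W} {p' : V' → W'} (Φ : V →ₗ[𝕜] V') (Ψ : W →ₗ[𝕜] W')

lemma map_transferI (hq : ∀ r D x, Φ (q r D x) = q' r D (fun a => Φ (x a)))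
    (hh : ∀ D x, Φ (h D x) = h' D (Φ x)) (hi : ∀ w, Φ (i w) = i' (Ψ w)) (r : ℕ) :
    ∀ (D : Fin r → ℤ) (x : Fin r → W), Φ (transferI 𝕜 q h i r D x) =
      transferI 𝕜 q' h' i' r D (fun a => Ψ (x a)) := by
  induction r using Nat.strong_induction_on with
  | _ r ih =>
    intro D x
    match r, ih, D, x with
    | 0, _, D, x => simp [transferI]
    | 1, _, D, x => simp [transferI, hi]
    | r + 2, ih, D, x =>
      conv_lhs => rw [transferI]
      conv_rhs => rw [transferI]
      simp only [map_neg, hh, map_sum, map_smul, map_zsmul, hq]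
      refine congrArg (fun z => -h' _ z) (Finset.sum_congr rfl fun k _ => congrArg _
        (Finset.sum_congr rfl fun f _ => congrArg _ (congrArg _ (funext fun j => ?_))))
      exact ih _ (block_card_lt f j) _ _

lemma map_homotopyWord (hh : ∀ D x, Φ (h D x) = h' D (Φ x)) (hi : ∀ w, Φ (i w) = i' (Ψ w))
    (hp : ∀ x, Ψ (p x) = p' (Φ x)) {r : ℕ} (D : Fin r → ℤ) (x : Fin r → V) (j : Fin r) :
    (fun a => Φ (homotopyWord h i p D x j a)) =
      homotopyWord h' i' p' D (fun a => Φ (x a)) j := by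
  funext a
  unfold homotopyWord
  split_ifs <;> simp [hh, hi, hp]

/-- The recursion for `p_∞` is natural in the data of the contraction. -/
lemma map_transferP (hq : ∀ r D x, Φ (q r D x) = q' r D (fun a => Φ (x a)))
    (hh : ∀ D x, Φ (h D x) = h' D (Φ x)) (hi : ∀ w, Φ (i w) = i' (Ψ w))
    (hp : ∀ x, Ψ (p x) = p' (Φ x)) (r : ℕ) :
    ∀ (D : Fin r → ℤ) (x : Fin r → V), Ψ (transferP 𝕜 q h i p r D x) =
      transferP 𝕜 q' h' i' p' r D (fun a => Φ (x a)) := by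
  induction r using Nat.strong_induction_on with
  | _ r ih =>
    intro D x
    match r, ih, D, x with
    | 0, _, D, x => simp [transferP]
    | 1, _, D, x => simp [transferP, hp]
    | r + 2, ih, D, x =>
      conv_lhs => rw [transferP]
      conv_rhs => rw [transferP]
      simp only [map_sum, map_smul, map_zsmul]
      refine congrArg _ (Finset.sum_congr rfl fun σ _ => Finset.sum_congr rfl fun j _ => congrArg _
        (Finset.sum_congr rfl fun S _ => congrArg _ ?_))
      rw [ih _ (compl_card_lt S)]
      refine congrArg _ (funext fun a => ?_)
      rw [← map_homotopyWord Φ Ψ hh hi hp]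
      refine Fin.cases ?_ (fun a => rfl) a
      exact hq _ _ _

lemma map_diagonalSum {f : Ops V W} {f' : Ops V' W'}
    (hf : ∀ r D x, Ψ (f r D x) = f' r D (fun a => Φ (x a))) (x : V) (N : ℕ)
    (h0 : ∀ r, N < r → f r (fun _ => 0) (fun _ => x) = 0) :
    Ψ (diagonalSum 𝕜 f x) = diagonalSum 𝕜 f' (Φ x) := by
  rw [diagonalSum_eq_sum f x N h0, diagonalSum_eq_sum f' (Φ x) N fun r hr => by
    rw [← hf, h0 r hr, map_zero], map_sum]
  exact Finset.sum_congr rfl fun r _ => by rw [map_smul, hf]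

end Naturality

section TensorNaturality

variable {𝕜 : Type*} [Field 𝕜] {M M' : Type*} [AddCommGroup M] [Module 𝕜 M] [AddCommGroup M']
  [Module 𝕜 M'] {n : ℕ} (f : M →ₗ[𝕜] M')

lemma rTensor_oddMap (u : Form 𝕜 n →ₗ[𝕜] Form 𝕜 n) (D : ℤ) (x : M ⊗[𝕜] Form 𝕜 n) :
    f.rTensor (Form 𝕜 n) (oddMap u D x) = oddMap u D (f.rTensor (Form 𝕜 n) x) := by
  induction x with
  | zero => simp
  | add x y hx hy => simp only [map_add, hx, hy]
  | tmul v w =>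
    unfold oddMap
    rw [LinearMap.rTensor_tmul, LinearMap.sum_apply, LinearMap.sum_apply, map_sum]
    exact Finset.sum_congr rfl fun e _ => map_zsmul _ _ _

lemma rTensor_tensorOps {g : (r : ℕ) → MultilinearMap 𝕜 (fun _ : Fin r => M) M}
    {g' : (r : ℕ) → MultilinearMap 𝕜 (fun _ : Fin r => M') M'}
    (hf : ∀ r x, f (g r x) = g' r fun a => f (x a)) (r : ℕ) (D : Fin r → ℤ)
    (x : Fin r → M ⊗[𝕜] Form 𝕜 n) : f.rTensor (Form 𝕜 n) (tensorOps g r D x) =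
      tensorOps g' r D fun a => f.rTensor (Form 𝕜 n) (x a) := by
  rw [← scalarOps_add_diffOps, ← scalarOps_add_diffOps, add_apply, add_apply, map_add]
  congr 1
  · refine multi_induction (fun _ => {x : M ⊗[𝕜] Form 𝕜 n | ∃ v w, x = v ⊗ₜ w})
      (p := fun x => f.rTensor (Form 𝕜 n) (scalarOps g r D x) =
        scalarOps g' r D fun a => f.rTensor (Form 𝕜 n) (x a))
      (fun x a ha => ?_) (fun x a y z hy hz => ?_) (fun x hx => ?_) x fun a => mem_closure_tmul _
    · rw [MultilinearMap.map_coord_zero _ a ha, MultilinearMap.map_coord_zero _ a, map_zero]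
      rw [ha, map_zero]
    · have h : ∀ y, (fun b => f.rTensor (Form 𝕜 n) (Function.update x a y b)) =
          Function.update (fun b => f.rTensor (Form 𝕜 n) (x b)) a (f.rTensor (Form 𝕜 n) y) :=
        fun y => funext fun b => Function.apply_update (fun _ => f.rTensor (Form 𝕜 n)) x a y b
      rw [h] at hy hz ⊢
      rw [MultilinearMap.map_update_add, map_add, hy, hz, map_add, MultilinearMap.map_update_add]
    · choose v w h using hx
      rw [funext h, scalarOps_apply, scalarOps_apply, map_sum]
      refine Finset.sum_congr rfl fun e _ => ?_
      simp only [part_tmul, map_zsmul, extendScalars_tmul, LinearMap.rTensor_tmul, hf]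
  · rw [diffOps_apply, diffOps_apply, map_sum]
    refine Finset.sum_congr rfl fun a _ => ?_
    split_ifs
    · exact rTensor_oddMap f _ _ _
    · rw [map_zero]

variable [CharZero 𝕜]

lemma NilpotentBrackets.contraction_ops (B : NilpotentBrackets 𝕜 M) :
    (B.contraction n).ops = tensorOps B.bracket := by
  funext r D x
  exact scalarOps_add_diffOps _ _ _

lemma NilpotentBrackets.mapP_eq (B : NilpotentBrackets 𝕜 M) (x : M ⊗[𝕜] Form 𝕜 n) :
    mapP B.bracket x = diagonalSum 𝕜 (B.contraction n).opsP x := by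
  rw [Contraction.opsP, B.contraction_ops]
  rfl

lemma NilpotentBrackets.mapI_eq (B : NilpotentBrackets 𝕜 M) (x : M ⊗[𝕜] basicForms 𝕜 n) :
    mapI B.bracket x = diagonalSum 𝕜 (B.contraction n).opsI x := by
  rw [Contraction.opsI, B.contraction_ops]
  rfl

/-- Rectification commutes with the maps induced by strict morphisms of nilpotent
`L∞`-algebras. -/
lemma NilpotentBrackets.rTensor_mapI_mapP (B : NilpotentBrackets 𝕜 M)
    (B' : NilpotentBrackets 𝕜 M') (hf : ∀ r x, f (B.bracket r x) = B'.bracket r fun a => f (x a))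
    (x : M ⊗[𝕜] Form 𝕜 n) :
    f.rTensor (Form 𝕜 n) (mapI B.bracket (mapP B.bracket x)) =
      mapI B'.bracket (mapP B'.bracket (f.rTensor (Form 𝕜 n) x)) := by
  have hi : ∀ w : M ⊗[𝕜] basicForms 𝕜 n, f.rTensor (Form 𝕜 n)
      ((basicForms 𝕜 n).subtype.lTensor M w) =
        (basicForms 𝕜 n).subtype.lTensor M' (f.rTensor _ w) := fun w =>
    LinearMap.congr_fun ((LinearMap.rTensor_comp_lTensor ..).trans
      (LinearMap.lTensor_comp_rTensor ..).symm) w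
  have hp : ∀ x : M ⊗[𝕜] Form 𝕜 n, f.rTensor _ ((dupontP 𝕜 n).lTensor M x) =
        (dupontP 𝕜 n).lTensor M' (f.rTensor (Form 𝕜 n) x) := fun w =>
    LinearMap.congr_fun ((LinearMap.rTensor_comp_lTensor ..).trans
      (LinearMap.lTensor_comp_rTensor ..).symm) w
  have h1 : f.rTensor _ (mapP B.bracket x) = mapP B'.bracket (f.rTensor (Form 𝕜 n) x) := by
    refine map_diagonalSum (f.rTensor (Form 𝕜 n)) (f.rTensor (basicForms 𝕜 n))
      (map_transferP (f.rTensor (Form 𝕜 n)) (f.rTensor (basicForms 𝕜 n)) (rTensor_tensorOps f hf)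
        (rTensor_oddMap f _) hi hp) x (B.contraction n).N fun r hr => ?_
    have h := (B.contraction n).P_eq_zero (fun _ : Fin r => 0) (fun _ => 1) (fun _ => x)
      (fun _ => (B.contraction n).mem_Fil_one _) (by simp; omega)
    rw [← Contraction.opsP_eq, Contraction.opsP] at h
    rw [B.contraction_ops] at h
    exact h
  rw [← h1]
  refine map_diagonalSum (f.rTensor (basicForms 𝕜 n)) (f.rTensor (Form 𝕜 n))
    (map_transferI (f.rTensor (Form 𝕜 n)) (f.rTensor (basicForms 𝕜 n)) (rTensor_tensorOps f hf)
      (rTensor_oddMap f _) hi) _ ((B.contraction n).N + 1) fun r hr => ?_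
  have h := (B.contraction n).eq_zero_of_mem_Fil (by omega)
    ((B.contraction n).diagI_mem_Fil (mapP B.bracket x) r)
  rw [Contraction.diagI, Contraction.opsI] at h
  rw [B.contraction_ops] at h
  exact h

end TensorNaturality


/-! ### Top degree and vertices -/

section TopDegree

variable {𝕜 : Type*} [Field 𝕜] {n : ℕ}

lemma isDeg_t (i : Fin (n + 1)) : IsDeg 0 (t 𝕜 n i) := by
  rw [IsDeg, t, formProj_tmul, extProj_zero_eq, map_one, map_one]

lemma isDeg_dt (i : Fin (n + 1)) : IsDeg 1 (dt 𝕜 n i) := by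
  have h := extProj_succ_ι_mul 0 (dtVec 𝕜 n i) 1
  rw [extProj_zero_eq, map_one, map_one, mul_one] at h
  rw [IsDeg, dt, formProj_tmul, h]

lemma IsDeg.smul {e : ℕ} {w : Form 𝕜 n} (hw : IsDeg e w) (c : 𝕜) : IsDeg e (c • w) := by
  rw [IsDeg, map_smul, hw]

lemma isDeg_basicForm {k : ℕ} (θ : Fin (k + 1) → Fin (n + 1)) : IsDeg k (basicForm 𝕜 θ) := by
  refine IsDeg.smul ?_ _
  rw [IsDeg, map_sum]
  refine Finset.sum_congr rfl fun j _ => ?_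
  rw [map_zsmul]
  congr 1
  have h := (isDeg_t (𝕜 := 𝕜) (θ j)).mul (isDeg_prod (fun _ => 1)
    (fun l : Fin k => dt 𝕜 n (θ (j.succAbove l))) fun l => isDeg_dt _)
  simpa [IsDeg] using h

/-- The top degree part of the projection to the basic forms is given by integration. -/
lemma formProj_top_dupontProj (w : Form 𝕜 n) : formProj 𝕜 n n (dupontProj 𝕜 n w) =
    integral 𝕜 n (pullback 𝕜 id w) • basicForm 𝕜 (id : Fin (n + 1) → Fin (n + 1)) := by
  have h0 : dupontProj 𝕜 n w = ∑ k ∈ Finset.range (n + 1), ∑ θ : Face n k,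
      integral 𝕜 k (pullback 𝕜 θ.1 w) • basicForm 𝕜 θ.1 := by
    simp [dupontProj, dupontP]
  have h1 : ∀ θ : Face n n, θ.1 = id := fun θ => by
    refine (θ.2.range_inj strictMono_id).1 ?_
    rw [Set.range_id, (Finite.injective_iff_surjective.1 θ.2.injective).range_eq]
  rw [h0, map_sum, Finset.sum_range_succ, Finset.sum_eq_zero, zero_add, map_sum,
    Fintype.sum_eq_single (⟨id, strictMono_id⟩ : Face n n), map_smul, isDeg_basicForm]
  · exact fun θ hθ => absurd (Subtype.ext (h1 θ)) hθ
  · intro k hk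
    rw [map_sum]
    refine Finset.sum_eq_zero fun θ _ => ?_
    rw [map_smul, (isDeg_basicForm θ.1).formProj_of_ne (Finset.mem_range.1 hk).ne', smul_zero]

lemma basicForm_one : basicForm 𝕜 (id : Fin (1 + 1) → Fin (1 + 1)) = dt 𝕜 1 1 := by
  have h1 : t 𝕜 1 0 + t 𝕜 1 1 = 1 := by
    have h := sum_tPoly (𝕜 := 𝕜) (n := 1)
    rw [Fin.sum_univ_two] at h
    rw [t, t, ← TensorProduct.add_tmul, h]
    rfl
  have h2 : dt 𝕜 1 0 = (-1 : 𝕜) • dt 𝕜 1 1 := by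
    have h := sum_dtVec (𝕜 := 𝕜) (n := 1)
    rw [Fin.sum_univ_two] at h
    rw [dt, dt, eq_neg_of_add_eq_zero_left h, ← neg_one_smul 𝕜, map_smul, TensorProduct.tmul_smul]
  have e1 : (1 : Fin 2).succAbove (0 : Fin 1) = 0 := rfl
  have e2 : basicForm 𝕜 (id : Fin (1 + 1) → Fin (1 + 1)) =
      t 𝕜 1 0 * dt 𝕜 1 1 + (-1 : ℤ) • (t 𝕜 1 1 * dt 𝕜 1 0) := by
    rw [basicForm, Fin.sum_univ_two]
    simp [e1]
  rw [e2, h2, mul_smul_comm, ← Int.cast_smul_eq_zsmul 𝕜, smul_smul]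
  have e3 : (((-1 : ℤ) : 𝕜) * (-1 : 𝕜)) = 1 := by norm_num
  rw [e3, one_smul, ← add_mul, h1, one_mul]

lemma evalAt_one (x : Fin n → 𝕜) : evalAt 𝕜 x 1 = 1 := by
  rw [Algebra.TensorProduct.one_def, evalAt_tmul, map_one, map_one, one_mul]

lemma evalAt_mul (x : Fin n → 𝕜) (w w' : Form 𝕜 n) :
    evalAt 𝕜 x (w * w') = evalAt 𝕜 x w * evalAt 𝕜 x w' := by
  induction w using TensorProduct.induction_on with
  | zero => simp
  | add a b ha hb => rw [add_mul, map_add, ha, hb, map_add, add_mul]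
  | tmul f a =>
    induction w' using TensorProduct.induction_on with
    | zero => simp
    | add b c hb hc => rw [mul_add, map_add, hb, hc, map_add, mul_add]
    | tmul g b =>
      rw [Algebra.TensorProduct.tmul_mul_tmul, evalAt_tmul, evalAt_tmul, evalAt_tmul, map_mul,
        map_mul]
      ring

lemma evalAt_prod {r : ℕ} (x : Fin n → 𝕜) (w : Fin r → Form 𝕜 n) :
    evalAt 𝕜 x (List.ofFn w).prod = ∏ a, evalAt 𝕜 x (w a) := by
  induction r with
  | zero => simpa using evalAt_one x
  | succ r ih => rw [prod_ofFn_succ, evalAt_mul, ih, Fin.prod_univ_succ]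

lemma evalAt_formProj (x : Fin n → 𝕜) (e : ℕ) (w : Form 𝕜 n) :
    evalAt 𝕜 x (formProj 𝕜 n e w) = if e = 0 then evalAt 𝕜 x w else 0 := by
  split_ifs with he
  · subst he; exact evalAt_opProj_zero x w
  · rw [← evalAt_opProj_zero x]
    change evalAt 𝕜 x (formProj 𝕜 n 0 _) = 0
    rw [formProj_formProj, if_neg (Ne.symm he), map_zero]

variable {M : Type*} [AddCommGroup M] [Module 𝕜 M]

lemma evalPoint_tmul (x : Fin n → 𝕜) (v : M) (w : Form 𝕜 n) :
    evalPoint x (v ⊗ₜ[𝕜] w) = evalAt 𝕜 x w • v := rfl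

lemma evalPoint_part (x : Fin n → 𝕜) (e : ℕ) (y : M ⊗[𝕜] Form 𝕜 n) :
    evalPoint x (part e y) = if e = 0 then evalPoint x y else 0 := by
  induction y with
  | zero => simp
  | add y z hy hz => rw [map_add, map_add, hy, hz, map_add]; split_ifs <;> simp
  | tmul v w =>
    rw [part_tmul, evalPoint_tmul, evalAt_formProj, evalPoint_tmul]
    split_ifs <;> simp

lemma evalPoint_extendScalars {r : ℕ} (x : Fin n → 𝕜)
    (f : MultilinearMap 𝕜 (fun _ : Fin r => M) M) (y : Fin r → M ⊗[𝕜] Form 𝕜 n) :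
    evalPoint x (extendScalars f y) = f fun a => evalPoint x (y a) := by
  refine multi_induction (fun _ => {x : M ⊗[𝕜] Form 𝕜 n | ∃ v w, x = v ⊗ₜ w})
    (p := fun y => evalPoint x (extendScalars f y) = f fun a => evalPoint x (y a))
    (fun y a ha => ?_) (fun y a z z' hz hz' => ?_) (fun y hy => ?_) y fun a => mem_closure_tmul _
  · rw [MultilinearMap.map_coord_zero _ a ha, MultilinearMap.map_coord_zero _ a, map_zero]
    rw [ha, map_zero]
  · have h : ∀ z, (fun b => evalPoint x (Function.update y a z b)) =
        Function.update (fun b => evalPoint x (y b)) a (evalPoint x z) :=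
      fun z => funext fun b => Function.apply_update (fun _ => evalPoint x) y a z b
    rw [h] at hz hz' ⊢
    rw [MultilinearMap.map_update_add, map_add, hz, hz', map_add, MultilinearMap.map_update_add]
  · choose v w h using hy
    rw [funext h, extendScalars_tmul, evalPoint_tmul, evalAt_prod]
    simp only [evalPoint_tmul, MultilinearMap.map_smul_univ]

lemma evalPoint_oddMap (x : Fin n → 𝕜) (u : Form 𝕜 n →ₗ[𝕜] Form 𝕜 n)
    (hu : ∀ w, evalAt 𝕜 x (u w) = 0) (D : ℤ) (y : M ⊗[𝕜] Form 𝕜 n) :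
    evalPoint x (oddMap u D y) = 0 := by
  induction y using isDeg_induction with
  | zero => simp
  | add y z hy hz => rw [map_add, map_add, hy, hz, add_zero]
  | tmul e v w hw => rw [oddMap_tmul _ _ _ hw, map_zsmul, evalPoint_tmul, hu, zero_smul, smul_zero]

/-- The elements that vanish at a point form an ideal. -/
lemma evalPoint_tensorBrackets (B : NilpotentBrackets 𝕜 M) {r : ℕ} (x : Fin n → 𝕜) (D : Fin r → ℤ)
    (y : Fin r → M ⊗[𝕜] Form 𝕜 n) (a : Fin r) (ha : evalPoint x (y a) = 0) :
    evalPoint x (B.tensorBrackets r D y) = 0 := by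
  rw [B.tensorBrackets_apply, map_add, scalarOps_apply, diffOps_apply, map_sum, map_sum,
    Finset.sum_eq_zero, Finset.sum_eq_zero, add_zero]
  · intro b _
    split_ifs
    · exact evalPoint_oddMap x _ (evalAt_opD x) _ _
    · rw [map_zero]
  · intro e _
    rw [map_zsmul, evalPoint_extendScalars, MultilinearMap.map_coord_zero _ a, smul_zero]
    rw [evalPoint_part, ha, ite_self]

variable (n M) in
/-- Integration of forms on the whole simplex, with coefficients in `M`. -/
def integrate : M ⊗[𝕜] Form 𝕜 n →ₗ[𝕜] M :=
  (TensorProduct.rid 𝕜 M).toLinearMap ∘ₗ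
    (integral 𝕜 n ∘ₗ (pullback 𝕜 id).toLinearMap).lTensor M

lemma integrate_tmul (v : M) (w : Form 𝕜 n) :
    integrate n M (v ⊗ₜ[𝕜] w) = integral 𝕜 n (pullback 𝕜 id w) • v := rfl

lemma integrate_rTensor {M' : Type*} [AddCommGroup M'] [Module 𝕜 M'] (f : M →ₗ[𝕜] M')
    (x : M ⊗[𝕜] Form 𝕜 n) :
    integrate n M' (f.rTensor (Form 𝕜 n) x) = f (integrate n M x) := by
  induction x with
  | zero => simp
  | add x y hx hy => simp only [map_add, hx, hy]
  | tmul v w => rw [LinearMap.rTensor_tmul, integrate_tmul, integrate_tmul, map_smul]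

lemma part_mem {deg : ℤ → Submodule 𝕜 M} {d : ℤ} {x : M ⊗[𝕜] Form 𝕜 n}
    (hx : x ∈ totalDeg deg (d + 1)) (k : ℕ) :
    part k x ∈ Submodule.map₂ (TensorProduct.mk 𝕜 M (Form 𝕜 n)) (deg (d + 1 - k))
      (LinearMap.range (formProj 𝕜 n k)) := by
  have h := mem_closure_homogTensors hx
  clear hx
  induction h using AddSubmonoid.closure_induction with
  | mem x h =>
    obtain ⟨e, v, w, hv, hw, rfl⟩ := h
    rw [part_tmul]
    by_cases he : k = e
    · subst he
      exact Submodule.apply_mem_map₂ (TensorProduct.mk 𝕜 M (Form 𝕜 n)) hv ⟨w, rfl⟩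
    · rw [hw.formProj_of_ne he, TensorProduct.tmul_zero]
      exact zero_mem _
  | zero => rw [map_zero]; exact zero_mem _
  | add x y _ _ hx hy => rw [map_add]; exact add_mem hx hy

lemma integrate_mem {deg : ℤ → Submodule 𝕜 M} {d : ℤ} {x : M ⊗[𝕜] Form 𝕜 n}
    (hx : x ∈ totalDeg deg (d + 1)) : integrate n M x ∈ deg (d + 1 - n) := by
  have h := mem_closure_homogTensors hx
  clear hx
  induction h using AddSubmonoid.closure_induction with
  | mem x h =>
    obtain ⟨e, v, w, hv, hw, rfl⟩ := h
    rw [integrate_tmul]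
    by_cases he : e = n
    · subst he
      exact Submodule.smul_mem _ _ hv
    · have h1 := integral_opProj (k := n) e (pullback 𝕜 id w)
      have h2 : opProj 𝕜 n e w = w := hw
      rw [opProj_pullback, h2, if_neg he] at h1
      rw [h1, zero_smul]
      exact zero_mem _
  | zero => rw [map_zero]; exact zero_mem _
  | add x y _ _ hx hy => rw [map_add]; exact add_mem hx hy

variable [CharZero 𝕜]

lemma part_oddMap_dupontH (D : ℤ) (x : M ⊗[𝕜] Form 𝕜 n) :
    part n (oddMap (dupontH 𝕜 n) D x) = 0 := by
  induction x using isDeg_induction with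
  | zero => simp
  | add x y hx hy => rw [map_add, map_add, hx, hy, add_zero]
  | tmul e v w hw =>
    have h : formProj 𝕜 n (n + 1) w = 0 := (isDeg_formProj _ w).eq_zero (Nat.lt_succ_self n)
    rw [oddMap_tmul _ _ _ hw, map_zsmul, part_tmul, formProj_dupontH, h, map_zero,
      TensorProduct.tmul_zero, smul_zero]

/-- The top degree part of an element in the kernel of the homotopy. -/
lemma part_top_eq (B : NilpotentBrackets 𝕜 M) {x : M ⊗[𝕜] Form 𝕜 n}
    (hx : oddMap (dupontH 𝕜 n) 0 x = 0) :
    part n x = integrate n M x ⊗ₜ basicForm 𝕜 (id : Fin (n + 1) → Fin (n + 1)) := by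
  have h1 := (B.contraction n).homotopy 0 x
  have h2 : (B.contraction n).h 0 x = 0 := hx
  rw [h2, MultilinearMap.map_coord_zero _ 0 rfl, zero_add] at h1
  have h3 := congrArg (part n) h1
  rw [map_sub] at h3
  have h4 : part n ((B.contraction n).h (0 + 1) ((B.contraction n).q 1 (fun _ => 0) fun _ => x)) =
      0 := part_oddMap_dupontH _ _
  rw [h4, eq_comm, sub_eq_zero] at h3
  rw [h3]
  clear h1 h2 h3 h4 hx
  induction x with
  | zero => simp
  | add x y hx hy => simp only [map_add, hx, hy, TensorProduct.add_tmul]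
  | tmul v w =>
    change v ⊗ₜ formProj 𝕜 n n (dupontProj 𝕜 n w) = _
    rw [formProj_top_dupontProj, integrate_tmul, TensorProduct.tmul_smul, TensorProduct.smul_tmul']

end TopDegree


/-! ### The nilpotent quotients of an `L∞`-algebra -/

namespace LInftyAlgebra

variable {𝕜 : Type*} [Field 𝕜] {G : Type*} [AddCommGroup G] [Module 𝕜 G]
  (L : LInftyAlgebra 𝕜 G) {r : ℕ}

lemma filt_anti : Antitone L.filt :=
  fun _ _ h => Submodule.span_mono fun _ ⟨w, hw, hx⟩ => ⟨w, h.trans hw, hx⟩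

lemma filt_one : L.filt 1 = ⊤ :=
  top_unique fun x _ => Submodule.subset_span ⟨1, le_rfl, IsBracketing.leaf x⟩

open scoped Pointwise in
lemma bracket_mem_filt_sum (k : Fin r → ℕ) (x : Fin r → G) (hx : ∀ a, x a ∈ L.filt (k a)) :
    L.bracket r x ∈ L.filt (∑ a, k a) := by
  refine multi_induction (fun a => (Set.univ : Set 𝕜) • {x | ∃ w, k a ≤ w ∧ L.IsBracketing w x})
    (p := fun x => L.bracket r x ∈ L.filt (∑ a, k a))
    (fun x a ha => ?_) (fun x a y z hy hz => ?_) (fun x hx => ?_) x fun a => ?_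
  · rw [MultilinearMap.map_coord_zero _ a ha]; exact zero_mem _
  · rw [MultilinearMap.map_update_add]; exact add_mem hy hz
  · choose c _ y hy h using fun a => Set.mem_smul.1 (hx a)
    choose w hw hb using hy
    rw [← funext h]
    rw [MultilinearMap.map_smul_univ]
    exact Submodule.smul_mem _ _ (Submodule.subset_span
      ⟨_, Finset.sum_le_sum fun a _ => hw a, IsBracketing.node r w y hb⟩)
  · have h := hx a
    rwa [filt, ← Submodule.mem_toAddSubmonoid, Submodule.span_eq_closure] at h

lemma exists_mk_eq {m : ℕ} (D : Fin r → ℤ) (x : Fin r → G ⧸ L.filt m)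
    (hx : ∀ a, x a ∈ L.quotDeg m (D a)) :
    ∃ y : Fin r → G, (∀ a, y a ∈ L.deg (D a)) ∧ x = fun a => Submodule.Quotient.mk (y a) := by
  choose y hy h using hx
  exact ⟨y, hy, (funext h).symm⟩

lemma mk_zsmul {m : ℕ} (c : ℤ) (x : G) : (Submodule.Quotient.mk (c • x) : G ⧸ L.filt m) =
    c • Submodule.Quotient.mk x := map_zsmul (L.filt m).mkQ c x

/-- The quotient of an `L∞`-algebra by a step of the canonical filtration. -/
def quotient (m : ℕ) : NilpotentBrackets 𝕜 (G ⧸ L.filt m) where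
  deg := L.quotDeg m
  bracket := L.quotBracket m
  fil k := (L.filt k).map (L.filt m).mkQ
  N := m
  bracket_zero := by
    ext x
    change Submodule.Quotient.mk (L.bracket 0 _) = 0
    rw [L.bracket_zero]
    rfl
  bracket_mem r D x hx := by
    obtain ⟨y, hy, rfl⟩ := L.exists_mk_eq D x hx
    rw [quotBracket_mk]
    exact ⟨_, L.bracket_mem r D y hy, rfl⟩
  bracket_perm r D x hx σ := by
    obtain ⟨y, hy, rfl⟩ := L.exists_mk_eq D x hx
    rw [quotBracket_mk, quotBracket_mk, L.bracket_perm r D y hy σ, mk_zsmul]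
  jacobi r D x hx := by
    obtain ⟨y, hy, rfl⟩ := L.exists_mk_eq D x hx
    have h := congrArg (L.filt m).mkQ (L.jacobi r D y hy)
    rw [map_sum, map_zero] at h
    rw [← h]
    refine Finset.sum_congr rfl fun S _ => ?_
    rw [map_zsmul, Submodule.mkQ_apply, ← L.quotBracket_mk]
    congr 2
    funext a
    refine Fin.cases ?_ (fun a => rfl) a
    exact L.quotBracket_mk m _ (sub y S)
  fil_one := by rw [filt_one, Submodule.map_top, Submodule.range_mkQ]
  fil_anti _ _ h := Submodule.map_mono (L.filt_anti h)
  fil_N := Submodule.mkQ_map_self _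
  bracket_fil r k x hx := by
    choose y hy h using hx
    have h' : x = fun a => Submodule.Quotient.mk (y a) := (funext h).symm
    rw [h', quotBracket_mk]
    exact ⟨_, L.bracket_mem_filt_sum k y hy, rfl⟩

lemma factor_quotBracket (m : ℕ) (x : Fin r → G ⧸ L.filt (m + 1)) :
    Submodule.factor (L.filt_succ_le m) (L.quotBracket (m + 1) r x) =
      L.quotBracket m r fun a => Submodule.factor (L.filt_succ_le m) (x a) := by
  choose y hy using fun a => Submodule.Quotient.mk_surjective _ (x a)
  rw [← funext hy, quotBracket_mk]
  exact (L.quotBracket_mk m r y).symm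

/-! ### The rectification map -/

variable [CharZero 𝕜] {n : ℕ}

lemma rectify_compat {α : L.Tower n}
    (hα : ∀ m, (Submodule.factor (L.filt_succ_le m)).rTensor (Form 𝕜 n) (α (m + 1)) = α m) (m : ℕ) :
    (Submodule.factor (L.filt_succ_le m)).rTensor (Form 𝕜 n) (L.rectify n α (m + 1)) =
      L.rectify n α m := by
  have h := (L.quotient (m + 1)).rTensor_mapI_mapP (Submodule.factor (L.filt_succ_le m))
    (L.quotient m) (fun r x => L.factor_quotBracket m x) (α (m + 1))
  rw [hα] at h
  exact h

/-- The properties of rectification in a nilpotent quotient: the result is a Maurer–Cartan element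
in the kernel of the homotopy, with the same values at the vertices. -/
lemma rectify_spec {α : L.Tower n} (hα : α ∈ L.MCSimplices n) (m : ℕ) :
    L.rectify n α m ∈ totalDeg (L.quotDeg m) (0 + 1) ∧
    MCEquation 𝕜 (tensorOps (L.quotBracket m)) (L.rectify n α m) ∧
    oddMap (dupontH 𝕜 n) 0 (L.rectify n α m) = 0 ∧
    ∀ i, evalPoint (vertex 𝕜 n i) (L.rectify n α m) = evalPoint (vertex 𝕜 n i) (α m) := by
  let C := (L.quotient m).contraction n
  have hops : C.ops = tensorOps (L.quotBracket m) := (L.quotient m).contraction_ops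
  have hβ : L.rectify n α m = diagonalSum 𝕜 C.opsI (diagonalSum 𝕜 C.opsP (α m)) := by
    rw [← (L.quotient m).mapP_eq, ← (L.quotient m).mapI_eq]
    rfl
  have h1 : α m ∈ C.U 0 := by
    change α m ∈ totalDeg (L.quotDeg m) (0 + 1)
    rw [zero_add]
    exact (hα.2 m).1
  have h2 : C.F (α m) = 0 := by
    rw [← C.diagonalSum_ops, hops]
    exact (hα.2 m).2
  obtain ⟨h3, h4, h5, h6⟩ := C.rectification h1 h2
  rw [← hβ] at h3 h4 h5 h6
  refine ⟨h3, ?_, h5, fun i => ?_⟩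
  · rw [MCEquation, ← hops, C.diagonalSum_ops, h4]
  · have h7 := h6 (LinearMap.ker (evalPoint (vertex 𝕜 n i)))
      (fun x => evalPoint_oddMap _ _ (evalAt_dupontH i) _ _)
      fun r D x a ha => evalPoint_tensorBrackets (L.quotient m) _ D x a ha
    rwa [LinearMap.mem_ker, map_sub, sub_eq_zero] at h7

lemma rectify_mem {α : L.Tower n} (hα : α ∈ L.MCSimplices n) :
    L.rectify n α ∈ L.MCSimplices n := by
  refine ⟨L.rectify_compat hα.1, fun m => ⟨?_, (L.rectify_spec hα m).2.1⟩⟩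
  have h := (L.rectify_spec hα m).1
  rwa [zero_add] at h

/-- The coefficient of the top form is the integral, which is compatible with the quotient maps, so
completeness lifts it to `𝔤`. -/
lemma rectify_eq_sum_add (hL : L.IsComplete) {α : L.Tower n} (hα : α ∈ L.MCSimplices n) :
    ∃ ξ ∈ L.deg (1 - n), ∀ m, L.rectify n α m =
      (∑ k ∈ Finset.range n, part k (L.rectify n α m)) +
        (Submodule.Quotient.mk ξ : G ⧸ L.filt m) ⊗ₜ[𝕜] basicForm 𝕜 (id : Fin (n + 1) → _) := by
  have h1 : ∀ m, integrate n _ (L.rectify n α m) ∈ L.quotDeg m (1 - n) := fun m => by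
    have h := integrate_mem (L.rectify_spec hα m).1
    rwa [zero_add] at h
  choose y hy hy' using h1
  obtain ⟨ξ, hξ, hξ'⟩ := (hL (1 - n)).2 y hy fun m => by
    have h2 := integrate_rTensor (n := n) (Submodule.factor (L.filt_succ_le m))
      (L.rectify n α (m + 1))
    rw [L.rectify_compat hα.1, ← hy' m, ← hy' (m + 1)] at h2
    exact (Submodule.Quotient.eq _).1 h2.symm
  refine ⟨ξ, hξ, fun m => ?_⟩
  have h3 : (Submodule.Quotient.mk ξ : G ⧸ L.filt m) = integrate n _ (L.rectify n α m) := by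
    rw [← hy' m]
    exact (Submodule.Quotient.eq _).2 (hξ' m)
  rw [h3, ← part_top_eq (L.quotient m) (L.rectify_spec hα m).2.2.1, ← Finset.sum_range_succ,
    sum_range_part]

end LInftyAlgebra

end DHG

theorem proposition4p3 {𝕜 : Type*} [Field 𝕜] [CharZero 𝕜] {G : Type*} [AddCommGroup G]
    [Module 𝕜 G] (L : DHG.LInftyAlgebra 𝕜 G) (hL : L.IsComplete) :
    (∀ (n : ℕ), ∀ α ∈ L.MCSimplices n,
      L.rectify n α ∈ L.MCSimplices n ∧
      (∃ ξ ∈ L.deg (1 - n), ∀ m, L.rectify n α m =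
        (∑ k ∈ Finset.range n, DHG.part k (L.rectify n α m)) +
          (Submodule.Quotient.mk ξ : G ⧸ L.filt m) ⊗ₜ[𝕜] DHG.basicForm 𝕜 (id : Fin (n + 1) → _)) ∧
      (∀ k m : ℕ, DHG.part k (L.rectify n α m) ∈
        Submodule.map₂ (TensorProduct.mk 𝕜 (G ⧸ L.filt m) (DHG.Form 𝕜 n)) (L.quotDeg m (1 - k))
          (LinearMap.range (DHG.formProj 𝕜 n k))) ∧
      ∀ m (i : Fin (n + 1)), DHG.evalPoint (DHG.vertex 𝕜 n i) (DHG.part 0 (L.rectify n α m)) =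
        DHG.evalPoint (DHG.vertex 𝕜 n i) (DHG.part 0 (α m))) ∧
    ∀ α ∈ L.MCSimplices 1,
      (∃ l ∈ L.deg 0, ∀ m, L.rectify 1 α m = DHG.part 0 (L.rectify 1 α m) +
        (Submodule.Quotient.mk l : G ⧸ L.filt m) ⊗ₜ[𝕜] DHG.dt 𝕜 1 1) ∧
      ∀ m, DHG.evalPoint (fun _ => 0) (DHG.part 0 (L.rectify 1 α m)) =
          DHG.evalPoint (fun _ => 0) (DHG.part 0 (α m)) ∧
        DHG.evalPoint (fun _ => 1) (DHG.part 0 (L.rectify 1 α m)) =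
          DHG.evalPoint (fun _ => 1) (DHG.part 0 (α m)) := by
  have hv : ∀ {n : ℕ} {α : L.Tower n}, α ∈ L.MCSimplices n → ∀ m (i : Fin (n + 1)),
      DHG.evalPoint (DHG.vertex 𝕜 n i) (DHG.part 0 (L.rectify n α m)) =
        DHG.evalPoint (DHG.vertex 𝕜 n i) (DHG.part 0 (α m)) := fun hα m i => by
    rw [DHG.evalPoint_part, DHG.evalPoint_part, if_pos rfl, if_pos rfl]
    exact (L.rectify_spec hα m).2.2.2 i
  refine ⟨fun n α hα => ⟨L.rectify_mem hα, L.rectify_eq_sum_add hL hα, fun k m => ?_, hv hα⟩,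
    fun α hα => ⟨?_, fun m => ?_⟩⟩
  · have h := DHG.part_mem (L.rectify_spec hα m).1 k
    rwa [zero_add] at h
  · obtain ⟨l, hl, h⟩ := L.rectify_eq_sum_add hL hα
    refine ⟨l, by simpa using hl, fun m => ?_⟩
    have h1 := h m
    rwa [DHG.basicForm_one, Finset.sum_range_one] at h1
  · have h0 : DHG.vertex 𝕜 1 0 = fun _ => 0 := by
      funext j
      exact if_neg (Fin.succ_ne_zero j).symm
    have h1 : DHG.vertex 𝕜 1 1 = fun _ => 1 := by
      funext j
      exact if_pos (by rw [Subsingleton.elim j 0]; rfl)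
    rw [← h0, ← h1]
    exact ⟨hv hα m 0, hv hα m 1⟩
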